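/- **Notation.** For integers $d\ge 2$ and $0\le k\le d$, identify the complex Grassmannian with $$\mathsf{Gr}_k(\mathbb C^d)=\{U\in M_d(\mathbb C): U=U^*,\ U^2=\mathbf 1_d,\ \mathrm{Tr}(U)=d-2k\},$$ and let $\mathcal Rat(\mathbb R;\mathsf{Gr}_k(\mathbb C^d))$ be the set of maps $\mathbb R\to\mathsf{Gr}_k(\mathbb C^d)$ whose entries are rational functions of $x\in\mathbb R$. Put $\|\mathbf U\|_{\dot H^s}=\||D|^s\mathbf U\|_{L^2}$ for $s>0$ (with the Frobenius norm on $M_d(\mathbb C)$), where $|D|$ is the Fourier multiplier with symbol $|\xi|$, and $H^\infty_\bullet=\bigcap_{s>0}\big(M_d(\mathbb C)\oplus H^s(\mathbb R;M_d(\mathbb C))\big)$; $H^\infty_\bullet(\mathbb R;\mathsf{Gr}_k(\mathbb C^d))$ is the subset of $\mathsf{Gr}_k(\mathbb C^d)$-valued maps. The generalized half-wave maps equation is $$\partial_t\mathbf U=-\tfrac{\mathrm i}{2}[\mathbf U,|D|\mathbf U].\qquad(\mathrm{HWM}_d)$$ A *traveling solitary wave* with velocity $v\in\mathbb R$ is a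 finite-energy solution $\mathbf Q(x-vt)$ of $(\mathrm{HWM}_d)$ with profile $\mathbf Q\in\dot H^{1/2}(\mathbb R;\mathsf{Gr}_k(\mathbb C^d))$. Let $L^2_+(\mathbb R;\mathbb C^d)$ be the Hardy space of those $f\in L^2(\mathbb R;\mathbb C^d)$ with $\mathrm{supp}\,\widehat f\subset[0,\infty)$, let $\Pi_+$ be the orthogonal projection of $L^2(\mathbb R;\mathbb C^d)$ onto it, and let $T_{\mathbf U}f=\Pi_+(\mathbf Uf)$ be the Toeplitz operator on $L^2_+(\mathbb R;\mathbb C^d)$. Its discrete spectrum $\sigma_{\mathrm d}(T_{\mathbf U})$ is the set of isolated points of its spectrum that have finite multiplicity; it is *simple* if all these multiplicities equal $1$. **Theorem (soliton resolution and non-turbulence for $(\mathrm{HWM}_d)$).** Let $d\ge2$ and $0\le k\le d$. Let $\mathbf U_0\in\mathcal Rat(\mathbb R;\mathsf{Gr}_k(\mathbb C^d))$ be such that $T_{\mathbf U_0}:L^2_+(\mathbb R;\mathbb C^d)\to L^2_+(\mathbb R;\mathbb C^d)$ has simple discrete spectrum. Then $\sigma_{\mathrm d}(T_{\mathbf U_0})=\{v_1,\dots,v_N\}$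 is a finite set of $N\ge 0$ distinct real numbers, there is a unique global solution $\mathbf U\in C(\mathbb R;H^\infty_\bullet(\mathbb R;\mathsf{Gr}_k(\mathbb C^d)))$ of $(\mathrm{HWM}_d)$ with $\mathbf U(0)=\mathbf U_0$, and it satisfies $$\lim_{t\to\pm\infty}\|\mathbf U(t)-\mathbf U^{\pm}(t)\|_{\dot H^s}=0\quad\text{for all }s>0,$$ where, for both signs, $$\mathbf U^\pm(t,x)=\sum_{j=1}^N\mathbf Q_{v_j}(x-v_jt)-(N-1)\mathbf U_\infty .$$ Here $\mathbf U_\infty=\lim_{|x|\to\infty}\mathbf U_0(x)\in\mathsf{Gr}_k(\mathbb C^d)$, and each $\mathbf Q_{v_j}\in\mathcal Rat(\mathbb R;\mathsf{Gr}_k(\mathbb C^d))$ is the profile of a traveling solitary wave for $(\mathrm{HWM}_d)$ with velocity $v_j$, given by $$\mathbf Q_{v_j}(x)=\mathbf U_\infty+\frac{A_j}{x-y_j+\mathrm i\delta_j}+\frac{A_j^*}{x-y_j-\mathrm i\delta_j}$$ with some $A_j\in M_d(\mathbb C)$ such that $\mathrm{rank}(A_j)=1$ and $A_j^2=0$, some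 $y_j\in\mathbb R$ and some $\delta_j>0$. Moreover, for every $s>0$ there is a constant $C=C(\mathbf U_0,s)<\infty$ with $$\sup_{t\in\mathbb R}\|\mathbf U(t)\|_{\dot H^s}\le C .$$ -/

import Mathlib

open MeasureTheory Filter Topology FourierTransform Polynomial
open scoped SchwartzMap ENNReal NNReal

noncomputable section

namespace HWM

/-- The algebra `M_d(ℂ)`. -/
abbrev Mat (d : ℕ) : Type := Matrix (Fin d) (Fin d) ℂ

/-- The complex Grassmannian `Gr_k(ℂ^d)`, a `k`-dimensional subspace with orthogonal projection `P`
being identified with the matrix `1 - 2P`. -/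
def Gr (k d : ℕ) : Set (Mat d) :=
  {U | U.conjTranspose = U ∧ U * U = 1 ∧ U.trace = (d : ℂ) - 2 * (k : ℂ)}

/-- The matrix-valued function `U` on `ℝ` is rational (without poles on `ℝ`). -/
def IsRationalMap {d : ℕ} (U : ℝ → Mat d) : Prop :=
  ∀ i j, ∃ p q : ℂ[X], ∀ x : ℝ, q.eval (x : ℂ) ≠ 0 ∧ U x i j = p.eval (x : ℂ) / q.eval (x : ℂ)

/-- The set of rational maps `ℝ → Gr_k(ℂ^d)`. -/
def RatGr (k d : ℕ) : Set (ℝ → Mat d) :=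
  {U | IsRationalMap U ∧ ∀ x, U x ∈ Gr k d}

/-! ### Sobolev norms and the operator `|D|`

Mathlib's Fourier transform is `𝓕 f ξ = ∫ f x e^{-2πixξ} dx`, so that `D = -i∂ₓ` has the symbol
`2πξ`. The transform `𝓕` is unitary on `L²`. -/

/-- `f` is a tempered function whose distributional Fourier transform is, on `ℝ ∖ {0}`, the locally
integrable function `g`. (What the transform does at the origin is invisible to the homogeneous
norms and to `|D|`; for instance constants have `g = 0`.) Given `f`, the function `g` is unique up
to null sets. -/
def HasPuncturedFourier (f g : ℝ → ℂ) : Prop :=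
  (∀ φ : 𝓢(ℝ, ℂ), Integrable (fun x => f x * φ x)) ∧
  LocallyIntegrableOn g {0}ᶜ ∧
  ∀ φ : 𝓢(ℝ, ℂ), HasCompactSupport φ → (0 : ℝ) ∉ tsupport φ →
    ∫ x, f x * (𝓕 φ) x = ∫ ξ, g ξ * φ ξ

/-- The homogeneous Sobolev semi-norm `‖|D|^s f‖_{L²}` of a scalar function (`s > 0`); its value
is `∞` if `f` does not belong to the homogeneous Sobolev space. -/
def homSobolevENorm (s : ℝ) (f : ℝ → ℂ) : ℝ≥0∞ :=
  ⨅ (g : ℝ → ℂ) (_ : HasPuncturedFourier f g),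
    eLpNorm (fun ξ : ℝ => (((2 * Real.pi * |ξ|) ^ s : ℝ) : ℂ) * g ξ) 2 volume

/-- The semi-norm `‖U‖_{Ḣ^s}` of a matrix-valued function, with respect to the Frobenius norm. -/
def homSobolevENormMat {d : ℕ} (s : ℝ) (U : ℝ → Mat d) : ℝ≥0∞ :=
  (∑ i, ∑ j, homSobolevENorm s (fun x => U x i j) ^ 2) ^ (1 / 2 : ℝ)

/-- The inhomogeneous Sobolev norm `‖⟨D⟩^s w‖_{L²}` of `w ∈ L²(ℝ; ℂ)` (`s ≥ 0`); it is `∞` if `w`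
does not belong to `H^s`. -/
def sobolevENorm (s : ℝ) (w : Lp ℂ 2 (volume : Measure ℝ)) : ℝ≥0∞ :=
  eLpNorm (fun ξ : ℝ => (((1 + (2 * Real.pi * ξ) ^ 2) ^ (s / 2) : ℝ) : ℂ) *
    (𝓕 w : Lp ℂ 2 (volume : Measure ℝ)) ξ) 2 volume

/-- `h = |D| f`, in the sense that the Fourier transform of `h` is the integrable function
`2π|ξ| g(ξ)`, with `g` the Fourier transform of `f` on `ℝ ∖ {0}`; here `h` is the continuous
representative. -/
def IsAbsD (f h : ℝ → ℂ) : Prop :=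
  ∃ g : ℝ → ℂ, HasPuncturedFourier f g ∧
    Integrable (fun ξ : ℝ => ((2 * Real.pi * |ξ| : ℝ) : ℂ) * g ξ) ∧
    ∀ x, h x = 𝓕⁻ (fun ξ : ℝ => ((2 * Real.pi * |ξ| : ℝ) : ℂ) * g ξ) x

/-! ### The generalized half-wave maps equation -/

/-- `U` belongs to `C(ℝ; H^∞_•(ℝ; M_d(ℂ)))`, where `H^s_• = M_d(ℂ) ⊕ H^s(ℝ; M_d(ℂ))` and
`H^∞_• = ⋂_{s>0} H^s_•`: we have `U(t) = c(t) + V(t)` with `c` continuous and with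
`V ∈ C(ℝ; H^s)` for every `s > 0`. Each `U(t)` is the continuous representative of its class. -/
def IsContinuousCurve {d : ℕ} (U : ℝ → ℝ → Mat d) : Prop :=
  (∀ t, Continuous (U t)) ∧
  ∃ (c : ℝ → Mat d) (V : ℝ → Fin d → Fin d → Lp ℂ 2 (volume : Measure ℝ)),
    Continuous c ∧
    (∀ t i j, (fun x => U t x i j) =ᵐ[volume] fun x => c t i j + V t i j x) ∧
    ∀ s : ℝ, 0 < s → ∀ t i j, sobolevENorm s (V t i j) < ⊤ ∧
      Tendsto (fun τ => sobolevENorm s (V τ i j - V t i j)) (𝓝 t) (𝓝 0)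

/-- `U` is a global solution in `C(ℝ; H^∞_•(ℝ; Gr_k(ℂ^d)))` of
`∂ₜ U = -(i/2) [U, |D| U]`. -/
structure IsSolution (k d : ℕ) (U : ℝ → ℝ → Mat d) : Prop where
  mem_gr : ∀ t x, U t x ∈ Gr k d
  curve : IsContinuousCurve U
  equation : ∀ t, ∃ W : ℝ → Mat d,
    (∀ i j, IsAbsD (fun x => U t x i j) (fun x => W x i j)) ∧
    ∀ x, HasDerivAt (fun τ => U τ x)
      (-(Complex.I / 2) • (U t x * W x - W x * U t x)) t

/-- `Q` is the profile of a traveling solitary wave with velocity `v`: a map into `Gr_k(ℂ^d)` of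
finite energy `½ ‖Q‖²_{Ḣ^{1/2}}` such that `Q(x - vt)` is a solution. -/
structure IsSolitaryWaveProfile (k d : ℕ) (v : ℝ) (Q : ℝ → Mat d) : Prop where
  mem_gr : ∀ x, Q x ∈ Gr k d
  finite_energy : homSobolevENormMat (1 / 2) Q < ⊤
  solution : IsSolution k d (fun t x => Q (x - v * t))

/-! ### Hardy space, Toeplitz operators and the discrete spectrum -/

/-- `L²(ℝ; ℂ^d)`. -/
abbrev L2V (d : ℕ) : Type := Lp (EuclideanSpace ℂ (Fin d)) 2 (volume : Measure ℝ)

/-- The Hardy space `L²₊(ℝ; ℂ^d)` of those `f ∈ L²(ℝ; ℂ^d)` whose Fourier transform vanishes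
almost everywhere on `(-∞, 0)`. -/
def hardySpace (d : ℕ) : Submodule ℂ (L2V d) :=
  ((LpToLpRestrictCLM ℝ (EuclideanSpace ℂ (Fin d)) ℂ volume 2 (Set.Iio (0 : ℝ))).comp
    (Lp.fourierTransformₗᵢ ℝ (EuclideanSpace ℂ (Fin d))).toContinuousLinearEquiv.toContinuousLinearMap).ker

theorem mem_hardySpace_iff {d : ℕ} (f : L2V d) :
    f ∈ hardySpace d ↔ ∀ᵐ ξ ∂(volume : Measure ℝ), ξ < 0 → (𝓕 f : L2V d) ξ = 0 := by
  have h1 : f ∈ hardySpace d ↔ LpToLpRestrictCLM ℝ (EuclideanSpace ℂ (Fin d)) ℂ volume 2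
      (Set.Iio (0 : ℝ)) (𝓕 f : L2V d) = 0 := Iff.rfl
  rw [h1, Lp.eq_zero_iff_ae_eq_zero]
  have h2 := LpToLpRestrictCLM_coeFn (F := EuclideanSpace ℂ (Fin d)) (μ := volume) (p := 2) ℂ
    (Set.Iio (0 : ℝ)) (𝓕 f : L2V d)
  have h3 : (∀ᵐ ξ ∂(volume : Measure ℝ), ξ < 0 → (𝓕 f : L2V d) ξ = 0) ↔
      ∀ᵐ ξ ∂((volume : Measure ℝ).restrict (Set.Iio 0)), (𝓕 f : L2V d) ξ = 0 :=
    (ae_restrict_iff' measurableSet_Iio).symm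
  rw [h3]
  constructor
  · intro h
    filter_upwards [h, h2] with ξ a b
    rw [← b]; exact a
  · intro h
    filter_upwards [h, h2] with ξ a b
    rw [b]; exact a

instance instCompleteSpaceHardy (d : ℕ) : CompleteSpace (hardySpace d) :=
  (ContinuousLinearMap.isClosed_ker _).completeSpace_coe

/-- The matrix-valued symbol `U`, regarded as a function into the operators on `ℂ^d`. -/
def symbol {d : ℕ} (U : ℝ → Mat d) :
    ℝ → (EuclideanSpace ℂ (Fin d) →L[ℂ] EuclideanSpace ℂ (Fin d)) :=
  fun x => Matrix.toEuclideanCLM (𝕜 := ℂ) (n := Fin d) (U x)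

open scoped Classical in
/-- The operator `f ↦ U f` on `L²(ℝ; ℂ^d)` for `U ∈ L^∞(ℝ; M_d(ℂ))` (and `0` for other `U`). -/
def mulOp {d : ℕ} (U : ℝ → Mat d) : L2V d →L[ℂ] L2V d :=
  if h : MemLp (symbol U) ⊤ (volume : Measure ℝ) then
    (ContinuousLinearMap.id ℂ
      (EuclideanSpace ℂ (Fin d) →L[ℂ] EuclideanSpace ℂ (Fin d))).holderL volume ⊤ 2 2 h.toLp
  else 0

/-- The Toeplitz operator `T_U f = Π₊(U f)` on `L²₊(ℝ; ℂ^d)`, where `Π₊` is the orthogonal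
projection of `L²(ℝ; ℂ^d)` onto `L²₊(ℝ; ℂ^d)`. -/
def toeplitz {d : ℕ} (U : ℝ → Mat d) : hardySpace d →L[ℂ] hardySpace d :=
  ((hardySpace d).orthogonalProjectionOnto.comp (mulOp U)).comp (hardySpace d).subtypeL

/-- The discrete spectrum of a (self-adjoint) bounded operator: the isolated points of the
spectrum with finite multiplicity. -/
def discreteSpectrum {H : Type*} [NormedAddCommGroup H] [NormedSpace ℂ H] (T : H →L[ℂ] H) :
    Set ℂ :=
  {μ | μ ∈ spectrum ℂ T ∧ (∃ ε > 0, ∀ z ∈ spectrum ℂ T, z ≠ μ → ε ≤ dist z μ) ∧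
    FiniteDimensional ℂ (Module.End.eigenspace (T : H →ₗ[ℂ] H) μ)}

/-- All points of the discrete spectrum have multiplicity one. -/
def HasSimpleDiscreteSpectrum {H : Type*} [NormedAddCommGroup H] [NormedSpace ℂ H]
    (T : H →L[ℂ] H) : Prop :=
  ∀ μ ∈ discreteSpectrum T, Module.finrank ℂ (Module.End.eigenspace (T : H →ₗ[ℂ] H) μ) = 1

/-- The profile `U_∞ + A/(x - y + iδ) + A^*/(x - y - iδ)`. -/
def solitonProfile {d : ℕ} (Uinf A : Mat d) (y δ : ℝ) (x : ℝ) : Mat d :=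
  Uinf + ((x : ℂ) - y + Complex.I * δ)⁻¹ • A + ((x : ℂ) - y - Complex.I * δ)⁻¹ • A.conjTranspose

end HWM

end

/-! The flow is linear on a finite-dimensional model. A rational map into the Grassmannian factors
as `U = Ψ W Ψ^*`, where `W` is its value at infinity and `Ψ` is a finite Blaschke–Potapov product,
and such a product is a transfer function `Ψ(x) = 1 + i ρ (G - x)⁻¹ ρ^*` with `ρ^* ρ = i (G - G^*)`.
The Sylvester equation `ρ^* W ρ = i (G T - T G^*)` then has a unique solution `T`, which is
Hermitian, and the quadratic expression `Ψ W Ψ^*` collapses to `W + V + V^*` with `V = -i ρ (G -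
x)⁻¹ B` (`realized_eq`).

Both identities persist when `G` is replaced by `G + t T`: the added terms are `t (T - T^*)` and `t
(T T - T T)`. This substitution solves the equation. Conjugation by `Ψ` reduces the claim to `[W, W
Y + Y W] = 0`, which holds because `W² = 1` (`evolution_identity`). No pole ever reaches the real
line (`IsRealization.evol`), so the solution is global.

The matrix `T` is the Toeplitz operator in disguise. The map `u ↦ ρ (G - x)⁻¹ u` embeds the model
space into the Hardy space and intertwines `T` with `T_U` (`toeplitz_modelMap`), and since `U² = 1`
the range of `T_U² - 1` lies in the model space (`toeplitz_toeplitz_sub`). The spectrum of `T_U` is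
thus contained in that of `T` together with `±1`. The points `±1`, when in the spectrum, have
infinite multiplicity, and the corresponding eigenvectors of `T` can be discarded from the
realization (`diag_annihilation`). What remains is a diagonal `T` whose entries form the discrete
spectrum, and simplicity makes these entries distinct.

For distinct `v_j` the large matrix `G + t T` is diagonalized to first order: a conjugation by `1 +
X / t` removes the off-diagonal part of `G` up to `O(1/t)`. On the Fourier side `U(t)` is given by
the semigroup `exp(-2πi ξ (G + t T))`, `ξ > 0`, so Duhamel's formula and an exponential decay
uniform in `t` (`exists_uniformDecay`) bound every Sobolev norm and give convergence at rate `1/|t|`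
to the map obtained from the diagonal part of `G`. That map is a superposition of simple poles at
`G_jj + t v_j` and their conjugates: the sum of solitons, each of which is itself the flow of a
one-dimensional realization.

Uniqueness is an `L²` energy estimate. The time derivative of the energy of a difference `D` only
contains `(|D_x| D) D - D (|D_x| D)` paired with one of the solutions, where `|D_x|` denotes the
Fourier multiplier; its Fourier kernel `|ξ| - |ξ - ζ|` is at most `|ζ|`, so the derivative moves to
the smooth factor (`norm_fourierInv_commTerm_le`) and Grönwall's inequality applies. -/

noncomputable section

namespace HWM

open Matrix Complex
open scoped ComplexOrder

set_option linter.unusedSectionVars false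

/-! ### Finite-dimensional realizations of rational maps into the Grassmannian -/

section Realization

variable {d : ℕ} {ι : Type*} [Fintype ι] [DecidableEq ι]

/-- The matrices `G`, `T` and `ρ` form a realization with the limit `W` at infinity: `G` plays the
role of the generator of the adjoint shift semigroup on a finite-dimensional model space, `T` that
of the Toeplitz operator, and `ρ` is the residue at infinity. -/
structure IsRealization (W : Mat d) (G T : Matrix ι ι ℂ) (ρ : Matrix (Fin d) ι ℂ) : Prop where
  herm : Wᴴ = W
  sq : W * W = 1
  dissip : ρᴴ * ρ = I • (G - Gᴴ)
  sylvester : ρᴴ * W * ρ = I • (G * T - T * Gᴴ)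
  toeplitz_herm : Tᴴ = T
  regular : ∀ x : ℝ, IsUnit (G - (x : ℂ) • (1 : Matrix ι ι ℂ))

/-- The resolvent `(G - x)⁻¹`. -/
def resol (G : Matrix ι ι ℂ) (x : ℝ) : Matrix ι ι ℂ := (G - (x : ℂ) • (1 : Matrix ι ι ℂ))⁻¹

/-- The matrix `B = T ρ^* - ρ^* W`. -/
def inputMat (W : Mat d) (T : Matrix ι ι ℂ) (ρ : Matrix (Fin d) ι ℂ) : Matrix ι (Fin d) ℂ :=
  T * ρᴴ - ρᴴ * W

/-- The holomorphic part `V(x) = -i ρ (G - x)⁻¹ B`. -/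
def hardyPart (W : Mat d) (G T : Matrix ι ι ℂ) (ρ : Matrix (Fin d) ι ℂ) (x : ℝ) : Mat d :=
  -(I • (ρ * resol G x * inputMat W T ρ))

/-- The map `U = W + V + V^*`. -/
def realized (W : Mat d) (G T : Matrix ι ι ℂ) (ρ : Matrix (Fin d) ι ℂ) (x : ℝ) : Mat d :=
  W + hardyPart W G T ρ x + (hardyPart W G T ρ x)ᴴ

/-- The inner function `Ψ(x) = 1 + i ρ (G - x)⁻¹ ρ^*`. -/
def innerFun (G : Matrix ι ι ℂ) (ρ : Matrix (Fin d) ι ℂ) (x : ℝ) : Mat d :=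
  1 + I • (ρ * resol G x * ρᴴ)

/-- The linear evolution `M(t) = G + t T`. -/
def evol (G T : Matrix ι ι ℂ) (t : ℝ) : Matrix ι ι ℂ := G + (t : ℂ) • T

/-! ### Algebraic identities of a realization -/

section Identities

variable {W : Mat d} {G T : Matrix ι ι ℂ} {ρ : Matrix (Fin d) ι ℂ} {x : ℝ}

theorem resol_mul (h : IsUnit (G - (x : ℂ) • (1 : Matrix ι ι ℂ))) :
    resol G x * (G - (x : ℂ) • (1 : Matrix ι ι ℂ)) = 1 :=
  Matrix.nonsing_inv_mul _ ((Matrix.isUnit_iff_isUnit_det _).1 h)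

theorem mul_resol (h : IsUnit (G - (x : ℂ) • (1 : Matrix ι ι ℂ))) :
    (G - (x : ℂ) • (1 : Matrix ι ι ℂ)) * resol G x = 1 :=
  Matrix.mul_nonsing_inv _ ((Matrix.isUnit_iff_isUnit_det _).1 h)

theorem conjTranspose_sub_real (G : Matrix ι ι ℂ) (x : ℝ) :
    (G - (x : ℂ) • (1 : Matrix ι ι ℂ))ᴴ = Gᴴ - (x : ℂ) • (1 : Matrix ι ι ℂ) := by
  simp [conjTranspose_sub, conjTranspose_smul]

theorem dissip_shift (h : ρᴴ * ρ = I • (G - Gᴴ)) (x : ℝ) :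
    ρᴴ * ρ = I • ((G - (x : ℂ) • (1 : Matrix ι ι ℂ)) - (G - (x : ℂ) • (1 : Matrix ι ι ℂ))ᴴ) := by
  rw [h, conjTranspose_sub_real]; congr 1; abel

theorem sylvester_shift (h : ρᴴ * W * ρ = I • (G * T - T * Gᴴ)) (x : ℝ) :
    ρᴴ * W * ρ = I • ((G - (x : ℂ) • (1 : Matrix ι ι ℂ)) * T -
      T * (G - (x : ℂ) • (1 : Matrix ι ι ℂ))ᴴ) := by
  rw [h, conjTranspose_sub_real]; congr 1
  simp [sub_mul, mul_sub]

theorem resolH_dissip_resol (h : ρᴴ * ρ = I • (G - Gᴴ))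
    (hu : IsUnit (G - (x : ℂ) • (1 : Matrix ι ι ℂ))) :
    (resol G x)ᴴ * (ρᴴ * ρ) * resol G x = I • ((resol G x)ᴴ - resol G x) := by
  rw [dissip_shift h x]
  set K := G - (x : ℂ) • (1 : Matrix ι ι ℂ)
  have h1 : K * resol G x = 1 := mul_resol hu
  have h2 : (resol G x)ᴴ * Kᴴ = 1 := by rw [← conjTranspose_mul, h1, conjTranspose_one]
  rw [Matrix.mul_smul, Matrix.smul_mul, mul_sub, sub_mul, mul_assoc, h1, h2, mul_one, one_mul]

theorem resol_sylvester_resolH (h : ρᴴ * W * ρ = I • (G * T - T * Gᴴ))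
    (hu : IsUnit (G - (x : ℂ) • (1 : Matrix ι ι ℂ))) :
    resol G x * (ρᴴ * W * ρ) * (resol G x)ᴴ = I • (T * (resol G x)ᴴ - resol G x * T) := by
  rw [sylvester_shift h x]
  set K := G - (x : ℂ) • (1 : Matrix ι ι ℂ)
  have h1 : resol G x * K = 1 := resol_mul hu
  have h2 : Kᴴ * (resol G x)ᴴ = 1 := by rw [← conjTranspose_mul, h1, conjTranspose_one]
  rw [Matrix.mul_smul, Matrix.smul_mul, mul_sub, sub_mul, ← mul_assoc, h1, one_mul, ← mul_assoc,
    mul_assoc (resol G x * T), h2, mul_one]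

theorem innerFunH (G : Matrix ι ι ℂ) (ρ : Matrix (Fin d) ι ℂ) (x : ℝ) :
    (innerFun G ρ x)ᴴ = 1 - I • (ρ * (resol G x)ᴴ * ρᴴ) := by
  simp [innerFun, conjTranspose_add, conjTranspose_smul, conjTranspose_mul, Matrix.mul_assoc,
    sub_eq_add_neg]

/-- The sandwich `R^* ρ^* ρ R` equals `i (R^* - R)` by dissipation. This turns the quadratic term of
`Ψ^* ρ R` into a difference that replaces `R` by `R^*`. Unitarity of `Ψ` on the real line and the
later conjugation formulas follow from it. -/
theorem innerFunH_mul_ρ_resol (h : ρᴴ * ρ = I • (G - Gᴴ))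
    (hu : IsUnit (G - (x : ℂ) • (1 : Matrix ι ι ℂ))) :
    (innerFun G ρ x)ᴴ * (ρ * resol G x) = ρ * (resol G x)ᴴ := by
  have h1 := resolH_dissip_resol h hu
  rw [innerFunH, Matrix.sub_mul, Matrix.one_mul, Matrix.smul_mul]
  have : ρ * (resol G x)ᴴ * ρᴴ * (ρ * resol G x) =
      ρ * ((resol G x)ᴴ * (ρᴴ * ρ) * resol G x) := by simp only [Matrix.mul_assoc]
  rw [this, h1, Matrix.mul_smul, smul_smul, I_mul_I, Matrix.mul_sub]
  simp

theorem innerFunH_mul_innerFun (h : ρᴴ * ρ = I • (G - Gᴴ))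
    (hu : IsUnit (G - (x : ℂ) • (1 : Matrix ι ι ℂ))) :
    (innerFun G ρ x)ᴴ * innerFun G ρ x = 1 := by
  have h1 := innerFunH_mul_ρ_resol h hu
  have : innerFun G ρ x = 1 + I • ((ρ * resol G x) * ρᴴ) := rfl
  conv_lhs => rw [this, Matrix.mul_add, Matrix.mul_one, Matrix.mul_smul, ← this, ← Matrix.mul_assoc,
    h1, innerFunH]
  simp

theorem innerFun_mul_innerFunH (h : ρᴴ * ρ = I • (G - Gᴴ))
    (hu : IsUnit (G - (x : ℂ) • (1 : Matrix ι ι ℂ))) :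
    innerFun G ρ x * (innerFun G ρ x)ᴴ = 1 :=
  mul_eq_one_comm.1 (innerFunH_mul_innerFun h hu)

theorem hardyPartH (hW : Wᴴ = W) (hT : Tᴴ = T) (x : ℝ) :
    (hardyPart W G T ρ x)ᴴ = I • ((ρ * T - W * ρ) * (resol G x)ᴴ * ρᴴ) := by
  simp [hardyPart, inputMat, conjTranspose_smul, conjTranspose_mul, Matrix.mul_assoc,
    hW, hT]

/-- The only quadratic term of `Ψ W Ψ^*` contains `R (ρ^* W ρ) R^*`, which the Sylvester equation
rewrites as the linear expression `i (T R^* - R T)`. The linear terms then regroup into `V` and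
`V^*`. -/
theorem realized_eq (h : IsRealization W G T ρ) (x : ℝ) :
    realized W G T ρ x = innerFun G ρ x * W * (innerFun G ρ x)ᴴ := by
  have h3 := resol_sylvester_resolH h.sylvester (h.regular x)
  have h4 : ρ * resol G x * ρᴴ * W * (ρ * (resol G x)ᴴ * ρᴴ) =
      ρ * (I • (T * (resol G x)ᴴ - resol G x * T)) * ρᴴ := by
    rw [← h3]; simp only [Matrix.mul_assoc]
  rw [realized, hardyPartH h.herm h.toeplitz_herm, innerFunH, innerFun, hardyPart, inputMat]
  simp only [Matrix.add_mul, Matrix.mul_sub, Matrix.one_mul, Matrix.mul_one, Matrix.smul_mul,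
    Matrix.mul_smul, h4, smul_smul, I_mul_I, Matrix.sub_mul, smul_sub]
  simp only [Matrix.mul_assoc]
  match_scalars <;> simp

/-- Dissipation and the Sylvester equation make the terms with `K^*`, `K = G - x`, cancel in `B Ψ`.
It is the companion of `innerFunH_mul_ρ_resol` for the right-hand factor of `V`. -/
theorem inputMat_mul_innerFun (h : IsRealization W G T ρ) (x : ℝ) :
    resol G x * (inputMat W T ρ * innerFun G ρ x) =
      T * resol G x * ρᴴ - resol G x * ρᴴ * W := by
  have hu := h.regular x
  have h1 := dissip_shift h.dissip x
  have h2 := sylvester_shift h.sylvester x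
  set K := G - (x : ℂ) • (1 : Matrix ι ι ℂ) with hK
  have h3 : K * resol G x = 1 := mul_resol hu
  have h4 : resol G x * K = 1 := resol_mul hu
  have h5 : inputMat W T ρ * innerFun G ρ x = K * T * resol G x * ρᴴ - ρᴴ * W := by
    have e1 : T * ρᴴ * (ρ * resol G x * ρᴴ) = T * (ρᴴ * ρ) * (resol G x * ρᴴ) := by
      simp only [Matrix.mul_assoc]
    have e2 : ρᴴ * W * (ρ * resol G x * ρᴴ) = (ρᴴ * W * ρ) * (resol G x * ρᴴ) := by
      simp only [Matrix.mul_assoc]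
    have e3 : T * K * (resol G x * ρᴴ) = T * ρᴴ := by
      rw [Matrix.mul_assoc, ← Matrix.mul_assoc K, h3, Matrix.one_mul]
    rw [inputMat, innerFun, Matrix.mul_add, Matrix.mul_one, Matrix.mul_smul, Matrix.sub_mul, e1, e2,
      h1, h2]
    simp only [Matrix.mul_smul, Matrix.smul_mul, ← smul_sub, smul_smul, I_mul_I, Matrix.mul_sub,
      Matrix.sub_mul, e3]
    simp only [Matrix.mul_assoc]
    module
  rw [h5, Matrix.mul_sub]
  congr 1
  · rw [← Matrix.mul_assoc, ← Matrix.mul_assoc, ← Matrix.mul_assoc, h4, Matrix.one_mul]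
  · rw [Matrix.mul_assoc]

theorem conj_innerFun_injective (h : ρᴴ * ρ = I • (G - Gᴴ))
    (hu : IsUnit (G - (x : ℂ) • (1 : Matrix ι ι ℂ))) {Y Z : Mat d}
    (hYZ : (innerFun G ρ x)ᴴ * Y * innerFun G ρ x = Z) :
    Y = innerFun G ρ x * Z * (innerFun G ρ x)ᴴ := by
  have h1 := innerFun_mul_innerFunH h hu
  rw [← hYZ]
  calc Y = (innerFun G ρ x * (innerFun G ρ x)ᴴ) * Y * (innerFun G ρ x * (innerFun G ρ x)ᴴ) := by
        rw [h1]; simp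
    _ = _ := by noncomm_ring

/-- The identity `∂ₜ U = -(1/2) [U, ∂ₓ V - ∂ₓ V^*]`, where `∂ₜ V = i ρ R T R B` and
`∂ₓ V = -i ρ R R B`. -/
theorem evolution_identity (h : IsRealization W G T ρ) (x : ℝ) :
    I • (ρ * (resol G x * T * resol G x) * inputMat W T ρ) +
      (I • (ρ * (resol G x * T * resol G x) * inputMat W T ρ))ᴴ =
    -(1 / 2 : ℂ) • (realized W G T ρ x *
        (-(I • (ρ * (resol G x * resol G x) * inputMat W T ρ)) -
          (-(I • (ρ * (resol G x * resol G x) * inputMat W T ρ)))ᴴ) -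
      (-(I • (ρ * (resol G x * resol G x) * inputMat W T ρ)) -
          (-(I • (ρ * (resol G x * resol G x) * inputMat W T ρ)))ᴴ) * realized W G T ρ x) := by
  have hu := h.regular x
  have hI := h.dissip
  have a1 := innerFunH_mul_ρ_resol hI hu
  have a2 := inputMat_mul_innerFun h x
  have a3 := innerFunH_mul_innerFun hI hu
  set Ψ := innerFun G ρ x with hΨ
  set R := resol G x with hR
  set B := inputMat W T ρ with hB
  set X : Mat d := ρ * Rᴴ * T * R * ρᴴ with hX
  set X₂ : Mat d := ρ * Rᴴ * T * T * R * ρᴴ with hX₂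
  set Y : Mat d := ρ * Rᴴ * R * ρᴴ with hY
  have hXh : Xᴴ = X := by simp [hX, conjTranspose_mul, Matrix.mul_assoc, h.toeplitz_herm]
  have hX₂h : X₂ᴴ = X₂ := by simp [hX₂, conjTranspose_mul, Matrix.mul_assoc, h.toeplitz_herm]
  have hYh : Yᴴ = Y := by simp [hY, conjTranspose_mul, Matrix.mul_assoc]
  -- `Ψ^*` is absorbed by the left factor `ρ R` and `Ψ` by the right factor `R B`. The cases `S = T`
  -- and `S = 1` give the time and the space derivative of `V`.
  have key : ∀ S : Matrix ι ι ℂ, Ψᴴ * (ρ * (R * S * R) * B) * Ψ =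
      ρ * Rᴴ * S * (T * R * ρᴴ - R * ρᴴ * W) := by
    intro S
    calc Ψᴴ * (ρ * (R * S * R) * B) * Ψ = (Ψᴴ * (ρ * R)) * S * (R * (B * Ψ)) := by
          simp only [Matrix.mul_assoc]
      _ = _ := by rw [a1, a2]
  have b1 : Ψᴴ * (I • (ρ * (R * T * R) * B)) * Ψ = I • (X₂ - X * W) := by
    rw [Matrix.mul_smul, Matrix.smul_mul, key T, Matrix.mul_sub]
    simp only [hX₂, hX, Matrix.mul_assoc]
  have b2 : Ψᴴ * (-(I • (ρ * (R * R) * B))) * Ψ = -(I • (X - Y * W)) := by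
    have := key 1
    rw [Matrix.mul_one, Matrix.mul_one] at this
    rw [Matrix.mul_neg, Matrix.neg_mul, Matrix.mul_smul, Matrix.smul_mul, this, Matrix.mul_sub]
    simp only [hY, hX, Matrix.mul_assoc]
  have c1 := conj_innerFun_injective hI hu b1
  have c2 := conj_innerFun_injective hI hu b2
  rw [realized_eq h x, c1, c2]
  simp only [← hΨ, conjTranspose_mul, conjTranspose_conjTranspose, conjTranspose_neg,
    conjTranspose_smul, conjTranspose_sub, hXh, hX₂h, hYh, h.herm]
  -- The term `X₂` is Hermitian, so `i X₂` cancels against its adjoint.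
  have e1 : Ψ * (I • (X₂ - X * W)) * Ψᴴ + Ψ * (star I • (X₂ - W * X) * Ψᴴ) =
      Ψ * (I • (W * X - X * W)) * Ψᴴ := by
    rw [← Matrix.mul_assoc Ψ, ← Matrix.add_mul, ← Matrix.mul_add]
    congr 2
    simp only [star_def, conj_I]
    module
  rw [e1]
  have e2 : Ψ * -(I • (X - Y * W)) * Ψᴴ - Ψ * (-(star I • (X - W * Y)) * Ψᴴ) =
      Ψ * (-(I • ((2 : ℂ) • X - Y * W - W * Y))) * Ψᴴ := by
    rw [← Matrix.mul_assoc Ψ, ← Matrix.sub_mul, ← Matrix.mul_sub]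
    congr 2
    simp only [star_def, conj_I]
    module
  rw [e2]
  have e3 : ∀ P Q : Mat d, Ψ * P * Ψᴴ * (Ψ * Q * Ψᴴ) = Ψ * (P * Q) * Ψᴴ := by
    intro P Q
    calc Ψ * P * Ψᴴ * (Ψ * Q * Ψᴴ) = Ψ * P * (Ψᴴ * Ψ) * Q * Ψᴴ := by simp only [Matrix.mul_assoc]
      _ = _ := by rw [a3]; simp only [Matrix.mul_assoc, Matrix.one_mul]
  rw [e3, e3, ← Matrix.sub_mul, ← Matrix.mul_sub, ← Matrix.smul_mul, ← Matrix.mul_smul]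
  congr 2
  -- These relations give `[W, Y W + W Y] = 0`, so only `X` contributes to the commutator.
  have f1 : W * (Y * W) = W * Y * W := (Matrix.mul_assoc _ _ _).symm
  have f2 : W * (W * Y) = Y := by rw [← Matrix.mul_assoc, h.sq, Matrix.one_mul]
  have f3 : Y * W * W = Y := by rw [Matrix.mul_assoc, h.sq, Matrix.mul_one]
  simp only [Matrix.mul_neg, Matrix.neg_mul, Matrix.mul_smul, Matrix.smul_mul, Matrix.mul_sub,
    Matrix.sub_mul, f1, f2, f3]
  module

theorem realized_mem_gr {k : ℕ} (h : IsRealization W G T ρ) (hW : W ∈ Gr k d) (x : ℝ) :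
    realized W G T ρ x ∈ Gr k d := by
  have a := innerFunH_mul_innerFun h.dissip (h.regular x)
  have b := innerFun_mul_innerFunH h.dissip (h.regular x)
  rw [realized_eq h]
  refine ⟨?_, ?_, ?_⟩
  · simp [conjTranspose_mul, Matrix.mul_assoc, h.herm]
  · calc _ = innerFun G ρ x * W * ((innerFun G ρ x)ᴴ * innerFun G ρ x) * W * (innerFun G ρ x)ᴴ := by
          simp only [Matrix.mul_assoc]
      _ = innerFun G ρ x * (W * W) * (innerFun G ρ x)ᴴ := by
          rw [a]; simp only [Matrix.mul_assoc, Matrix.one_mul]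
      _ = 1 := by rw [h.sq, Matrix.mul_one, b]
  · rw [Matrix.trace_mul_comm, ← Matrix.mul_assoc, a, Matrix.one_mul]; exact hW.2.2

end Identities

/-! ### The linear evolution of a realization -/

section Evolution

variable {W : Mat d} {G T : Matrix ι ι ℂ} {ρ : Matrix (Fin d) ι ℂ}

/-- For a real eigenvalue, `‖ρ u‖² = i ⟨u, (G - G^*) u⟩` vanishes. -/
theorem ρ_mulVec_eq_zero_of_real_eigenvalue (h : ρᴴ * ρ = I • (G - Gᴴ)) {x : ℝ} {u : ι → ℂ}
    (hu : G *ᵥ u = (x : ℂ) • u) : ρ *ᵥ u = 0 := by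
  have h1 : star u ⬝ᵥ ((ρᴴ * ρ) *ᵥ u) = 0 := by
    rw [h, smul_mulVec, sub_mulVec, hu, dotProduct_smul, dotProduct_sub]
    have : star u ⬝ᵥ (Gᴴ *ᵥ u) = (x : ℂ) * (star u ⬝ᵥ u) := by
      rw [dotProduct_mulVec, ← star_mulVec, hu, star_smul, smul_dotProduct]
      simp
    rw [this, dotProduct_smul]
    simp
  rw [← mulVec_mulVec, dotProduct_mulVec, ← star_mulVec] at h1
  exact dotProduct_star_self_eq_zero.1 h1

theorem exists_mulVec_eq_of_not_isUnit {A : Matrix ι ι ℂ} (h : ¬ IsUnit A) :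
    ∃ u : ι → ℂ, u ≠ 0 ∧ A *ᵥ u = 0 := by
  rw [Matrix.isUnit_iff_isUnit_det, isUnit_iff_ne_zero, not_not] at h
  exact Matrix.exists_mulVec_eq_zero_iff.2 h

theorem eq_zero_of_mulVec_eq_smul {z : ℂ} (h : IsUnit (G - z • (1 : Matrix ι ι ℂ))) {u : ι → ℂ}
    (hu : G *ᵥ u = z • u) : u = 0 := by
  have h1 : (G - z • (1 : Matrix ι ι ℂ)) *ᵥ u = 0 := by
    rw [sub_mulVec, smul_mulVec, one_mulVec, hu, sub_self]
  have := Matrix.nonsing_inv_mul _ ((Matrix.isUnit_iff_isUnit_det _).1 h)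
  rw [← one_mulVec u, ← this, ← mulVec_mulVec, h1, mulVec_zero]

theorem eigenvalue_real_of_herm (hT : Tᴴ = T) {z : ℂ} {u : ι → ℂ} (h0 : u ≠ 0)
    (hu : T *ᵥ u = z • u) : (z.re : ℂ) = z := by
  have h1 : star u ⬝ᵥ (T *ᵥ u) = z * (star u ⬝ᵥ u) := by rw [hu, dotProduct_smul]; simp
  have h2 : star u ⬝ᵥ (T *ᵥ u) = star z * (star u ⬝ᵥ u) := by
    conv_lhs => rw [← hT]
    rw [dotProduct_mulVec, ← star_mulVec, hu, star_smul, smul_dotProduct]; simp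
  have h3 : star u ⬝ᵥ u ≠ 0 := by
    intro h; exact h0 (dotProduct_star_self_eq_zero.1 h)
  have h4 := mul_right_cancel₀ h3 (h1.symm.trans h2)
  exact conj_eq_iff_re.1 h4.symm

/-- The identities are stable because `T` is Hermitian and commutes with itself; regularity is the
point. If `M = G + t T` had a real eigenvalue `x`, its eigenspace would lie in the kernel of `ρ`,
where `M^* = M`, and the Sylvester equation would make it invariant under `T`. A common eigenvector
of `M` and `T` would then be an eigenvector of `G` with a real eigenvalue. -/
theorem IsRealization.evol (h : IsRealization W G T ρ) (t : ℝ) :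
    IsRealization W (evol G T t) T ρ := by
  have hd : ρᴴ * ρ = I • (HWM.evol G T t - (HWM.evol G T t)ᴴ) := by
    rw [h.dissip]; congr 1
    simp [HWM.evol, conjTranspose_add, conjTranspose_smul, h.toeplitz_herm]
  have hs : ρᴴ * W * ρ = I • (HWM.evol G T t * T - T * (HWM.evol G T t)ᴴ) := by
    rw [h.sylvester]; congr 1
    simp [HWM.evol, conjTranspose_add, conjTranspose_smul, h.toeplitz_herm, Matrix.add_mul,
      Matrix.mul_add]
  refine ⟨h.herm, h.sq, hd, hs, h.toeplitz_herm, fun x => ?_⟩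
  by_contra hx
  set M := HWM.evol G T t with hM
  obtain ⟨u, hu0, hu⟩ := exists_mulVec_eq_of_not_isUnit hx
  have hu' : M *ᵥ u = (x : ℂ) • u := by
    rw [sub_mulVec, smul_mulVec, one_mulVec] at hu; exact sub_eq_zero.1 hu
  let E : Submodule ℂ (ι → ℂ) := Module.End.eigenspace (Matrix.toLin' M) (x : ℂ)
  have memE : ∀ w, w ∈ E ↔ M *ᵥ w = (x : ℂ) • w := fun w => by
    simp [E]
  have hTE : ∀ w ∈ E, Matrix.toLin' T w ∈ E := by
    intro w hw
    rw [memE] at hw ⊢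
    have hρ := ρ_mulVec_eq_zero_of_real_eigenvalue hd hw
    have hMh : Mᴴ *ᵥ w = (x : ℂ) • w := by
      have h1 : (ρᴴ * ρ) *ᵥ w = 0 := by rw [← mulVec_mulVec, hρ, mulVec_zero]
      rw [hd, smul_mulVec, smul_eq_zero_iff_right I_ne_zero, sub_mulVec, sub_eq_zero] at h1
      rw [← h1, hw]
    have h1 : (ρᴴ * W * ρ) *ᵥ w = 0 := by rw [← mulVec_mulVec, hρ, mulVec_zero]
    rw [hs, smul_mulVec, smul_eq_zero_iff_right I_ne_zero, sub_mulVec, sub_eq_zero,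
      ← mulVec_mulVec, ← mulVec_mulVec, hMh, mulVec_smul] at h1
    simpa using h1
  have : Nontrivial E := ⟨⟨⟨u, (memE u).2 hu'⟩, 0, fun h => hu0 (congrArg Subtype.val h)⟩⟩
  obtain ⟨v, hv⟩ := Module.End.exists_eigenvalue ((Matrix.toLin' T).restrict hTE)
  obtain ⟨φ, hφ⟩ := hv.exists_hasEigenvector
  have hφ0 : (φ : ι → ℂ) ≠ 0 := fun h => hφ.2 (Subtype.ext h)
  have hTφ : T *ᵥ (φ : ι → ℂ) = v • (φ : ι → ℂ) := by
    have := congrArg Subtype.val hφ.apply_eq_smul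
    simpa using this
  have hv' := eigenvalue_real_of_herm h.toeplitz_herm hφ0 hTφ
  have hMφ := (memE φ).1 φ.2
  -- `G = M - t T` acts on the common eigenvector by a real scalar, since the eigenvalue of the
  -- Hermitian `T` is real.
  have hGφ : G *ᵥ (φ : ι → ℂ) = ((x - t * v.re : ℝ) : ℂ) • (φ : ι → ℂ) := by
    rw [hM, HWM.evol, add_mulVec, smul_mulVec, hTφ] at hMφ
    push_cast
    rw [hv', sub_smul, mul_smul, ← hMφ]; abel
  exact hφ0 (eq_zero_of_mulVec_eq_smul (h.regular _) hGφ)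

end Evolution

end Realization

end HWM

end

noncomputable section

namespace HWM

open Matrix Complex
open scoped ComplexOrder Matrix.Norms.L2Operator

set_option linter.unusedSectionVars false

/-! ### Exponential semigroups -/

section Semigroup

variable {𝔸 : Type*} [NormedRing 𝔸] [NormedAlgebra ℝ 𝔸] [CompleteSpace 𝔸]

theorem exp_add_smul (A : 𝔸) (r s : ℝ) :
    NormedSpace.exp ((r + s) • A) = NormedSpace.exp (r • A) * NormedSpace.exp (s • A) := by
  let _ : NormedAlgebra ℚ 𝔸 := NormedAlgebra.restrictScalars ℚ ℝ 𝔸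
  rw [add_smul]
  exact NormedSpace.exp_add_of_commute (((Commute.refl A).smul_left r).smul_right s)

theorem continuous_exp' : Continuous (NormedSpace.exp : 𝔸 → 𝔸) := by
  let _ : NormedAlgebra ℚ 𝔸 := NormedAlgebra.restrictScalars ℚ ℝ 𝔸
  exact NormedSpace.exp_continuous

theorem exp_nat_smul (A : 𝔸) (n : ℕ) :
    NormedSpace.exp ((n : ℝ) • A) = NormedSpace.exp A ^ n := by
  let _ : NormedAlgebra ℚ 𝔸 := NormedAlgebra.restrictScalars ℚ ℝ 𝔸
  rw [← NormedSpace.exp_nsmul, Nat.cast_smul_eq_nsmul]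

theorem hasDerivAt_duhamel (A A₀ X : 𝔸) (ξ r : ℝ) :
    HasDerivAt (fun r : ℝ => NormedSpace.exp ((ξ - r) • A) * X * NormedSpace.exp (r • A₀))
      (NormedSpace.exp ((ξ - r) • A) * (X * A₀ - A * X) * NormedSpace.exp (r • A₀)) r := by
  have h1 : HasDerivAt (fun r : ℝ => NormedSpace.exp ((ξ - r) • A))
      (-(NormedSpace.exp ((ξ - r) • A) * A)) r := by
    have := (hasDerivAt_exp_smul_const A (ξ - r)).scomp r ((hasDerivAt_id r).const_sub ξ)
    refine (this.congr_deriv (by simp)).congr_of_eventuallyEq (Eventually.of_forall fun _ => rfl)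
  have h2 := hasDerivAt_exp_smul_const' A₀ r
  refine ((h1.mul_const X).mul h2).congr_deriv ?_
  noncomm_ring

/-- Duhamel's estimate for two exponentially decaying semigroups intertwined up to an error. -/
theorem norm_intertwine_exp_sub_le (A A₀ X : 𝔸) {C c : ℝ} (hA : ∀ r : ℝ, 0 ≤ r →
    ‖NormedSpace.exp (r • A)‖ ≤ C * Real.exp (-c * r)) (hA₀ : ∀ r : ℝ, 0 ≤ r →
    ‖NormedSpace.exp (r • A₀)‖ ≤ C * Real.exp (-c * r)) {ξ : ℝ} (hξ : 0 ≤ ξ) :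
    ‖X * NormedSpace.exp (ξ • A₀) - NormedSpace.exp (ξ • A) * X‖ ≤
      C ^ 2 * ‖X * A₀ - A * X‖ * (ξ * Real.exp (-c * ξ)) := by
  have key : ∀ r ∈ Set.Icc 0 ξ,
      ‖NormedSpace.exp ((ξ - r) • A) * (X * A₀ - A * X) * NormedSpace.exp (r • A₀)‖ ≤
        C ^ 2 * ‖X * A₀ - A * X‖ * Real.exp (-c * ξ) := by
    intro r hr
    calc _ ≤ ‖NormedSpace.exp ((ξ - r) • A)‖ * ‖X * A₀ - A * X‖ * ‖NormedSpace.exp (r • A₀)‖ :=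
          (norm_mul_le _ _).trans (by gcongr; exact norm_mul_le _ _)
      _ ≤ (C * Real.exp (-c * (ξ - r))) * ‖X * A₀ - A * X‖ * (C * Real.exp (-c * r)) := by
          have h1 := hA (ξ - r) (by linarith [hr.2])
          have h2 := hA₀ r hr.1
          have : 0 ≤ C * Real.exp (-c * (ξ - r)) := (norm_nonneg _).trans h1
          gcongr
      _ = C ^ 2 * ‖X * A₀ - A * X‖ * (Real.exp (-c * (ξ - r)) * Real.exp (-c * r)) := by ring
      _ = _ := by rw [← Real.exp_add]; congr 2; ring
  have := Convex.norm_image_sub_le_of_norm_hasDerivWithin_le (𝕜 := ℝ)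
    (fun r _ => (hasDerivAt_duhamel A A₀ X ξ r).hasDerivWithinAt) key (convex_Icc 0 ξ)
    (Set.left_mem_Icc.2 hξ) (Set.right_mem_Icc.2 hξ)
  simp only [sub_self, zero_smul, sub_zero, NormedSpace.exp_zero, one_mul, mul_one] at this
  rw [Real.norm_of_nonneg hξ] at this
  linarith

/-- Splitting `r` into integer and fractional part bounds the norm by `q ^ ⌊r⌋`. The factor `q⁻¹`
pays for the fractional part. -/
theorem exp_decay_of_norm_le (A : 𝔸) (h1 : ∀ r : ℝ, 0 ≤ r → ‖NormedSpace.exp (r • A)‖ ≤ 1) {q : ℝ}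
    (hq : 0 < q) (hq1 : q < 1) (hA : ‖NormedSpace.exp A‖ ≤ q) (r : ℝ) (hr : 0 ≤ r) :
    ‖NormedSpace.exp (r • A)‖ ≤ q⁻¹ * Real.exp (-(-Real.log q) * r) := by
  have e : r = (⌊r⌋₊ : ℝ) + (r - ⌊r⌋₊) := by ring
  have hf := Nat.floor_le hr
  have hf2 := Nat.lt_floor_add_one r
  have h2 : ‖NormedSpace.exp ((⌊r⌋₊ : ℝ) • A)‖ ≤ q ^ ⌊r⌋₊ := by
    rcases Nat.eq_zero_or_pos ⌊r⌋₊ with h0 | h0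
    · have := h1 0 le_rfl
      simpa [h0] using this
    · rw [exp_nat_smul]
      exact (norm_pow_le' _ h0).trans (pow_le_pow_left₀ (norm_nonneg _) hA _)
  calc ‖NormedSpace.exp (r • A)‖
      ≤ ‖NormedSpace.exp ((⌊r⌋₊ : ℝ) • A)‖ * ‖NormedSpace.exp ((r - ⌊r⌋₊) • A)‖ := by
        conv_lhs => rw [e, exp_add_smul]
        exact norm_mul_le _ _
    _ ≤ q ^ ⌊r⌋₊ * 1 := by
        have := h1 (r - ⌊r⌋₊) (by linarith)
        gcongr
    _ ≤ q⁻¹ * Real.exp (-(-Real.log q) * r) := by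
        rw [neg_neg, ← Real.rpow_def_of_pos hq, mul_one, ← Real.rpow_natCast, ← Real.rpow_neg_one,
          ← Real.rpow_add hq]
        exact Real.rpow_le_rpow_of_exponent_ge hq hq1.le (by linarith)

end Semigroup

/-! ### Dissipative semigroups: contraction and exponential decay -/

section Contraction

variable {d : ℕ} {ι : Type*} [Fintype ι] [DecidableEq ι]

theorem re_star_dotProduct_self {n : Type*} [Fintype n] (u : n → ℂ) :
    (star u ⬝ᵥ u).re = ‖(WithLp.toLp 2 u : EuclideanSpace ℂ n)‖ ^ 2 := by
  rw [EuclideanSpace.norm_sq_eq]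
  simp only [dotProduct, Complex.re_sum]
  refine Finset.sum_congr rfl fun i _ => ?_
  simp [← Complex.normSq_eq_norm_sq, Complex.normSq_apply]

theorem re_dotProduct_conjTranspose_mul_self {m n : Type*} [Fintype m] [Fintype n]
    (Q : Matrix m n ℂ) (u : n → ℂ) : (star u ⬝ᵥ ((Qᴴ * Q) *ᵥ u)).re =
      ‖(WithLp.toLp 2 (Q *ᵥ u) : EuclideanSpace ℂ m)‖ ^ 2 := by
  rw [← re_star_dotProduct_self, ← mulVec_mulVec, dotProduct_mulVec, ← star_mulVec]

theorem l2_opNorm_le_of_forall (P : Matrix ι ι ℂ) {q : ℝ} (hq : 0 ≤ q)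
    (h : ∀ u : ι → ℂ, ‖(WithLp.toLp 2 (P *ᵥ u) : EuclideanSpace ℂ ι)‖ ≤
      q * ‖(WithLp.toLp 2 u : EuclideanSpace ℂ ι)‖) : ‖P‖ ≤ q := by
  rw [Matrix.l2_opNorm_def]
  refine ContinuousLinearMap.opNorm_le_bound _ hq fun u => ?_
  exact h u.ofLp

/-- Compactness of the unit sphere: the norm of `P u` attains its maximum there, so the pointwise
strict inequality is uniform. The sphere is empty exactly when the index type is, hence the separate
case. -/
theorem l2_opNorm_lt_one_of_forall (P : Matrix ι ι ℂ)
    (h : ∀ u : ι → ℂ, u ≠ 0 → ‖(WithLp.toLp 2 (P *ᵥ u) : EuclideanSpace ℂ ι)‖ <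
      ‖(WithLp.toLp 2 u : EuclideanSpace ℂ ι)‖) : ‖P‖ < 1 := by
  let f : EuclideanSpace ℂ ι → ℝ := fun u => ‖(WithLp.toLp 2 (P *ᵥ u.ofLp) : EuclideanSpace ℂ ι)‖
  have hf : Continuous f := by
    have : Continuous (Matrix.toEuclideanLin P) := LinearMap.continuous_of_finiteDimensional _
    exact this.norm
  rcases (Metric.sphere (0 : EuclideanSpace ℂ ι) 1).eq_empty_or_nonempty with he | hne
  · refine (l2_opNorm_le_of_forall P le_rfl fun u => ?_).trans_lt one_pos
    by_cases hu : u = 0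
    · simp [hu]
    · exfalso
      have hu' : (WithLp.toLp 2 u : EuclideanSpace ℂ ι) ≠ 0 := by simpa using hu
      have : ((‖(WithLp.toLp 2 u : EuclideanSpace ℂ ι)‖⁻¹ : ℝ) : ℂ) •
          (WithLp.toLp 2 u : EuclideanSpace ℂ ι) ∈ Metric.sphere (0 : EuclideanSpace ℂ ι) 1 := by
        simp [norm_smul, hu']
      rw [he] at this; exact this
  · obtain ⟨u₀, hu₀, hmax⟩ := (isCompact_sphere (0 : EuclideanSpace ℂ ι) 1).exists_isMaxOn hne
      hf.continuousOn
    have hu₀' : ‖u₀‖ = 1 := by simpa using hu₀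
    have hlt : f u₀ < 1 := by
      have := h u₀.ofLp (fun h0 => by
        have : u₀ = 0 := by ext i; simp [h0]
        rw [this] at hu₀'; simp at hu₀')
      rw [WithLp.toLp_ofLp, hu₀'] at this
      exact this
    refine (l2_opNorm_le_of_forall P (norm_nonneg _) fun u => ?_).trans_lt hlt
    by_cases hu : u = 0
    · simp [hu]
    · set u' : EuclideanSpace ℂ ι := WithLp.toLp 2 u with hu'
      have hn : ‖u'‖ ≠ 0 := by simpa [hu'] using hu
      have := hmax (show ((‖u'‖⁻¹ : ℝ) : ℂ) • u' ∈ Metric.sphere (0 : EuclideanSpace ℂ ι) 1 by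
        simp only [mem_sphere_zero_iff_norm, norm_smul, norm_real, norm_inv, norm_norm]
        exact inv_mul_cancel₀ hn)
      simp only [Set.mem_ofPred_eq, f, WithLp.ofLp_smul, mulVec_smul, WithLp.toLp_smul, norm_smul,
        norm_real, norm_inv, norm_norm] at this
      rw [inv_mul_le_iff₀ (by positivity)] at this
      rw [mul_comm]
      exact this

/-- The generator `-2πi M` of the semigroup that gives the Fourier transform of a realization. -/
def gen (M : Matrix ι ι ℂ) : Matrix ι ι ℂ := (-(2 * Real.pi * I) : ℂ) • M

variable {M : Matrix ι ι ℂ} {ρ : Matrix (Fin d) ι ℂ}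

theorem gen_add_conjTranspose (h : ρᴴ * ρ = I • (M - Mᴴ)) :
    gen M + (gen M)ᴴ = (-(2 * Real.pi) : ℂ) • (ρᴴ * ρ) := by
  rw [h, gen, conjTranspose_smul]
  simp only [star_neg, star_mul', star_def, conj_I, Complex.conj_ofReal, map_ofNat]
  module

/-- The Hermitian part of the generator is `-π ρ^* ρ`, so energy is lost only through `ρ`. -/
theorem hasDerivAt_energy (h : ρᴴ * ρ = I • (M - Mᴴ)) (u : ι → ℂ) (ξ : ℝ) :
    HasDerivAt (fun r : ℝ => ‖(WithLp.toLp 2 (NormedSpace.exp (r • gen M) *ᵥ u) :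
        EuclideanSpace ℂ ι)‖ ^ 2)
      (-(2 * Real.pi) * ‖(WithLp.toLp 2 (ρ *ᵥ (NormedSpace.exp (ξ • gen M) *ᵥ u)) :
        EuclideanSpace ℂ (Fin d))‖ ^ 2) ξ := by
  have h1 := hasDerivAt_exp_smul_const' (gen M) ξ
  have h2 := (h1.star).mul h1
  set P := NormedSpace.exp (ξ • gen M) with hP
  have h3 : star (gen M * P) * P + star P * (gen M * P) = (-(2 * Real.pi) : ℂ) • ((ρ * P)ᴴ * (ρ * P)) := by
    calc star (gen M * P) * P + star P * (gen M * P) = Pᴴ * ((gen M + (gen M)ᴴ) * P) := by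
          simp only [star_eq_conjTranspose, conjTranspose_mul]; noncomm_ring
      _ = _ := by
          rw [gen_add_conjTranspose h, conjTranspose_mul]
          simp [Matrix.mul_assoc]
  rw [h3] at h2
  let ℓ : Matrix ι ι ℂ →ₗ[ℝ] ℝ :=
    { toFun := fun A => (star u ⬝ᵥ (A *ᵥ u)).re
      map_add' := fun A B => by simp [add_mulVec, dotProduct_add]
      map_smul' := fun c A => by
        have : c • A = (c : ℂ) • A := by ext; simp
        rw [this, smul_mulVec, dotProduct_smul]; simp }
  have h4 := (LinearMap.toContinuousLinearMap ℓ).hasFDerivAt.comp_hasDerivAt ξ h2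
  refine (h4.congr_deriv ?_).congr_of_eventuallyEq (Eventually.of_forall fun r => ?_)
  · change (star u ⬝ᵥ (((-(2 * Real.pi) : ℂ) • ((ρ * P)ᴴ * (ρ * P))) *ᵥ u)).re = _
    rw [smul_mulVec, dotProduct_smul, mulVec_mulVec, ← re_dotProduct_conjTranspose_mul_self]
    have : (-(2 * Real.pi) : ℂ) = ((-(2 * Real.pi) : ℝ) : ℂ) := by push_cast; ring
    rw [this, smul_eq_mul, Complex.re_ofReal_mul]
  · exact (re_dotProduct_conjTranspose_mul_self _ _).symm

theorem energy_antitone (h : ρᴴ * ρ = I • (M - Mᴴ)) (u : ι → ℂ) :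
    Antitone (fun r : ℝ => ‖(WithLp.toLp 2 (NormedSpace.exp (r • gen M) *ᵥ u) :
        EuclideanSpace ℂ ι)‖ ^ 2) :=
  antitone_of_hasDerivAt_nonpos (fun ξ => hasDerivAt_energy h u ξ) fun ξ => by
    have := Real.pi_pos
    simp only [Pi.zero_apply]
    nlinarith [sq_nonneg ‖(WithLp.toLp 2 (ρ *ᵥ (NormedSpace.exp (ξ • gen M) *ᵥ u)) :
        EuclideanSpace ℂ (Fin d))‖]

theorem norm_exp_gen_le_one (h : ρᴴ * ρ = I • (M - Mᴴ)) (r : ℝ) (hr : 0 ≤ r) :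
    ‖NormedSpace.exp (r • gen M)‖ ≤ 1 := by
  refine l2_opNorm_le_of_forall _ zero_le_one fun u => ?_
  have := energy_antitone h u hr
  simp only [zero_smul, NormedSpace.exp_zero, one_mulVec] at this
  rw [one_mul]
  exact (sq_le_sq₀ (norm_nonneg _) (norm_nonneg _)).1 this

/-- An observability argument. If some `u` keeps its norm up to time `1`, then `ρ` vanishes along
the orbit, hence on the whole unobservable subspace generated by it. This subspace is invariant
under the generator, so it contains an eigenvector `φ` with `ρ φ = 0`. There `M^* φ = M φ`, the
eigenvalue is real, and regularity is violated. -/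
theorem norm_exp_gen_lt_one (h : ρᴴ * ρ = I • (M - Mᴴ))
    (hreg : ∀ x : ℝ, IsUnit (M - (x : ℂ) • (1 : Matrix ι ι ℂ))) :
    ‖NormedSpace.exp (gen M)‖ < 1 := by
  refine l2_opNorm_lt_one_of_forall _ fun u hu0 => ?_
  by_contra hlt
  push Not at hlt
  set y : ℝ → ι → ℂ := fun r => NormedSpace.exp (r • gen M) *ᵥ u with hy
  have hanti := energy_antitone h u
  have hconst : ∀ r ∈ Set.Ioo (0 : ℝ) 1,
      ‖(WithLp.toLp 2 (NormedSpace.exp (r • gen M) *ᵥ u) : EuclideanSpace ℂ ι)‖ ^ 2 =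
      ‖(WithLp.toLp 2 u : EuclideanSpace ℂ ι)‖ ^ 2 := by
    intro r hr
    have h1 := hanti hr.1.le
    have h2 := hanti hr.2.le
    simp only [zero_smul, NormedSpace.exp_zero, one_mulVec, one_smul] at h1 h2
    refine le_antisymm h1 (le_trans ?_ h2)
    gcongr
  have hρ0 : ∀ r ∈ Set.Ioo (0 : ℝ) 1, ρ *ᵥ y r = 0 := by
    intro r hr
    have h1 := hasDerivAt_energy h u r
    have h2 : HasDerivAt (fun r : ℝ => ‖(WithLp.toLp 2 (NormedSpace.exp (r • gen M) *ᵥ u) :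
        EuclideanSpace ℂ ι)‖ ^ 2) 0 r :=
      (hasDerivAt_const r _).congr_of_eventuallyEq
        (Filter.eventuallyEq_of_mem (Ioo_mem_nhds hr.1 hr.2) hconst)
    have h3 := h1.unique h2
    have hpi := Real.pi_pos
    have h4 : ‖(WithLp.toLp 2 (ρ *ᵥ y r) : EuclideanSpace ℂ (Fin d))‖ ^ 2 = 0 := by
      rcases mul_eq_zero.1 h3 with h | h
      · linarith
      · exact h
    simpa using h4
  -- Each differentiation in time produces one more power of the generator. The open interval keeps
  -- all derivatives two-sided.
  have hρn : ∀ n : ℕ, ∀ r ∈ Set.Ioo (0 : ℝ) 1, ρ *ᵥ ((gen M) ^ n *ᵥ y r) = 0 := by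
    intro n
    induction n with
    | zero => simpa using hρ0
    | succ n ih =>
      intro r hr
      let ℓ : Matrix ι ι ℂ →ₗ[ℝ] (Fin d → ℂ) :=
        { toFun := fun A => ρ *ᵥ ((gen M) ^ n *ᵥ (A *ᵥ u))
          map_add' := fun A B => by simp [add_mulVec, mulVec_add]
          map_smul' := fun c A => by
            have : c • A = (c : ℂ) • A := by ext; simp
            rw [this, smul_mulVec, mulVec_smul, mulVec_smul]; ext; simp }
      have h1 := (LinearMap.toContinuousLinearMap ℓ).hasFDerivAt.comp_hasDerivAt r
        (hasDerivAt_exp_smul_const' (gen M) r)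
      have h2 : HasDerivAt (LinearMap.toContinuousLinearMap ℓ ∘
          fun r : ℝ => NormedSpace.exp (r • gen M)) 0 r :=
        (hasDerivAt_const r (0 : Fin d → ℂ)).congr_of_eventuallyEq
          (Filter.eventuallyEq_of_mem (Ioo_mem_nhds hr.1 hr.2) ih)
      have h3 := h1.unique h2
      have h4 : ρ *ᵥ ((gen M) ^ n *ᵥ ((gen M * NormedSpace.exp (r • gen M)) *ᵥ u)) = 0 := h3
      rw [pow_succ, ← mulVec_mulVec, hy]
      simpa [← mulVec_mulVec] using h4
  have hy0 : y (1 / 2) ≠ 0 := by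
    intro h0
    have h1 := hconst (1 / 2) (by constructor <;> norm_num)
    have h2 : NormedSpace.exp ((1 / 2 : ℝ) • gen M) *ᵥ u = 0 := h0
    rw [h2] at h1
    have h3 : ‖(WithLp.toLp 2 u : EuclideanSpace ℂ ι)‖ ^ 2 = 0 := by rw [← h1]; simp
    exact hu0 (by simpa using h3)
  -- The unobservable subspace. It contains the nonzero vector `y (1 / 2)`.
  let O : Submodule ℂ (ι → ℂ) := ⨅ n : ℕ, LinearMap.ker (Matrix.toLin' (ρ * (gen M) ^ n))
  have memO : ∀ w, w ∈ O ↔ ∀ n : ℕ, ρ *ᵥ ((gen M) ^ n *ᵥ w) = 0 := by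
    intro w; simp only [O, Submodule.mem_iInf, LinearMap.mem_ker, Matrix.toLin'_apply, mulVec_mulVec]
  have hinv : ∀ w ∈ O, Matrix.toLin' (gen M) w ∈ O := by
    intro w hw
    rw [memO] at hw ⊢
    intro n
    have := hw (n + 1)
    rw [pow_succ, ← mulVec_mulVec] at this
    simpa using this
  have : Nontrivial O := ⟨⟨⟨y (1 / 2), (memO _).2 fun n => hρn n _ (by constructor <;> norm_num)⟩, 0,
    fun h => hy0 (congrArg Subtype.val h)⟩⟩
  obtain ⟨z, hz⟩ := Module.End.exists_eigenvalue ((Matrix.toLin' (gen M)).restrict hinv)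
  obtain ⟨φ, hφ⟩ := hz.exists_hasEigenvector
  have hφ0 : (φ : ι → ℂ) ≠ 0 := fun h => hφ.2 (Subtype.ext h)
  have hgφ : gen M *ᵥ (φ : ι → ℂ) = z • (φ : ι → ℂ) := by
    have := congrArg Subtype.val hφ.apply_eq_smul
    simpa using this
  have hρφ : ρ *ᵥ (φ : ι → ℂ) = 0 := by simpa using (memO φ).1 φ.2 0
  have hc : (-(2 * Real.pi * I) : ℂ) ≠ 0 := by simp [Real.pi_ne_zero]
  have hMφ : M *ᵥ (φ : ι → ℂ) = ((-(2 * Real.pi * I) : ℂ)⁻¹ * z) • (φ : ι → ℂ) := by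
    rw [mul_smul, ← hgφ, gen, smul_mulVec, smul_smul, inv_mul_cancel₀ hc, one_smul]
  set lam := (-(2 * Real.pi * I) : ℂ)⁻¹ * z
  have hMh : Mᴴ *ᵥ (φ : ι → ℂ) = M *ᵥ (φ : ι → ℂ) := by
    have h1 : (ρᴴ * ρ) *ᵥ (φ : ι → ℂ) = 0 := by rw [← mulVec_mulVec, hρφ, mulVec_zero]
    rw [h, smul_mulVec, smul_eq_zero_iff_right I_ne_zero, sub_mulVec, sub_eq_zero] at h1
    exact h1.symm
  have hreal : (lam.re : ℂ) = lam := by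
    have h1 : star (φ : ι → ℂ) ⬝ᵥ (M *ᵥ (φ : ι → ℂ)) = lam * (star (φ : ι → ℂ) ⬝ᵥ (φ : ι → ℂ)) := by
      rw [hMφ, dotProduct_smul]; simp
    have h2 : star (φ : ι → ℂ) ⬝ᵥ (M *ᵥ (φ : ι → ℂ)) =
        star lam * (star (φ : ι → ℂ) ⬝ᵥ (φ : ι → ℂ)) := by
      rw [← hMh, dotProduct_mulVec, ← star_mulVec, hMφ, star_smul, smul_dotProduct]; simp
    have h3 : star (φ : ι → ℂ) ⬝ᵥ (φ : ι → ℂ) ≠ 0 := fun h =>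
      hφ0 (dotProduct_star_self_eq_zero.1 h)
    exact conj_eq_iff_re.1 (mul_right_cancel₀ h3 (h1.symm.trans h2)).symm
  rw [← hreal] at hMφ
  exact hφ0 (eq_zero_of_mulVec_eq_smul (hreg _) hMφ)

theorem exists_exp_gen_decay (h : ρᴴ * ρ = I • (M - Mᴴ))
    (hreg : ∀ x : ℝ, IsUnit (M - (x : ℂ) • (1 : Matrix ι ι ℂ))) :
    ∃ C c : ℝ, 0 < C ∧ 0 < c ∧ ∀ r : ℝ, 0 ≤ r →
      ‖NormedSpace.exp (r • gen M)‖ ≤ C * Real.exp (-c * r) := by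
  obtain ⟨q, h1, h2⟩ := exists_between (max_lt (norm_exp_gen_lt_one h hreg) one_pos)
  have hq0 : 0 < q := (le_max_right _ _).trans_lt h1
  exact ⟨q⁻¹, -Real.log q, inv_pos.2 hq0, by linarith [Real.log_neg hq0 h2],
    exp_decay_of_norm_le _ (norm_exp_gen_le_one h) hq0 h2 ((le_max_left _ _).trans h1.le)⟩

end Contraction

end HWM

end

noncomputable section

namespace HWM

open Matrix Complex
open scoped ComplexOrder Matrix.Norms.L2Operator

set_option linter.unusedSectionVars false

/-! ### Large times: a realization with a diagonal matrix `T` with distinct entries -/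

section LargeTime

variable {d : ℕ} {ι : Type*} [Fintype ι] [DecidableEq ι]
variable {W : Mat d} {G : Matrix ι ι ℂ} {v : ι → ℝ} {ρ : Matrix (Fin d) ι ℂ}

/-- The diagonal matrix with real entries `v`. -/
abbrev realDiag (v : ι → ℝ) : Matrix ι ι ℂ := diagonal fun j => (v j : ℂ)

theorem norm_sq_col (h : ρᴴ * ρ = I • (G - Gᴴ)) (j : ι) :
    ‖(WithLp.toLp 2 (ρ.col j) : EuclideanSpace ℂ (Fin d))‖ ^ 2 = -2 * (G j j).im := by
  have h1 := congrArg Complex.re (congrFun (congrFun h j) j)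
  rw [← re_star_dotProduct_self]
  have h2 : (ρᴴ * ρ) j j = star (ρ.col j) ⬝ᵥ (ρ.col j) := rfl
  rw [← h2, h1]
  simp
  ring

/-- If `ρ e_j = 0`, then `G^* e_j = G e_j` and the Sylvester equation gives `(v_j - v_i) G_ij = 0`
for all `i`. Distinct velocities make `e_j` an eigenvector of `G`, with an eigenvalue that is real
by dissipation: a contradiction. With `norm_sq_col` this puts each diagonal entry `G_jj` strictly in
the lower half plane. -/
theorem col_ne_zero (h : IsRealization W G (realDiag v) ρ) (hv : Function.Injective v) (j : ι) :
    ρ.col j ≠ 0 := by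
  intro h0
  have hρ : ρ *ᵥ Pi.single j 1 = 0 := by rw [mulVec_single_one, h0]
  have hGh : Gᴴ *ᵥ Pi.single j 1 = G *ᵥ Pi.single j 1 := by
    have h1 : (ρᴴ * ρ) *ᵥ Pi.single j 1 = 0 := by rw [← mulVec_mulVec, hρ, mulVec_zero]
    rw [h.dissip, smul_mulVec, smul_eq_zero_iff_right I_ne_zero, sub_mulVec, sub_eq_zero] at h1
    exact h1.symm
  have h1 : (ρᴴ * W * ρ) *ᵥ Pi.single j 1 = 0 := by rw [← mulVec_mulVec, hρ, mulVec_zero]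
  rw [h.sylvester, smul_mulVec, smul_eq_zero_iff_right I_ne_zero, sub_mulVec, sub_eq_zero,
    ← mulVec_mulVec, ← mulVec_mulVec, hGh, diagonal_mulVec_single, mul_one] at h1
  have hoff : ∀ i, i ≠ j → G i j = 0 := by
    intro i hij
    have h2 := congrFun h1 i
    rw [mulVec_diagonal, mulVec_single, mulVec_single_one] at h2
    simp only [Pi.smul_apply, col_apply, MulOpposite.smul_eq_mul_unop, MulOpposite.unop_op] at h2
    have h3 : ((v j : ℂ) - v i) * G i j = 0 := by linear_combination h2
    rcases mul_eq_zero.1 h3 with h4 | h4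
    · exact absurd (hv (by exact_mod_cast (sub_eq_zero.1 h4).symm)) hij
    · exact h4
  have him : (G j j).im = 0 := by
    have := norm_sq_col h.dissip j
    rw [h0] at this
    simp at this
    exact this
  have hG : G *ᵥ Pi.single j 1 = (((G j j).re : ℝ) : ℂ) • (Pi.single j 1 : ι → ℂ) := by
    rw [mulVec_single_one]
    ext i
    by_cases hij : i = j
    · subst hij
      simp only [col_apply, Pi.smul_apply, Pi.single_eq_same, smul_eq_mul, mul_one]
      exact Complex.ext (by simp) (by simp [him])
    · simp [hij, hoff i hij]
  have := congrFun (eq_zero_of_mulVec_eq_smul (h.regular _) hG) j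
  simp at this

theorem diag_im_neg (h : IsRealization W G (realDiag v) ρ) (hv : Function.Injective v) (j : ι) :
    (G j j).im < 0 := by
  have h1 := norm_sq_col h.dissip j
  have h2 : 0 < ‖(WithLp.toLp 2 (ρ.col j) : EuclideanSpace ℂ (Fin d))‖ := by
    rw [norm_pos_iff]; simpa using col_ne_zero h hv j
  nlinarith

theorem exists_diag_im_le (h : IsRealization W G (realDiag v) ρ) (hv : Function.Injective v) :
    ∃ δ > 0, ∀ j, (G j j).im ≤ -δ := by
  have h1 : ∀ᶠ δ in 𝓝[>] (0 : ℝ), ∀ j, (G j j).im ≤ -δ := by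
    refine eventually_all.2 fun j => nhdsWithin_le_nhds ?_
    have := diag_im_neg h hv j
    filter_upwards [Iio_mem_nhds (show (0 : ℝ) < -(G j j).im by linarith)] with δ hδ
    linarith [Set.mem_Iio.1 hδ]
  obtain ⟨δ, hδ, hδ'⟩ := (h1.and self_mem_nhdsWithin).exists
  exact ⟨δ, hδ', hδ⟩

theorem real_smul_gen (r : ℝ) (M : Matrix ι ι ℂ) :
    r • gen M = ((r : ℂ) * (-(2 * Real.pi * I))) • M := by
  ext i j
  simp [gen, mul_assoc]

theorem norm_exp_gen_diagonal_le {g : ι → ℂ} {δ : ℝ} (hδ : ∀ j, (g j).im ≤ -δ) (t r : ℝ)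
    (hr : 0 ≤ r) :
    ‖NormedSpace.exp (r • gen (evol (diagonal g) (realDiag v) t))‖ ≤
      Real.exp (-(2 * Real.pi * δ) * r) := by
  have e : r • gen (evol (diagonal g) (realDiag v) t) =
      diagonal fun j => (r : ℂ) * (-(2 * Real.pi * I)) * (g j + t * v j) := by
    rw [real_smul_gen, evol, ← diagonal_smul, diagonal_add, ← diagonal_smul]
    congr 1
  rw [e, Matrix.exp_diagonal, l2_opNorm_diagonal]
  refine (pi_norm_le_iff_of_nonneg (Real.exp_pos _).le).2 fun j => ?_
  rw [Pi.coe_exp, ← Complex.exp_eq_exp_ℂ, Complex.norm_exp, Real.exp_le_exp]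
  have h1 : ((r : ℂ) * (-(2 * Real.pi * I)) * (g j + t * v j)).re = 2 * Real.pi * r * (g j).im := by
    simp only [mul_re, mul_im, neg_re, neg_im, add_re, add_im, ofReal_re, ofReal_im, I_re, I_im,
      re_ofNat, im_ofNat]
    ring
  rw [h1]
  have := Real.pi_pos
  have h2 := hδ j
  have : 0 ≤ 2 * Real.pi * r := by positivity
  nlinarith

/-- The off-diagonal solution `X` of the homological equation `T X - X T = diag G - G`. -/
def homologicalMat (G : Matrix ι ι ℂ) (v : ι → ℝ) : Matrix ι ι ℂ :=
  fun j k => if j = k then 0 else G j k / ((v k : ℂ) - v j)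

theorem homologicalMat_eq (G : Matrix ι ι ℂ) (hv : Function.Injective v) :
    G - diagonal (fun j => G j j) +
      (realDiag v * homologicalMat G v - homologicalMat G v * realDiag v) = 0 := by
  ext j k
  simp only [Matrix.add_apply, Matrix.sub_apply, diagonal_mul, mul_diagonal, homologicalMat,
    Matrix.zero_apply]
  by_cases hjk : j = k
  · subst hjk; simp
  · have : (v k : ℂ) - v j ≠ 0 := by
      intro h0; exact hjk (hv (by exact_mod_cast (sub_eq_zero.1 h0).symm))
    simp only [hjk, if_false, diagonal_apply_ne _ hjk]
    field_simp
    ring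

/-- The error in the near-identity conjugation. -/
def homologicalErr (G : Matrix ι ι ℂ) (v : ι → ℝ) : Matrix ι ι ℂ :=
  G * homologicalMat G v - homologicalMat G v * diagonal fun j => G j j

/-- In `(G + t T)(1 + X / t) - (1 + X / t)(diag G + t T)` the terms of order `t` cancel and those of
order `1` cancel by the homological equation. Only a multiple of `1 / t` is left. -/
theorem intertwine_error (G : Matrix ι ι ℂ) (hv : Function.Injective v) {t : ℝ} (ht : t ≠ 0) :
    (1 + (t : ℂ)⁻¹ • homologicalMat G v) *
        gen (evol (diagonal fun j => G j j) (realDiag v) t) -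
      gen (evol G (realDiag v) t) * (1 + (t : ℂ)⁻¹ • homologicalMat G v) =
    ((2 * Real.pi * I) * (t : ℂ)⁻¹) • homologicalErr G v := by
  have h0 := homologicalMat_eq G hv
  have ht' : (t : ℂ) ≠ 0 := by exact_mod_cast ht
  have h1 : evol G (realDiag v) t * (1 + (t : ℂ)⁻¹ • homologicalMat G v) -
      (1 + (t : ℂ)⁻¹ • homologicalMat G v) * evol (diagonal fun j => G j j) (realDiag v) t =
      (G - diagonal (fun j => G j j) +
      (realDiag v * homologicalMat G v - homologicalMat G v * realDiag v)) +
      (t : ℂ)⁻¹ • homologicalErr G v := by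
    simp only [evol, homologicalErr, Matrix.add_mul, Matrix.mul_add, Matrix.mul_one, Matrix.one_mul,
      Matrix.smul_mul, Matrix.mul_smul, smul_sub, smul_add]
    rw [smul_smul, smul_smul, inv_mul_cancel₀ ht', mul_inv_cancel₀ ht', one_smul, one_smul]
    abel
  rw [h0, zero_add] at h1
  rw [mul_smul, ← h1, gen, gen, Matrix.mul_smul, Matrix.smul_mul]
  module

theorem norm_intertwine_error_le (G : Matrix ι ι ℂ) (hv : Function.Injective v) {t : ℝ}
    (ht : t ≠ 0) :
    ‖(1 + (t : ℂ)⁻¹ • homologicalMat G v) *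
        gen (evol (diagonal fun j => G j j) (realDiag v) t) -
      gen (evol G (realDiag v) t) * (1 + (t : ℂ)⁻¹ • homologicalMat G v)‖ ≤
    2 * Real.pi * ‖homologicalErr G v‖ * |t|⁻¹ := by
  rw [intertwine_error G hv ht, norm_smul]
  simp only [norm_mul, norm_inv, norm_real, norm_I, Real.norm_eq_abs, abs_of_pos Real.pi_pos]
  norm_num
  exact le_of_eq (by ring)

/-- Duhamel's estimate compares the two semigroups through the intertwiner `1 + X / t`. Removing the
two corrections `X / t` costs another `O(1 / |t|)`. -/
theorem norm_exp_gen_sub_diag_le (hv : Function.Injective v)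
    {t : ℝ} (ht : t ≠ 0) {C c : ℝ}
    (h1 : ∀ r : ℝ, 0 ≤ r → ‖NormedSpace.exp (r • gen (evol G (realDiag v) t))‖ ≤
      C * Real.exp (-c * r))
    (h2 : ∀ r : ℝ, 0 ≤ r → ‖NormedSpace.exp (r • gen (evol (diagonal fun j => G j j)
      (realDiag v) t))‖ ≤ C * Real.exp (-c * r)) {r : ℝ} (hr : 0 ≤ r) :
    ‖NormedSpace.exp (r • gen (evol G (realDiag v) t)) -
      NormedSpace.exp (r • gen (evol (diagonal fun j => G j j) (realDiag v) t))‖ ≤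
    (2 * C * ‖homologicalMat G v‖ + C ^ 2 * (2 * Real.pi * ‖homologicalErr G v‖) * r) *
      Real.exp (-c * r) * |t|⁻¹ := by
  have h3 := norm_intertwine_exp_sub_le _ _ (1 + (t : ℂ)⁻¹ • homologicalMat G v) h1 h2 hr
  have h4 := norm_intertwine_error_le G hv ht
  set E := NormedSpace.exp (r • gen (evol G (realDiag v) t))
  set E₀ := NormedSpace.exp (r • gen (evol (diagonal fun j => G j j) (realDiag v) t))
  set X := homologicalMat G v
  have e : E - E₀ = (t : ℂ)⁻¹ • (X * E₀) - (t : ℂ)⁻¹ • (E * X) -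
      ((1 + (t : ℂ)⁻¹ • X) * E₀ - E * (1 + (t : ℂ)⁻¹ • X)) := by
    simp only [Matrix.add_mul, Matrix.mul_add, Matrix.mul_one, Matrix.one_mul,
      Matrix.smul_mul, Matrix.mul_smul]
    abel
  have n1 : ‖(t : ℂ)⁻¹ • (X * E₀)‖ ≤ |t|⁻¹ * (‖X‖ * (C * Real.exp (-c * r))) := by
    rw [norm_smul, norm_inv, norm_real, Real.norm_eq_abs]
    gcongr
    exact (norm_mul_le _ _).trans (by gcongr; exact h2 r hr)
  have n2 : ‖(t : ℂ)⁻¹ • (E * X)‖ ≤ |t|⁻¹ * ((C * Real.exp (-c * r)) * ‖X‖) := by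
    rw [norm_smul, norm_inv, norm_real, Real.norm_eq_abs]
    gcongr
    exact (norm_mul_le _ _).trans (by gcongr; exact h1 r hr)
  have n3 : C ^ 2 * ‖(1 + (t : ℂ)⁻¹ • X) * gen (evol (diagonal fun j => G j j) (realDiag v) t) -
      gen (evol G (realDiag v) t) * (1 + (t : ℂ)⁻¹ • X)‖ * (r * Real.exp (-c * r)) ≤
      C ^ 2 * (2 * Real.pi * ‖homologicalErr G v‖ * |t|⁻¹) * (r * Real.exp (-c * r)) := by
    gcongr
  calc ‖E - E₀‖ ≤ ‖(t : ℂ)⁻¹ • (X * E₀)‖ + ‖(t : ℂ)⁻¹ • (E * X)‖ +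
        ‖(1 + (t : ℂ)⁻¹ • X) * E₀ - E * (1 + (t : ℂ)⁻¹ • X)‖ := by
        rw [e]
        exact (norm_sub_le _ _).trans (by gcongr; exact norm_sub_le _ _)
    _ ≤ |t|⁻¹ * (‖X‖ * (C * Real.exp (-c * r))) + |t|⁻¹ * ((C * Real.exp (-c * r)) * ‖X‖) +
        C ^ 2 * (2 * Real.pi * ‖homologicalErr G v‖ * |t|⁻¹) * (r * Real.exp (-c * r)) :=
        add_le_add (add_le_add n1 n2) (h3.trans n3)
    _ = _ := by ring

/-- The semigroups decay exponentially, uniformly in time. -/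
def UniformDecay (G T : Matrix ι ι ℂ) (C c : ℝ) : Prop :=
  0 < C ∧ 0 < c ∧ ∀ t r : ℝ, 0 ≤ r →
    ‖NormedSpace.exp (r • gen (evol G T t))‖ ≤ C * Real.exp (-c * r)

theorem continuous_evol (G T : Matrix ι ι ℂ) : Continuous (evol G T) := by
  unfold evol; fun_prop

/-- It suffices to bound the norm of the semigroup at `r = 1` by one constant below `1`. For large
`|t|` the diagonal comparison gives `exp(-2πδ) + K / |t|`; for the remaining compact range of times
continuity and the strict contraction at each time suffice. -/
theorem exists_uniformDecay (h : IsRealization W G (realDiag v) ρ) (hv : Function.Injective v) :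
    ∃ C c, UniformDecay G (realDiag v) C c := by
  set T := realDiag v
  let f : ℝ → ℝ := fun t => ‖NormedSpace.exp (gen (evol G T t))‖
  have hf : Continuous f := by
    refine (continuous_exp'.comp ?_).norm
    unfold gen
    exact (continuous_evol G T).const_smul (-(2 * Real.pi * I) : ℂ)
  have hcon : ∀ t r : ℝ, 0 ≤ r → ‖NormedSpace.exp (r • gen (evol G T t))‖ ≤ 1 := fun t =>
    norm_exp_gen_le_one (h.evol t).dissip
  have hlt : ∀ t, f t < 1 := fun t =>
    norm_exp_gen_lt_one (h.evol t).dissip (h.evol t).regular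
  obtain ⟨δ, hδ, hδ'⟩ := exists_diag_im_le h hv
  set K := 2 * ‖homologicalMat G v‖ + 2 * Real.pi * ‖homologicalErr G v‖ with hK
  set q₀ := Real.exp (-(2 * Real.pi * δ)) with hq₀
  have hq₀1 : q₀ < 1 := by
    rw [hq₀, Real.exp_lt_one_iff]; have := Real.pi_pos; simp; positivity
  have hlarge : ∀ t : ℝ, t ≠ 0 → f t ≤ q₀ + K * |t|⁻¹ := by
    intro t ht
    have hd := fun r hr => norm_exp_gen_diagonal_le (v := v) (g := fun j => G j j) hδ' t r hr
    -- Mere contractivity, that is `C = 1` and `c = 0`, is used here, since uniform decay is still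
    -- to be proved.
    have h1 := norm_exp_gen_sub_diag_le (C := 1) (c := 0) hv ht
      (fun r hr => by simpa using hcon t r hr) (fun r hr => by
        refine (hd r hr).trans ?_
        have := Real.pi_pos
        simp only [one_mul, neg_zero, zero_mul, Real.exp_zero, Real.exp_le_one_iff]
        have : 0 ≤ 2 * Real.pi * δ * r := by positivity
        linarith) zero_le_one
    have h2 := hd 1 zero_le_one
    simp only [one_smul, mul_one, neg_zero, Real.exp_zero, one_pow, one_mul] at h1 h2
    calc f t ≤ ‖NormedSpace.exp (gen (evol (diagonal fun j => G j j) (realDiag v) t))‖ +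
          ‖NormedSpace.exp (gen (evol G (realDiag v) t)) -
          NormedSpace.exp (gen (evol (diagonal fun j => G j j) (realDiag v) t))‖ := by
          have := norm_add_le (NormedSpace.exp (gen (evol (diagonal fun j => G j j) (realDiag v) t)))
            (NormedSpace.exp (gen (evol G (realDiag v) t)) -
          NormedSpace.exp (gen (evol (diagonal fun j => G j j) (realDiag v) t)))
          rwa [add_sub_cancel] at this
      _ ≤ _ := add_le_add h2 h1
  obtain ⟨q₁, hq₁, hq₁1⟩ := exists_between hq₀1
  have hq₁0 : 0 < q₁ := (Real.exp_pos _).trans hq₁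
  -- The threshold `L` is such that `K / |t|` fits into the gap `q₁ - q₀`.
  obtain ⟨L, hL⟩ : ∃ L : ℝ, 0 < L ∧ ∀ t : ℝ, L ≤ |t| → f t ≤ q₁ := by
    refine ⟨K / (q₁ - q₀) + 1, by positivity [sub_pos.2 hq₁], fun t ht => ?_⟩
    have hp : 0 < q₁ - q₀ := sub_pos.2 hq₁
    have hK0 : 0 ≤ K := by have := Real.pi_pos; positivity
    have htpos : 0 < |t| := lt_of_lt_of_le (by positivity) ht
    refine (hlarge t (abs_pos.1 htpos)).trans ?_
    have : K * |t|⁻¹ ≤ q₁ - q₀ := by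
      rw [← div_eq_mul_inv, div_le_iff₀ htpos]
      have h1 : K / (q₁ - q₀) ≤ |t| := by linarith
      rw [div_le_iff₀ hp] at h1
      linarith
    linarith
  obtain ⟨t₀, -, ht₀⟩ := (isCompact_Icc (a := -L) (b := L)).exists_isMaxOn
    ⟨0, by constructor <;> linarith [hL.1]⟩ hf.continuousOn
  set q := max q₁ (f t₀)
  have hq0 : 0 < q := hq₁0.trans_le (le_max_left _ _)
  have hq1 : q < 1 := max_lt hq₁1 (hlt t₀)
  have hall : ∀ t, f t ≤ q := by
    intro t
    by_cases ht : L ≤ |t|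
    · exact (hL.2 t ht).trans (le_max_left _ _)
    · have : t ∈ Set.Icc (-L) L := by
        rw [not_le, abs_lt] at ht; exact ⟨ht.1.le, ht.2.le⟩
      exact (ht₀ this).trans (le_max_right _ _)
  exact ⟨q⁻¹, -Real.log q, inv_pos.2 hq0, by linarith [Real.log_neg hq0 hq1],
    fun t => exp_decay_of_norm_le _ (hcon t) hq0 hq1 (hall t)⟩

/-- For large times, the semigroup is close to the diagonal one. -/
theorem exists_exp_gen_sub_diag_le (h : IsRealization W G (realDiag v) ρ)
    (hv : Function.Injective v) :
    ∃ C c : ℝ, 0 < c ∧ ∀ t : ℝ, t ≠ 0 → ∀ r : ℝ, 0 ≤ r →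
      ‖NormedSpace.exp (r • gen (evol G (realDiag v) t)) -
        NormedSpace.exp (r • gen (evol (diagonal fun j => G j j) (realDiag v) t))‖ ≤
      C * |t|⁻¹ * ((1 + r) * Real.exp (-c * r)) := by
  obtain ⟨C₁, c₁, hC₁, hc₁, h1⟩ := exists_uniformDecay h hv
  obtain ⟨δ, hδ, hδ'⟩ := exists_diag_im_le h hv
  have hpi := Real.pi_pos
  set C := max C₁ 1
  set c := min c₁ (2 * Real.pi * δ)
  have hC : 0 < C := hC₁.trans_le (le_max_left _ _)
  refine ⟨2 * C * ‖homologicalMat G v‖ + C ^ 2 * (2 * Real.pi * ‖homologicalErr G v‖), c,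
    lt_min hc₁ (by positivity), fun t ht r hr => ?_⟩
  refine (norm_exp_gen_sub_diag_le (C := C) (c := c) hv ht (fun r hr => ?_) (fun r hr => ?_)
    hr).trans ?_
  · refine (h1 t r hr).trans ?_
    gcongr
    · exact le_max_left _ _
    · exact min_le_left _ _
  · refine (norm_exp_gen_diagonal_le hδ' t r hr).trans ?_
    rw [← one_mul (Real.exp _)]
    gcongr
    · exact le_max_right _ _
    · exact min_le_right _ _
  · have : 2 * C * ‖homologicalMat G v‖ + C ^ 2 * (2 * Real.pi * ‖homologicalErr G v‖) * r ≤
      (2 * C * ‖homologicalMat G v‖ + C ^ 2 * (2 * Real.pi * ‖homologicalErr G v‖)) * (1 + r) := by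
      have e1 : 0 ≤ 2 * C * ‖homologicalMat G v‖ * r := by positivity
      have e2 : 0 ≤ C ^ 2 * (2 * Real.pi * ‖homologicalErr G v‖) := by positivity
      nlinarith
    calc _ ≤ (2 * C * ‖homologicalMat G v‖ + C ^ 2 * (2 * Real.pi * ‖homologicalErr G v‖)) *
          (1 + r) * Real.exp (-c * r) * |t|⁻¹ := by gcongr
      _ = _ := by ring

end LargeTime

end HWM

end

noncomputable section

namespace HWM

open Complex

/-! ### The Fourier integral on `L¹ ∩ L²` -/

section FourierL2

variable {F : Type*} [NormedAddCommGroup F] [InnerProductSpace ℂ F] [CompleteSpace F]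

theorem integral_fourier_smul_eq_integral_smul_fourier {E : Type*} [NormedAddCommGroup E]
    [NormedSpace ℂ E] [CompleteSpace E] {φ : ℝ → ℂ} {h : ℝ → E} (hφ : Integrable φ)
    (hh : Integrable h) :
    ∫ ξ, 𝓕 φ ξ • h ξ = ∫ x, φ x • 𝓕 h x := by
  simpa using! VectorFourier.integral_fourierIntegral_smul_eq_flip (L := innerₗ ℝ)
    Real.continuous_fourierChar continuous_inner hφ hh

theorem integral_smul_fourierInv_eq {E : Type*} [NormedAddCommGroup E]
    [NormedSpace ℂ E] [CompleteSpace E] {φ : ℝ → ℂ} {h : ℝ → E} (hφ : Integrable φ)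
    (hh : Integrable h) :
    ∫ x, φ x • 𝓕⁻ h x = ∫ ξ, 𝓕⁻ φ ξ • h ξ := by
  have h1 := integral_fourier_smul_eq_integral_smul_fourier hφ.comp_neg hh
  simp_rw [Real.fourierInv_eq_fourier_neg (f := h)]
  rw [← integral_neg_eq_self (fun x => φ x • 𝓕 h (-x))]
  simp only [neg_neg]
  rw [← h1]
  congr 1
  ext ξ
  rw [Real.fourierInv_eq_fourier_comp_neg]

theorem norm_fourierInv_le {E : Type*} [NormedAddCommGroup E]
    [NormedSpace ℂ E] (h : ℝ → E) (x : ℝ) : ‖𝓕⁻ h x‖ ≤ ∫ ξ, ‖h ξ‖ := by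
  rw [Real.fourierInv_eq]
  refine (norm_integral_le_integral_norm _).trans (le_of_eq ?_)
  simp

theorem continuous_fourierInv {E : Type*} [NormedAddCommGroup E]
    [NormedSpace ℂ E] {h : ℝ → E} (hh : Integrable h) : Continuous (𝓕⁻ h) := by
  rw [Real.fourierInv_eq_fourier_comp_neg]
  exact VectorFourier.fourierIntegral_continuous Real.continuous_fourierChar
    (by exact continuous_inner) hh.comp_neg

theorem tendsto_fourierInv_cocompact {E : Type*} [NormedAddCommGroup E]
    [NormedSpace ℂ E] (h : ℝ → E) : Tendsto (𝓕⁻ h) (cocompact ℝ) (𝓝 0) := by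
  have h1 := Real.tendsto_integral_exp_smul_cocompact (fun v => h (-v))
  refine h1.congr fun x => ?_
  rw [Real.fourierInv_eq, ← integral_neg_eq_self]
  simp [mul_comm]

/-- On `L¹ ∩ L²`, the `L²` inverse Fourier transform is given by the integral. -/
theorem fourierInv_toLp_ae_eq {h : ℝ → F} (h1 : Integrable h) (h2 : MemLp h 2) :
    ((𝓕⁻ h2.toLp : Lp F 2 (volume : Measure ℝ)) : ℝ → F) =ᵐ[volume] 𝓕⁻ h := by
  set g : Lp F 2 (volume : Measure ℝ) := 𝓕⁻ h2.toLp with hg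
  have hgl : LocallyIntegrable (g : ℝ → F) := (Lp.memLp g).locallyIntegrable (by norm_num)
  have hhl : LocallyIntegrable (𝓕⁻ h) := (continuous_fourierInv h1).locallyIntegrable
  have key : ∀ φ : 𝓢(ℝ, ℂ), HasCompactSupport φ → ∫ x, φ x • (g x - 𝓕⁻ h x) = 0 := by
    intro φ hφ
    have e1 := congrArg (fun u : 𝓢'(ℝ, F) => u φ) (Lp.fourierInv_toTemperedDistribution_eq h2.toLp)
    simp only [TemperedDistribution.fourierInv_apply, Lp.toTemperedDistribution_apply] at e1
    have e2 : ∫ x, (𝓕⁻ φ) x • (h2.toLp : ℝ → F) x = ∫ x, 𝓕⁻ (φ : ℝ → ℂ) x • h x := by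
      rw [← SchwartzMap.fourierInv_coe]
      exact integral_congr_ae (by filter_upwards [h2.coeFn_toLp] with x hx; rw [hx])
    rw [e2, ← integral_smul_fourierInv_eq φ.integrable h1] at e1
    simp only [smul_sub]
    rw [integral_sub, sub_eq_zero]
    · exact e1.symm
    · exact hgl.integrable_smul_left_of_hasCompactSupport φ.continuous hφ
    · exact hhl.integrable_smul_left_of_hasCompactSupport φ.continuous hφ
  have h3 := ae_eq_zero_of_integral_contDiff_smul_eq_zero (hgl.sub hhl) (fun φ hφ hc => by
    have hφ' : ContDiff ℝ (⊤ : ℕ∞) (fun x => (φ x : ℂ)) := Complex.ofRealCLM.contDiff.comp hφ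
    have hc' : HasCompactSupport (fun x => (φ x : ℂ)) := hc.comp_left (g := Complex.ofReal) (by simp)
    have := key (hc'.toSchwartzMap hφ') hc'
    simpa using this)
  filter_upwards [h3] with x hx
  exact sub_eq_zero.1 hx

theorem memLp_fourierInv {h : ℝ → F} (h1 : Integrable h) (h2 : MemLp h 2) : MemLp (𝓕⁻ h) 2 :=
  (memLp_congr_ae (fourierInv_toLp_ae_eq h1 h2)).1 (Lp.memLp _)

theorem toLp_fourierInv {h : ℝ → F} (h1 : Integrable h) (h2 : MemLp h 2) :
    (memLp_fourierInv h1 h2).toLp = (𝓕⁻ h2.toLp : Lp F 2 (volume : Measure ℝ)) :=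
  Lp.ext ((MemLp.coeFn_toLp _).trans (fourierInv_toLp_ae_eq h1 h2).symm)

theorem fourier_toLp_fourierInv {h : ℝ → F} (h1 : Integrable h) (h2 : MemLp h 2) :
    𝓕 ((memLp_fourierInv h1 h2).toLp) = (h2.toLp : Lp F 2 (volume : Measure ℝ)) := by
  rw [toLp_fourierInv h1, FourierTransform.fourier_fourierInv_eq]

end FourierL2

/-! ### The Fourier transform away from the origin -/

section Punctured

theorem hasPuncturedFourier_const_add {h : ℝ → ℂ} (hh : Integrable h) (c : ℂ) :
    HasPuncturedFourier (fun x => c + 𝓕⁻ h x) h := by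
  have hb : ∀ x, ‖c + 𝓕⁻ h x‖ ≤ ‖c‖ + ∫ ξ, ‖h ξ‖ := fun x =>
    (norm_add_le _ _).trans (by gcongr; exact norm_fourierInv_le h x)
  have hc : Continuous fun x => c + 𝓕⁻ h x := continuous_const.add (continuous_fourierInv hh)
  refine ⟨fun φ => φ.integrable.bdd_mul hc.aestronglyMeasurable (Eventually.of_forall hb),
    hh.locallyIntegrable.locallyIntegrableOn _, fun φ _ h0 => ?_⟩
  have i1 : Integrable (fun x => c * (𝓕 φ) x) := (𝓕 φ).integrable.const_mul c
  have i2 : Integrable (fun x => 𝓕⁻ h x * (𝓕 φ) x) := (𝓕 φ).integrable.bdd_mul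
    (continuous_fourierInv hh).aestronglyMeasurable (Eventually.of_forall (norm_fourierInv_le h))
  simp_rw [add_mul]
  rw [integral_add i1 i2, integral_const_mul]
  -- This integral equals `φ(0)`, and the origin is outside the support. Hence the additive constant
  -- is invisible.
  have e1 : ∫ x, (𝓕 φ) x = 0 := by
    have h1 : 𝓕⁻ (𝓕 φ) = φ := FourierTransform.fourierInv_fourier_eq φ
    have h2 := congrArg (fun ψ : 𝓢(ℝ, ℂ) => ψ 0) h1
    simp only [SchwartzMap.fourierInv_coe, Real.fourierInv_eq, inner_zero_right,
      AddChar.map_zero_eq_one, one_smul] at h2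
    rw [h2]
    exact image_eq_zero_of_notMem_tsupport h0
  have e2 := integral_smul_fourierInv_eq (𝓕 φ).integrable hh
  have h1 : 𝓕⁻ ((𝓕 φ : 𝓢(ℝ, ℂ)) : ℝ → ℂ) = φ := by
    rw [← SchwartzMap.fourierInv_coe, FourierTransform.fourierInv_fourier_eq]
  rw [h1] at e2
  simp only [smul_eq_mul] at e2
  rw [e1, mul_zero, zero_add]
  simp_rw [mul_comm (𝓕⁻ h _), mul_comm (h _)]
  exact e2

theorem isAbsD_const_add {h : ℝ → ℂ} (hh : Integrable h) (c : ℂ)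
    (hh' : Integrable (fun ξ : ℝ => ((2 * Real.pi * |ξ| : ℝ) : ℂ) * h ξ)) :
    IsAbsD (fun x => c + 𝓕⁻ h x) (𝓕⁻ (fun ξ : ℝ => ((2 * Real.pi * |ξ| : ℝ) : ℂ) * h ξ)) :=
  ⟨h, hasPuncturedFourier_const_add hh c, hh', fun _ => rfl⟩

theorem homSobolevENorm_const_add_le {h : ℝ → ℂ} (hh : Integrable h) (c : ℂ) (s : ℝ) :
    homSobolevENorm s (fun x => c + 𝓕⁻ h x) ≤
      eLpNorm (fun ξ : ℝ => (((2 * Real.pi * |ξ|) ^ s : ℝ) : ℂ) * h ξ) 2 volume :=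
  iInf₂_le h (hasPuncturedFourier_const_add hh c)

end Punctured

/-! ### Exponentially decaying weights -/

section Weights

theorem integrable_exp_neg_abs {a : ℝ} (ha : 0 < a) : Integrable fun ξ : ℝ => Real.exp (-a * |ξ|) := by
  rw [← integrableOn_univ, ← Set.Iic_union_Ioi (a := (0 : ℝ)), integrableOn_union]
  constructor
  · refine (integrableOn_exp_mul_Iic ha 0).congr_fun (fun ξ hξ => ?_) measurableSet_Iic
    simp [abs_of_nonpos (Set.mem_Iic.1 hξ)]
  · refine (integrableOn_exp_mul_Ioi (neg_lt_zero.2 ha) 0).congr_fun (fun ξ hξ => ?_)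
      measurableSet_Ioi
    simp [abs_of_pos (Set.mem_Ioi.1 hξ)]

/-- The weight `(1 + |ξ|) e^{-c|ξ|}`. -/
def decayWeight (c ξ : ℝ) : ℝ := (1 + |ξ|) * Real.exp (-c * |ξ|)

theorem decayWeight_nonneg (c ξ : ℝ) : 0 ≤ decayWeight c ξ := by unfold decayWeight; positivity

theorem continuous_decayWeight (c : ℝ) : Continuous (decayWeight c) := by
  unfold decayWeight; fun_prop

/-- The Sobolev weight `⟨ξ⟩^s`. -/
def japanese (s ξ : ℝ) : ℝ := (1 + (2 * Real.pi * ξ) ^ 2) ^ (s / 2)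

theorem continuous_japanese (s : ℝ) : Continuous (japanese s) := by
  unfold japanese
  exact (by fun_prop : Continuous fun ξ : ℝ => 1 + (2 * Real.pi * ξ) ^ 2).rpow_const
    fun ξ => Or.inl (by positivity)

theorem japanese_pos (s ξ : ℝ) : 0 < japanese s ξ := by unfold japanese; positivity

theorem rpow_abs_le_japanese {s : ℝ} (hs : 0 ≤ s) (ξ : ℝ) :
    (2 * Real.pi * |ξ|) ^ s ≤ japanese s ξ := by
  have hp := Real.pi_pos
  have h1 : (2 * Real.pi * |ξ|) ^ s = ((2 * Real.pi * |ξ|) ^ 2) ^ (s / 2) := by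
    rw [← Real.rpow_natCast, ← Real.rpow_mul (by positivity)]; congr 1; push_cast; ring
  rw [h1, japanese]
  refine Real.rpow_le_rpow (by positivity) ?_ (by linarith)
  rw [mul_pow, sq_abs, mul_pow]
  linarith

theorem exists_japanese_mul_decayWeight_le (s : ℝ) {c : ℝ} (hc : 0 < c) :
    ∃ K : ℝ, 0 ≤ K ∧ ∀ ξ, japanese s ξ * decayWeight c ξ ≤ K * Real.exp (-(c / 2) * |ξ|) := by
  obtain ⟨n, hn⟩ := exists_nat_ge |s|
  have hp := Real.pi_pos
  -- With this `a` and `y = 1 + 2π|ξ|` one has `a y = a + (c / 2)|ξ|`: half of the exponential decay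
  -- absorbs the power `y ^ (n + 1)`.
  set a := c / 2 / (2 * Real.pi) with ha
  have ha0 : 0 < a := by positivity
  refine ⟨(n + 1).factorial / a ^ (n + 1) * Real.exp a, by positivity, fun ξ => ?_⟩
  set y := 1 + 2 * Real.pi * |ξ| with hy
  have hy1 : 1 ≤ y := by rw [hy]; have : 0 ≤ 2 * Real.pi * |ξ| := by positivity
                         linarith
  have h1 : japanese s ξ ≤ y ^ n := by
    have e1 : 1 + (2 * Real.pi * ξ) ^ 2 ≤ y ^ 2 := by
      rw [hy]
      have : (2 * Real.pi * ξ) ^ 2 = (2 * Real.pi * |ξ|) ^ 2 := by rw [mul_pow, mul_pow _ |ξ|, sq_abs]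
      rw [this]
      have : 0 ≤ 2 * Real.pi * |ξ| := by positivity
      nlinarith
    have e0 : 1 ≤ 1 + (2 * Real.pi * ξ) ^ 2 := by nlinarith [sq_nonneg (2 * Real.pi * ξ)]
    calc japanese s ξ ≤ (1 + (2 * Real.pi * ξ) ^ 2) ^ (|s| / 2) := by
          refine Real.rpow_le_rpow_of_exponent_le e0 ?_
          linarith [le_abs_self s]
      _ ≤ (y ^ 2) ^ (|s| / 2) := Real.rpow_le_rpow (by positivity) e1 (by positivity)
      _ = y ^ |s| := by
          rw [← Real.rpow_natCast, ← Real.rpow_mul (by positivity)]; congr 1; push_cast; ring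
      _ ≤ y ^ (n : ℝ) := Real.rpow_le_rpow_of_exponent_le hy1 hn
      _ = y ^ n := Real.rpow_natCast _ _
  have h2 : 1 + |ξ| ≤ y := by
    rw [hy]
    have : |ξ| ≤ 2 * Real.pi * |ξ| := by
      nlinarith [abs_nonneg ξ, Real.pi_gt_three]
    linarith
  have h3 : y ^ (n + 1) ≤ (n + 1).factorial / a ^ (n + 1) * Real.exp (a * y) := by
    have := Real.pow_div_factorial_le_exp (x := a * y) (by positivity) (n + 1)
    rw [div_le_iff₀ (by positivity), mul_pow] at this
    rw [div_mul_eq_mul_div, le_div_iff₀ (by positivity)]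
    linarith
  have h4 : a * y = a + c / 2 * |ξ| := by
    rw [hy, ha]; field_simp
  calc japanese s ξ * decayWeight c ξ ≤ y ^ n * (y * Real.exp (-c * |ξ|)) := by
        unfold decayWeight
        gcongr
    _ = y ^ (n + 1) * Real.exp (-c * |ξ|) := by ring
    _ ≤ ((n + 1).factorial / a ^ (n + 1) * Real.exp (a * y)) * Real.exp (-c * |ξ|) := by gcongr
    _ = (n + 1).factorial / a ^ (n + 1) * Real.exp a * Real.exp (-(c / 2) * |ξ|) := by
        rw [h4, Real.exp_add, mul_assoc, mul_assoc, mul_assoc, ← Real.exp_add (c / 2 * |ξ|)]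
        congr 3; ring_nf

theorem integrable_japanese_mul_decayWeight (s : ℝ) {c : ℝ} (hc : 0 < c) :
    Integrable fun ξ => japanese s ξ * decayWeight c ξ := by
  obtain ⟨K, hK, h⟩ := exists_japanese_mul_decayWeight_le s hc
  refine ((integrable_exp_neg_abs (half_pos hc)).const_mul K).mono'
    ((continuous_japanese s).mul (continuous_decayWeight c)).aestronglyMeasurable
    (Eventually.of_forall fun ξ => ?_)
  rw [Real.norm_of_nonneg (mul_nonneg (japanese_pos s ξ).le (decayWeight_nonneg c ξ))]
  exact h ξ

/-- The square is at most a bound for `decayWeight c` times the integrable function with the Sobolev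
exponent `s + s`. -/
theorem memLp_japanese_mul_decayWeight (s : ℝ) {c : ℝ} (hc : 0 < c) :
    MemLp (fun ξ => japanese s ξ * decayWeight c ξ) 2 := by
  have hm := ((continuous_japanese s).mul (continuous_decayWeight c)).aestronglyMeasurable
    (μ := (volume : Measure ℝ))
  refine (memLp_two_iff_integrable_sq hm).2 ?_
  have h1 := integrable_japanese_mul_decayWeight (s + s) hc
  obtain ⟨K, hK, hle⟩ := exists_japanese_mul_decayWeight_le 0 hc
  refine (h1.const_mul K).mono' (hm.pow 2) (Eventually.of_forall fun ξ => ?_)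
  have e1 : japanese (s + s) ξ = japanese s ξ * japanese s ξ := by
    unfold japanese; rw [← Real.rpow_add (by positivity)]; congr 1; ring
  have e2 : decayWeight c ξ ≤ K := by
    have := hle ξ
    have e3 : japanese 0 ξ = 1 := by simp [japanese]
    rw [e3, one_mul] at this
    refine this.trans (mul_le_of_le_one_right hK ?_)
    rw [Real.exp_le_one_iff]
    have : 0 ≤ c / 2 * |ξ| := by positivity
    linarith
  have hd := decayWeight_nonneg c ξ
  have hj := japanese_pos s ξ
  rw [Real.norm_of_nonneg (by positivity), e1]
  calc (japanese s ξ * decayWeight c ξ) ^ 2 =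
      decayWeight c ξ * (japanese s ξ * japanese s ξ * decayWeight c ξ) := by ring
    _ ≤ _ := by gcongr

theorem eLpNorm_weight_le {w : ℝ → ℝ} {s c K : ℝ}
    (hw : ∀ ξ, |w ξ| ≤ japanese s ξ) {g : ℝ → ℂ}
    (hg : ∀ ξ, ‖g ξ‖ ≤ K * decayWeight c ξ) :
    eLpNorm (fun ξ => (w ξ : ℂ) * g ξ) 2 volume ≤
      ENNReal.ofReal K * eLpNorm (fun ξ => japanese s ξ * decayWeight c ξ) 2 volume := by
  have := eLpNorm_le_mul_eLpNorm_of_ae_le_mul (μ := (volume : Measure ℝ)) (c := K)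
    (f := fun ξ => (w ξ : ℂ) * g ξ) (g := fun ξ => japanese s ξ * decayWeight c ξ)
    (Eventually.of_forall fun ξ => ?_) 2
  · exact this
  · rw [norm_mul, norm_real, Real.norm_eq_abs, Real.norm_of_nonneg
      (mul_nonneg (japanese_pos s ξ).le (decayWeight_nonneg c ξ))]
    calc |w ξ| * ‖g ξ‖ ≤ japanese s ξ * (K * decayWeight c ξ) := by
          gcongr
          · exact (japanese_pos s ξ).le
          · exact hw ξ
          · exact hg ξ
      _ = _ := by ring

end Weights

end HWM

end

noncomputable section

namespace HWM

open Matrix Complex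
open scoped ComplexOrder Matrix.Norms.L2Operator

set_option linter.unusedSectionVars false

/-! ### The Fourier transform of a realization -/

section FourierRealization

variable {d : ℕ} {ι : Type*} [Fintype ι] [DecidableEq ι]

theorem norm_entry_le_l2_opNorm {m n : Type*} [Fintype m] [Fintype n] [DecidableEq n]
    (A : Matrix m n ℂ) (i : m) (j : n) : ‖A i j‖ ≤ ‖A‖ := by
  have h1 := Matrix.l2_opNorm_mulVec A (EuclideanSpace.single j (1 : ℂ))
  have h2 : ‖((EuclideanSpace.equiv m ℂ).symm (A *ᵥ (EuclideanSpace.single j (1 : ℂ)).ofLp)) i‖ ≤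
      ‖(EuclideanSpace.equiv m ℂ).symm (A *ᵥ (EuclideanSpace.single j (1 : ℂ)).ofLp)‖ :=
    PiLp.norm_apply_le _ i
  simpa using h2.trans h1

/-- The character `ξ ↦ e^{2πi x ξ}`. -/
def chr (x ξ : ℝ) : ℂ := Complex.exp (((2 * Real.pi * (x * ξ) : ℝ) : ℂ) * I)

theorem norm_chr (x ξ : ℝ) : ‖chr x ξ‖ = 1 := Complex.norm_exp_ofReal_mul_I _

theorem continuous_chr (x : ℝ) : Continuous (chr x) := by unfold chr; fun_prop

theorem chr_neg (x ξ : ℝ) : chr x (-ξ) = (starRingEnd ℂ) (chr x ξ) := by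
  unfold chr
  rw [← Complex.exp_conj, map_mul, Complex.conj_ofReal, Complex.conj_I]
  congr 1
  push_cast
  ring

theorem fourierInv_eq_integral_chr {E : Type*} [NormedAddCommGroup E] [NormedSpace ℂ E]
    (f : ℝ → E) (x : ℝ) : 𝓕⁻ f x = ∫ ξ, chr x ξ • f ξ := by
  rw [Real.fourierInv_eq']
  rfl

theorem hasDerivAt_chr (x ξ : ℝ) : HasDerivAt (chr x) ((2 * Real.pi * x * I) * chr x ξ) ξ := by
  have h1 : HasDerivAt (fun ξ : ℝ => ((2 * Real.pi * (x * ξ) : ℝ) : ℂ) * I)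
      ((2 * Real.pi * x : ℝ) * I) ξ := by
    have := (((hasDerivAt_id ξ).const_mul x).const_mul (2 * Real.pi)).ofReal_comp.mul_const I
    simpa [mul_assoc] using! this
  have := h1.cexp
  unfold chr
  refine this.congr_deriv ?_
  push_cast
  ring

variable {M : Matrix ι ι ℂ}

theorem hasDerivAt_chr_smul_exp (M : Matrix ι ι ℂ) (x ξ : ℝ) :
    HasDerivAt (fun ξ : ℝ => chr x ξ • NormedSpace.exp (ξ • gen M))
      (gen (M - (x : ℂ) • 1) * (chr x ξ • NormedSpace.exp (ξ • gen M))) ξ := by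
  have h := (hasDerivAt_chr x ξ).smul (hasDerivAt_exp_smul_const' (gen M) ξ)
  refine h.congr_deriv ?_
  have : gen (M - (x : ℂ) • (1 : Matrix ι ι ℂ)) = gen M + (2 * Real.pi * x * I : ℂ) • 1 := by
    unfold gen; module
  rw [this, Matrix.add_mul, Matrix.smul_mul, Matrix.one_mul, Matrix.mul_smul, smul_smul]

theorem resol_mul_gen {x : ℝ} (hM : IsUnit (M - (x : ℂ) • (1 : Matrix ι ι ℂ)))
    (Y : Matrix ι ι ℂ) :
    (-(2 * Real.pi * I : ℂ)⁻¹) • (resol M x * (gen (M - (x : ℂ) • 1) * Y)) = Y := by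
  have hc : (2 * Real.pi * I : ℂ) ≠ 0 := by simp [Real.pi_ne_zero]
  rw [gen, Matrix.smul_mul, Matrix.mul_smul, ← Matrix.mul_assoc, resol_mul hM, Matrix.one_mul,
    smul_smul, neg_mul_neg, inv_mul_cancel₀ hc, one_smul]

section Decay

variable {C c : ℝ} (hc : 0 < c)
  (hdec : ∀ r : ℝ, 0 ≤ r → ‖NormedSpace.exp (r • gen M)‖ ≤ C * Real.exp (-c * r))

theorem continuous_exp_gen (M : Matrix ι ι ℂ) :
    Continuous fun ξ : ℝ => NormedSpace.exp (ξ • gen M) :=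
  continuous_exp'.comp (continuous_id.smul continuous_const)

include hc hdec

theorem integrableOn_chr_smul_exp (x : ℝ) :
    IntegrableOn (fun ξ : ℝ => chr x ξ • NormedSpace.exp (ξ • gen M)) (Set.Ioi 0) := by
  refine Integrable.mono' (g := fun ξ => C * Real.exp (-c * ξ)) ?_ ?_ ?_
  · exact (integrableOn_exp_mul_Ioi (neg_lt_zero.2 hc) 0).const_mul C
  · exact ((continuous_chr x).smul (continuous_exp_gen M)).aestronglyMeasurable
  · filter_upwards [ae_restrict_mem measurableSet_Ioi] with ξ hξ
    rw [norm_smul, norm_chr, one_mul]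
    exact hdec ξ (Set.mem_Ioi.1 hξ).le

theorem tendsto_chr_smul_exp (x : ℝ) :
    Tendsto (fun ξ : ℝ => chr x ξ • NormedSpace.exp (ξ • gen M)) atTop (𝓝 0) := by
  refine squeeze_zero_norm' (a := fun ξ => C * Real.exp (-c * ξ)) ?_ ?_
  · filter_upwards [eventually_ge_atTop 0] with ξ hξ
    rw [norm_smul, norm_chr, one_mul]
    exact hdec ξ hξ
  · have : Tendsto (fun ξ : ℝ => Real.exp (-c * ξ)) atTop (𝓝 0) :=
      Real.tendsto_exp_atBot.comp ((tendsto_const_mul_atBot_of_neg (neg_lt_zero.2 hc)).2 tendsto_id)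
    simpa using this.const_mul C

/-- The Laplace transform of a semigroup is the resolvent of its generator: the integrand is an
orbit of the semigroup generated by `gen (M - x)`, so the fundamental theorem of calculus inverts
that matrix. -/
theorem integral_chr_smul_exp {x : ℝ} (hM : IsUnit (M - (x : ℂ) • (1 : Matrix ι ι ℂ))) :
    ∫ ξ in Set.Ioi (0 : ℝ), chr x ξ • NormedSpace.exp (ξ • gen M) =
      (2 * Real.pi * I : ℂ)⁻¹ • resol M x := by
  have hi := integrableOn_chr_smul_exp hc hdec x
  have hd := fun ξ => hasDerivAt_chr_smul_exp M x ξ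
  have hi' : IntegrableOn (fun ξ : ℝ => gen (M - (x : ℂ) • 1) *
      (chr x ξ • NormedSpace.exp (ξ • gen M))) (Set.Ioi 0) :=
    (ContinuousLinearMap.mul ℝ (Matrix ι ι ℂ) (gen (M - (x : ℂ) • 1))).integrable_comp hi
  have h1 := integral_Ioi_of_hasDerivAt_of_tendsto (hd 0).continuousAt.continuousWithinAt
    (fun ξ _ => hd ξ) hi' (tendsto_chr_smul_exp hc hdec x)
  have h2 : ∫ ξ in Set.Ioi (0 : ℝ), gen (M - (x : ℂ) • 1) *
      (chr x ξ • NormedSpace.exp (ξ • gen M)) = gen (M - (x : ℂ) • 1) *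
      ∫ ξ in Set.Ioi (0 : ℝ), chr x ξ • NormedSpace.exp (ξ • gen M) :=
    (ContinuousLinearMap.mul ℝ (Matrix ι ι ℂ) (gen (M - (x : ℂ) • 1))).integral_comp_comm hi
  rw [h2] at h1
  have h3 := resol_mul_gen hM (∫ ξ in Set.Ioi (0 : ℝ), chr x ξ • NormedSpace.exp (ξ • gen M))
  rw [h1] at h3
  rw [← h3]
  simp [chr, NormedSpace.exp_zero]

theorem integrableOn_smul_chr_smul_exp (x : ℝ) :
    IntegrableOn (fun ξ : ℝ => ξ • (chr x ξ • NormedSpace.exp (ξ • gen M))) (Set.Ioi 0) := by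
  have hC : 0 ≤ C := by
    have := (norm_nonneg _).trans (hdec 0 le_rfl)
    simpa using this
  refine Integrable.mono' (g := fun ξ => C * (japanese 0 ξ * decayWeight c ξ)) ?_ ?_ ?_
  · exact ((integrable_japanese_mul_decayWeight 0 hc).const_mul C).integrableOn
  · exact (continuous_id.smul
      ((continuous_chr x).smul (continuous_exp_gen M))).aestronglyMeasurable
  · filter_upwards [ae_restrict_mem measurableSet_Ioi] with ξ hξ
    have hξ' := Set.mem_Ioi.1 hξ
    rw [norm_smul, norm_smul, norm_chr, one_mul, Real.norm_eq_abs]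
    have e : japanese 0 ξ = 1 := by simp [japanese]
    rw [e, one_mul, decayWeight]
    have := hdec ξ hξ'.le
    rw [abs_of_pos hξ']
    calc ξ * ‖NormedSpace.exp (ξ • gen M)‖ ≤ (1 + ξ) * (C * Real.exp (-c * ξ)) := by
          gcongr; linarith
      _ = _ := by ring

theorem tendsto_smul_chr_smul_exp (x : ℝ) :
    Tendsto (fun ξ : ℝ => ξ • (chr x ξ • NormedSpace.exp (ξ • gen M))) atTop (𝓝 0) := by
  refine squeeze_zero_norm' (a := fun ξ => C * (ξ ^ (1 : ℝ) * Real.exp (-c * ξ))) ?_ ?_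
  · filter_upwards [eventually_ge_atTop 0] with ξ hξ
    rw [norm_smul, norm_smul, norm_chr, one_mul, Real.norm_of_nonneg hξ, Real.rpow_one]
    have := hdec ξ hξ
    calc _ ≤ ξ * (C * Real.exp (-c * ξ)) := by gcongr
      _ = _ := by ring
  · simpa using (tendsto_rpow_mul_exp_neg_mul_atTop_nhds_zero 1 c hc).const_mul C

/-- The factor `ξ` raises the order of the pole: integrating the derivative of `ξ e^{ξ gen (M - x)}`
reduces to the previous integral and yields the squared resolvent. This provides `|D|` of a
realization. -/
theorem integral_smul_chr_smul_exp {x : ℝ} (hM : IsUnit (M - (x : ℂ) • (1 : Matrix ι ι ℂ))) :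
    ∫ ξ in Set.Ioi (0 : ℝ), ξ • (chr x ξ • NormedSpace.exp (ξ • gen M)) =
      ((2 * Real.pi * I : ℂ)⁻¹) ^ 2 • (resol M x * resol M x) := by
  have hi := integrableOn_chr_smul_exp hc hdec x
  have hi1 := integrableOn_smul_chr_smul_exp hc hdec x
  set N := gen (M - (x : ℂ) • (1 : Matrix ι ι ℂ))
  have hd : ∀ ξ : ℝ, HasDerivAt (fun ξ : ℝ => ξ • (chr x ξ • NormedSpace.exp (ξ • gen M)))
      (chr x ξ • NormedSpace.exp (ξ • gen M) +
        N * (ξ • (chr x ξ • NormedSpace.exp (ξ • gen M)))) ξ := by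
    intro ξ
    refine ((hasDerivAt_id ξ).smul (hasDerivAt_chr_smul_exp M x ξ)).congr_deriv ?_
    simp only [id, one_smul]
    rw [add_comm, mul_smul_comm, mul_smul_comm, mul_smul_comm]
  have hi' : IntegrableOn (fun ξ : ℝ => N * (ξ • (chr x ξ • NormedSpace.exp (ξ • gen M))))
      (Set.Ioi 0) := (ContinuousLinearMap.mul ℝ (Matrix ι ι ℂ) N).integrable_comp hi1
  have h1 := integral_Ioi_of_hasDerivAt_of_tendsto (hd 0).continuousAt.continuousWithinAt
    (fun ξ _ => hd ξ) (hi.add hi') (tendsto_smul_chr_smul_exp hc hdec x)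
  have h2 : ∫ ξ in Set.Ioi (0 : ℝ), N * (ξ • (chr x ξ • NormedSpace.exp (ξ • gen M))) = N *
      ∫ ξ in Set.Ioi (0 : ℝ), ξ • (chr x ξ • NormedSpace.exp (ξ • gen M)) :=
    (ContinuousLinearMap.mul ℝ (Matrix ι ι ℂ) N).integral_comp_comm hi1
  rw [integral_add hi hi', h2, integral_chr_smul_exp hc hdec hM, zero_smul, sub_zero] at h1
  have h3 := resol_mul_gen hM
    (∫ ξ in Set.Ioi (0 : ℝ), ξ • (chr x ξ • NormedSpace.exp (ξ • gen M)))
  rw [eq_neg_of_add_eq_zero_right h1] at h3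
  rw [← h3, Matrix.mul_neg, Matrix.mul_smul, smul_neg, neg_smul, neg_neg, smul_smul, sq]

end Decay

/-! ### Two-sided Fourier transforms of Hermitian matrix-valued functions -/

section TwoSided

/-- The function `2π ρ E(ξ) B` on `ξ > 0`, continued to `ξ < 0` as a Hermitian symmetric function. -/
def twoSided (ρ : Matrix (Fin d) ι ℂ) (B : Matrix ι (Fin d) ℂ) (E : ℝ → Matrix ι ι ℂ) (ξ : ℝ) :
    Mat d :=
  if 0 < ξ then (2 * Real.pi : ℂ) • (ρ * E ξ * B)
  else if ξ < 0 then ((2 * Real.pi : ℂ) • (ρ * E (-ξ) * B))ᴴ else 0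

variable (ρ : Matrix (Fin d) ι ℂ) (B : Matrix ι (Fin d) ℂ)

theorem twoSided_sub (E E' : ℝ → Matrix ι ι ℂ) (ξ : ℝ) :
    twoSided ρ B (fun r => E r - E' r) ξ = twoSided ρ B E ξ - twoSided ρ B E' ξ := by
  unfold twoSided
  split_ifs
  · simp only [Matrix.mul_sub, Matrix.sub_mul, smul_sub]
  · simp only [Matrix.mul_sub, Matrix.sub_mul, smul_sub, conjTranspose_sub]
  · simp

theorem twoSided_smul (E : ℝ → Matrix ι ι ℂ) (ξ : ℝ) :
    twoSided ρ B (fun r => (2 * Real.pi) • (r • E r)) ξ =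
      ((2 * Real.pi * |ξ| : ℝ) : ℂ) • twoSided ρ B E ξ := by
  have e : ∀ (r : ℝ) (A : Matrix ι ι ℂ), (2 * Real.pi) • (r • A) =
      ((2 * Real.pi * r : ℝ) : ℂ) • A := by
    intro r A; rw [smul_smul]; ext i j; simp
  simp only [twoSided, e]
  split_ifs with h1 h2
  · rw [ abs_of_pos h1, Matrix.mul_smul, Matrix.smul_mul, smul_comm]
  · rw [abs_of_neg h2, Matrix.mul_smul, Matrix.smul_mul, smul_comm, conjTranspose_smul]
    simp
  · simp

theorem norm_twoSided_entry_le {E : ℝ → Matrix ι ι ℂ} {K c : ℝ}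
    (hE : ∀ r : ℝ, 0 ≤ r → ‖E r‖ ≤ K * ((1 + r) * Real.exp (-c * r))) (hK : 0 ≤ K)
    (ξ : ℝ) (i j : Fin d) :
    ‖twoSided ρ B E ξ i j‖ ≤ (2 * Real.pi * ‖ρ‖ * ‖B‖ * K) * decayWeight c ξ := by
  have hp := Real.pi_pos
  have key : ∀ r : ℝ, 0 ≤ r → ∀ i j : Fin d, ‖((2 * Real.pi : ℂ) • (ρ * E r * B)) i j‖ ≤
      (2 * Real.pi * ‖ρ‖ * ‖B‖ * K) * ((1 + r) * Real.exp (-c * r)) := by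
    intro r hr i j
    refine (norm_entry_le_l2_opNorm _ i j).trans ?_
    rw [norm_smul]
    have e : ‖(2 * Real.pi : ℂ)‖ = 2 * Real.pi := by simp [abs_of_pos hp]
    rw [e]
    calc 2 * Real.pi * ‖ρ * E r * B‖ ≤ 2 * Real.pi * (‖ρ‖ * ‖E r‖ * ‖B‖) := by
          gcongr
          exact (Matrix.l2_opNorm_mul _ _).trans (by gcongr; exact Matrix.l2_opNorm_mul _ _)
      _ ≤ 2 * Real.pi * (‖ρ‖ * (K * ((1 + r) * Real.exp (-c * r))) * ‖B‖) := by
          gcongr; exact hE r hr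
      _ = _ := by ring
  unfold twoSided
  split_ifs with h1 h2
  · have := key ξ h1.le i j
    rwa [decayWeight, abs_of_pos h1]
  · have := key (-ξ) (by linarith) j i
    rw [decayWeight, abs_of_neg h2, conjTranspose_apply, norm_star]
    exact this
  · simp only [Matrix.zero_apply, norm_zero]
    have := decayWeight_nonneg c ξ
    positivity

theorem twoSided_entry_eq (E : ℝ → Matrix ι ι ℂ) (i j : Fin d) :
    (fun ξ => twoSided ρ B E ξ i j) =
      (Set.Ioi (0 : ℝ)).indicator (fun ξ => ((2 * Real.pi : ℂ) • (ρ * E ξ * B)) i j) +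
      fun ξ => (Set.Ioi (0 : ℝ)).indicator
        (fun ξ => (starRingEnd ℂ) (((2 * Real.pi : ℂ) • (ρ * E ξ * B)) j i)) (-ξ) := by
  ext ξ
  simp only [Pi.add_apply, Set.indicator, Set.mem_Ioi, twoSided]
  rcases lt_trichotomy ξ 0 with h | h | h
  · rw [if_neg h.not_gt, if_pos h, if_neg h.not_gt, if_pos (neg_pos.2 h), zero_add,
      conjTranspose_apply]
    rfl
  · simp [h]
  · rw [if_pos h, if_pos h, if_neg (by linarith), add_zero]

/-- The entry functional `A ↦ 2π (ρ A B)_{ij}`. -/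
def entryCLM (i j : Fin d) : Matrix ι ι ℂ →L[ℂ] ℂ :=
  LinearMap.toContinuousLinearMap
    { toFun := fun A => ((2 * Real.pi : ℂ) • (ρ * A * B)) i j
      map_add' := fun A A' => by simp [Matrix.mul_add, Matrix.add_mul, mul_add]
      map_smul' := fun a A => by simp [mul_left_comm] }

theorem entryCLM_apply (i j : Fin d) (A : Matrix ι ι ℂ) :
    entryCLM ρ B i j A = ((2 * Real.pi : ℂ) • (ρ * A * B)) i j := rfl

variable {ρ B}

theorem aestronglyMeasurable_twoSided {E : ℝ → Matrix ι ι ℂ} (hE : Continuous E) (i j : Fin d) :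
    AEStronglyMeasurable (fun ξ => twoSided ρ B E ξ i j) := by
  rw [twoSided_entry_eq]
  have h1 : ∀ i j, Continuous fun ξ => ((2 * Real.pi : ℂ) • (ρ * E ξ * B)) i j := fun i j =>
    (entryCLM ρ B i j).continuous.comp hE
  have h2 : StronglyMeasurable ((Set.Ioi (0 : ℝ)).indicator
      (fun ξ => (starRingEnd ℂ) (((2 * Real.pi : ℂ) • (ρ * E ξ * B)) j i))) :=
    (Complex.continuous_conj.comp (h1 j i)).stronglyMeasurable.indicator measurableSet_Ioi
  exact (((h1 i j).stronglyMeasurable.indicator measurableSet_Ioi).add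
    (h2.comp_measurable measurable_neg)).aestronglyMeasurable

theorem integrable_twoSided {E : ℝ → Matrix ι ι ℂ} (hE : Continuous E) {K c : ℝ} (hc : 0 < c)
    (hK : 0 ≤ K) (hb : ∀ r : ℝ, 0 ≤ r → ‖E r‖ ≤ K * ((1 + r) * Real.exp (-c * r)))
    (i j : Fin d) : Integrable (fun ξ => twoSided ρ B E ξ i j) := by
  have h1 := integrable_japanese_mul_decayWeight 0 hc
  have e : ∀ ξ, japanese 0 ξ = 1 := fun ξ => by simp [japanese]
  simp only [e, one_mul] at h1
  exact (h1.const_mul (2 * Real.pi * ‖ρ‖ * ‖B‖ * K)).mono' (aestronglyMeasurable_twoSided hE i j)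
    (Eventually.of_forall fun ξ => norm_twoSided_entry_le ρ B hb hK ξ i j)

theorem memLp_twoSided {E : ℝ → Matrix ι ι ℂ} (hE : Continuous E) {K c : ℝ} (hc : 0 < c)
    (hK : 0 ≤ K) (hb : ∀ r : ℝ, 0 ≤ r → ‖E r‖ ≤ K * ((1 + r) * Real.exp (-c * r)))
    (i j : Fin d) : MemLp (fun ξ => twoSided ρ B E ξ i j) 2 := by
  have h1 := memLp_japanese_mul_decayWeight 0 hc
  have e : ∀ ξ, japanese 0 ξ = 1 := fun ξ => by simp [japanese]
  simp only [e, one_mul] at h1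
  refine h1.of_le_mul (c := 2 * Real.pi * ‖ρ‖ * ‖B‖ * K) (aestronglyMeasurable_twoSided hE i j)
    (Eventually.of_forall fun ξ => ?_)
  rw [Real.norm_of_nonneg (decayWeight_nonneg c ξ)]
  exact norm_twoSided_entry_le ρ B hb hK ξ i j

/-- The negative frequencies are by construction the Hermitian reflection of the positive ones, so
they contribute the adjoint matrix. -/
theorem fourierInv_twoSided {E : ℝ → Matrix ι ι ℂ} {x : ℝ}
    (hE : IntegrableOn (fun ξ => chr x ξ • E ξ) (Set.Ioi 0)) (i j : Fin d) :
    𝓕⁻ (fun ξ => twoSided ρ B E ξ i j) x =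
      ((2 * Real.pi : ℂ) • (ρ * (∫ ξ in Set.Ioi (0 : ℝ), chr x ξ • E ξ) * B) +
        ((2 * Real.pi : ℂ) • (ρ * (∫ ξ in Set.Ioi (0 : ℝ), chr x ξ • E ξ) * B))ᴴ) i j := by
  have h1 : ∀ i j, IntegrableOn (fun ξ => chr x ξ * ((2 * Real.pi : ℂ) • (ρ * E ξ * B)) i j)
      (Set.Ioi 0) := fun i j => by
    have := (entryCLM ρ B i j).integrable_comp hE
    refine this.congr (Eventually.of_forall fun ξ => ?_)
    simp only [map_smul, smul_eq_mul]; rfl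
  have h2 : ∀ i j, ∫ ξ in Set.Ioi (0 : ℝ), chr x ξ * ((2 * Real.pi : ℂ) • (ρ * E ξ * B)) i j =
      ((2 * Real.pi : ℂ) • (ρ * (∫ ξ in Set.Ioi (0 : ℝ), chr x ξ • E ξ) * B)) i j := fun i j => by
    have := (entryCLM ρ B i j).integral_comp_comm hE
    rw [entryCLM_apply] at this
    rw [← this]
    congr 1; ext ξ
    simp only [map_smul, smul_eq_mul]; rfl
  rw [twoSided_entry_eq, fourierInv_eq_integral_chr, Matrix.add_apply, conjTranspose_apply,
    ← h2 i j, ← h2 j i]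
  have e1 : ∀ ξ, chr x ξ • (Set.Ioi (0 : ℝ)).indicator
      (fun ξ => ((2 * Real.pi : ℂ) • (ρ * E ξ * B)) i j) ξ =
      (Set.Ioi (0 : ℝ)).indicator (fun ξ => chr x ξ * ((2 * Real.pi : ℂ) • (ρ * E ξ * B)) i j) ξ :=
    fun ξ => by simp only [Set.indicator]; split_ifs <;> simp
  have e2 : ∀ ξ, chr x ξ • (Set.Ioi (0 : ℝ)).indicator
      (fun ξ => (starRingEnd ℂ) (((2 * Real.pi : ℂ) • (ρ * E ξ * B)) j i)) (-ξ) =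
      (fun ξ => (Set.Ioi (0 : ℝ)).indicator (fun ξ => (starRingEnd ℂ)
        (chr x ξ * ((2 * Real.pi : ℂ) • (ρ * E ξ * B)) j i)) ξ) (-ξ) :=
    fun ξ => by
      simp only [Set.indicator]
      split_ifs
      · rw [map_mul, ← chr_neg, neg_neg, smul_eq_mul]
      · simp
  simp only [Pi.add_apply, smul_add]
  simp_rw [e1, e2]
  have hconj : Integrable ((Set.Ioi (0 : ℝ)).indicator (fun ξ => (starRingEnd ℂ)
        (chr x ξ * ((2 * Real.pi : ℂ) • (ρ * E ξ * B)) j i))) :=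
    (integrable_indicator_iff measurableSet_Ioi).2
      (Complex.conjCLE.toContinuousLinearMap.integrable_comp (h1 j i))
  rw [integral_add ((integrable_indicator_iff measurableSet_Ioi).2 (h1 i j)) hconj.comp_neg,
    integral_indicator measurableSet_Ioi, integral_neg_eq_self,
    integral_indicator measurableSet_Ioi, integral_conj]
  rfl

end TwoSided

end FourierRealization

end HWM

end

noncomputable section

namespace HWM

open Matrix Complex
open scoped ComplexOrder Matrix.Norms.L2Operator

set_option linter.unusedSectionVars false

/-! ### Realizations give solutions of the half-wave maps equation -/

section Solution

variable {d : ℕ} {ι : Type*} [Fintype ι] [DecidableEq ι]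
variable {W : Mat d} {G T M : Matrix ι ι ℂ} {ρ : Matrix (Fin d) ι ℂ}

/-- The Fourier transform of `realized W M T ρ` away from the origin. -/
def realizedHat (W : Mat d) (M T : Matrix ι ι ℂ) (ρ : Matrix (Fin d) ι ℂ) (ξ : ℝ) : Mat d :=
  twoSided ρ (inputMat W T ρ) (fun r => NormedSpace.exp (r • gen M)) ξ

theorem two_pi_smul_inv_smul (Y : Mat d) :
    (2 * Real.pi : ℂ) • ((2 * Real.pi * I : ℂ)⁻¹ • Y) = -(I • Y) := by
  have hp : (Real.pi : ℂ) ≠ 0 := by simp [Real.pi_ne_zero]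
  rw [smul_smul, ← neg_smul]
  congr 1
  field_simp
  rw [I_sq, neg_neg]

theorem neg_add_conjTranspose_eq (Y : Mat d) :
    -Y + (-Y)ᴴ = -(I • (-(I • Y) - (-(I • Y))ᴴ)) := by
  ext i j
  simp only [Matrix.add_apply, Matrix.neg_apply, Matrix.sub_apply, Matrix.smul_apply,
    conjTranspose_apply, smul_eq_mul, star_neg, star_mul', star_def, conj_I]
  linear_combination (-(Y i j + (starRingEnd ℂ) (Y j i))) * I_mul_I

theorem half_smul_commutator_eq (U Z : Mat d) :
    -(1 / 2 : ℂ) • (U * Z - Z * U) = -(I / 2) • (U * -(I • Z) - -(I • Z) * U) := by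
  have : -(I / 2) • (U * -(I • Z) - -(I • Z) * U) = (I * I / 2) • (U * Z - Z * U) := by
    simp only [Matrix.mul_neg, Matrix.neg_mul, Matrix.mul_smul, Matrix.smul_mul]
    module
  rw [this, I_mul_I]
  norm_num

section Decay

variable {C c : ℝ} (hc : 0 < c) (hC : 0 ≤ C)
  (hdec : ∀ r : ℝ, 0 ≤ r → ‖NormedSpace.exp (r • gen M)‖ ≤ C * Real.exp (-c * r))
include hc hdec

theorem realized_entry_eq (hM : ∀ x : ℝ, IsUnit (M - (x : ℂ) • (1 : Matrix ι ι ℂ))) (x : ℝ)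
    (i j : Fin d) :
    realized W M T ρ x i j = W i j + 𝓕⁻ (fun ξ => realizedHat W M T ρ ξ i j) x := by
  unfold realizedHat
  rw [fourierInv_twoSided (integrableOn_chr_smul_exp hc hdec x),
    integral_chr_smul_exp hc hdec (hM x), Matrix.mul_smul, Matrix.smul_mul, two_pi_smul_inv_smul,
    realized, add_assoc, Matrix.add_apply]
  rfl

/-- `|D|` acts as `-i∂ₓ` on the positive frequencies and as `i∂ₓ` on the negative ones. It therefore
gives `-i (V' - (V')^*)`, where `V' = -i ρ (M - x)⁻² B`. -/
theorem fourierInv_abs_mul_realizedHat (hM : ∀ x : ℝ, IsUnit (M - (x : ℂ) • (1 : Matrix ι ι ℂ)))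
    (x : ℝ) (i j : Fin d) :
    𝓕⁻ (fun ξ => ((2 * Real.pi * |ξ| : ℝ) : ℂ) * realizedHat W M T ρ ξ i j) x =
      (-(I • (-(I • (ρ * (resol M x * resol M x) * inputMat W T ρ)) -
        (-(I • (ρ * (resol M x * resol M x) * inputMat W T ρ)))ᴴ))) i j := by
  have hp : (Real.pi : ℂ) ≠ 0 := by simp [Real.pi_ne_zero]
  have e1 : (fun ξ => ((2 * Real.pi * |ξ| : ℝ) : ℂ) * realizedHat W M T ρ ξ i j) =
      fun ξ => twoSided ρ (inputMat W T ρ)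
        (fun r => (2 * Real.pi) • (r • NormedSpace.exp (r • gen M))) ξ i j := by
    ext ξ; rw [twoSided_smul]; rfl
  have hi := integrableOn_smul_chr_smul_exp hc hdec x
  have e2 : ∀ ξ : ℝ, chr x ξ • ((2 * Real.pi) • (ξ • NormedSpace.exp (ξ • gen M))) =
      (2 * Real.pi) • (ξ • (chr x ξ • NormedSpace.exp (ξ • gen M))) := fun ξ => by
    rw [smul_comm (chr x ξ), smul_comm (chr x ξ)]
  rw [e1, fourierInv_twoSided]
  · simp_rw [e2]
    rw [integral_smul, integral_smul_chr_smul_exp hc hdec (hM x)]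
    have e3 : (2 * Real.pi : ℂ) • (ρ * ((2 * Real.pi) • ((2 * Real.pi * I : ℂ)⁻¹ ^ 2 •
        (resol M x * resol M x))) * inputMat W T ρ) =
        -(ρ * (resol M x * resol M x) * inputMat W T ρ) := by
      have : (2 * Real.pi) • ((2 * Real.pi * I : ℂ)⁻¹ ^ 2 • (resol M x * resol M x)) =
          (2 * Real.pi * (2 * Real.pi * I : ℂ)⁻¹ ^ 2) • (resol M x * resol M x) := by
        rw [mul_smul]; ext i j; simp; ring
      rw [this, Matrix.mul_smul, Matrix.smul_mul, smul_smul, ← neg_one_smul ℂ (ρ * _ * _)]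
      congr 1
      field_simp
      rw [I_sq, neg_neg]
    rw [e3, neg_add_conjTranspose_eq]
  · simp_rw [e2]
    exact hi.smul (2 * Real.pi)

include hC

theorem exp_gen_le_weight (r : ℝ) (hr : 0 ≤ r) :
    ‖NormedSpace.exp (r • gen M)‖ ≤ C * ((1 + r) * Real.exp (-c * r)) := by
  refine (hdec r hr).trans ?_
  gcongr
  nlinarith [Real.exp_pos (-c * r)]

theorem norm_realizedHat_le (ξ : ℝ) (i j : Fin d) :
    ‖realizedHat W M T ρ ξ i j‖ ≤
      (2 * Real.pi * ‖ρ‖ * ‖inputMat W T ρ‖ * C) * decayWeight c ξ :=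
  norm_twoSided_entry_le _ _ (exp_gen_le_weight hc hC hdec) hC ξ i j

theorem integrable_realizedHat (i j : Fin d) :
    Integrable fun ξ => realizedHat W M T ρ ξ i j :=
  integrable_twoSided (continuous_exp_gen M) hc hC (exp_gen_le_weight hc hC hdec) i j

theorem memLp_realizedHat (i j : Fin d) :
    MemLp (fun ξ => realizedHat W M T ρ ξ i j) 2 :=
  memLp_twoSided (continuous_exp_gen M) hc hC (exp_gen_le_weight hc hC hdec) i j

theorem integrable_abs_mul_realizedHat (i j : Fin d) :
    Integrable fun ξ : ℝ => ((2 * Real.pi * |ξ| : ℝ) : ℂ) * realizedHat W M T ρ ξ i j := by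
  have h1 := (integrable_japanese_mul_decayWeight 1 hc).const_mul
    (2 * Real.pi * ‖ρ‖ * ‖inputMat W T ρ‖ * C)
  refine h1.mono' ?_ (Eventually.of_forall fun ξ => ?_)
  · exact (Continuous.aestronglyMeasurable (by fun_prop)).mul
      (aestronglyMeasurable_twoSided (continuous_exp_gen M) i j)
  · have hp := Real.pi_pos
    rw [norm_mul, norm_real, Real.norm_of_nonneg (by positivity)]
    have e1 := rpow_abs_le_japanese zero_le_one ξ
    rw [Real.rpow_one] at e1
    calc _ ≤ japanese 1 ξ * ((2 * Real.pi * ‖ρ‖ * ‖inputMat W T ρ‖ * C) * decayWeight c ξ) := by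
          gcongr
          · exact (japanese_pos 1 ξ).le
          · exact norm_realizedHat_le hc hC hdec ξ i j
      _ = _ := by ring

end Decay

/-- The solution of the half-wave maps equation that belongs to a realization. -/
def flow (W : Mat d) (G T : Matrix ι ι ℂ) (ρ : Matrix (Fin d) ι ℂ) (t x : ℝ) : Mat d :=
  realized W (evol G T t) T ρ x

theorem hasDerivAt_resol {x t : ℝ} (hM : IsUnit (evol G T t - (x : ℂ) • (1 : Matrix ι ι ℂ))) :
    HasDerivAt (fun τ => resol (evol G T τ) x)
      (-(resol (evol G T t) x * T * resol (evol G T t) x)) t := by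
  obtain ⟨u, hu⟩ := hM
  have h1 : HasDerivAt (fun τ => evol G T τ - (x : ℂ) • (1 : Matrix ι ι ℂ)) T t := by
    have e : ∀ τ : ℝ, evol G T τ - (x : ℂ) • (1 : Matrix ι ι ℂ) =
        τ • T + (G - (x : ℂ) • (1 : Matrix ι ι ℂ)) := fun τ => by
      have : (τ : ℂ) • T = τ • T := by ext; simp
      rw [evol, this]; abel
    simp_rw [e]
    simpa using ((hasDerivAt_id t).smul_const T).add_const (G - (x : ℂ) • (1 : Matrix ι ι ℂ))
  have h2 := (hasFDerivAt_ringInverse (𝕜 := ℝ) u)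
  rw [hu] at h2
  have h3 := h2.comp_hasDerivAt t h1
  have e : ∀ A : Matrix ι ι ℂ, A⁻¹ = Ring.inverse A := fun A => Matrix.nonsing_inv_eq_ringInverse A
  unfold resol
  simp_rw [e]
  refine h3.congr_deriv ?_
  rw [← hu, Ring.inverse_unit]
  simp

theorem hasDerivAt_flow (h : IsRealization W G T ρ) (t x : ℝ) :
    HasDerivAt (fun τ => flow W G T ρ τ x)
      (I • (ρ * (resol (evol G T t) x * T * resol (evol G T t) x) * inputMat W T ρ) +
      (I • (ρ * (resol (evol G T t) x * T * resol (evol G T t) x) * inputMat W T ρ))ᴴ) t := by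
  let ℓ : Matrix ι ι ℂ →ₗ[ℝ] Mat d :=
    { toFun := fun A => -(I • (ρ * A * inputMat W T ρ)) + (-(I • (ρ * A * inputMat W T ρ)))ᴴ
      map_add' := fun A A' => by
        simp only [Matrix.mul_add, Matrix.add_mul, smul_add, neg_add, conjTranspose_add]; abel
      map_smul' := fun a A => by
        have e : a • A = (a : ℂ) • A := by ext; simp
        have e' : ∀ Y : Mat d, a • Y = (a : ℂ) • Y := fun Y => by ext; simp
        simp only [e, e', Matrix.mul_smul, Matrix.smul_mul, RingHom.id_apply,
          conjTranspose_neg, conjTranspose_smul, star_def, conj_ofReal]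
        module }
  have h1 := hasDerivAt_resol (G := G) (T := T) ((h.evol t).regular x)
  have h2 := (LinearMap.toContinuousLinearMap ℓ).hasFDerivAt.comp_hasDerivAt t h1
  have h3 := h2.const_add W
  have e : ∀ τ, flow W G T ρ τ x = W + (LinearMap.toContinuousLinearMap ℓ ∘
      fun τ => resol (evol G T τ) x) τ := fun τ => by
    rw [flow, realized, add_assoc]; rfl
  simp_rw [e]
  refine h3.congr_deriv ?_
  change -(I • (ρ * -(resol (evol G T t) x * T * resol (evol G T t) x) * inputMat W T ρ)) +
    (-(I • (ρ * -(resol (evol G T t) x * T * resol (evol G T t) x) * inputMat W T ρ)))ᴴ = _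
  simp only [Matrix.mul_neg, Matrix.neg_mul, smul_neg, neg_neg]

/-- The semi-norm of a map whose Fourier transform decays exponentially. -/
theorem homSobolevENormMat_le {X : ℝ → Mat d} {c₀ : Mat d} {h : ℝ → Mat d} {s K c : ℝ} (hs : 0 < s)
    (hX : ∀ x i j, X x i j = c₀ i j + 𝓕⁻ (fun ξ => h ξ i j) x)
    (hint : ∀ i j, Integrable fun ξ => h ξ i j)
    (hb : ∀ ξ i j, ‖h ξ i j‖ ≤ K * decayWeight c ξ) :
    homSobolevENormMat s X ≤ ENNReal.ofReal K *
      (((d : ℝ≥0∞) * d) ^ (1 / 2 : ℝ) *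
        eLpNorm (fun ξ => japanese s ξ * decayWeight c ξ) 2 volume) := by
  set A := ENNReal.ofReal K * eLpNorm (fun ξ => japanese s ξ * decayWeight c ξ) 2 volume
  have h1 : ∀ i j, homSobolevENorm s (fun x => X x i j) ≤ A := by
    intro i j
    have e : (fun x => X x i j) = fun x => c₀ i j + 𝓕⁻ (fun ξ => h ξ i j) x :=
      funext fun x => hX x i j
    rw [e]
    refine (homSobolevENorm_const_add_le (hint i j) _ s).trans
      (eLpNorm_weight_le (w := fun ξ => (2 * Real.pi * |ξ|) ^ s) (fun ξ => ?_) fun ξ => hb ξ i j)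
    have := Real.pi_pos
    rw [abs_of_nonneg (by positivity)]
    exact rpow_abs_le_japanese hs.le ξ
  calc homSobolevENormMat s X ≤ (∑ _i : Fin d, ∑ _j : Fin d, A ^ 2) ^ (1 / 2 : ℝ) := by
        unfold homSobolevENormMat
        gcongr with i _ j _
        exact h1 i j
    _ = (((d : ℝ≥0∞) * d) * A ^ (2 : ℝ)) ^ (1 / 2 : ℝ) := by
        simp [mul_assoc]
    _ = ((d : ℝ≥0∞) * d) ^ (1 / 2 : ℝ) * A := by
        rw [ENNReal.mul_rpow_of_nonneg _ _ (by norm_num), ← ENNReal.rpow_mul]; norm_num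
    _ = _ := by simp only [A]; ring

/-! ### Time-uniform bounds and the solution property -/

section Uniform

variable {C c : ℝ}

theorem flow_entry_eq (h : IsRealization W G T ρ) (hu : UniformDecay G T C c) (t x : ℝ)
    (i j : Fin d) :
    flow W G T ρ t x i j = W i j + 𝓕⁻ (fun ξ => realizedHat W (evol G T t) T ρ ξ i j) x :=
  realized_entry_eq hu.2.1 (hu.2.2 t) (h.evol t).regular x i j

theorem exists_homSobolevENormMat_flow_le (h : IsRealization W G T ρ) (hu : UniformDecay G T C c)
    {s : ℝ} (hs : 0 < s) :
    ∃ K : ℝ≥0, ∀ t, homSobolevENormMat s (flow W G T ρ t) ≤ K := by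
  set A := ENNReal.ofReal (2 * Real.pi * ‖ρ‖ * ‖inputMat W T ρ‖ * C) *
      (((d : ℝ≥0∞) * d) ^ (1 / 2 : ℝ) *
        eLpNorm (fun ξ => japanese s ξ * decayWeight c ξ) 2 volume) with hA
  have hA' : A ≠ ⊤ := by
    refine ENNReal.mul_ne_top ENNReal.ofReal_ne_top (ENNReal.mul_ne_top ?_
      (memLp_japanese_mul_decayWeight s hu.2.1).2.ne)
    exact ENNReal.rpow_ne_top_of_nonneg (by norm_num)
      (ENNReal.mul_ne_top (ENNReal.natCast_ne_top d) (ENNReal.natCast_ne_top d))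
  refine ⟨A.toNNReal, fun t => ?_⟩
  rw [ENNReal.coe_toNNReal hA']
  exact homSobolevENormMat_le hs (flow_entry_eq h hu t)
    (integrable_realizedHat hu.2.1 hu.1.le (hu.2.2 t))
    (norm_realizedHat_le hu.2.1 hu.1.le (hu.2.2 t))

/-- Duhamel's estimate with the trivial intertwiner `1`: the generators at times `τ` and `t` differ
by `(τ - t) gen T`. The Lipschitz bound carries an exponential weight, so it gives continuity in all
Sobolev spaces at once. -/
theorem norm_realizedHat_sub_le (hu : UniformDecay G T C c) (τ t ξ : ℝ) (i j : Fin d) :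
    ‖realizedHat W (evol G T τ) T ρ ξ i j - realizedHat W (evol G T t) T ρ ξ i j‖ ≤
      (2 * Real.pi * ‖ρ‖ * ‖inputMat W T ρ‖ * (C ^ 2 * ‖gen T‖ * |τ - t|)) * decayWeight c ξ := by
  have h1 : ∀ r : ℝ, 0 ≤ r → ‖NormedSpace.exp (r • gen (evol G T τ)) -
      NormedSpace.exp (r • gen (evol G T t))‖ ≤
      (C ^ 2 * ‖gen T‖ * |τ - t|) * ((1 + r) * Real.exp (-c * r)) := by
    intro r hr
    have := norm_intertwine_exp_sub_le (gen (evol G T t)) (gen (evol G T τ)) 1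
      (hu.2.2 t) (hu.2.2 τ) hr
    rw [one_mul, one_mul, mul_one, mul_one] at this
    have e : gen (evol G T τ) - gen (evol G T t) = ((τ - t : ℝ) : ℂ) • gen T := by
      simp only [gen, evol]; push_cast; module
    rw [e, norm_smul, norm_real, Real.norm_eq_abs] at this
    refine this.trans ?_
    calc _ = C ^ 2 * ‖gen T‖ * |τ - t| * (r * Real.exp (-c * r)) := by ring
      _ ≤ _ := by gcongr; linarith
  have h2 := norm_twoSided_entry_le ρ (inputMat W T ρ) h1 (by positivity) ξ i j
  rw [twoSided_sub] at h2
  exact h2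

theorem isContinuousCurve_flow (h : IsRealization W G T ρ) (hu : UniformDecay G T C c) :
    IsContinuousCurve (flow W G T ρ) := by
  have hint := fun t => integrable_realizedHat (W := W) (T := T) (ρ := ρ) hu.2.1 hu.1.le (hu.2.2 t)
  have hmem := fun t => memLp_realizedHat (W := W) (T := T) (ρ := ρ) hu.2.1 hu.1.le (hu.2.2 t)
  refine ⟨fun t => ?_, fun _ => W,
    fun t i j => (memLp_fourierInv (hint t i j) (hmem t i j)).toLp, continuous_const,
    fun t i j => ?_, fun s hs t i j => ⟨?_, ?_⟩⟩
  · refine continuous_matrix fun i j => ?_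
    simp_rw [flow_entry_eq h hu]
    exact continuous_const.add (continuous_fourierInv (hint t i j))
  · filter_upwards [(memLp_fourierInv (hint t i j) (hmem t i j)).coeFn_toLp] with x hx
    rw [hx, flow_entry_eq h hu]
  · unfold sobolevENorm
    rw [fourier_toLp_fourierInv (hint t i j) (hmem t i j)]
    rw [eLpNorm_congr_ae (g := fun ξ => ((japanese s ξ : ℝ) : ℂ) *
      realizedHat W (evol G T t) T ρ ξ i j) (by
        filter_upwards [(hmem t i j).coeFn_toLp] with ξ hξ
        rw [hξ]; rfl)]
    refine (eLpNorm_weight_le (w := japanese s) (s := s) (c := c)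
      (fun ξ => (abs_of_pos (japanese_pos s ξ)).le)
      fun ξ => norm_realizedHat_le hu.2.1 hu.1.le (hu.2.2 t) ξ i j).trans_lt ?_
    exact ENNReal.mul_lt_top ENNReal.ofReal_lt_top (memLp_japanese_mul_decayWeight s hu.2.1).2
  · set A := eLpNorm (fun ξ => japanese s ξ * decayWeight c ξ) 2 volume with hA
    have hA' : A ≠ ⊤ := (memLp_japanese_mul_decayWeight s hu.2.1).2.ne
    have hle : ∀ τ, sobolevENorm s ((memLp_fourierInv (hint τ i j) (hmem τ i j)).toLp -
        (memLp_fourierInv (hint t i j) (hmem t i j)).toLp) ≤ ENNReal.ofReal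
        (2 * Real.pi * ‖ρ‖ * ‖inputMat W T ρ‖ * (C ^ 2 * ‖gen T‖ * |τ - t|)) * A := by
      intro τ
      unfold sobolevENorm
      have e1 : 𝓕 ((memLp_fourierInv (hint τ i j) (hmem τ i j)).toLp -
          (memLp_fourierInv (hint t i j) (hmem t i j)).toLp) =
          ((hmem τ i j).toLp - (hmem t i j).toLp : Lp ℂ 2 (volume : Measure ℝ)) := by
        rw [← fourier_toLp_fourierInv (hint τ i j), ← fourier_toLp_fourierInv (hint t i j)]
        exact map_sub (Lp.fourierTransformₗᵢ ℝ ℂ) _ _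
      rw [e1]
      rw [eLpNorm_congr_ae (g := fun ξ => ((japanese s ξ : ℝ) : ℂ) *
        (realizedHat W (evol G T τ) T ρ ξ i j - realizedHat W (evol G T t) T ρ ξ i j)) (by
          filter_upwards [(hmem t i j).coeFn_toLp, (hmem τ i j).coeFn_toLp,
            Lp.coeFn_sub (hmem τ i j).toLp (hmem t i j).toLp] with ξ h1 h2 h3
          rw [h3, Pi.sub_apply, h1, h2]; rfl)]
      exact eLpNorm_weight_le (w := japanese s) (s := s) (c := c)
        (fun ξ => (abs_of_pos (japanese_pos s ξ)).le) fun ξ => norm_realizedHat_sub_le hu τ t ξ i j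
    refine tendsto_of_tendsto_of_tendsto_of_le_of_le tendsto_const_nhds ?_ (fun _ => zero_le) hle
    have h1 : Tendsto (fun τ => 2 * Real.pi * ‖ρ‖ * ‖inputMat W T ρ‖ * (C ^ 2 * ‖gen T‖ * |τ - t|))
        (𝓝 t) (𝓝 0) := by
      have : Continuous fun τ =>
          2 * Real.pi * ‖ρ‖ * ‖inputMat W T ρ‖ * (C ^ 2 * ‖gen T‖ * |τ - t|) := by fun_prop
      simpa using this.tendsto t
    have h2 := ENNReal.Tendsto.mul_const (ENNReal.tendsto_ofReal h1) (Or.inr hA')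
    simpa using h2

theorem isSolution_flow {k : ℕ} (h : IsRealization W G T ρ) (hu : UniformDecay G T C c)
    (hW : W ∈ Gr k d) : IsSolution k d (flow W G T ρ) where
  mem_gr t x := realized_mem_gr (h.evol t) hW x
  curve := isContinuousCurve_flow h hu
  equation t := by
    set M := evol G T t with hM
    refine ⟨fun x => -(I • (-(I • (ρ * (resol M x * resol M x) * inputMat W T ρ)) -
        (-(I • (ρ * (resol M x * resol M x) * inputMat W T ρ)))ᴴ)), fun i j => ?_, fun x => ?_⟩
    · have h1 := isAbsD_const_add (integrable_realizedHat (W := W) (T := T) (ρ := ρ)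
        hu.2.1 hu.1.le (hu.2.2 t) i j) (W i j)
        (integrable_abs_mul_realizedHat hu.2.1 hu.1.le (hu.2.2 t) i j)
      convert h1 using 1
      · ext x; exact flow_entry_eq h hu t x i j
      · ext x
        exact (fourierInv_abs_mul_realizedHat hu.2.1 (hu.2.2 t) (h.evol t).regular x i j).symm
    · refine (hasDerivAt_flow h t x).congr_deriv ?_
      rw [← hM, evolution_identity (h.evol t) x]
      exact half_smul_commutator_eq _ _

end Uniform

end Solution

end HWM

end

noncomputable section

namespace HWM

open Matrix Complex
open scoped ComplexOrder Matrix.Norms.L2Operator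

set_option linter.unusedSectionVars false

/-! ### Solitons and the large-time asymptotics -/

section Solitons

variable {d : ℕ} {ι : Type*} [Fintype ι] [DecidableEq ι]
variable {W : Mat d} {G : Matrix ι ι ℂ} {v : ι → ℝ} {ρ : Matrix (Fin d) ι ℂ}

theorem fourierInv_sub {E : Type*} [NormedAddCommGroup E] [NormedSpace ℂ E] {f g : ℝ → E}
    (hf : Integrable f) (hg : Integrable g) (x : ℝ) :
    𝓕⁻ (fun ξ => f ξ - g ξ) x = 𝓕⁻ f x - 𝓕⁻ g x := by
  have key : ∀ {f : ℝ → E}, Integrable f → Integrable fun ξ => chr x ξ • f ξ := fun {f} hf => by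
    refine hf.norm.mono' ((continuous_chr x).aestronglyMeasurable.smul hf.1)
      (Eventually.of_forall fun ξ => ?_)
    rw [norm_smul, norm_chr, one_mul]
  simp_rw [fourierInv_eq_integral_chr, smul_sub]
  exact integral_sub (key hf) (key hg)

theorem isUnit_diagonal_sub {g : ι → ℂ} (hg : ∀ j, (g j).im ≠ 0) (t x : ℝ) :
    IsUnit (evol (diagonal g) (realDiag v) t - (x : ℂ) • (1 : Matrix ι ι ℂ)) := by
  have e : evol (diagonal g) (realDiag v) t - (x : ℂ) • (1 : Matrix ι ι ℂ) =
      diagonal fun j => g j + t * v j - x := by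
    ext i j
    by_cases hij : i = j
    · subst hij; simp [evol]
    · simp [evol, hij]
  rw [e, Matrix.isUnit_diagonal, Pi.isUnit_iff]
  intro j
  refine isUnit_iff_ne_zero.2 fun h0 => hg j ?_
  have := congrArg Complex.im h0
  simpa using this

theorem resol_diagonal {g : ι → ℂ} (hg : ∀ j, (g j).im ≠ 0) (t x : ℝ) :
    resol (evol (diagonal g) (realDiag v) t) x = diagonal fun j => (g j + t * v j - x)⁻¹ := by
  have e : evol (diagonal g) (realDiag v) t - (x : ℂ) • (1 : Matrix ι ι ℂ) =
      diagonal fun j => g j + t * v j - x := by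
    ext i j
    by_cases hij : i = j
    · subst hij; simp [evol]
    · simp [evol, hij]
  rw [resol, e]
  refine Matrix.inv_eq_left_inv ?_
  rw [diagonal_mul_diagonal, ← diagonal_one]
  congr 1
  ext j
  refine inv_mul_cancel₀ fun h0 => hg j ?_
  have := congrArg Complex.im h0
  simpa using this

/-- The flow approaches that of the diagonal part. -/
theorem tendsto_flow_sub_diag (h : IsRealization W G (realDiag v) ρ) (hv : Function.Injective v)
    {s : ℝ} (hs : 0 < s) :
    Tendsto (fun t => homSobolevENormMat s (fun x => flow W G (realDiag v) ρ t x -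
      realized W (evol (diagonal fun j => G j j) (realDiag v) t) (realDiag v) ρ x))
      (atBot ⊔ atTop) (𝓝 0) := by
  obtain ⟨C₁, c₁, hu⟩ := exists_uniformDecay h hv
  obtain ⟨C, c, hc, hle⟩ := exists_exp_gen_sub_diag_le h hv
  obtain ⟨δ, hδ, hδ'⟩ := exists_diag_im_le h hv
  have hdiag : ∀ t r : ℝ, 0 ≤ r →
      ‖NormedSpace.exp (r • gen (evol (diagonal fun j => G j j) (realDiag v) t))‖ ≤
      1 * Real.exp (-(2 * Real.pi * δ) * r) := fun t r hr => by
    rw [one_mul]; exact norm_exp_gen_diagonal_le hδ' t r hr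
  have hc' : 0 < 2 * Real.pi * δ := by have := Real.pi_pos; positivity
  have him : ∀ j, (G j j).im ≠ 0 := fun j => (diag_im_neg h hv j).ne
  set T := realDiag v
  set B := inputMat W T ρ
  set A := ((d : ℝ≥0∞) * d) ^ (1 / 2 : ℝ) *
        eLpNorm (fun ξ => japanese s ξ * decayWeight c ξ) 2 volume with hA
  have hA' : A ≠ ⊤ := by
    refine ENNReal.mul_ne_top ?_ (memLp_japanese_mul_decayWeight s hc).2.ne
    exact ENNReal.rpow_ne_top_of_nonneg (by norm_num)
      (ENNReal.mul_ne_top (ENNReal.natCast_ne_top d) (ENNReal.natCast_ne_top d))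
  have hbound : ∀ t : ℝ, t ≠ 0 → homSobolevENormMat s (fun x => flow W G T ρ t x -
      realized W (evol (diagonal fun j => G j j) T t) T ρ x) ≤
      ENNReal.ofReal (2 * Real.pi * ‖ρ‖ * ‖B‖ * (|C| * |t|⁻¹)) * A := by
    intro t ht
    refine homSobolevENormMat_le (c₀ := 0) (h := fun ξ => realizedHat W (evol G T t) T ρ ξ -
      realizedHat W (evol (diagonal fun j => G j j) T t) T ρ ξ) hs (fun x i j => ?_)
      (fun i j => ?_) (fun ξ i j => ?_)
    · rw [Matrix.sub_apply, flow_entry_eq h hu, realized_entry_eq hc' (hdiag t)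
        (isUnit_diagonal_sub him t)]
      have := fourierInv_sub (integrable_realizedHat (W := W) (T := T) (ρ := ρ)
        hu.2.1 hu.1.le (hu.2.2 t) i j)
        (integrable_realizedHat (W := W) (T := T) (ρ := ρ) hc' zero_le_one (hdiag t) i j) x
      simp only [Matrix.sub_apply, Matrix.zero_apply]
      rw [this]
      ring
    · exact (integrable_realizedHat (W := W) (T := T) (ρ := ρ)
        hu.2.1 hu.1.le (hu.2.2 t) i j).sub
        (integrable_realizedHat (W := W) (T := T) (ρ := ρ) hc' zero_le_one (hdiag t) i j)
    · have h1 : ∀ r : ℝ, 0 ≤ r → ‖NormedSpace.exp (r • gen (evol G T t)) -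
          NormedSpace.exp (r • gen (evol (diagonal fun j => G j j) T t))‖ ≤
          (|C| * |t|⁻¹) * ((1 + r) * Real.exp (-c * r)) := fun r hr => by
        refine (hle t ht r hr).trans ?_
        gcongr
        exact le_abs_self C
      have h2 := norm_twoSided_entry_le ρ B h1 (by positivity) ξ i j
      rw [twoSided_sub] at h2
      exact h2
  have hlim : Tendsto (fun t : ℝ =>
      ENNReal.ofReal (2 * Real.pi * ‖ρ‖ * ‖B‖ * (|C| * |t|⁻¹)) * A) (atBot ⊔ atTop) (𝓝 0) := by
    have h0 : Tendsto (fun t : ℝ => |t|⁻¹) (atBot ⊔ atTop) (𝓝 0) :=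
      tendsto_inv_atTop_zero.comp (tendsto_abs_atBot_atTop.sup tendsto_abs_atTop_atTop)
    have h1 : Tendsto (fun t : ℝ => 2 * Real.pi * ‖ρ‖ * ‖B‖ * (|C| * |t|⁻¹)) (atBot ⊔ atTop)
        (𝓝 0) := by
      simpa using (h0.const_mul |C|).const_mul (2 * Real.pi * ‖ρ‖ * ‖B‖)
    have h2 := ENNReal.Tendsto.mul_const (ENNReal.tendsto_ofReal h1) (Or.inr hA')
    simpa using h2
  refine tendsto_of_tendsto_of_tendsto_of_le_of_le' tendsto_const_nhds hlim
    (Eventually.of_forall fun _ => zero_le) ?_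
  have : ∀ᶠ t : ℝ in atBot ⊔ atTop, t ≠ 0 :=
    eventually_sup.2 ⟨eventually_ne_atBot 0, eventually_ne_atTop 0⟩
  filter_upwards [this] with t ht using hbound t ht

/-- The residue `A_j = i ρ_j (v_j ρ_j^* - ρ_j^* W)` of the `j`-th soliton. -/
def solitonResidue (W : Mat d) (v : ι → ℝ) (ρ : Matrix (Fin d) ι ℂ) (j : ι) : Mat d :=
  I • vecMulVec (ρ.col j) ((inputMat W (realDiag v) ρ).row j)

theorem inputMat_realDiag_apply (W : Mat d) (v : ι → ℝ) (ρ : Matrix (Fin d) ι ℂ) (j : ι)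
    (k : Fin d) :
    inputMat W (realDiag v) ρ j k = v j * star (ρ k j) - (ρᴴ * W) j k := by
  rw [inputMat, Matrix.sub_apply, diagonal_mul]; rfl

theorem hardyPart_diagonal {g : ι → ℂ} (hg : ∀ j, (g j).im ≠ 0) (t x : ℝ) :
    hardyPart W (evol (diagonal g) (realDiag v) t) (realDiag v) ρ x =
      ∑ j, ((x : ℂ) - v j * t - g j)⁻¹ • solitonResidue W v ρ j := by
  rw [hardyPart, resol_diagonal hg]
  ext i k
  rw [Matrix.neg_apply, Matrix.smul_apply, Matrix.mul_apply, Matrix.sum_apply, Finset.smul_sum,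
    ← Finset.sum_neg_distrib]
  refine Finset.sum_congr rfl fun j _ => ?_
  have e : (x : ℂ) - v j * t - g j = -(g j + t * v j - x) := by ring
  rw [mul_diagonal, solitonResidue, e, inv_neg]
  simp only [Matrix.smul_apply, vecMulVec_apply, smul_eq_mul, col_apply, row_apply]
  ring

/-- The residue of the soliton with the pole parameters given by the diagonal of `G`. -/
theorem sum_solitonProfile_eq {N : ℕ} {G : Matrix (Fin N) (Fin N) ℂ} {v : Fin N → ℝ}
    {ρ : Matrix (Fin d) (Fin N) ℂ} (hg : ∀ j, (G j j).im ≠ 0) (t x : ℝ) :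
    (∑ j, solitonProfile W (solitonResidue W v ρ j) (G j j).re (-(G j j).im) (x - v j * t)) -
      ((N : ℂ) - 1) • W =
    realized W (evol (diagonal fun j => G j j) (realDiag v) t) (realDiag v) ρ x := by
  rw [realized, hardyPart_diagonal hg, conjTranspose_sum]
  simp only [solitonProfile, Finset.sum_add_distrib, Finset.sum_const, Finset.card_univ,
    Fintype.card_fin]
  have e1 : ∀ j, (((x - v j * t : ℝ) : ℂ) - ((G j j).re : ℂ) + I * ((-(G j j).im : ℝ) : ℂ)) =
      (x : ℂ) - v j * t - G j j := fun j => by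
    apply Complex.ext <;> simp
  have e2 : ∀ j, (((((x : ℂ) - v j * t - G j j)⁻¹ • solitonResidue W v ρ j)ᴴ : Mat d)) =
      (((x - v j * t : ℝ) : ℂ) - ((G j j).re : ℂ) - I * ((-(G j j).im : ℝ) : ℂ))⁻¹ •
        (solitonResidue W v ρ j)ᴴ := fun j => by
    rw [conjTranspose_smul, star_inv₀]
    congr 2
    apply Complex.ext <;> simp
  simp_rw [e1, e2]
  rw [sub_smul, one_smul, ← Nat.cast_smul_eq_nsmul ℂ]
  abel

/-- Since `T` is diagonal, the `(j, j)` entries of both matrix identities involve only `G_jj`, `v_j`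
and the column `ρ_j`. Regularity is the strict negativity of `Im G_jj`. Hence a single soliton is
the flow of a one-dimensional realization. -/
theorem isRealization_submatrix_unit (h : IsRealization W G (realDiag v) ρ)
    (hv : Function.Injective v) (j : ι) :
    IsRealization W (G.submatrix (fun _ : Fin 1 => j) fun _ => j)
      (realDiag fun _ : Fin 1 => v j) (ρ.submatrix id fun _ => j) where
  herm := h.herm
  sq := h.sq
  dissip := by
    ext a b
    exact congrFun (congrFun h.dissip j) j
  sylvester := by
    ext a b
    have h1 := congrFun (congrFun h.sylvester j) j
    have hab : a = b := Subsingleton.elim _ _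
    subst hab
    have h2 : ((ρ.submatrix id fun _ : Fin 1 => j)ᴴ * W * (ρ.submatrix id fun _ => j)) a a =
        (ρᴴ * W * ρ) j j := rfl
    rw [h2, h1]
    simp [Matrix.mul_diagonal, Matrix.diagonal_mul]
  toeplitz_herm := by
    rw [diagonal_conjTranspose]; congr 1; ext; simp
  regular x := by
    rw [Matrix.isUnit_iff_isUnit_det, Matrix.det_unique, isUnit_iff_ne_zero]
    intro h0
    have := congrArg Complex.im h0
    simp at this
    exact (diag_im_neg h hv j).ne this

theorem flow_unit_eq (h : IsRealization W G (realDiag v) ρ) (hv : Function.Injective v) (j : ι)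
    (t x : ℝ) :
    flow W (G.submatrix (fun _ : Fin 1 => j) fun _ => j) (realDiag fun _ : Fin 1 => v j)
      (ρ.submatrix id fun _ => j) t x =
    solitonProfile W (solitonResidue W v ρ j) (G j j).re (-(G j j).im) (x - v j * t) := by
  have hd : (G.submatrix (fun _ : Fin 1 => j) fun _ => j) =
      diagonal fun k : Fin 1 => (G.submatrix (fun _ : Fin 1 => j) fun _ => j) k k := by
    ext a b
    have hab : a = b := Subsingleton.elim _ _
    subst hab
    simp
  have h1 := sum_solitonProfile_eq (W := W) (G := G.submatrix (fun _ : Fin 1 => j) fun _ => j)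
    (v := fun _ => v j) (ρ := ρ.submatrix id fun _ => j)
    (fun _ => (diag_im_neg h hv j).ne) t x
  rw [← hd] at h1
  rw [flow, ← h1]
  simp only [Finset.univ_unique, Finset.sum_singleton, Nat.cast_one, sub_self, zero_smul, sub_zero,
    submatrix_apply]
  congr 1
  unfold solitonResidue
  congr 2
  ext k
  rw [row_apply, row_apply, inputMat_realDiag_apply, inputMat_realDiag_apply]
  rfl

/-- This is the diagonal entry of `B ρ = T ρ^* ρ - ρ^* W ρ`, in which dissipation and the Sylvester
equation both give `v_j i (G_jj - conj G_jj)`. It makes the residue nilpotent. -/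
theorem inputMat_row_dot_col (h : IsRealization W G (realDiag v) ρ) (j : ι) :
    (inputMat W (realDiag v) ρ).row j ⬝ᵥ ρ.col j = 0 := by
  have h1 := congrFun (congrFun h.sylvester j) j
  have h2 := congrFun (congrFun h.dissip j) j
  have e : (inputMat W (realDiag v) ρ).row j ⬝ᵥ ρ.col j = (inputMat W (realDiag v) ρ * ρ) j j := rfl
  rw [e, inputMat, Matrix.sub_mul, Matrix.sub_apply, h1, Matrix.mul_assoc, diagonal_mul, h2]
  simp [diagonal_mul, mul_diagonal]
  ring

theorem solitonResidue_sq (h : IsRealization W G (realDiag v) ρ) (j : ι) :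
    solitonResidue W v ρ j ^ 2 = 0 := by
  rw [sq, solitonResidue, Matrix.smul_mul, Matrix.mul_smul, vecMulVec_mul_vecMulVec,
    inputMat_row_dot_col h j]
  simp

/-- The residue is a product of a column and a row, so only their nonvanishing matters. If the row
`ρ_j^* (v_j - W)` were zero, multiplication by `v_j + W` would give `(v_j² - 1) ρ_j^* = 0`. -/
theorem solitonResidue_rank (h : IsRealization W G (realDiag v) ρ) (hv : Function.Injective v)
    (hv1 : ∀ j, v j ^ 2 ≠ 1) (j : ι) : (solitonResidue W v ρ j).rank = 1 := by
  have hρ := col_ne_zero h hv j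
  have hB : (inputMat W (realDiag v) ρ).row j ≠ 0 := by
    intro h0
    have h1 : (inputMat W (realDiag v) ρ).row j ᵥ* ((v j : ℂ) • (1 : Mat d) + W) = 0 := by
      rw [h0, zero_vecMul]
    have h2 : (inputMat W (realDiag v) ρ).row j =
        (ρᴴ).row j ᵥ* ((v j : ℂ) • (1 : Mat d) - W) := by
      rw [vecMul_sub, vecMul_smul, vecMul_one]
      ext k
      rw [row_apply, inputMat_realDiag_apply]
      rfl
    have h3 : ((v j : ℂ) • (1 : Mat d) - W) * ((v j : ℂ) • (1 : Mat d) + W) =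
        ((v j : ℂ) ^ 2 - 1) • (1 : Mat d) := by
      simp only [Matrix.mul_add, Matrix.sub_mul, Matrix.smul_mul, Matrix.mul_smul, Matrix.one_mul,
        Matrix.mul_one, h.sq]
      module
    rw [h2, vecMul_vecMul, h3, vecMul_smul, vecMul_one, smul_eq_zero] at h1
    rcases h1 with h1 | h1
    · exact hv1 j (by exact_mod_cast sub_eq_zero.1 h1)
    · refine hρ ?_
      ext i
      have := congrFun h1 i
      simpa using this
  have hne : solitonResidue W v ρ j ≠ 0 := by
    obtain ⟨i, hi⟩ := Function.ne_iff.1 hρ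
    obtain ⟨k, hk⟩ := Function.ne_iff.1 hB
    intro h0
    have := congrFun (congrFun h0 i) k
    simp only [solitonResidue, Matrix.smul_apply, vecMulVec_apply, smul_eq_mul,
      Matrix.zero_apply] at this
    exact mul_ne_zero I_ne_zero (mul_ne_zero hi hk) this
  refine le_antisymm ?_ (Nat.one_le_iff_ne_zero.2 fun h0 => hne ?_)
  · have e : solitonResidue W v ρ j =
        vecMulVec (I • ρ.col j) ((inputMat W (realDiag v) ρ).row j) := by
      rw [solitonResidue, smul_vecMulVec]
    rw [e]
    exact rank_vecMulVec_le _ _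
  · rw [Matrix.rank, Submodule.finrank_eq_zero, LinearMap.range_eq_bot] at h0
    refine Matrix.ext_of_mulVec_single fun i => ?_
    rw [zero_mulVec]
    exact congrArg (fun f => f (Pi.single i 1)) h0

theorem isRationalMap_solitonProfile (W A : Mat d) (y : ℝ) {δ : ℝ} (hδ : 0 < δ) :
    IsRationalMap (solitonProfile W A y δ) := by
  intro i j
  refine ⟨C (W i j) * ((X - C (y : ℂ) + C (I * δ)) * (X - C (y : ℂ) - C (I * δ))) +
    C (A i j) * (X - C (y : ℂ) - C (I * δ)) + C (Aᴴ i j) * (X - C (y : ℂ) + C (I * δ)),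
    (X - C (y : ℂ) + C (I * δ)) * (X - C (y : ℂ) - C (I * δ)), fun x => ?_⟩
  have h1 : (x : ℂ) - y + I * δ ≠ 0 := fun h0 => hδ.ne' (by simpa using congrArg Complex.im h0)
  have h2 : (x : ℂ) - y - I * δ ≠ 0 := fun h0 => hδ.ne' (by simpa using congrArg Complex.im h0)
  simp only [eval_mul, eval_add, eval_sub, eval_X, eval_C]
  refine ⟨mul_ne_zero h1 h2, ?_⟩
  rw [eq_div_iff (mul_ne_zero h1 h2)]
  simp only [solitonProfile, Matrix.add_apply, Matrix.smul_apply, smul_eq_mul]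
  field_simp

theorem isSolitaryWaveProfile_soliton {k : ℕ} (h : IsRealization W G (realDiag v) ρ)
    (hv : Function.Injective v) (hW : W ∈ Gr k d) (j : ι) :
    IsSolitaryWaveProfile k d (v j)
      (solitonProfile W (solitonResidue W v ρ j) (G j j).re (-(G j j).im)) := by
  have h1 := isRealization_submatrix_unit h hv j
  obtain ⟨C, c, hu⟩ := exists_uniformDecay h1 (Function.injective_of_subsingleton _)
  have h2 := isSolution_flow h1 hu hW
  have e : (fun t x => flow W (G.submatrix (fun _ : Fin 1 => j) fun _ => j)
      (realDiag fun _ : Fin 1 => v j) (ρ.submatrix id fun _ => j) t x) = fun t x =>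
      solitonProfile W (solitonResidue W v ρ j) (G j j).re (-(G j j).im) (x - v j * t) :=
    funext fun t => funext fun x => flow_unit_eq h hv j t x
  have e0 : flow W (G.submatrix (fun _ : Fin 1 => j) fun _ => j)
      (realDiag fun _ : Fin 1 => v j) (ρ.submatrix id fun _ => j) 0 =
      solitonProfile W (solitonResidue W v ρ j) (G j j).re (-(G j j).im) := by
    ext x; rw [flow_unit_eq h hv j]; simp
  refine ⟨fun x => ?_, ?_, ?_⟩
  · rw [← e0]; exact h2.mem_gr 0 x
  · obtain ⟨K, hK⟩ := exists_homSobolevENormMat_flow_le h1 hu (s := 1 / 2) (by norm_num)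
    rw [← e0]
    exact (hK 0).trans_lt ENNReal.coe_lt_top
  · rw [← e]; exact h2

/-- Riemann–Lebesgue: up to the constant `W`, the entries are inverse Fourier transforms of
integrable functions. -/
theorem tendsto_realized_cocompact {T : Matrix ι ι ℂ} (h : IsRealization W G T ρ) :
    Tendsto (realized W G T ρ) (cocompact ℝ) (𝓝 W) := by
  obtain ⟨C, c, hC, hc, hdec⟩ := exists_exp_gen_decay h.dissip h.regular
  refine tendsto_pi_nhds.2 fun i => tendsto_pi_nhds.2 fun j => ?_
  have e : (fun x => realized W G T ρ x i j) =
      fun x => W i j + 𝓕⁻ (fun ξ => realizedHat W G T ρ ξ i j) x :=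
    funext fun x => realized_entry_eq hc hdec h.regular x i j
  rw [e]
  simpa using (tendsto_fourierInv_cocompact (fun ξ => realizedHat W G T ρ ξ i j)).const_add (W i j)

theorem flow_zero (W : Mat d) (G T : Matrix ι ι ℂ) (ρ : Matrix (Fin d) ι ℂ) :
    flow W G T ρ 0 = realized W G T ρ := by
  ext x; simp [flow, evol]

end Solitons

end HWM

end

noncomputable section

namespace HWM

open Matrix Complex
open scoped ComplexOrder Matrix.Norms.L2Operator

set_option linter.unusedSectionVars false

/-! ### Construction of realizations from inner functions -/

section Construction

variable {d : ℕ} {ι κ : Type*} [Fintype ι] [DecidableEq ι] [Fintype κ] [DecidableEq κ]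

/-- With `A = gen G`, the equation says `A X + X A^* = 0`, so `exp(r A) X exp(r A^*)` is constant in
`r`. At `r = 1` this gives `‖X‖ ≤ ‖exp A‖² ‖X‖`, and `‖exp A‖ < 1`. -/
theorem eq_zero_of_sylvester {G : Matrix ι ι ℂ} {ρ : Matrix (Fin d) ι ℂ}
    (h : ρᴴ * ρ = I • (G - Gᴴ)) (hreg : ∀ x : ℝ, IsUnit (G - (x : ℂ) • (1 : Matrix ι ι ℂ)))
    {X : Matrix ι ι ℂ} (hX : G * X - X * Gᴴ = 0) : X = 0 := by
  set A := gen G with hA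
  have h0 : X * Aᴴ - -A * X = 0 := by
    have : Aᴴ = (2 * Real.pi * I : ℂ) • Gᴴ := by
      rw [hA, gen, conjTranspose_smul]
      congr 1
      simp only [star_neg, star_mul', star_def, conj_I, conj_ofReal, map_ofNat]
      ring
    rw [this, hA, gen, sub_eq_zero.1 hX |> fun e => show (X * ((2 * Real.pi * I : ℂ) • Gᴴ) -
      -((-(2 * Real.pi * I) : ℂ) • G) * X) = (2 * Real.pi * I : ℂ) • (X * Gᴴ - G * X) by
        simp only [Matrix.mul_smul, Matrix.smul_mul, Matrix.neg_mul]; module, ← neg_sub, hX]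
    simp
  have hd : ∀ r : ℝ, HasDerivAt (fun r : ℝ => NormedSpace.exp ((0 - r) • -A) * X *
      NormedSpace.exp (r • Aᴴ)) 0 r := fun r => by
    refine (hasDerivAt_duhamel (-A) Aᴴ X 0 r).congr_deriv ?_
    rw [h0]; simp
  have hconst := is_const_of_deriv_eq_zero (fun r => (hd r).differentiableAt)
    (fun r => (hd r).deriv) 1 0
  simp only [zero_sub, smul_neg, neg_smul, one_smul, neg_neg, zero_smul, neg_zero,
    NormedSpace.exp_zero, one_mul, mul_one] at hconst
  rw [Matrix.exp_conjTranspose] at hconst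
  have hlt := norm_exp_gen_lt_one h hreg
  have hle : ‖X‖ ≤ ‖NormedSpace.exp A‖ * ‖X‖ * ‖NormedSpace.exp A‖ := by
    conv_lhs => rw [← hconst]
    refine (norm_mul_le _ _).trans ?_
    rw [Matrix.l2_opNorm_conjTranspose]
    gcongr
    exact norm_mul_le _ _
  by_contra hne
  have hpos : 0 < ‖X‖ := norm_pos_iff.2 hne
  have h1 : ‖NormedSpace.exp A‖ * ‖NormedSpace.exp A‖ < 1 :=
    mul_lt_one_of_nonneg_of_lt_one_left (norm_nonneg _) hlt hlt.le
  nlinarith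

/-- An injective endomorphism of a finite-dimensional space is onto, which gives existence of `T`.
The adjoint `T^*` solves the same equation, so uniqueness makes `T` Hermitian. -/
theorem exists_isRealization {W : Mat d} (hW : Wᴴ = W) (hW2 : W * W = 1) {G : Matrix ι ι ℂ}
    {ρ : Matrix (Fin d) ι ℂ} (h : ρᴴ * ρ = I • (G - Gᴴ))
    (hreg : ∀ x : ℝ, IsUnit (G - (x : ℂ) • (1 : Matrix ι ι ℂ))) :
    ∃ T, IsRealization W G T ρ := by
  let S : Matrix ι ι ℂ →ₗ[ℂ] Matrix ι ι ℂ :=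
    LinearMap.mulLeft ℂ G - LinearMap.mulRight ℂ Gᴴ
  have hS : ∀ X, S X = G * X - X * Gᴴ := fun X => rfl
  have hinj : Function.Injective S := by
    rw [← LinearMap.ker_eq_bot, LinearMap.ker_eq_bot']
    exact fun X hX => eq_zero_of_sylvester h hreg hX
  obtain ⟨T, hT⟩ := LinearMap.surjective_of_injective hinj (-(I • (ρᴴ * W * ρ)))
  rw [hS] at hT
  have hTh : Tᴴ = T := by
    refine hinj ?_
    rw [hS, hS, hT]
    have := congrArg conjTranspose hT
    simp only [conjTranspose_sub, conjTranspose_mul, conjTranspose_conjTranspose,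
      conjTranspose_neg, conjTranspose_smul, hW, star_def, conj_I, neg_smul, neg_neg] at this
    rw [← neg_sub, this, Matrix.mul_assoc]
  refine ⟨T, hW, hW2, h, ?_, hTh, hreg⟩
  rw [hT, smul_neg, smul_smul, I_mul_I]
  simp

variable {G₁ : Matrix ι ι ℂ} {ρ₁ : Matrix (Fin d) ι ℂ} {G₂ : Matrix κ κ ℂ}
  {ρ₂ : Matrix (Fin d) κ ℂ}

/-- The generator of the cascade of two inner functions. -/
def cascade (G₁ : Matrix ι ι ℂ) (ρ₁ : Matrix (Fin d) ι ℂ) (G₂ : Matrix κ κ ℂ)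
    (ρ₂ : Matrix (Fin d) κ ℂ) : Matrix (ι ⊕ κ) (ι ⊕ κ) ℂ :=
  fromBlocks G₁ (-(I • (ρ₁ᴴ * ρ₂))) 0 G₂

theorem cascade_sub (z : ℂ) : cascade G₁ ρ₁ G₂ ρ₂ - z • (1 : Matrix (ι ⊕ κ) (ι ⊕ κ) ℂ) =
    fromBlocks (G₁ - z • 1) (-(I • (ρ₁ᴴ * ρ₂))) 0 (G₂ - z • 1) := by
  rw [cascade, ← fromBlocks_one, fromBlocks_smul, sub_eq_add_neg, fromBlocks_neg, fromBlocks_add]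
  simp [sub_eq_add_neg]

/-- The coupling block `-i ρ₁^* ρ₂` is the one for which the off-diagonal blocks of `i (G - G^*)`
match those of `ρ^* ρ`. -/
theorem cascade_dissip (h₁ : ρ₁ᴴ * ρ₁ = I • (G₁ - G₁ᴴ)) (h₂ : ρ₂ᴴ * ρ₂ = I • (G₂ - G₂ᴴ)) :
    (fromCols ρ₁ ρ₂)ᴴ * fromCols ρ₁ ρ₂ =
      I • (cascade G₁ ρ₁ G₂ ρ₂ - (cascade G₁ ρ₁ G₂ ρ₂)ᴴ) := by
  rw [conjTranspose_fromCols_eq_fromRows_conjTranspose, fromRows_mul_fromCols, cascade,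
    fromBlocks_conjTranspose, sub_eq_add_neg, fromBlocks_neg, fromBlocks_add, fromBlocks_smul, h₁,
    h₂]
  refine fromBlocks_inj.2 ⟨by simp [sub_eq_add_neg], ?_, ?_, by simp [sub_eq_add_neg]⟩
  · simp [smul_smul, I_mul_I]
  · simp [conjTranspose_smul, conjTranspose_mul, smul_smul, I_mul_I]

theorem cascade_regular (h₁ : ∀ x : ℝ, IsUnit (G₁ - (x : ℂ) • (1 : Matrix ι ι ℂ)))
    (h₂ : ∀ x : ℝ, IsUnit (G₂ - (x : ℂ) • (1 : Matrix κ κ ℂ))) (x : ℝ) :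
    IsUnit (cascade G₁ ρ₁ G₂ ρ₂ - (x : ℂ) • (1 : Matrix (ι ⊕ κ) (ι ⊕ κ) ℂ)) := by
  rw [cascade_sub]
  exact isUnit_fromBlocks_zero₂₁.2 ⟨h₁ x, h₂ x⟩

/-- The off-diagonal block of the inverse of the triangular matrix supplies the cross term of the
product. Multiplying inner functions thus amounts to stacking their model spaces. -/
theorem innerFun_cascade (h₁ : ∀ x : ℝ, IsUnit (G₁ - (x : ℂ) • (1 : Matrix ι ι ℂ)))
    (h₂ : ∀ x : ℝ, IsUnit (G₂ - (x : ℂ) • (1 : Matrix κ κ ℂ))) (x : ℝ) :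
    innerFun (cascade G₁ ρ₁ G₂ ρ₂) (fromCols ρ₁ ρ₂) x = innerFun G₁ ρ₁ x * innerFun G₂ ρ₂ x := by
  have e : resol (cascade G₁ ρ₁ G₂ ρ₂) x =
      fromBlocks (resol G₁ x) (I • (resol G₁ x * (ρ₁ᴴ * ρ₂) * resol G₂ x)) 0 (resol G₂ x) := by
    rw [resol, cascade_sub, inv_fromBlocks_zero₂₁_of_isUnit_iff _ _ _ ⟨fun _ => h₂ x, fun _ => h₁ x⟩]
    simp [resol]
  rw [innerFun, e, conjTranspose_fromCols_eq_fromRows_conjTranspose, fromCols_mul_fromBlocks,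
    fromCols_mul_fromRows, innerFun, innerFun]
  simp only [Matrix.mul_zero, add_zero, Matrix.add_mul, Matrix.mul_add, Matrix.mul_smul,
    Matrix.smul_mul, Matrix.mul_one, Matrix.one_mul, smul_add]
  simp only [Matrix.mul_assoc]
  abel

/-- An isometry onto the range of a square matrix. -/
theorem exists_isometry_onto_range (L : Mat d) :
    ∃ (r : ℕ) (V : Matrix (Fin d) (Fin r) ℂ) (Z : Matrix (Fin d) (Fin r) ℂ),
      Vᴴ * V = 1 ∧ V * Vᴴ * L = L ∧ V = L * Z := by
  let S : Submodule ℂ (EuclideanSpace ℂ (Fin d)) := LinearMap.range (Matrix.toEuclideanLin L)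
  let b := stdOrthonormalBasis ℂ S
  have hmem : ∀ k, ∃ z : EuclideanSpace ℂ (Fin d), Matrix.toEuclideanLin L z = (b k : _) := fun k =>
    (b k).2
  choose z hz using hmem
  set V : Matrix (Fin d) (Fin (Module.finrank ℂ S)) ℂ := fun i k => (b k : EuclideanSpace ℂ (Fin d)) i
    with hV
  have hcol : ∀ y : EuclideanSpace ℂ (Fin d), y ∈ S → ∀ i,
      (V *ᵥ (Vᴴ *ᵥ y.ofLp)) i = y i := by
    intro y hy i
    have h1 := b.sum_repr' ⟨y, hy⟩
    have h2 := congrArg (fun w : S => (w : EuclideanSpace ℂ (Fin d)) i) h1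
    simp only [Submodule.coe_sum, Submodule.coe_smul, Submodule.coe_inner] at h2
    rw [← h2]
    simp only [mulVec, dotProduct, conjTranspose_apply, hV]
    rw [WithLp.ofLp_sum, Finset.sum_apply]
    refine Finset.sum_congr rfl fun k _ => ?_
    rw [EuclideanSpace.inner_eq_star_dotProduct]
    simp only [PiLp.smul_apply, smul_eq_mul, dotProduct, Pi.star_apply]
    rw [mul_comm]
    congr 1
    exact Finset.sum_congr rfl fun _ _ => mul_comm _ _
  refine ⟨_, V, fun i k => z k i, ?_, ?_, ?_⟩
  · ext k l
    have := orthonormal_iff_ite.1 b.orthonormal k l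
    rw [Submodule.coe_inner, EuclideanSpace.inner_eq_star_dotProduct] at this
    rw [Matrix.mul_apply, Matrix.one_apply, ← this]
    simp only [dotProduct, Pi.star_apply, hV]
    exact Finset.sum_congr rfl fun _ _ => mul_comm _ _
  · refine Matrix.ext_of_mulVec_single fun k => ?_
    rw [← mulVec_mulVec, ← mulVec_mulVec]
    ext i
    exact hcol (Matrix.toEuclideanLin L (WithLp.toLp 2 (Pi.single k 1))) ⟨_, rfl⟩ i
  · ext i k
    have := congrArg (fun w : EuclideanSpace ℂ (Fin d) => w i) (hz k)
    exact this.symm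

theorem elementary_dissip {r : ℕ} {V : Matrix (Fin d) (Fin r) ℂ} (hV : Vᴴ * V = 1) {p : ℂ}
    (hp : p.im < 0) :
    (((Real.sqrt (-2 * p.im) : ℝ) : ℂ) • V)ᴴ * (((Real.sqrt (-2 * p.im) : ℝ) : ℂ) • V) =
      I • (p • (1 : Matrix (Fin r) (Fin r) ℂ) - (p • (1 : Matrix (Fin r) (Fin r) ℂ))ᴴ) := by
  rw [conjTranspose_smul, Matrix.smul_mul, Matrix.mul_smul, hV, conjTranspose_smul,
    conjTranspose_one, ← sub_smul, smul_smul, smul_smul]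
  congr 1
  rw [star_def, conj_ofReal, ← ofReal_mul, Real.mul_self_sqrt (by linarith)]
  apply Complex.ext <;> simp
  ring

theorem elementary_regular {r : ℕ} {p : ℂ} (hp : p.im < 0) (x : ℝ) :
    IsUnit (p • (1 : Matrix (Fin r) (Fin r) ℂ) - (x : ℂ) • 1) := by
  rw [← sub_smul]
  have : p - x ≠ 0 := fun h0 => hp.ne (by simpa using congrArg Complex.im h0)
  exact (isUnit_one (M := Matrix (Fin r) (Fin r) ℂ)).smul (Units.mk0 _ this)

end Construction

end HWM

end

noncomputable section

namespace HWM

open Matrix Complex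
open scoped ComplexOrder Matrix.Norms.L2Operator

set_option linter.unusedSectionVars false

/-! ### Factorization of rational maps into the Grassmannian -/

section PolynomialMatrices

variable {d : ℕ}

/-- Evaluation of a polynomial matrix. -/
def evalMat (z : ℂ) : Matrix (Fin d) (Fin d) ℂ[X] →+* Mat d := (evalRingHom z).mapMatrix

/-- Constant polynomial matrices. -/
def constMat : Mat d →+* Matrix (Fin d) (Fin d) ℂ[X] := (C : ℂ →+* ℂ[X]).mapMatrix

theorem constMat_apply (L : Mat d) (i j : Fin d) : constMat L i j = C (L i j) := rfl

theorem evalMat_apply (z : ℂ) (F : Matrix (Fin d) (Fin d) ℂ[X]) (i j : Fin d) :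
    evalMat z F i j = (F i j).eval z := rfl

theorem evalMat_smul (z : ℂ) (g : ℂ[X]) (F : Matrix (Fin d) (Fin d) ℂ[X]) :
    evalMat z (g • F) = g.eval z • evalMat z F := by
  ext i j; simp [evalMat_apply]

theorem evalMat_constMat (z : ℂ) (L : Mat d) : evalMat z (constMat L) = L := by
  ext i j; simp [evalMat_apply, constMat_apply]

theorem exists_eq_constMat_add (F : Matrix (Fin d) (Fin d) ℂ[X]) (z : ℂ) :
    ∃ F₁, F = constMat (evalMat z F) + (X - C z) • F₁ := by
  have : ∀ i j, ∃ g, F i j - C ((F i j).eval z) = (X - C z) * g := fun i j =>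
    X_sub_C_dvd_sub_C_eval
  choose g hg using this
  refine ⟨Matrix.of g, ?_⟩
  ext1 i j
  simp [constMat_apply, evalMat_apply, ← hg]

theorem infinite_real_setOf {P : ℂ → Prop} (h : ∀ x : ℝ, P x) : {z | P z}.Infinite :=
  (Set.infinite_range_of_injective Complex.ofReal_injective).mono (by rintro _ ⟨x, rfl⟩; exact h x)

theorem polyMat_ext {F H : Matrix (Fin d) (Fin d) ℂ[X]}
    (h : ∀ x : ℝ, evalMat (x : ℂ) F = evalMat (x : ℂ) H) : F = H := by
  ext1 i j
  refine eq_of_infinite_eval_eq _ _ (infinite_real_setOf fun x => ?_)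
  exact congrFun (congrFun (h x) i) j

/-- The adjoint of a polynomial matrix, for which `F^♯(x) = F(x)^*` at real points. -/
def sharp (F : Matrix (Fin d) (Fin d) ℂ[X]) : Matrix (Fin d) (Fin d) ℂ[X] :=
  Matrix.of fun i j => (F j i).map (starRingEnd ℂ)

theorem evalMat_sharp (F : Matrix (Fin d) (Fin d) ℂ[X]) (x : ℝ) :
    evalMat (x : ℂ) (sharp F) = (evalMat (x : ℂ) F)ᴴ := by
  ext i j
  have := eval_map_apply (p := F j i) (starRingEnd ℂ) (x : ℂ)
  rw [conj_ofReal] at this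
  simp only [evalMat_apply, sharp, Matrix.of_apply, conjTranspose_apply, this]
  rfl

theorem sharp_expand (L L₁ : Mat d) (F₂ : Matrix (Fin d) (Fin d) ℂ[X]) (z : ℂ) :
    sharp (constMat L + (X - C z) • constMat L₁ + (X - C z) ^ 2 • F₂) =
      constMat Lᴴ + (X - C (starRingEnd ℂ z)) • constMat L₁ᴴ +
        (X - C (starRingEnd ℂ z)) ^ 2 • sharp F₂ := by
  ext1 i j
  simp [sharp, constMat_apply]

/-- The coefficients of `y⁰` and `y¹` consist of products containing `Q L`, `L P` or `Q L₁ P`, all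
of which vanish. -/
theorem sq_dvd_of_annihilate {R A : Type*} [CommRing R] [Ring A] [Algebra R A] (k y : R)
    {Q P L L₁ F₂ : A} (h1 : Q * L = 0) (h2 : L * P = 0) (h3 : Q * L₁ * P = 0) :
    (k • Q + y • 1) * (L + y • L₁ + y ^ 2 • F₂) * (k • P + y • 1) =
      y ^ 2 • ((k • Q + y • 1) * F₂ * (k • P + y • 1) + k • (Q * L₁) + k • (L₁ * P) + y • L₁ + L) := by
  have h3' : Q * (L₁ * P) = 0 := by rw [← mul_assoc, h3]
  simp only [mul_add, add_mul, smul_mul_assoc, mul_smul_comm, mul_one, one_mul, mul_assoc, h1, h2,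
    h3', smul_zero, zero_add]
  module

/-- At a double zero of `F²` the value and the first derivative satisfy two algebraic relations. -/
theorem sq_eq_zero_of_expand {L L₁ : Mat d} {F F₂ : Matrix (Fin d) (Fin d) ℂ[X]} {z : ℂ}
    (hF : F = constMat L + (X - C z) • constMat L₁ + (X - C z) ^ 2 • F₂) {g : ℂ[X]}
    (h : F * F = ((X - C z) ^ 2 * g) • 1) : L * L = 0 ∧ L * L₁ + L₁ * L = 0 := by
  set Y := X - C z with hY
  have hYz : Y.eval z = 0 := by simp [hY]
  have hY0 : Y ≠ 0 := X_sub_C_ne_zero z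
  have h1 : L * L = 0 := by
    have e := congrArg (evalMat z) h
    rw [map_mul, hF] at e
    simpa [map_add, evalMat_smul, evalMat_constMat, hYz] using e
  refine ⟨h1, ?_⟩
  have h1' : constMat L * constMat L = 0 := by rw [← map_mul, h1, map_zero]
  -- Once `L² = 0` removes the constant term, one factor `Y` can be cancelled. Evaluation at `z`
  -- then reads off the first-order coefficient.
  have e : Y • (constMat L * (constMat L₁ + Y • F₂) + (constMat L₁ + Y • F₂) * constMat L +
      Y • ((constMat L₁ + Y • F₂) * (constMat L₁ + Y • F₂))) = Y • ((Y * g) • 1) := by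
    rw [smul_smul, show Y * (Y * g) = Y ^ 2 * g by ring, ← h, hF]
    simp only [mul_add, add_mul, smul_mul_assoc, mul_smul_comm, h1']
    module
  have e2 := congrArg (evalMat z) (smul_right_injective _ hY0 e)
  simpa [map_add, map_mul, evalMat_smul, evalMat_constMat, hYz] using e2

end PolynomialMatrices

/-! ### Splitting off Blaschke–Potapov factors -/

section Factorization

variable {d : ℕ}

theorem innerFun_elementary {r : ℕ} (V : Matrix (Fin d) (Fin r) ℂ) {p : ℂ}
    (hp : p.im < 0) (x : ℝ) :
    innerFun (p • (1 : Matrix (Fin r) (Fin r) ℂ)) (((Real.sqrt (-2 * p.im) : ℝ) : ℂ) • V) x =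
      ((x : ℂ) - p)⁻¹ • ((p - starRingEnd ℂ p) • (V * Vᴴ) + ((x : ℂ) - p) • 1) := by
  have hne : p - x ≠ 0 := fun h0 => hp.ne (by simpa using congrArg Complex.im h0)
  have hne' : (x : ℂ) - p ≠ 0 := fun h0 => hne (by rw [← neg_sub, h0, neg_zero])
  have hr : resol (p • (1 : Matrix (Fin r) (Fin r) ℂ)) x = (p - x)⁻¹ • 1 := by
    rw [resol, ← sub_smul]
    refine Matrix.inv_eq_left_inv ?_
    rw [Matrix.smul_mul, Matrix.one_mul, smul_smul, inv_mul_cancel₀ hne, one_smul]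
  have hs : ((Real.sqrt (-2 * p.im) : ℝ) : ℂ) * ((Real.sqrt (-2 * p.im) : ℝ) : ℂ) =
      I * (p - starRingEnd ℂ p) := by
    rw [← ofReal_mul, Real.mul_self_sqrt (by linarith)]
    apply Complex.ext <;> simp
    ring
  rw [innerFun, hr, conjTranspose_smul, star_def, conj_ofReal]
  simp only [Matrix.smul_mul, Matrix.mul_smul, Matrix.mul_one, smul_add, smul_smul]
  rw [inv_mul_cancel₀ hne', one_smul, add_comm]
  congr 2
  rw [show I * (((Real.sqrt (-2 * p.im) : ℝ) : ℂ) * ((p - x)⁻¹ * ((Real.sqrt (-2 * p.im) : ℝ) : ℂ)))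
    = I * (p - x)⁻¹ * (((Real.sqrt (-2 * p.im) : ℝ) : ℂ) * ((Real.sqrt (-2 * p.im) : ℝ) : ℂ)) by ring,
    hs, show (p - x)⁻¹ = -((x : ℂ) - p)⁻¹ by rw [← neg_sub, inv_neg]]
  linear_combination (-((x : ℂ) - p)⁻¹ * (p - starRingEnd ℂ p)) * I_mul_I

/-- The numerator `F` has `F(p)² = 0`, so the range of `L = F(p)` lies in its kernel. Let `P`
project orthogonally onto this range. Then `(1 - P) L = 0` and `L P = 0`, and `L L₁ + L₁ L = 0`
yields `(1 - P) L₁ P = 0`. The two outer factors are the numerators of `b^*` and `b` for the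
elementary inner function `b` with pole `p` and projection `P`, so conjugating by `b` produces a
double zero at `p` and, by Hermitian symmetry, one at the conjugate point. One of the two zeros at
each point is used up by the denominators of `b` and `b^*`; the other removes the pole of the map.
-/
theorem exists_divided {F : Matrix (Fin d) (Fin d) ℂ[X]} {p : ℂ} (hp : p.im < 0)
    (hherm : sharp F = F) {g : ℂ[X]} (hsq : F * F = ((X - C p) ^ 2 * g) • 1) :
    ∃ (r : ℕ) (V : Matrix (Fin d) (Fin r) ℂ) (F' : Matrix (Fin d) (Fin d) ℂ[X]),
      Vᴴ * V = 1 ∧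
      (C (p - starRingEnd ℂ p) • constMat (1 - V * Vᴴ) + (X - C p) • 1) * F *
        (C (p - starRingEnd ℂ p) • constMat (V * Vᴴ) + (X - C p) • 1) =
        ((X - C p) * (X - C (starRingEnd ℂ p))) ^ 2 • F' := by
  obtain ⟨F₁, hF₁⟩ := exists_eq_constMat_add F p
  obtain ⟨F₂, hF₂⟩ := exists_eq_constMat_add F₁ p
  set L := evalMat p F
  set L₁ := evalMat p F₁
  have hF : F = constMat L + (X - C p) • constMat L₁ + (X - C p) ^ 2 • F₂ := by
    rw [hF₂] at hF₁
    rw [hF₁]; module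
  obtain ⟨hL, hLL⟩ := sq_eq_zero_of_expand hF hsq
  obtain ⟨r, V, Z, hV, hVL, hVZ⟩ := exists_isometry_onto_range L
  set P := V * Vᴴ with hP
  have hPH : Pᴴ = P := by rw [hP, conjTranspose_mul, conjTranspose_conjTranspose]
  have a1 : (1 - P) * L = 0 := by rw [Matrix.sub_mul, hVL, Matrix.one_mul, sub_self]
  have hPL : P = L * (Z * Vᴴ) := by rw [← Matrix.mul_assoc, ← hVZ]
  have a2 : L * P = 0 := by rw [hPL, ← Matrix.mul_assoc, hL, Matrix.zero_mul]
  have a3 : (1 - P) * L₁ * P = 0 := by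
    rw [Matrix.mul_assoc, show L₁ * P = -(L * L₁) * (Z * Vᴴ) by
      rw [← eq_neg_of_add_eq_zero_right hLL, Matrix.mul_assoc, ← hPL], Matrix.neg_mul,
      Matrix.mul_neg, Matrix.mul_assoc L, ← Matrix.mul_assoc, a1, Matrix.zero_mul, neg_zero]
  have b1 : P * Lᴴ = 0 := by simpa [hPH] using congrArg conjTranspose a2
  have b2 : Lᴴ * (1 - P) = 0 := by simpa [hPH] using congrArg conjTranspose a1
  have b3 : P * L₁ᴴ * (1 - P) = 0 := by
    simpa [hPH, Matrix.mul_assoc] using congrArg conjTranspose a3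
  set pb := starRingEnd ℂ p
  have hF' : F = constMat Lᴴ + (X - C pb) • constMat L₁ᴴ + (X - C pb) ^ 2 • sharp F₂ := by
    rw [← sharp_expand, ← hF, hherm]
  have hc : ∀ {A B : Mat d}, A * B = 0 → constMat A * constMat B = 0 := fun {A B} h => by
    rw [← map_mul, h, map_zero]
  set H := (C (p - pb) • constMat (1 - P) + (X - C p) • 1) * F *
    (C (p - pb) • constMat P + (X - C p) • 1) with hH
  have d1 : ∃ K, H = (X - C p) ^ 2 • K := by
    have h3 : constMat (1 - P) * constMat L₁ * constMat P = 0 := by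
      rw [← map_mul, ← map_mul, a3, map_zero]
    refine ⟨_, Eq.trans ?_ (sq_dvd_of_annihilate (F₂ := F₂) (C (p - pb)) (X - C p) (hc a1) (hc a2) h3)⟩
    rw [hH, ← hF]
  have d2 : ∃ K, H = (X - C pb) ^ 2 • K := by
    have h3 : constMat P * constMat L₁ᴴ * constMat (1 - P) = 0 := by
      rw [← map_mul, ← map_mul, b3, map_zero]
    refine ⟨_, Eq.trans ?_ (sq_dvd_of_annihilate (F₂ := sharp F₂) (C (pb - p)) (X - C pb) (hc b1)
      (hc b2) h3)⟩
    -- Expanded about the conjugate point, the two factors keep their form with `P` and `1 - P`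
    -- exchanged. The same divisibility lemma therefore applies to the adjoint expansion.
    have e1 : C (p - pb) • constMat (1 - P) + (X - C p) • (1 : Matrix (Fin d) (Fin d) ℂ[X]) =
        C (pb - p) • constMat P + (X - C pb) • 1 := by
      rw [map_sub constMat, map_one, C_sub, C_sub]; module
    have e2 : C (p - pb) • constMat P + (X - C p) • (1 : Matrix (Fin d) (Fin d) ℂ[X]) =
        C (pb - p) • constMat (1 - P) + (X - C pb) • 1 := by
      rw [map_sub constMat, map_one, C_sub, C_sub]; module
    rw [hH, e1, e2, ← hF']
  obtain ⟨K₁, hK₁⟩ := d1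
  obtain ⟨K₂, hK₂⟩ := d2
  have hcop : IsCoprime ((X - C p) ^ 2) ((X - C pb) ^ 2) := by
    refine (isCoprime_X_sub_C_of_isUnit_sub (isUnit_iff_ne_zero.2 fun h0 => ?_)).pow
    have := congrArg Complex.im h0
    simp [pb] at this
    linarith
  have hdvd : ∀ i j, ((X - C p) * (X - C pb)) ^ 2 ∣ H i j := fun i j => by
    rw [mul_pow]
    refine hcop.mul_dvd ⟨K₁ i j, ?_⟩ ⟨K₂ i j, ?_⟩
    · rw [hK₁]; rfl
    · rw [hK₂]; rfl
  choose F' hF' using hdvd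
  refine ⟨r, V, Matrix.of F', hV, ?_⟩
  ext1 i j
  exact hF' i j

/-- The product `∏ (X - p)` over a list of points. -/
def listPoly (s : List ℂ) : ℂ[X] := (s.map fun p => X - C p).prod

theorem exists_const_of_bounded {g : ℂ[X]} {C₀ : ℝ} (h : ∀ x : ℝ, ‖g.eval (x : ℂ)‖ ≤ C₀) :
    ∃ a, g = C a := by
  by_contra hne
  have hdeg : 0 < g.degree := by
    by_contra hle
    exact hne ⟨_, eq_C_of_degree_le_zero (not_lt.1 hle)⟩
  have h1 : Tendsto (fun x : ℝ => ‖(x : ℂ)‖) atTop atTop := by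
    simpa [Complex.norm_real] using tendsto_abs_atTop_atTop (G := ℝ)
  obtain ⟨x, hx⟩ := ((g.tendsto_norm_atTop hdeg h1).eventually_gt_atTop C₀).exists
  exact absurd (h x) (not_le.2 hx)

theorem norm_entry_le_one {U : Mat d} (hU : Uᴴ = U) (hU2 : U * U = 1) (i j : Fin d) :
    ‖U i j‖ ≤ 1 := by
  have h1 := congrFun (congrFun hU2 i) i
  rw [Matrix.mul_apply, Matrix.one_apply_eq] at h1
  have h2 : ∀ j, U i j * U j i = ((‖U i j‖ ^ 2 : ℝ) : ℂ) := fun j => by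
    conv_lhs => rw [← hU]
    rw [conjTranspose_apply, conjTranspose_apply, show U j i = star (U i j) by
      conv_lhs => rw [← hU]
      rfl]
    rw [star_star, star_def, Complex.mul_conj, Complex.normSq_eq_norm_sq]
  simp only [h2] at h1
  rw [← Complex.ofReal_sum] at h1
  have h3 : ∑ j, ‖U i j‖ ^ 2 = 1 := by exact_mod_cast h1
  have h4 : ‖U i j‖ ^ 2 ≤ 1 := h3 ▸ Finset.single_le_sum (f := fun j => ‖U i j‖ ^ 2)
    (fun _ _ => by positivity) (Finset.mem_univ j)
  nlinarith [norm_nonneg (U i j)]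

/-- Induction on the poles in the lower half plane. Conjugation by an elementary inner function
removes one pair of conjugate poles and preserves Hermitian involutions; the removed factor is
restored at the end by a cascade. -/
theorem exists_innerFun_of_listPoly (s : List ℂ) : ∀ (_ : ∀ p ∈ s, p.im < 0) (U : ℝ → Mat d)
    (F : Matrix (Fin d) (Fin d) ℂ[X]) (_ : ∀ x, (U x)ᴴ = U x) (_ : ∀ x, U x * U x = 1)
    (_ : ∀ x : ℝ, (listPoly s * listPoly (s.map (starRingEnd ℂ))).eval (x : ℂ) • U x =
      evalMat (x : ℂ) F),
    ∃ (ι : Type) (_ : Fintype ι) (_ : DecidableEq ι) (G : Matrix ι ι ℂ) (ρ : Matrix (Fin d) ι ℂ)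
      (W : Mat d), Wᴴ = W ∧ W * W = 1 ∧ ρᴴ * ρ = I • (G - Gᴴ) ∧
      (∀ x : ℝ, IsUnit (G - (x : ℂ) • (1 : Matrix ι ι ℂ))) ∧
      ∀ x, U x = innerFun G ρ x * W * (innerFun G ρ x)ᴴ := by
  induction s with
  | nil =>
    intro _ U F hU hU2 hF
    have hF' : ∀ x : ℝ, U x = evalMat (x : ℂ) F := fun x => by
      rw [← hF]; simp [listPoly]
    -- Without poles the entries are bounded polynomials, hence constants, and the model space is
    -- zero.
    have hc : ∀ i j, ∃ a, F i j = C a := fun i j =>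
      exists_const_of_bounded (C₀ := 1) fun x => by
        rw [← evalMat_apply, ← hF']
        exact norm_entry_le_one (hU x) (hU2 x) i j
    choose a ha using hc
    have hU0 : ∀ x, U x = U 0 := fun x => by
      rw [hF', hF' 0]
      ext i j
      simp [evalMat_apply, ha]
    refine ⟨Empty, inferInstance, inferInstance, 0, 0, U 0, hU 0, hU2 0, by ext i; exact i.elim, fun x => ?_,
      fun x => ?_⟩
    · rw [Subsingleton.elim (0 - (x : ℂ) • (1 : Matrix Empty Empty ℂ)) 1]; exact isUnit_one
    · rw [hU0]; simp [innerFun]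
  | cons p s ih =>
    intro hs U F hU hU2 hF
    have hp : p.im < 0 := hs p (by simp)
    set pb := starRingEnd ℂ p with hpb
    set q := listPoly s with hq
    set qb := listPoly (s.map (starRingEnd ℂ)) with hqb
    have hqq : listPoly (p :: s) * listPoly ((p :: s).map (starRingEnd ℂ)) =
        ((X - C p) * (X - C pb)) * (q * qb) := by
      simp only [listPoly, List.map_cons, List.prod_cons, hq, hqb, hpb]; ring
    rw [hqq] at hF
    have hsharp : sharp F = F := polyMat_ext fun x => by
      have hreal : star ((((X - C p) * (X - C pb)) * (q * qb)).eval (x : ℂ)) =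
          (((X - C p) * (X - C pb)) * (q * qb)).eval (x : ℂ) := by
        have h1 : star (q.eval (x : ℂ)) = qb.eval (x : ℂ) := by
          rw [hq, hqb, listPoly, listPoly, eval_list_prod, eval_list_prod, List.map_map,
            List.map_map, List.map_map, star_def, map_list_prod, List.map_map]
          congr 2
          funext z
          simp
        have h2 : star (qb.eval (x : ℂ)) = q.eval (x : ℂ) := by rw [← h1, star_star]
        simp only [eval_mul, star_mul', h1, h2, eval_sub, eval_X, eval_C, star_sub, hpb, star_def,
          conj_ofReal, conj_conj]
        ring
      rw [evalMat_sharp, ← hF, conjTranspose_smul, hU, hreal]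
    have hsq : F * F = ((X - C p) ^ 2 * ((X - C pb) ^ 2 * (q * qb) ^ 2)) • 1 :=
      polyMat_ext fun x => by
        rw [map_mul, ← hF, evalMat_smul, map_one, Matrix.smul_mul, Matrix.mul_smul, hU2, smul_smul]
        congr 1
        simp only [eval_mul, eval_pow]
        ring
    obtain ⟨r, V, F', hV, hH⟩ := exists_divided hp hsharp hsq
    set G₁ := p • (1 : Matrix (Fin r) (Fin r) ℂ) with hG₁
    set ρ₁ := ((Real.sqrt (-2 * p.im) : ℝ) : ℂ) • V with hρ₁
    have hdis := elementary_dissip hV hp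
    have hreg := fun x => elementary_regular (r := r) hp x
    set b := innerFun G₁ ρ₁ with hb
    have hbb : ∀ x, (b x)ᴴ * b x = 1 := fun x => innerFunH_mul_innerFun hdis (hreg x)
    have hbb' : ∀ x, b x * (b x)ᴴ = 1 := fun x => innerFun_mul_innerFunH hdis (hreg x)
    have hs' : ∀ p ∈ s, p.im < 0 := fun z hz => hs z (by simp [hz])
    obtain ⟨ι, _, _, G, ρ, W, hW, hW2, hd, hr, hUU⟩ := ih hs' (fun x => (b x)ᴴ * U x * b x) F'
      (fun x => by simp [hU, Matrix.mul_assoc])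
      (fun x => by
        rw [show (b x)ᴴ * U x * b x * ((b x)ᴴ * U x * b x) =
          (b x)ᴴ * (U x * (b x * (b x)ᴴ) * U x) * b x by simp only [Matrix.mul_assoc],
          hbb', Matrix.mul_one, hU2, Matrix.mul_one, hbb])
      (fun x => by
        have hx : (x : ℂ) - p ≠ 0 := fun h0 => hp.ne (by simpa using congrArg Complex.im h0)
        have hxb : (x : ℂ) - pb ≠ 0 := fun h0 => hp.ne (by
          simpa [hpb] using congrArg Complex.im h0)
        have e := congrArg (evalMat (x : ℂ)) hH
        simp only [map_mul, map_add, evalMat_smul, evalMat_constMat, map_one, eval_C, eval_sub,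
          eval_X, eval_pow, eval_mul, ← hF] at e
        have hb1 : b x = ((x : ℂ) - p)⁻¹ • ((p - pb) • (V * Vᴴ) + ((x : ℂ) - p) • 1) :=
          innerFun_elementary V hp x
        have hb2 : (b x)ᴴ = ((x : ℂ) - pb)⁻¹ •
            ((p - pb) • (1 - V * Vᴴ) + ((x : ℂ) - p) • 1) := by
          rw [hb1]
          simp only [conjTranspose_smul, conjTranspose_add, conjTranspose_mul,
            conjTranspose_conjTranspose, conjTranspose_one, star_def, map_sub, map_inv₀,
            conj_ofReal, hpb, conj_conj]
          module
        rw [hb2, hb1]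
        simp only [Matrix.smul_mul, Matrix.mul_smul, smul_smul] at e ⊢
        have e' := congrArg (fun M => ((((x : ℂ) - p) * (x - pb)) ^ 2)⁻¹ • M) e
        simp only [smul_smul] at e'
        rw [inv_mul_cancel₀ (pow_ne_zero 2 (mul_ne_zero hx hxb)), one_smul] at e'
        rw [← e', eval_mul]
        congr 1
        field_simp)
    refine ⟨Fin r ⊕ ι, inferInstance, inferInstance, cascade G₁ ρ₁ G ρ, fromCols ρ₁ ρ, W, hW, hW2,
      cascade_dissip hdis hd, cascade_regular hreg hr, fun x => ?_⟩
    rw [innerFun_cascade hreg hr, conjTranspose_mul,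
      show innerFun G₁ ρ₁ x * innerFun G ρ x * W * ((innerFun G ρ x)ᴴ * (innerFun G₁ ρ₁ x)ᴴ) =
        b x * (innerFun G ρ x * W * (innerFun G ρ x)ᴴ) * (b x)ᴴ by
          simp only [Matrix.mul_assoc, hb], ← hUU x,
      show b x * ((b x)ᴴ * U x * b x) * (b x)ᴴ = (b x * (b x)ᴴ) * U x * (b x * (b x)ᴴ) by
          simp only [Matrix.mul_assoc], hbb', Matrix.one_mul, Matrix.mul_one]

/-- It only remains to bring all entries over one denominator of the form `q q̄` with the roots of
`q` in the lower half plane. -/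
theorem exists_innerFun_of_isRationalMap {U : ℝ → Mat d} (hrat : IsRationalMap U)
    (hU : ∀ x, (U x)ᴴ = U x) (hU2 : ∀ x, U x * U x = 1) :
    ∃ (ι : Type) (_ : Fintype ι) (_ : DecidableEq ι) (G : Matrix ι ι ℂ) (ρ : Matrix (Fin d) ι ℂ)
      (W : Mat d), Wᴴ = W ∧ W * W = 1 ∧ ρᴴ * ρ = I • (G - Gᴴ) ∧
      (∀ x : ℝ, IsUnit (G - (x : ℂ) • (1 : Matrix ι ι ℂ))) ∧
      ∀ x, U x = innerFun G ρ x * W * (innerFun G ρ x)ᴴ := by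
  choose p q hpq using hrat
  set Q : ℂ[X] := ∏ i, ∏ j, q i j with hQ
  have hdvd : ∀ i j, q i j ∣ Q := fun i j =>
    (Finset.dvd_prod_of_mem (fun j => q i j) (Finset.mem_univ j)).trans
      (Finset.dvd_prod_of_mem (fun i => ∏ j, q i j) (Finset.mem_univ i))
  choose k hk using hdvd
  have hQx : ∀ x : ℝ, Q.eval (x : ℂ) ≠ 0 := fun x => by
    rw [hQ, eval_prod]
    refine Finset.prod_ne_zero_iff.2 fun i _ => ?_
    rw [eval_prod]
    exact Finset.prod_ne_zero_iff.2 fun j _ => (hpq i j x).1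
  have hQ0 : Q ≠ 0 := fun h0 => hQx 0 (by simp [h0])
  obtain ⟨l, hl⟩ := Quot.exists_rep Q.roots
  change (l : Multiset ℂ) = Q.roots at hl
  have hQl : Q = C Q.leadingCoeff * listPoly l := by
    conv_lhs => rw [(IsAlgClosed.splits Q).eq_prod_roots, ← hl]
    rw [Multiset.map_coe, Multiset.prod_coe, listPoly]
  have hlroot : ∀ z ∈ l, z.im ≠ 0 := fun z hz h0 => by
    have hz' : z ∈ Q.roots := by rw [← hl]; exact hz
    have := (mem_roots hQ0).1 hz'
    refine hQx z.re ?_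
    rwa [show ((z.re : ℝ) : ℂ) = z from Complex.ext (by simp) (by simp [h0])]
  -- Roots in the upper half plane are reflected. The product of the polynomial with its conjugate
  -- is unaffected.
  set s : List ℂ := l.map fun z => if z.im < 0 then z else starRingEnd ℂ z with hs
  have hsim : ∀ z ∈ s, z.im < 0 := fun z hz => by
    simp only [hs, List.mem_map] at hz
    obtain ⟨w, hw, rfl⟩ := hz
    split_ifs with h
    · exact h
    · have := hlroot w hw
      simp only [conj_im, Left.neg_neg_iff]
      exact lt_of_le_of_ne (not_lt.1 h) (Ne.symm this)
  have hprod : listPoly s * listPoly (s.map (starRingEnd ℂ)) =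
      listPoly l * listPoly (l.map (starRingEnd ℂ)) := by
    simp only [listPoly, ← List.prod_map_mul, hs, List.map_map]
    congr 1
    refine List.map_congr_left fun z _ => ?_
    simp only [Function.comp_apply]
    split_ifs with h
    · rfl
    · rw [conj_conj, mul_comm]
  refine exists_innerFun_of_listPoly s hsim U (Matrix.of fun i j => C (Q.leadingCoeff)⁻¹ * p i j * k i j *
    listPoly (l.map (starRingEnd ℂ))) hU hU2 fun x => ?_
  ext i j
  rw [hprod, Matrix.smul_apply, evalMat_apply, Matrix.of_apply, (hpq i j x).2]
  have h1 := congrArg (eval (x : ℂ)) hQl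
  have h2 := congrArg (eval (x : ℂ)) (hk i j)
  simp only [eval_mul, eval_C] at h1 h2
  have hlc : Q.leadingCoeff ≠ 0 := leadingCoeff_ne_zero.2 hQ0
  have hq := (hpq i j x).1
  simp only [eval_mul, eval_C, smul_eq_mul]
  have h3 : (listPoly l).eval (x : ℂ) = Q.leadingCoeff⁻¹ * (eval (x : ℂ) (q i j) * eval (x : ℂ) (k i j)) := by
    rw [← h2, h1]; field_simp
  rw [h3]
  field_simp

end Factorization

end HWM

end

noncomputable section

namespace HWM

open Matrix Complex
open scoped ComplexOrder Matrix.Norms.L2Operator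

set_option linter.unusedSectionVars false

/-! ### Reduction to a diagonal realization without the eigenvalues `±1` -/

section Reduction

variable {d : ℕ} {ι κ : Type*} [Fintype ι] [DecidableEq ι] [Fintype κ] [DecidableEq κ]
  {W : Mat d} {G T : Matrix ι ι ℂ} {ρ : Matrix (Fin d) ι ℂ}

/-- `V^* R V` is a left inverse of `G' - x`, so invertibility passes to the restriction to an
invariant subspace. -/
theorem resol_intertwine {G' : Matrix κ κ ℂ} {V : Matrix ι κ ℂ} (hV : Vᴴ * V = 1)
    (hGV : G * V = V * G') {x : ℝ} (hu : IsUnit (G - (x : ℂ) • (1 : Matrix ι ι ℂ))) :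
    IsUnit (G' - (x : ℂ) • (1 : Matrix κ κ ℂ)) ∧ resol G x * V = V * resol G' x := by
  have h1 : (G - (x : ℂ) • (1 : Matrix ι ι ℂ)) * V = V * (G' - (x : ℂ) • (1 : Matrix κ κ ℂ)) := by
    simp [Matrix.sub_mul, Matrix.mul_sub, hGV]
  have h2 : V = resol G x * V * (G' - (x : ℂ) • (1 : Matrix κ κ ℂ)) := by
    rw [Matrix.mul_assoc, ← h1, ← Matrix.mul_assoc, resol_mul hu, Matrix.one_mul]
  have h3 : (Vᴴ * resol G x * V) * (G' - (x : ℂ) • (1 : Matrix κ κ ℂ)) = 1 := by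
    rw [Matrix.mul_assoc, Matrix.mul_assoc, ← Matrix.mul_assoc (resol G x), ← h2, hV]
  have hu' : IsUnit (G' - (x : ℂ) • (1 : Matrix κ κ ℂ)) := IsUnit.of_mul_eq_one_right _ h3
  refine ⟨hu', ?_⟩
  conv_rhs => rw [h2]
  rw [Matrix.mul_assoc, mul_resol hu', Matrix.mul_one]

/-- Restriction of a realization to an invariant subspace containing the range of the input
matrix. -/
theorem IsRealization.compress (h : IsRealization W G T ρ) {G' T' : Matrix κ κ ℂ}
    {V : Matrix ι κ ℂ} (hV : Vᴴ * V = 1) (hGV : G * V = V * G') (hTV : T * V = V * T')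
    (hB : V * (Vᴴ * inputMat W T ρ) = inputMat W T ρ) :
    IsRealization W G' T' (ρ * V) ∧
      ∀ x, realized W G' T' (ρ * V) x = realized W G T ρ x := by
  have hG' : G' = Vᴴ * G * V := by rw [Matrix.mul_assoc, hGV, ← Matrix.mul_assoc, hV, Matrix.one_mul]
  have hT' : T' = Vᴴ * T * V := by rw [Matrix.mul_assoc, hTV, ← Matrix.mul_assoc, hV, Matrix.one_mul]
  have hT'h : T'ᴴ = T' := by
    rw [hT']; simp [h.toeplitz_herm, Matrix.mul_assoc]
  have hVT : Vᴴ * T = T' * Vᴴ := by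
    simpa [h.toeplitz_herm, hT'h] using congrArg conjTranspose hTV
  have hVG : Vᴴ * Gᴴ = G'ᴴ * Vᴴ := by
    simpa using congrArg conjTranspose hGV
  have hB' : Vᴴ * inputMat W T ρ = inputMat W T' (ρ * V) := by
    rw [inputMat, inputMat, conjTranspose_mul, Matrix.mul_sub, ← Matrix.mul_assoc, hVT,
      Matrix.mul_assoc, Matrix.mul_assoc]
  refine ⟨⟨h.herm, h.sq, ?_, ?_, hT'h, fun x => (resol_intertwine hV hGV (h.regular x)).1⟩,
    fun x => ?_⟩
  · rw [conjTranspose_mul, show Vᴴ * ρᴴ * (ρ * V) = Vᴴ * (ρᴴ * ρ) * V by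
      simp only [Matrix.mul_assoc], h.dissip, Matrix.mul_smul, Matrix.smul_mul, Matrix.mul_sub,
      Matrix.sub_mul, ← hG']
    congr 2
    rw [hG']; simp [Matrix.mul_assoc]
  · rw [conjTranspose_mul, show Vᴴ * ρᴴ * W * (ρ * V) = Vᴴ * (ρᴴ * W * ρ) * V by
      simp only [Matrix.mul_assoc], h.sylvester, Matrix.mul_smul, Matrix.smul_mul, Matrix.mul_sub,
      Matrix.sub_mul]
    congr 2
    · rw [Matrix.mul_assoc, Matrix.mul_assoc, hTV, ← Matrix.mul_assoc G, hGV, Matrix.mul_assoc,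
        ← Matrix.mul_assoc, hV, Matrix.one_mul]
    · rw [← Matrix.mul_assoc, hVT, Matrix.mul_assoc T', hVG, ← Matrix.mul_assoc, Matrix.mul_assoc,
        hV, Matrix.mul_one]
  · have e : hardyPart W G' T' (ρ * V) x = hardyPart W G T ρ x := by
      rw [hardyPart, hardyPart, ← hB', Matrix.mul_assoc ρ V,
        ← (resol_intertwine hV hGV (h.regular x)).2, ← hB]
      simp only [Matrix.mul_assoc]
      rw [← Matrix.mul_assoc Vᴴ V, hV, Matrix.one_mul]
    rw [realized, realized, e]

/-- Let `ε = v_j` be a sign, `f = e_j`, `g = ρ f` and `k = W g - ε g`. The two identities give `ρ^*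
k = i (ε - T) G^* f`, which is orthogonal to `f`, so `⟨g, k⟩ = 0`. As `W k = -ε k`, also `⟨W g, k⟩ =
0`, and therefore `k = 0`. This kills the row `B_j`, and `(ε - T) G^* f = 0` decouples row `j` of
`G` from all columns with `v_i² ≠ 1`. -/
theorem diag_annihilation {v : ι → ℝ} (h : IsRealization W G (realDiag v) ρ) {j : ι}
    (hj : v j ^ 2 = 1) :
    (∀ i, v i ^ 2 ≠ 1 → G j i = 0) ∧ ∀ a, inputMat W (realDiag v) ρ j a = 0 := by
  set f : ι → ℂ := Pi.single j 1 with hf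
  set g : Fin d → ℂ := ρ *ᵥ f with hg
  set ε : ℂ := (v j : ℂ) with hε
  have hε2 : ε * ε = 1 := by rw [hε, ← ofReal_mul, ← pow_two, hj, ofReal_one]
  have hεs : star ε = ε := by rw [hε, star_def, conj_ofReal]
  have hTf : realDiag v *ᵥ f = ε • f := by
    ext i
    rw [mulVec_diagonal, hf]
    by_cases hi : i = j
    · subst hi; simp [hε]
    · simp [hi]
  have e1 : ρᴴ *ᵥ (W *ᵥ g) = I • (ε • (G *ᵥ f) - realDiag v *ᵥ (Gᴴ *ᵥ f)) := by
    have := congrArg (fun M => M *ᵥ f) h.sylvester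
    simpa [← mulVec_mulVec, smul_mulVec, sub_mulVec, hTf, mulVec_smul] using this
  have e2 : ρᴴ *ᵥ g = I • (G *ᵥ f - Gᴴ *ᵥ f) := by
    have := congrArg (fun M => M *ᵥ f) h.dissip
    simpa [← mulVec_mulVec, smul_mulVec, sub_mulVec] using this
  set k := W *ᵥ g - ε • g with hk
  have e3 : ρᴴ *ᵥ k = I • (ε • (Gᴴ *ᵥ f) - realDiag v *ᵥ (Gᴴ *ᵥ f)) := by
    rw [hk, mulVec_sub, mulVec_smul, e1, e2]; module
  have e4 : star g ⬝ᵥ k = 0 := by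
    have h1 : star g ⬝ᵥ k = star f ⬝ᵥ (ρᴴ *ᵥ k) := by
      rw [hg, star_mulVec, dotProduct_mulVec]
    have h2 : star f ⬝ᵥ (realDiag v *ᵥ (Gᴴ *ᵥ f)) = ε * (star f ⬝ᵥ (Gᴴ *ᵥ f)) := by
      rw [dotProduct_mulVec, ← h.toeplitz_herm, ← star_mulVec, hTf, star_smul, hεs,
        smul_dotProduct, smul_eq_mul]
    rw [h1, e3, dotProduct_smul, dotProduct_sub, h2, dotProduct_smul, smul_eq_mul, smul_eq_mul,
      sub_self, mul_zero]
  have e5 : star k ⬝ᵥ k = 0 := by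
    have h1 : W *ᵥ k = -(ε • k) := by
      rw [hk, mulVec_sub, mulVec_mulVec, h.sq, one_mulVec, mulVec_smul, smul_sub, smul_smul, hε2]
      module
    have h2 : star (W *ᵥ g) ⬝ᵥ k = star g ⬝ᵥ (W *ᵥ k) := by
      rw [star_mulVec, h.herm, dotProduct_mulVec]
    conv_lhs => rw [hk]
    rw [star_sub, sub_dotProduct, ← hk, h2, h1, star_smul, smul_dotProduct, dotProduct_neg,
      dotProduct_smul, e4]
    simp
  have hk0 : k = 0 := dotProduct_star_self_eq_zero.1 e5
  rw [hk0, mulVec_zero] at e3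
  constructor
  · intro i hi
    have := congrFun e3 i
    simp only [Pi.zero_apply, Pi.smul_apply, Pi.sub_apply, mulVec_diagonal, smul_eq_mul] at this
    have h3 : (Gᴴ *ᵥ f) i = star (G j i) := by
      rw [hf, mulVec_single_one]; rfl
    rw [h3] at this
    have h4 : (ε - v i) * star (G j i) = 0 := by
      have := (mul_eq_zero.1 this.symm).resolve_left I_ne_zero
      linear_combination this
    rcases mul_eq_zero.1 h4 with h5 | h5
    · exfalso
      refine hi ?_
      have : v j = v i := by
        have := sub_eq_zero.1 h5
        rw [hε] at this
        exact_mod_cast this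
      rw [← this, hj]
    · simpa using congrArg star h5
  · intro a
    have h3 := congrArg star (congrFun hk0 a)
    have hgρ : ∀ b, g b = ρ b j := fun b => by rw [hg, hf, mulVec_single_one]; rfl
    simp only [hk, Pi.sub_apply, Pi.smul_apply, smul_eq_mul, Pi.zero_apply, star_sub, star_mul',
      hεs, star_zero, mulVec, dotProduct, star_sum, hgρ] at h3
    rw [inputMat, Matrix.sub_apply, Matrix.mul_apply_eq_vecMul]
    have h5 : (realDiag v * ρᴴ) j a = ε * star (ρ a j) := by
      rw [diagonal_mul, conjTranspose_apply]
    have h6 : (ρᴴ * W) j a = ∑ b, star (W a b) * star (ρ b j) := by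
      rw [Matrix.mul_apply]
      refine Finset.sum_congr rfl fun b _ => ?_
      conv_lhs => rw [← h.herm]
      rw [conjTranspose_apply, conjTranspose_apply, mul_comm]
    rw [← Matrix.mul_apply_eq_vecMul, h5, h6, ← neg_sub, h3, neg_zero]

/-- Two compressions: the unitary change to an eigenbasis of `T`, then the restriction to the
coordinates with `v² ≠ 1`. By `diag_annihilation` these span a `G`-invariant subspace containing the
range of `B`, so the map itself is unchanged. -/
theorem exists_diagonal_realization (h : IsRealization W G T ρ) :
    ∃ (N : ℕ) (G' : Matrix (Fin N) (Fin N) ℂ) (v : Fin N → ℝ) (ρ' : Matrix (Fin d) (Fin N) ℂ),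
      IsRealization W G' (realDiag v) ρ' ∧ (∀ j, v j ^ 2 ≠ 1) ∧
      ∀ x, realized W G' (realDiag v) ρ' x = realized W G T ρ x := by
  have hT : T.IsHermitian := h.toeplitz_herm
  set E : Matrix ι ι ℂ := (hT.eigenvectorUnitary : Matrix ι ι ℂ) with hE
  have hEE : Eᴴ * E = 1 := Matrix.mem_unitaryGroup_iff'.1 hT.eigenvectorUnitary.2
  have hEE' : E * Eᴴ = 1 := Matrix.mem_unitaryGroup_iff.1 hT.eigenvectorUnitary.2
  set l := hT.eigenvalues with hl
  have hTE : T * E = E * realDiag l := by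
    have h0 : T = E * realDiag l * Eᴴ := by
      conv_lhs => rw [hT.spectral_theorem, Unitary.conjStarAlgAut_apply]
      rfl
    conv_lhs => rw [h0]
    rw [Matrix.mul_assoc, hEE, Matrix.mul_one]
  obtain ⟨h1, hr1⟩ := h.compress (G' := Eᴴ * G * E) (T' := realDiag l) hEE
    (by rw [← Matrix.mul_assoc, ← Matrix.mul_assoc, hEE', Matrix.one_mul]) hTE
    (by rw [← Matrix.mul_assoc, hEE', Matrix.one_mul])
  set G₁ := Eᴴ * G * E
  set ρ₁ := ρ * E
  let S := {j : ι // l j ^ 2 ≠ 1}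
  let e : Fin (Fintype.card S) ≃ S := (Fintype.equivFin S).symm
  set m : Fin (Fintype.card S) → ι := fun a => (e a).1 with hm
  have hmi : Function.Injective m := Subtype.val_injective.comp e.injective
  have hml : ∀ a, l (m a) ^ 2 ≠ 1 := fun a => (e a).2
  have hms : ∀ j, l j ^ 2 ≠ 1 → ∃ a, m a = j := fun j hj => ⟨e.symm ⟨j, hj⟩, by simp [hm]⟩
  set V : Matrix ι (Fin (Fintype.card S)) ℂ := (1 : Matrix ι ι ℂ).submatrix id m with hV
  have hVm : ∀ (A : Matrix ι ι ℂ), A * V = A.submatrix id m := fun A => by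
    ext i a
    simp [hV, Matrix.mul_apply, Matrix.one_apply]
  have hVH : ∀ {α : Type} (A : Matrix ι α ℂ), Vᴴ * A = A.submatrix m id := fun A => by
    ext a i
    simp [hV, Matrix.mul_apply, Matrix.one_apply]
  have hVn : ∀ {α : Type} (A : Matrix (Fin (Fintype.card S)) α ℂ) (b) (a : α),
      (V * A) (m b) a = A b a := fun A b a => by
    simp [hV, Matrix.mul_apply, Matrix.one_apply, hmi.eq_iff]
  have hVz : ∀ {α : Type} (A : Matrix (Fin (Fintype.card S)) α ℂ) (i : ι) (a : α), l i ^ 2 = 1 →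
      (V * A) i a = 0 := fun A i a hi => by
    rw [Matrix.mul_apply]
    refine Finset.sum_eq_zero fun b _ => ?_
    have : i ≠ m b := fun h0 => hml b (h0 ▸ hi)
    simp [hV, this]
  have hVV : Vᴴ * V = 1 := by
    rw [hVH]
    ext a b
    simp [hV, Matrix.one_apply, hmi.eq_iff]
  obtain ⟨h2, hr2⟩ := h1.compress (G' := G₁.submatrix m m) (T' := realDiag (l ∘ m)) hVV
    (by
      rw [hVm]
      ext i a
      by_cases hi : l i ^ 2 = 1
      · rw [hVz _ _ _ hi]
        exact (diag_annihilation h1 hi).1 _ (hml a)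
      · obtain ⟨b, rfl⟩ := hms i hi
        rw [hVn]; rfl)
    (by
      ext i a
      rw [diagonal_mul, mul_diagonal, hV, Matrix.submatrix_apply, Matrix.one_apply]
      by_cases hi : i = m a <;> simp [hi])
    (by
      rw [hVH]
      ext i a
      by_cases hi : l i ^ 2 = 1
      · rw [hVz _ _ _ hi]
        exact ((diag_annihilation h1 hi).2 a).symm
      · obtain ⟨b, rfl⟩ := hms i hi
        rw [hVn]; rfl)
  exact ⟨_, _, l ∘ m, _, h2, hml, fun x => by rw [hr2, hr1]⟩

/-- Every rational map into the Grassmannian has a diagonal realization. -/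
theorem exists_realization_of_mem_ratGr {k : ℕ} {U : ℝ → Mat d} (hU : U ∈ RatGr k d) :
    ∃ (N : ℕ) (W : Mat d) (G : Matrix (Fin N) (Fin N) ℂ) (v : Fin N → ℝ)
      (ρ : Matrix (Fin d) (Fin N) ℂ),
      IsRealization W G (realDiag v) ρ ∧ (∀ j, v j ^ 2 ≠ 1) ∧ W ∈ Gr k d ∧
      realized W G (realDiag v) ρ = U := by
  obtain ⟨ι, _, _, G, ρ, W, hW, hW2, hd, hr, hUU⟩ := exists_innerFun_of_isRationalMap hU.1
    (fun x => (hU.2 x).1) (fun x => (hU.2 x).2.1)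
  obtain ⟨T, hT⟩ := exists_isRealization hW hW2 hd hr
  obtain ⟨N, G', v, ρ', h', hv, hR⟩ := exists_diagonal_realization hT
  refine ⟨N, W, G', v, ρ', h', hv, ⟨hW, hW2, ?_⟩, funext fun x => ?_⟩
  · rw [← (hU.2 0).2.2, hUU 0, Matrix.trace_mul_cycle, innerFunH_mul_innerFun hd (hr 0),
      Matrix.one_mul]
  · rw [hR, realized_eq hT, hUU]

end Reduction

end HWM

end

noncomputable section

namespace HWM

open Matrix Complex
open scoped ComplexOrder Matrix.Norms.L2Operator

set_option linter.unusedSectionVars false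

/-! ### Functions with one-sided Fourier transform -/

section OneSided

variable {E : Type*} [NormedAddCommGroup E] [InnerProductSpace ℂ E] [CompleteSpace E]
  {ι : Type*} [Fintype ι] [DecidableEq ι]

/-- `f` is the inverse Fourier transform of an element of `L¹ ∩ L²` supported in `S`. -/
def HasFourierIn (S : Set ℝ) (f : ℝ → E) : Prop :=
  ∃ g : ℝ → E, Integrable g ∧ MemLp g 2 ∧ (∀ ξ, ξ ∉ S → g ξ = 0) ∧ f = 𝓕⁻ g

variable {S : Set ℝ} {f f' : ℝ → E}

theorem HasFourierIn.memLp (h : HasFourierIn S f) : MemLp f 2 := by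
  obtain ⟨g, h1, h2, -, rfl⟩ := h
  exact memLp_fourierInv h1 h2

theorem HasFourierIn.add (h : HasFourierIn S f) (h' : HasFourierIn S f') :
    HasFourierIn S fun x => f x + f' x := by
  obtain ⟨g, h1, h2, h3, rfl⟩ := h
  obtain ⟨g', h1', h2', h3', rfl⟩ := h'
  refine ⟨fun ξ => g ξ - -g' ξ, h1.sub h1'.neg, h2.sub h2'.neg, fun ξ hξ => ?_, funext fun x => ?_⟩
  · simp [h3 ξ hξ, h3' ξ hξ]
  · have e : 𝓕⁻ (fun ξ => -g' ξ) x = -𝓕⁻ g' x := by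
      simp_rw [fourierInv_eq_integral_chr, smul_neg, integral_neg]
    exact ((fourierInv_sub h1 h1'.neg x).trans ((congrArg _ e).trans (sub_neg_eq_add _ _))).symm

theorem HasFourierIn.fourier_ae (h : HasFourierIn S f) :
    ∀ᵐ ξ, ξ ∉ S → (𝓕 h.memLp.toLp : Lp E 2 (volume : Measure ℝ)) ξ = 0 := by
  obtain ⟨g, h1, h2, h3, hf⟩ := h
  have e : (HasFourierIn.memLp ⟨g, h1, h2, h3, hf⟩ : MemLp f 2).toLp =
      (memLp_fourierInv h1 h2).toLp := by subst hf; rfl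
  rw [e, fourier_toLp_fourierInv h1 h2]
  filter_upwards [h2.coeFn_toLp] with ξ hξ hS
  rw [hξ, h3 ξ hS]

theorem integrable_memLp_of_norm_le {g : ℝ → E} {K c : ℝ} (hc : 0 < c)
    (hm : AEStronglyMeasurable g) (hg : ∀ ξ, ‖g ξ‖ ≤ K * decayWeight c ξ) :
    Integrable g ∧ MemLp g 2 := by
  have h1 := integrable_japanese_mul_decayWeight 0 hc
  have h2 := memLp_japanese_mul_decayWeight 0 hc
  have e : ∀ ξ, japanese 0 ξ = 1 := fun ξ => by simp [japanese]
  simp only [e, one_mul] at h1 h2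
  refine ⟨(h1.const_mul K).mono' hm (Eventually.of_forall hg),
    h2.of_le_mul (c := K) hm (Eventually.of_forall fun ξ => ?_)⟩
  rw [Real.norm_of_nonneg (decayWeight_nonneg c ξ)]
  exact hg ξ

variable {M : Matrix ι ι ℂ} {C c : ℝ}

/-- The Fourier transform of `x ↦ Λ ((M - x)⁻¹)`. -/
def plusHat (Λ : Matrix ι ι ℂ →L[ℂ] E) (M : Matrix ι ι ℂ) : ℝ → E :=
  (Set.Ioi (0 : ℝ)).indicator fun ξ => (2 * Real.pi * I : ℂ) • Λ (NormedSpace.exp (ξ • gen M))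

/-- The Fourier transform of `x ↦ Λ (((M - x)⁻¹)^*)`. -/
def minusHat (Λ : Matrix ι ι ℂ →L[ℂ] E) (M : Matrix ι ι ℂ) : ℝ → E :=
  (Set.Iio (0 : ℝ)).indicator fun ξ =>
    (-(2 * Real.pi * I) : ℂ) • Λ (NormedSpace.exp ((-ξ) • gen M))ᴴ

theorem norm_two_pi_I : ‖(2 * Real.pi * I : ℂ)‖ = 2 * Real.pi := by
  simp [abs_of_pos Real.pi_pos]

theorem plusHat_props (hc : 0 < c) (hC : 0 ≤ C)
    (hdec : ∀ r : ℝ, 0 ≤ r → ‖NormedSpace.exp (r • gen M)‖ ≤ C * Real.exp (-c * r))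
    (Λ : Matrix ι ι ℂ →L[ℂ] E) : Integrable (plusHat Λ M) ∧ MemLp (plusHat Λ M) 2 := by
  refine integrable_memLp_of_norm_le (K := 2 * Real.pi * (‖Λ‖ * C)) hc ?_ fun ξ => ?_
  · exact (((Λ.continuous.comp (continuous_exp_gen M)).const_smul _).stronglyMeasurable.indicator
      measurableSet_Ioi).aestronglyMeasurable
  · rw [plusHat]
    by_cases hξ : ξ ∈ Set.Ioi (0 : ℝ)
    · have hξ' : 0 < ξ := hξ
      rw [Set.indicator_of_mem hξ, norm_smul, norm_two_pi_I, mul_assoc (2 * Real.pi)]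
      have h1 := (Λ.le_opNorm (NormedSpace.exp (ξ • gen M))).trans
        (mul_le_mul_of_nonneg_left (hdec ξ hξ'.le) (norm_nonneg Λ))
      rw [decayWeight, abs_of_pos hξ']
      have h2 : Real.exp (-c * ξ) ≤ (1 + ξ) * Real.exp (-c * ξ) :=
        le_mul_of_one_le_left (Real.exp_pos _).le (by linarith)
      have hp := Real.pi_pos
      refine mul_le_mul_of_nonneg_left (h1.trans ?_) (by positivity)
      rw [← mul_assoc]
      gcongr
    · rw [Set.indicator_of_notMem hξ, norm_zero]
      have := decayWeight_nonneg c ξ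
      have hp := Real.pi_pos
      positivity

theorem minusHat_props (hc : 0 < c) (hC : 0 ≤ C)
    (hdec : ∀ r : ℝ, 0 ≤ r → ‖NormedSpace.exp (r • gen M)‖ ≤ C * Real.exp (-c * r))
    (Λ : Matrix ι ι ℂ →L[ℂ] E) : Integrable (minusHat Λ M) ∧ MemLp (minusHat Λ M) 2 := by
  refine integrable_memLp_of_norm_le (K := 2 * Real.pi * (‖Λ‖ * C)) hc ?_ fun ξ => ?_
  · have h1 : Continuous fun ξ : ℝ => (NormedSpace.exp ((-ξ) • gen M))ᴴ :=
      ((continuous_exp_gen M).comp continuous_neg).matrix_conjTranspose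
    exact (((Λ.continuous.comp h1).const_smul _).stronglyMeasurable.indicator
      measurableSet_Iio).aestronglyMeasurable
  · rw [minusHat]
    by_cases hξ : ξ ∈ Set.Iio (0 : ℝ)
    · have hξ' : ξ < 0 := hξ
      rw [Set.indicator_of_mem hξ, norm_smul, norm_neg, norm_two_pi_I, mul_assoc (2 * Real.pi)]
      have h1 := (Λ.le_opNorm (NormedSpace.exp ((-ξ) • gen M))ᴴ).trans
        (mul_le_mul_of_nonneg_left ((Matrix.l2_opNorm_conjTranspose _).trans_le
          (hdec (-ξ) (by linarith))) (norm_nonneg Λ))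
      rw [decayWeight, abs_of_neg hξ']
      have h2 : Real.exp (-c * -ξ) ≤ (1 + -ξ) * Real.exp (-c * -ξ) :=
        le_mul_of_one_le_left (Real.exp_pos _).le (by linarith)
      have hp := Real.pi_pos
      refine mul_le_mul_of_nonneg_left (h1.trans ?_) (by positivity)
      rw [← mul_assoc]
      gcongr
    · rw [Set.indicator_of_notMem hξ, norm_zero]
      have := decayWeight_nonneg c ξ
      have hp := Real.pi_pos
      positivity

theorem fourierInv_plusHat (hc : 0 < c)
    (hdec : ∀ r : ℝ, 0 ≤ r → ‖NormedSpace.exp (r • gen M)‖ ≤ C * Real.exp (-c * r))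
    (Λ : Matrix ι ι ℂ →L[ℂ] E) {x : ℝ} (hM : IsUnit (M - (x : ℂ) • (1 : Matrix ι ι ℂ))) :
    𝓕⁻ (plusHat Λ M) x = Λ (resol M x) := by
  have hc0 : (2 * Real.pi * I : ℂ) ≠ 0 := by simp [Real.pi_ne_zero]
  rw [fourierInv_eq_integral_chr]
  have e : (fun ξ => chr x ξ • plusHat Λ M ξ) = (Set.Ioi (0 : ℝ)).indicator fun ξ =>
      (2 * Real.pi * I : ℂ) • Λ (chr x ξ • NormedSpace.exp (ξ • gen M)) := by
    ext ξ
    rw [plusHat]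
    by_cases hξ : ξ ∈ Set.Ioi (0 : ℝ)
    · rw [Set.indicator_of_mem hξ, Set.indicator_of_mem hξ, map_smul, smul_comm]
    · rw [Set.indicator_of_notMem hξ, Set.indicator_of_notMem hξ, smul_zero]
  rw [e, integral_indicator measurableSet_Ioi, integral_smul,
    Λ.integral_comp_comm (integrableOn_chr_smul_exp hc hdec x), integral_chr_smul_exp hc hdec hM,
    map_smul, smul_smul, mul_inv_cancel₀ hc0, one_smul]

theorem fourierInv_minusHat (hc : 0 < c)
    (hdec : ∀ r : ℝ, 0 ≤ r → ‖NormedSpace.exp (r • gen M)‖ ≤ C * Real.exp (-c * r))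
    (Λ : Matrix ι ι ℂ →L[ℂ] E) {x : ℝ} (hM : IsUnit (M - (x : ℂ) • (1 : Matrix ι ι ℂ))) :
    𝓕⁻ (minusHat Λ M) x = Λ (resol M x)ᴴ := by
  have hc0 : (2 * Real.pi * I : ℂ) ≠ 0 := by simp [Real.pi_ne_zero]
  let Λ' : Matrix ι ι ℂ →L[ℝ] E := LinearMap.toContinuousLinearMap
    { toFun := fun A => Λ Aᴴ
      map_add' := fun A B => by simp
      map_smul' := fun a A => by
        simp only [RingHom.id_apply, conjTranspose_smul, star_trivial]
        exact Λ.map_smul_of_tower a _ }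
  have hΛ' : ∀ A, Λ' A = Λ Aᴴ := fun _ => rfl
  rw [fourierInv_eq_integral_chr, ← integral_neg_eq_self]
  have e : (fun ξ => chr x (-ξ) • minusHat Λ M (-ξ)) = (Set.Ioi (0 : ℝ)).indicator fun ξ =>
      (-(2 * Real.pi * I) : ℂ) • Λ' (chr x ξ • NormedSpace.exp (ξ • gen M)) := by
    ext ξ
    rw [minusHat]
    by_cases hξ : ξ ∈ Set.Ioi (0 : ℝ)
    · have hξ' : -ξ ∈ Set.Iio (0 : ℝ) := by simpa using hξ
      rw [Set.indicator_of_mem hξ, Set.indicator_of_mem hξ', hΛ', conjTranspose_smul, map_smul,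
        smul_comm, neg_neg, chr_neg]
      rfl
    · have hξ' : -ξ ∉ Set.Iio (0 : ℝ) := by simpa using hξ
      rw [Set.indicator_of_notMem hξ, Set.indicator_of_notMem hξ', smul_zero]
  rw [e, integral_indicator measurableSet_Ioi, integral_smul,
    Λ'.integral_comp_comm (integrableOn_chr_smul_exp hc hdec x), integral_chr_smul_exp hc hdec hM,
    hΛ', conjTranspose_smul, map_smul, smul_smul]
  have : (-(2 * Real.pi * I) : ℂ) * star (2 * Real.pi * I : ℂ)⁻¹ = 1 := by
    rw [star_def, map_inv₀]
    simp only [map_mul, map_ofNat, conj_ofReal, conj_I, mul_neg]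
    rw [inv_neg, neg_mul_neg, mul_inv_cancel₀ hc0]
  rw [this, one_smul]

/-- A matrix all of whose resolvents at real points exist and whose semigroup decays. -/
def IsStable (M : Matrix ι ι ℂ) : Prop :=
  (∀ x : ℝ, IsUnit (M - (x : ℂ) • (1 : Matrix ι ι ℂ))) ∧ ∃ C c : ℝ, 0 ≤ C ∧ 0 < c ∧
    ∀ r : ℝ, 0 ≤ r → ‖NormedSpace.exp (r • gen M)‖ ≤ C * Real.exp (-c * r)

theorem IsStable.hasFourierIn_Ioi (h : IsStable M) (Λ : Matrix ι ι ℂ →L[ℂ] E) :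
    HasFourierIn (Set.Ioi 0) fun x => Λ (resol M x) := by
  obtain ⟨h1, C, c, hC, hc, hdec⟩ := h
  exact ⟨plusHat Λ M, (plusHat_props hc hC hdec Λ).1, (plusHat_props hc hC hdec Λ).2,
    fun ξ hξ => Set.indicator_of_notMem hξ _,
    funext fun x => (fourierInv_plusHat hc hdec Λ (h1 x)).symm⟩

theorem IsStable.hasFourierIn_Iio (h : IsStable M) (Λ : Matrix ι ι ℂ →L[ℂ] E) :
    HasFourierIn (Set.Iio 0) fun x => Λ (resol M x)ᴴ := by
  obtain ⟨h1, C, c, hC, hc, hdec⟩ := h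
  exact ⟨minusHat Λ M, (minusHat_props hc hC hdec Λ).1, (minusHat_props hc hC hdec Λ).2,
    fun ξ hξ => Set.indicator_of_notMem hξ _,
    funext fun x => (fourierInv_minusHat hc hdec Λ (h1 x)).symm⟩

theorem isStable_of_dissip {d : ℕ} {ρ : Matrix (Fin d) ι ℂ} (h : ρᴴ * ρ = I • (M - Mᴴ))
    (hreg : ∀ x : ℝ, IsUnit (M - (x : ℂ) • (1 : Matrix ι ι ℂ))) : IsStable M := by
  obtain ⟨C, c, hC, hc, hdec⟩ := exists_exp_gen_decay h hreg
  exact ⟨hreg, C, c, hC.le, hc, hdec⟩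

end OneSided

/-! ### Membership in the Hardy space and in its orthogonal complement -/

section Hardy

variable {d : ℕ} {f : ℝ → EuclideanSpace ℂ (Fin d)}

theorem HasFourierIn.mem_hardySpace (h : HasFourierIn (Set.Ioi 0) f) :
    h.memLp.toLp ∈ hardySpace d := by
  rw [mem_hardySpace_iff]
  filter_upwards [h.fourier_ae] with ξ hξ h0
  exact hξ (not_lt.2 h0.le)

theorem inner_fourier_L2V (f g : L2V d) : inner ℂ f g = inner ℂ (𝓕 f : L2V d) (𝓕 g : L2V d) :=
  ((Lp.fourierTransformₗᵢ ℝ (EuclideanSpace ℂ (Fin d))).inner_map_map f g).symm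

theorem HasFourierIn.mem_hardySpace_orthogonal (h : HasFourierIn (Set.Iio 0) f) :
    h.memLp.toLp ∈ (hardySpace d)ᗮ := by
  rw [Submodule.mem_orthogonal]
  intro u hu
  rw [inner_fourier_L2V, L2.inner_def]
  refine integral_eq_zero_of_ae ?_
  filter_upwards [h.fourier_ae, (mem_hardySpace_iff u).1 hu] with ξ h1 h2
  by_cases hξ : ξ < 0
  · rw [h2 hξ, inner_zero_left]; rfl
  · rw [h1 hξ, inner_zero_right]; rfl

end Hardy

end HWM

end

noncomputable section

namespace HWM

open Matrix Complex
open scoped ComplexOrder Matrix.Norms.L2Operator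

set_option linter.unusedSectionVars false

/-! ### Cauchy kernels and the multiplication operator -/

section Cauchy

variable {d : ℕ} {ι : Type*} [Fintype ι] [DecidableEq ι]

theorem resol_smul_one {r : ℕ} {z : ℂ} (hz : z.im ≠ 0) (x : ℝ) :
    resol (z • (1 : Matrix (Fin r) (Fin r) ℂ)) x = (z - x)⁻¹ • 1 := by
  have hne : z - x ≠ 0 := fun h0 => hz (by simpa using congrArg Complex.im h0)
  rw [resol, ← sub_smul]
  refine Matrix.inv_eq_left_inv ?_
  rw [Matrix.smul_mul, Matrix.one_mul, smul_smul, inv_mul_cancel₀ hne, one_smul]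

theorem isStable_smul_one {z : ℂ} (hz : z.im < 0) :
    IsStable (z • (1 : Matrix (Fin 1) (Fin 1) ℂ)) :=
  isStable_of_dissip (elementary_dissip (V := (1 : Matrix (Fin 1) (Fin 1) ℂ)) (by simp) hz)
    (elementary_regular hz)

/-- The map `A ↦ A₀₀ w`. -/
def scalarCLM (w : EuclideanSpace ℂ (Fin d)) :
    Matrix (Fin 1) (Fin 1) ℂ →L[ℂ] EuclideanSpace ℂ (Fin d) :=
  LinearMap.toContinuousLinearMap
    { toFun := fun A => A 0 0 • w
      map_add' := fun A B => by simp [add_smul]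
      map_smul' := fun a A => by simp [smul_smul] }

theorem scalarCLM_apply (w : EuclideanSpace ℂ (Fin d)) (A : Matrix (Fin 1) (Fin 1) ℂ) :
    scalarCLM w A = A 0 0 • w := rfl

/-- The map `A ↦ C A u`. -/
def sandwichCLM (C : Matrix (Fin d) ι ℂ) (u : ι → ℂ) :
    Matrix ι ι ℂ →L[ℂ] EuclideanSpace ℂ (Fin d) :=
  LinearMap.toContinuousLinearMap
    { toFun := fun A => WithLp.toLp 2 (C *ᵥ (A *ᵥ u))
      map_add' := fun A B => by simp [add_mulVec, mulVec_add]
      map_smul' := fun a A => by simp [smul_mulVec, mulVec_smul] }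

theorem sandwichCLM_apply (C : Matrix (Fin d) ι ℂ) (u : ι → ℂ) (A : Matrix ι ι ℂ) :
    sandwichCLM C u A = WithLp.toLp 2 (C *ᵥ (A *ᵥ u)) := rfl

theorem hasFourierIn_cauchy_Ioi {z : ℂ} (hz : z.im < 0) (w : EuclideanSpace ℂ (Fin d)) :
    HasFourierIn (Set.Ioi 0) fun x : ℝ => (z - x)⁻¹ • w := by
  have := (isStable_smul_one hz).hasFourierIn_Ioi (scalarCLM w)
  simpa [scalarCLM_apply, resol_smul_one hz.ne] using this

theorem hasFourierIn_cauchy_Iio {z : ℂ} (hz : 0 < z.im) (w : EuclideanSpace ℂ (Fin d)) :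
    HasFourierIn (Set.Iio 0) fun x : ℝ => (z - x)⁻¹ • w := by
  have hz' : (starRingEnd ℂ z).im < 0 := by simpa using hz
  have := (isStable_smul_one hz').hasFourierIn_Iio (scalarCLM w)
  simpa [scalarCLM_apply, resol_smul_one hz'.ne] using this

/-- Partial fractions by the resolvent identity. A product of a Cauchy kernel and the resolvent
becomes a difference of the two, each with a one-sided Fourier transform. -/
theorem cauchy_smul_resol {G : Matrix ι ι ℂ} {z : ℂ} (hz : z.im ≠ 0)
    (hG : IsUnit (G - z • (1 : Matrix ι ι ℂ))) {x : ℝ}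
    (hx : IsUnit (G - (x : ℂ) • (1 : Matrix ι ι ℂ))) :
    (z - x)⁻¹ • resol G x = ((z - x)⁻¹ • 1 - resol G x) * (G - z • (1 : Matrix ι ι ℂ))⁻¹ := by
  have hne : z - x ≠ 0 := fun h0 => hz (by simpa using congrArg Complex.im h0)
  have hdet := (Matrix.isUnit_iff_isUnit_det _).1 hG
  have h1 : ((z - x)⁻¹ • 1 - resol G x) = (z - x)⁻¹ • resol G x * (G - z • (1 : Matrix ι ι ℂ)) := by
    have e : G - z • (1 : Matrix ι ι ℂ) = (G - (x : ℂ) • 1) - (z - x) • 1 := by module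
    rw [e, Matrix.mul_sub, Matrix.smul_mul, resol_mul hx, Matrix.smul_mul, Matrix.mul_smul,
      smul_smul, inv_mul_cancel₀ hne, one_smul, Matrix.mul_one]
  rw [h1, Matrix.mul_assoc, Matrix.mul_nonsing_inv _ hdet, Matrix.mul_one]

theorem isUnit_sub_smul_of_norm_lt {G : Matrix ι ι ℂ} {z : ℂ}
    (h : ‖G‖ * ‖(1 : Matrix ι ι ℂ)‖ < |z.im|) : IsUnit (G - z • (1 : Matrix ι ι ℂ)) := by
  have h1 : z ∈ resolventSet ℂ G :=
    spectrum.mem_resolventSet_of_norm_lt_mul (h.trans_le (Complex.abs_im_le_norm z))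
  have h2 : IsUnit (algebraMap ℂ (Matrix ι ι ℂ) z - G) := h1
  rw [Algebra.algebraMap_eq_smul_one] at h2
  rw [← neg_sub]
  exact h2.neg

theorem exp_smul_gen_smul_one (z : ℂ) (t : ℝ) :
    NormedSpace.exp (t • gen (z • (1 : Matrix (Fin 1) (Fin 1) ℂ))) =
      Complex.exp (t * (-(2 * Real.pi * I) * z)) • 1 := by
  have e : t • gen (z • (1 : Matrix (Fin 1) (Fin 1) ℂ)) =
      algebraMap ℂ (Matrix (Fin 1) (Fin 1) ℂ) (t * (-(2 * Real.pi * I) * z)) := by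
    rw [Algebra.algebraMap_eq_smul_one, gen]
    ext i j
    simp [mul_assoc]
  rw [e, ← NormedSpace.algebraMap_exp_comm, Algebra.algebraMap_eq_smul_one, Complex.exp_eq_exp_ℂ]

/-- Functions orthogonal to all Cauchy kernels with poles on a horizontal line in the upper half
plane belong to the Hardy space. -/
theorem mem_hardySpace_of_inner_cauchy {s : ℝ} (hs : 0 < s) {f : L2V d}
    (h : ∀ (z : ℂ) (hz : z.im = s) (w : EuclideanSpace ℂ (Fin d)),
      inner ℂ ((hasFourierIn_cauchy_Iio (hz ▸ hs) w).memLp.toLp) f = 0) : f ∈ hardySpace d := by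
  rw [mem_hardySpace_iff]
  set F : L2V d := 𝓕 f with hF
  have key : ∀ w : EuclideanSpace ℂ (Fin d), ∀ᵐ ξ : ℝ, ξ < 0 → inner ℂ w (F ξ) = 0 := by
    intro w
    -- The Fourier transform of the Cauchy kernel at `z = r + i s` is, up to a factor and the phase
    -- in `r`, the function `e` times `w`. The hypothesis for all `r` says that the inverse Fourier
    -- transform of `e ⟨w, F⟩` vanishes identically, so `⟨w, F⟩ = 0` on the negative half line.
    set e : ℝ → ℂ := (Set.Iio (0 : ℝ)).indicator fun ξ => ((Real.exp (2 * Real.pi * s * ξ) : ℝ) : ℂ)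
      with he
    have hem : StronglyMeasurable e :=
      (by fun_prop : Continuous fun ξ : ℝ =>
        ((Real.exp (2 * Real.pi * s * ξ) : ℝ) : ℂ)).stronglyMeasurable.indicator measurableSet_Iio
    have hp := Real.pi_pos
    have heb : ∀ ξ, ‖e ξ‖ ≤ 1 := fun ξ => by
      rw [he]
      by_cases hξ : ξ ∈ Set.Iio (0 : ℝ)
      · rw [Set.indicator_of_mem hξ, Complex.norm_real, Real.norm_of_nonneg (Real.exp_pos _).le]
        exact Real.exp_le_one_iff.2 (mul_nonpos_of_nonneg_of_nonpos (by positivity) (le_of_lt hξ))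
      · rw [Set.indicator_of_notMem hξ, norm_zero]; exact zero_le_one
    have hed : ∀ ξ, ‖e ξ‖ ≤ 1 * decayWeight (2 * Real.pi * s) ξ := fun ξ => by
      rw [he]
      by_cases hξ : ξ ∈ Set.Iio (0 : ℝ)
      · rw [Set.indicator_of_mem hξ, Complex.norm_real, Real.norm_of_nonneg (Real.exp_pos _).le,
          decayWeight, abs_of_neg hξ, neg_mul_neg, one_mul]
        exact le_mul_of_one_le_left (Real.exp_pos _).le (by have : ξ < 0 := hξ; linarith)
      · rw [Set.indicator_of_notMem hξ, norm_zero, one_mul]; exact decayWeight_nonneg _ _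
    have he2 : MemLp e 2 := (integrable_memLp_of_norm_le (by positivity)
      hem.aestronglyMeasurable hed).2
    have hw : MemLp (fun ξ => inner ℂ w (F ξ)) 2 := (Lp.memLp F).const_inner w
    have hi : Integrable (fun ξ => e ξ * inner ℂ w (F ξ)) := he2.integrable_mul hw
    have hi2 : MemLp (fun ξ => e ξ * inner ℂ w (F ξ)) 2 :=
      hw.of_le_mul (c := 1) (hem.aestronglyMeasurable.mul hw.1) (Eventually.of_forall fun ξ => by
        rw [norm_mul]; gcongr; exact heb ξ)
    have hzero : 𝓕⁻ (fun ξ => e ξ * inner ℂ w (F ξ)) = 0 := by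
      ext r
      set z : ℂ := r + s * I with hz
      have hzs : z.im = s := by simp [hz]
      have h1 := h z hzs w
      have hz' : (starRingEnd ℂ z).im < 0 := by simpa [hzs] using hs
      obtain ⟨hreg, C, c, hC, hc, hdec⟩ := isStable_smul_one hz'
      have hm := minusHat_props hc hC hdec (scalarCLM w)
      have hfun : (fun x : ℝ => (z - x)⁻¹ • w) =
          𝓕⁻ (minusHat (scalarCLM w) (starRingEnd ℂ z • (1 : Matrix (Fin 1) (Fin 1) ℂ))) := by
        ext1 x
        rw [fourierInv_minusHat hc hdec (scalarCLM w) (hreg x), resol_smul_one hz'.ne,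
          scalarCLM_apply]
        simp
      have hLp : (hasFourierIn_cauchy_Iio (hzs ▸ hs) w).memLp.toLp =
          (memLp_fourierInv hm.1 hm.2).toLp :=
        MemLp.toLp_congr _ _ (Eventually.of_forall fun x => congrFun hfun x)
      rw [hLp, inner_fourier_L2V, fourier_toLp_fourierInv hm.1 hm.2, L2.inner_def] at h1
      have h2 : ∫ ξ, (2 * Real.pi * I : ℂ) * (chr r ξ • (e ξ * inner ℂ w (F ξ))) = 0 := by
        rw [← h1]
        refine integral_congr_ae ?_
        filter_upwards [hm.2.coeFn_toLp] with ξ hξ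
        rw [hξ, minusHat, he]
        by_cases hξ0 : ξ ∈ Set.Iio (0 : ℝ)
        · rw [Set.indicator_of_mem hξ0, Set.indicator_of_mem hξ0, exp_smul_gen_smul_one,
            scalarCLM_apply, inner_smul_left, conjTranspose_smul, conjTranspose_one,
            Matrix.smul_apply, Matrix.one_apply_eq, smul_eq_mul, smul_eq_mul, mul_one, inner_smul_left,
            star_def, conj_conj, chr, Complex.ofReal_exp]
          have e1 : Complex.exp (((-ξ : ℝ) : ℂ) * (-(2 * Real.pi * I) * starRingEnd ℂ z)) =
              Complex.exp (((2 * Real.pi * (r * ξ) : ℝ) : ℂ) * I) *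
                Complex.exp ((2 * Real.pi * s * ξ : ℝ) : ℂ) := by
            rw [← Complex.exp_add]
            congr 1
            simp only [hz, map_add, map_mul, conj_ofReal, conj_I]
            push_cast
            linear_combination (-2 * Real.pi * s * ξ) * I_mul_I
          rw [e1]
          simp only [map_neg, map_mul, map_ofNat, conj_ofReal, conj_I]
          ring
        · rw [Set.indicator_of_notMem hξ0, Set.indicator_of_notMem hξ0, inner_zero_left, zero_mul,
            smul_zero, mul_zero]
      rw [integral_const_mul] at h2
      rw [fourierInv_eq_integral_chr]
      exact (mul_eq_zero.1 h2).resolve_left (by simp [Real.pi_ne_zero])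
    have h3 := fourier_toLp_fourierInv hi hi2
    have h4 : (memLp_fourierInv hi hi2).toLp = 0 := by
      rw [Lp.eq_zero_iff_ae_eq_zero]
      filter_upwards [(memLp_fourierInv hi hi2).coeFn_toLp] with x hx
      rw [hx, hzero]
    rw [h4, FourierTransform.fourier_zero] at h3
    have h5 := hi2.coeFn_toLp
    rw [← h3] at h5
    filter_upwards [h5, Lp.coeFn_zero ℂ 2 (volume : Measure ℝ)] with ξ a b hξ
    rw [b] at a
    have hne : e ξ ≠ 0 := by
      rw [he, Set.indicator_of_mem (show ξ ∈ Set.Iio (0 : ℝ) from hξ)]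
      exact_mod_cast (Real.exp_pos _).ne'
    exact (mul_eq_zero.1 a.symm).resolve_left hne
  have hall : ∀ᵐ ξ : ℝ, ∀ i : Fin d, ξ < 0 → inner ℂ (EuclideanSpace.single i (1 : ℂ)) (F ξ) = 0 :=
    ae_all_iff.2 fun i => key _
  filter_upwards [hall] with ξ h1 h2
  ext i
  have h3 := h1 i h2
  rw [EuclideanSpace.inner_single_left] at h3
  simpa using h3

end Cauchy

/-! ### Multiplication by a matrix-valued symbol -/

section MulOp

variable {d : ℕ} {U : ℝ → Mat d}

/-- By the `C^*` identity `‖U‖² = ‖U^* U‖ = ‖1‖`. The bound is stated with `‖1‖`, which also covers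
`d = 0`. -/
theorem memLp_symbol (hc : Continuous U) (hU : ∀ x, (U x)ᴴ = U x) (hU2 : ∀ x, U x * U x = 1) :
    MemLp (symbol U) ⊤ (volume : Measure ℝ) := by
  have hcont : Continuous (symbol U) :=
    ((Matrix.toEuclideanCLM (𝕜 := ℂ) (n := Fin d)).toAlgEquiv.toLinearEquiv.toLinearMap
      |>.continuous_of_finiteDimensional).comp hc
  refine memLp_top_of_bound hcont.aestronglyMeasurable ‖(1 : Mat d)‖ (Eventually.of_forall fun x => ?_)
  have h1 : ‖symbol U x‖ = ‖U x‖ := rfl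
  have h2 : ‖U x‖ * ‖U x‖ = ‖(1 : Mat d)‖ := by
    rw [← hU2 x, ← Matrix.l2_opNorm_conjTranspose_mul_self, hU]
  have h3 : ‖(1 : Mat d)‖ * ‖(1 : Mat d)‖ = ‖(1 : Mat d)‖ := by
    rw [← Matrix.l2_opNorm_conjTranspose_mul_self, conjTranspose_one, Matrix.one_mul]
  rw [h1]
  nlinarith [norm_nonneg (U x), norm_nonneg (1 : Mat d)]

theorem mulOp_coeFn (hU : MemLp (symbol U) ⊤ (volume : Measure ℝ)) (f : L2V d) :
    mulOp U f =ᵐ[volume] fun x => symbol U x (f x) := by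
  rw [mulOp, dif_pos hU, ContinuousLinearMap.holderL_apply_apply]
  filter_upwards [ContinuousLinearMap.coeFn_holder (r := 2) (ContinuousLinearMap.id ℂ
    (EuclideanSpace ℂ (Fin d) →L[ℂ] EuclideanSpace ℂ (Fin d))) hU.toLp f, hU.coeFn_toLp] with x h1 h2
  rw [h1, h2]; rfl

theorem mulOp_toLp (hU : MemLp (symbol U) ⊤ (volume : Measure ℝ))
    {f g : ℝ → EuclideanSpace ℂ (Fin d)} (hf : MemLp f 2) (hg : MemLp g 2)
    (h : ∀ x, symbol U x (f x) = g x) : mulOp U hf.toLp = hg.toLp := by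
  refine Lp.ext ?_
  filter_upwards [mulOp_coeFn hU hf.toLp, hf.coeFn_toLp, hg.coeFn_toLp] with x h1 h2 h3
  rw [h1, h2, h3, h]

theorem mulOp_mulOp (hU : MemLp (symbol U) ⊤ (volume : Measure ℝ)) (hU2 : ∀ x, U x * U x = 1)
    (f : L2V d) : mulOp U (mulOp U f) = f := by
  refine Lp.ext ?_
  filter_upwards [mulOp_coeFn hU (mulOp U f), mulOp_coeFn hU f] with x h1 h2
  rw [h1, h2, ← mul_apply_eq_comp]
  have : symbol U x * symbol U x = 1 := by
    rw [symbol, ← map_mul, hU2, map_one]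
  rw [this]; rfl

theorem symbol_toLp (x : ℝ) (w : Fin d → ℂ) :
    symbol U x (WithLp.toLp 2 w) = WithLp.toLp 2 (U x *ᵥ w) := rfl

theorem toeplitz_apply (f : hardySpace d) :
    toeplitz U f = (hardySpace d).orthogonalProjectionOnto (mulOp U f) := rfl

theorem orthogonalProjectionOnto_hardy_add {a b : L2V d} (ha : a ∈ hardySpace d)
    (hb : b ∈ (hardySpace d)ᗮ) : (hardySpace d).orthogonalProjectionOnto (a + b) = ⟨a, ha⟩ := by
  rw [map_add, (hardySpace d).orthogonalProjectionOnto_eq_zero_iff.2 hb, add_zero]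
  exact (hardySpace d).orthogonalProjectionOnto_mem_subspace_eq_self ⟨a, ha⟩

end MulOp

end HWM

end

noncomputable section

namespace HWM

open Matrix Complex
open scoped ComplexOrder Matrix.Norms.L2Operator

set_option linter.unusedSectionVars false

/-! ### The discrete spectrum of the Toeplitz operator -/

section Abstract

variable {H : Type*} [NormedAddCommGroup H] [NormedSpace ℂ H] [CompleteSpace H] {N : ℕ}
  {A : H →L[ℂ] H} {J : (Fin N → ℂ) →ₗ[ℂ] H} {v : Fin N → ℝ}

/-- Modulo the range of `J` the operator satisfies `A² = 1`, so `(μ + A) / (μ² - 1)` inverts `μ - A`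
up to a correction in that range. There `A` is diagonal and `μ` avoids its entries. -/
theorem bijective_sub_of_model (hJ : Function.Injective J)
    (hAJ : ∀ u, A (J u) = J (realDiag v *ᵥ u)) (hsq : ∀ h, ∃ u, A (A h) - h = J u) {μ : ℂ}
    (hμ1 : μ ^ 2 ≠ 1) (hμ : ∀ j, μ ≠ v j) :
    Function.Bijective (algebraMap ℂ (H →L[ℂ] H) μ - A) := by
  have happ : ∀ h, (algebraMap ℂ (H →L[ℂ] H) μ - A) h = μ • h - A h := fun h => by
    rw [_root_.sub_apply, Algebra.algebraMap_eq_smul_one]; rfl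
  have h1 : μ ^ 2 - 1 ≠ 0 := sub_ne_zero.2 hμ1
  constructor
  · rw [injective_iff_map_eq_zero]
    intro h hh
    rw [happ, sub_eq_zero] at hh
    obtain ⟨u, hu⟩ := hsq h
    rw [← hh, map_smul, ← hh, smul_smul, ← pow_two] at hu
    have e1 : h = J ((μ ^ 2 - 1)⁻¹ • u) := by
      rw [map_smul, ← hu, ← one_smul ℂ h, smul_smul, mul_one, ← sub_smul, smul_smul,
        inv_mul_cancel₀ h1]
    set u' := (μ ^ 2 - 1)⁻¹ • u
    rw [e1, hAJ, ← map_smul] at hh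
    have e2 := hJ hh
    have e3 : u' = 0 := by
      ext j
      have := congrFun e2 j
      rw [Pi.smul_apply, smul_eq_mul, mulVec_diagonal] at this
      exact (mul_eq_zero.1 (show (μ - v j) * u' j = 0 by rw [sub_mul, this, sub_self])).resolve_left
        (sub_ne_zero.2 (hμ j))
    rw [e1, e3, map_zero]
  · intro h
    obtain ⟨u, hu⟩ := hsq h
    set u' : Fin N → ℂ := fun j => (μ - v j)⁻¹ * u j with hu'
    have e1 : μ • u' - realDiag v *ᵥ u' = u := by
      ext j
      rw [Pi.sub_apply, Pi.smul_apply, smul_eq_mul, mulVec_diagonal, ← sub_mul, hu', ← mul_assoc,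
        mul_inv_cancel₀ (sub_ne_zero.2 (hμ j)), one_mul]
    -- Applying `μ - A` to the bracket gives `(μ² - 1) h - J u + J u`, because `u'` solves `(μ - T)
    -- u' = u`.
    refine ⟨(μ ^ 2 - 1)⁻¹ • (μ • h + A h + J u'), ?_⟩
    have e2 : A (A h) = h + J u := by rw [← hu]; abel
    rw [happ, map_smul, smul_comm μ, ← smul_sub, map_add, map_add, map_smul, hAJ, e2,
      ← congrArg J e1, map_sub, map_smul]
    rw [inv_smul_eq_iff₀ h1]
    module

theorem eigenspace_le_of_model
    (hsq : ∀ h, ∃ u, A (A h) - h = J u) {μ : ℂ} (hμ1 : μ ^ 2 ≠ 1) :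
    Module.End.eigenspace (A : H →ₗ[ℂ] H) μ ≤ LinearMap.range J := by
  intro h hh
  have hh : A h = μ • h := Module.End.mem_eigenspace_iff.1 hh
  obtain ⟨u, hu⟩ := hsq h
  rw [hh, map_smul, hh, smul_smul, ← pow_two] at hu
  refine ⟨(μ ^ 2 - 1)⁻¹ • u, ?_⟩
  rw [map_smul, ← hu, ← one_smul ℂ h, smul_smul, mul_one, ← sub_smul, smul_smul,
    inv_mul_cancel₀ (sub_ne_zero.2 hμ1)]

theorem model_single_mem_eigenspace (hAJ : ∀ u, A (J u) = J (realDiag v *ᵥ u)) (j : Fin N) :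
    J (Pi.single j 1) ∈ Module.End.eigenspace (A : H →ₗ[ℂ] H) (v j : ℂ) := by
  rw [Module.End.mem_eigenspace_iff]
  refine (hAJ _).trans ?_
  rw [← map_smul]
  congr 1
  ext i
  rw [mulVec_diagonal]
  by_cases hi : i = j
  · subst hi; simp
  · simp [hi]

/-- The spectrum lies in the finite set of all `v_j` and `±1`, so every point of it is isolated and
only multiplicities decide. Eigenspaces away from `±1` lie in the finite-dimensional range of `J`.
-/
theorem discreteSpectrum_of_model (hJ : Function.Injective J) (hv1 : ∀ j, v j ^ 2 ≠ 1)
    (hAJ : ∀ u, A (J u) = J (realDiag v *ᵥ u)) (hsq : ∀ h, ∃ u, A (A h) - h = J u)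
    (hpm : ∀ ε : ℂ, ε ^ 2 = 1 → ε ∈ spectrum ℂ A →
      ¬ FiniteDimensional ℂ (Module.End.eigenspace (A : H →ₗ[ℂ] H) ε)) :
    discreteSpectrum A = Set.range fun j => (v j : ℂ) := by
  have hspec : ∀ μ ∈ spectrum ℂ A, μ ^ 2 = 1 ∨ ∃ j, μ = v j := by
    intro μ hμ
    by_contra hne
    push Not at hne
    exact hμ (ContinuousLinearMap.isUnit_iff_bijective.2
      (bijective_sub_of_model hJ hAJ hsq hne.1 hne.2))
  have hfin : (spectrum ℂ A).Finite := by
    refine Set.Finite.subset ((Set.finite_range fun j => (v j : ℂ)).union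
      (Set.toFinite {1, -1})) fun μ hμ => ?_
    rcases hspec μ hμ with h | ⟨j, hj⟩
    · right
      rcases mul_eq_zero.1 (show (μ - 1) * (μ + 1) = 0 by linear_combination h) with h | h
      · left; exact sub_eq_zero.1 h
      · right; exact eq_neg_of_add_eq_zero_left h
    · left; exact ⟨j, hj.symm⟩
  ext μ
  constructor
  · rintro ⟨h1, -, h3⟩
    rcases hspec μ h1 with h | ⟨j, hj⟩
    · exact absurd h3 (hpm μ h h1)
    · exact ⟨j, hj.symm⟩
  · rintro ⟨j, rfl⟩
    have hv1' : (v j : ℂ) ^ 2 ≠ 1 := by exact_mod_cast hv1 j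
    have hne : J (Pi.single j 1) ≠ 0 := fun h0 => by
      have := hJ (h0.trans (map_zero J).symm)
      simpa using congrFun this j
    have hmem := model_single_mem_eigenspace hAJ j
    refine ⟨fun hu => ?_, ?_, ?_⟩
    · have hb := (ContinuousLinearMap.isUnit_iff_bijective.1 hu).1
      refine hne (hb ?_)
      rw [map_zero, _root_.sub_apply, Algebra.algebraMap_eq_smul_one]
      exact sub_eq_zero.2 (Module.End.mem_eigenspace_iff.1 hmem).symm
    · have hf : (spectrum ℂ A \ {(v j : ℂ)}).Finite := hfin.subset Set.sdiff_subset
      obtain ⟨ε, hε, hball⟩ := Metric.isOpen_iff.1 hf.isClosed.isOpen_compl (v j : ℂ) (by simp)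
      refine ⟨ε, hε, fun z hz hzne => ?_⟩
      by_contra hlt
      exact hball (Metric.mem_ball.2 (not_le.1 hlt)) ⟨hz, hzne⟩
    · exact Submodule.finiteDimensional_of_le (eigenspace_le_of_model hsq hv1')

/-- Equal entries `v_i = v_j` would give two independent eigenvectors `J e_i`, `J e_j` for one
discrete eigenvalue. -/
theorem injective_of_model (hJ : Function.Injective J)
    (hAJ : ∀ u, A (J u) = J (realDiag v *ᵥ u)) (hds : discreteSpectrum A = Set.range fun j => (v j : ℂ))
    (hs : HasSimpleDiscreteSpectrum A) : Function.Injective v := by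
  intro i j hij
  by_contra hne
  have h1 := hs (v j) (by rw [hds]; exact ⟨j, rfl⟩)
  have hi : J (Pi.single i 1) ∈ Module.End.eigenspace (A : H →ₗ[ℂ] H) (v j : ℂ) :=
    hij ▸ model_single_mem_eigenspace hAJ i
  have hj := model_single_mem_eigenspace (J := J) (A := A) (v := v) hAJ j
  have hj0 : (⟨_, hj⟩ : Module.End.eigenspace (A : H →ₗ[ℂ] H) (v j : ℂ)) ≠ 0 := fun h0 => by
    have := hJ ((congrArg Subtype.val h0).trans (map_zero J).symm)
    simpa using congrFun this j
  obtain ⟨c, hc⟩ := (finrank_eq_one_iff_of_nonzero' _ hj0).1 h1 ⟨_, hi⟩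
  have h2 : J (c • Pi.single j 1) = J (Pi.single i 1) := by
    rw [map_smul]; exact congrArg Subtype.val hc
  have := congrFun (hJ h2) i
  simp [hne] at this

end Abstract

end HWM

end

noncomputable section

namespace HWM

open Matrix Complex
open scoped ComplexOrder Matrix.Norms.L2Operator

set_option linter.unusedSectionVars false

/-! ### The Toeplitz operator and the model space -/

section Toeplitz

variable {d : ℕ} {ι : Type*} [Fintype ι] [DecidableEq ι]
  {W : Mat d} {G T : Matrix ι ι ℂ} {ρ : Matrix (Fin d) ι ℂ}

theorem continuous_resol (h : ∀ x : ℝ, IsUnit (G - (x : ℂ) • (1 : Matrix ι ι ℂ))) :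
    Continuous (resol G) := by
  rw [continuous_iff_continuousAt]
  intro x
  have h1 : ContinuousAt (fun y : ℝ => G - (y : ℂ) • (1 : Matrix ι ι ℂ)) x := by fun_prop
  have h2 := NormedRing.inverse_continuousAt (h x).unit
  have h3 : resol G = fun y : ℝ => Ring.inverse (G - (y : ℂ) • (1 : Matrix ι ι ℂ)) :=
    funext fun y => Matrix.nonsing_inv_eq_ringInverse _
  rw [h3]
  exact ContinuousAt.comp (f := fun y : ℝ => G - (y : ℂ) • (1 : Matrix ι ι ℂ)) h2 h1

theorem continuous_realized (h : ∀ x : ℝ, IsUnit (G - (x : ℂ) • (1 : Matrix ι ι ℂ))) :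
    Continuous (realized W G T ρ) := by
  have h1 := continuous_resol h
  have h2 : Continuous (hardyPart W G T ρ) := by
    have : Continuous fun x => ρ * resol G x * inputMat W T ρ :=
      (continuous_const.matrix_mul h1).matrix_mul continuous_const
    exact (this.const_smul I).neg
  exact (continuous_const.add h2).add h2.matrix_conjTranspose

theorem IsRealization.isStable (h : IsRealization W G T ρ) : IsStable G :=
  isStable_of_dissip h.dissip h.regular

theorem IsRealization.realized_conjTranspose (h : IsRealization W G T ρ) (x : ℝ) :
    (realized W G T ρ x)ᴴ = realized W G T ρ x := by
  rw [realized_eq h]; simp [h.herm, Matrix.mul_assoc]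

theorem IsRealization.realized_mul_self (h : IsRealization W G T ρ) (x : ℝ) :
    realized W G T ρ x * realized W G T ρ x = 1 := by
  have a := innerFunH_mul_innerFun h.dissip (h.regular x)
  have b := innerFun_mul_innerFunH h.dissip (h.regular x)
  rw [realized_eq h, show innerFun G ρ x * W * (innerFun G ρ x)ᴴ *
    (innerFun G ρ x * W * (innerFun G ρ x)ᴴ) = innerFun G ρ x * (W * ((innerFun G ρ x)ᴴ *
      innerFun G ρ x) * W) * (innerFun G ρ x)ᴴ by simp only [Matrix.mul_assoc], a, Matrix.mul_one,
    h.sq, Matrix.mul_one, b]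

theorem IsRealization.memLp_symbol (h : IsRealization W G T ρ) :
    MemLp (symbol (realized W G T ρ)) ⊤ (volume : Measure ℝ) :=
  HWM.memLp_symbol (continuous_realized h.regular) h.realized_conjTranspose h.realized_mul_self

/-- The embedding of the model space into the Hardy space. -/
def modelMap (h : IsStable G) (ρ : Matrix (Fin d) ι ℂ) : (ι → ℂ) →ₗ[ℂ] hardySpace d where
  toFun u := ⟨(h.hasFourierIn_Ioi (sandwichCLM ρ u)).memLp.toLp,
    (h.hasFourierIn_Ioi (sandwichCLM ρ u)).mem_hardySpace⟩
  map_add' u u' := by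
    refine Subtype.ext (Eq.trans ?_ (MemLp.toLp_add (h.hasFourierIn_Ioi (sandwichCLM ρ u)).memLp
      (h.hasFourierIn_Ioi (sandwichCLM ρ u')).memLp))
    refine MemLp.toLp_congr (h.hasFourierIn_Ioi (sandwichCLM ρ (u + u'))).memLp _
      (Eventually.of_forall fun x => ?_)
    simp [sandwichCLM_apply, mulVec_add]
  map_smul' a u := by
    refine Subtype.ext (Eq.trans ?_ (MemLp.toLp_const_smul a
      (h.hasFourierIn_Ioi (sandwichCLM ρ u)).memLp))
    refine MemLp.toLp_congr (h.hasFourierIn_Ioi (sandwichCLM ρ (a • u))).memLp _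
      (Eventually.of_forall fun x => ?_)
    simp [sandwichCLM_apply, mulVec_smul]

theorem modelMap_coe (h : IsStable G) (u : ι → ℂ) :
    (modelMap h ρ u : L2V d) = (h.hasFourierIn_Ioi (sandwichCLM ρ u)).memLp.toLp := rfl

/-- The identity `U ρ R = ρ R T + (W ρ - ρ T) R^*` splits the product into a Hardy part and a part
with negative frequencies, which the projection removes. -/
theorem toeplitz_modelMap (h : IsRealization W G T ρ) (u : ι → ℂ) :
    toeplitz (realized W G T ρ) (modelMap h.isStable ρ u) = modelMap h.isStable ρ (T *ᵥ u) := by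
  have hm := h.isStable.hasFourierIn_Iio (sandwichCLM (W * ρ - ρ * T) u)
  have hp := h.isStable.hasFourierIn_Ioi (sandwichCLM ρ (T *ᵥ u))
  have e : mulOp (realized W G T ρ) (modelMap h.isStable ρ u : L2V d) =
      hp.memLp.toLp + hm.memLp.toLp := by
    rw [modelMap_coe, ← MemLp.toLp_add]
    refine mulOp_toLp h.memLp_symbol _ _ fun x => ?_
    have key : realized W G T ρ x * (ρ * resol G x) =
        ρ * (resol G x * T) + (W * ρ - ρ * T) * (resol G x)ᴴ := by
      have h3 := resol_sylvester_resolH h.sylvester (h.regular x)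
      rw [realized_eq h, Matrix.mul_assoc, innerFunH_mul_ρ_resol h.dissip (h.regular x), innerFun]
      have : ρ * resol G x * ρᴴ * (W * (ρ * (resol G x)ᴴ)) =
          ρ * (I • (T * (resol G x)ᴴ - resol G x * T)) := by
        rw [← h3]; simp only [Matrix.mul_assoc]
      rw [Matrix.mul_assoc, Matrix.add_mul, Matrix.one_mul, Matrix.smul_mul, this, Matrix.mul_smul,
        smul_smul, I_mul_I, Matrix.mul_sub, Matrix.sub_mul]
      simp only [Matrix.mul_assoc]
      module
    rw [sandwichCLM_apply, symbol_toLp, Pi.add_apply, sandwichCLM_apply, sandwichCLM_apply,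
      ← WithLp.toLp_add]
    congr 1
    have := congrArg (fun M => M *ᵥ u) key
    simpa [← mulVec_mulVec, add_mulVec] using this
  rw [toeplitz_apply, e, orthogonalProjectionOnto_hardy_add hp.mem_hardySpace
    hm.mem_hardySpace_orthogonal]
  rfl

/-- A Hankel operator with rational symbol has finite rank. On a Cauchy kernel with pole `z` in the
upper half plane, partial fractions exhibit the Hardy part of `U w / (z - x)` as an element of the
model space. Such kernels span a dense subspace of the orthogonal complement, and the preimage of a
finite-dimensional space is closed. -/
theorem projection_mulOp_mem_range (h : IsRealization W G T ρ) {m : L2V d}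
    (hm : m ∈ (hardySpace d)ᗮ) :
    (hardySpace d).orthogonalProjectionOnto (mulOp (realized W G T ρ) m) ∈
      LinearMap.range (modelMap h.isStable ρ) := by
  set U := realized W G T ρ with hU
  set J := modelMap h.isStable ρ with hJ
  -- Points at this height avoid the spectra of `G` and `G^*`, as the partial fractions require.
  set s : ℝ := ‖G‖ * ‖(1 : Matrix ι ι ℂ)‖ + 1 with hs
  have hs0 : 0 < s := by positivity
  set Θ : L2V d →L[ℂ] hardySpace d := (hardySpace d).orthogonalProjectionOnto.comp (mulOp U) with hΘ
  set D : Submodule ℂ (L2V d) := (LinearMap.range J).comap (Θ : L2V d →ₗ[ℂ] hardySpace d) with hD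
  have hclosed : IsClosed (D : Set (L2V d)) :=
    (Submodule.closed_of_finiteDimensional (LinearMap.range J)).preimage Θ.continuous
  set S : Set (L2V d) := {f | ∃ (z : ℂ) (hz : z.im = s) (w : EuclideanSpace ℂ (Fin d)),
    f = (hasFourierIn_cauchy_Iio (hz ▸ hs0) w).memLp.toLp} with hS
  have hSD : S ⊆ D := by
    rintro _ ⟨z, hz, w, rfl⟩
    have hz0 : z.im ≠ 0 := by rw [hz]; exact hs0.ne'
    have hGz : IsUnit (G - z • (1 : Matrix ι ι ℂ)) := isUnit_sub_smul_of_norm_lt (by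
      rw [hz, abs_of_pos hs0]; linarith)
    have hGHz : IsUnit (Gᴴ - z • (1 : Matrix ι ι ℂ)) := isUnit_sub_smul_of_norm_lt (by
      rw [hz, abs_of_pos hs0, Matrix.l2_opNorm_conjTranspose]; linarith)
    set N := (G - z • (1 : Matrix ι ι ℂ))⁻¹
    set N' := (Gᴴ - z • (1 : Matrix ι ι ℂ))⁻¹
    set B := inputMat W T ρ
    set w' : EuclideanSpace ℂ (Fin d) :=
      WithLp.toLp 2 ((W - I • (ρ * N * B) + I • (Bᴴ * N' * ρᴴ)) *ᵥ w.ofLp)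
    have hk := hasFourierIn_cauchy_Iio (d := d) (z := z) (hz ▸ hs0) w'
    have hm := hk.add (h.isStable.hasFourierIn_Iio (sandwichCLM Bᴴ (-(I • ((N' * ρᴴ) *ᵥ w.ofLp)))))
    have hp := h.isStable.hasFourierIn_Ioi (sandwichCLM ρ (I • ((N * B) *ᵥ w.ofLp)))
    have e : mulOp U (hasFourierIn_cauchy_Iio (hz ▸ hs0) w).memLp.toLp =
        hp.memLp.toLp + hm.memLp.toLp := by
      rw [← MemLp.toLp_add]
      refine mulOp_toLp h.memLp_symbol _ _ fun x => ?_
      have hresH : (resol G x)ᴴ = resol Gᴴ x := by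
        rw [resol, Matrix.conjTranspose_nonsing_inv, conjTranspose_sub_real, resol]
      have hxH : IsUnit (Gᴴ - (x : ℂ) • (1 : Matrix ι ι ℂ)) := by
        rw [← conjTranspose_sub_real]; exact (h.regular x).star
      have c1 := cauchy_smul_resol hz0 hGz (h.regular x)
      have c2 := cauchy_smul_resol hz0 hGHz hxH
      rw [← hresH] at c2
      have key : (z - x)⁻¹ • U x = ρ * resol G x * (I • (N * B)) +
          ((z - x)⁻¹ • (W - I • (ρ * N * B) + I • (Bᴴ * N' * ρᴴ)) +
            Bᴴ * (resol G x)ᴴ * (-(I • (N' * ρᴴ)))) := by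
        have e1 : (z - x)⁻¹ • hardyPart W G T ρ x = -(I • (ρ * ((z - x)⁻¹ • resol G x) * B)) := by
          rw [hardyPart, Matrix.mul_smul, Matrix.smul_mul, smul_neg, smul_comm]
        have e2 : (z - x)⁻¹ • (hardyPart W G T ρ x)ᴴ =
            I • (Bᴴ * ((z - x)⁻¹ • (resol G x)ᴴ) * ρᴴ) := by
          rw [hardyPart, Matrix.mul_smul, Matrix.smul_mul, conjTranspose_neg, conjTranspose_smul,
            conjTranspose_mul, conjTranspose_mul, star_def, conj_I, neg_smul, neg_neg, smul_comm,
            Matrix.mul_assoc]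
        rw [hU, realized, smul_add, smul_add, e1, e2, c1, c2]
        simp only [Matrix.mul_sub, Matrix.sub_mul, Matrix.mul_smul, Matrix.smul_mul,
          Matrix.one_mul, Matrix.mul_neg, ← Matrix.mul_assoc]
        module
      have := congrArg (fun M => M *ᵥ w.ofLp) key
      have h1 : symbol U x ((z - x)⁻¹ • w) = WithLp.toLp 2 (((z - x)⁻¹ • U x) *ᵥ w.ofLp) := by
        rw [map_smul, smul_mulVec]; rfl
      rw [h1, key, Pi.add_apply, sandwichCLM_apply, sandwichCLM_apply, ← WithLp.toLp_smul,
        ← WithLp.toLp_add, ← WithLp.toLp_add]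
      congr 1
      simp only [add_mulVec, ← mulVec_mulVec, smul_mulVec, neg_mulVec]
    change (hardySpace d).orthogonalProjectionOnto (mulOp U _) ∈ LinearMap.range J
    rw [e, orthogonalProjectionOnto_hardy_add hp.mem_hardySpace hm.mem_hardySpace_orthogonal]
    exact ⟨_, rfl⟩
  have h1 : (Submodule.span ℂ S)ᗮ ≤ hardySpace d := by
    intro f hf
    refine mem_hardySpace_of_inner_cauchy hs0 fun z hz w => ?_
    exact (Submodule.mem_orthogonal _ _).1 hf _ (Submodule.subset_span ⟨z, hz, w, rfl⟩)
  have h2 : (hardySpace d)ᗮ ≤ D := by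
    refine (Submodule.orthogonal_le h1).trans ?_
    rw [Submodule.orthogonal_orthogonal_eq_closure]
    exact Submodule.topologicalClosure_minimal _ (Submodule.span_le.2 hSD) hclosed
  exact h2 hm

/-- Write `T_U f = U f - m` with `m` orthogonal to the Hardy space. Since `U² = 1`, applying `T_U`
again gives `f` minus the projection of `U m`, which lies in the model space. -/
theorem toeplitz_toeplitz_sub (h : IsRealization W G T ρ) (f : hardySpace d) :
    ∃ u, toeplitz (realized W G T ρ) (toeplitz (realized W G T ρ) f) - f =
      modelMap h.isStable ρ u := by
  set U := realized W G T ρ with hU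
  set g := toeplitz U f with hg
  set m : L2V d := mulOp U f - g with hm
  have hmo : m ∈ (hardySpace d)ᗮ := by
    rw [hm, hg, toeplitz_apply]
    exact Submodule.sub_starProjection_mem_orthogonal _
  obtain ⟨u, hu⟩ := projection_mulOp_mem_range h hmo
  refine ⟨-u, ?_⟩
  have e : (g : L2V d) = mulOp U f - m := by rw [hm]; abel
  rw [toeplitz_apply, e, map_sub, mulOp_mulOp h.memLp_symbol h.realized_mul_self, map_sub, ← hu,
    map_neg, (hardySpace d).orthogonalProjectionOnto_mem_subspace_eq_self]
  abel

end Toeplitz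

end HWM

end

noncomputable section

namespace HWM

open Matrix Complex
open scoped ComplexOrder Matrix.Norms.L2Operator

set_option linter.unusedSectionVars false

/-! ### Identification of the discrete spectrum -/

section ToeplitzSpectrum

variable {d : ℕ} {ι : Type*} [Fintype ι] [DecidableEq ι]
  {W : Mat d} {G T : Matrix ι ι ℂ} {ρ : Matrix (Fin d) ι ℂ}

theorem resol_mul_resol {x y : ℝ} (hx : IsUnit (G - (x : ℂ) • (1 : Matrix ι ι ℂ)))
    (hy : IsUnit (G - (y : ℂ) • (1 : Matrix ι ι ℂ))) :
    resol G x - resol G y = ((x : ℂ) - y) • (resol G x * resol G y) := by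
  have e : ((x : ℂ) - y) • (1 : Matrix ι ι ℂ) =
      (G - (y : ℂ) • 1) - (G - (x : ℂ) • (1 : Matrix ι ι ℂ)) := by module
  have : ((x : ℂ) - y) • (resol G x * resol G y) =
      resol G x * (((x : ℂ) - y) • (1 : Matrix ι ι ℂ)) * resol G y := by simp
  rw [this, e, Matrix.mul_sub, Matrix.sub_mul, Matrix.mul_assoc, mul_resol hy, resol_mul hx,
    Matrix.mul_one, Matrix.one_mul]

/-- The vectors with `ρ (G - x)⁻¹ u = 0` for all `x` form a subspace invariant under the resolvent
at `0`. If nonzero, it contains an eigenvector of `G` annihilated by `ρ`; dissipation makes the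
eigenvalue real, against regularity. -/
theorem modelMap_injective (h : IsRealization W G T ρ) :
    Function.Injective (modelMap h.isStable ρ) := by
  have hcont := continuous_resol h.regular
  set S : Submodule ℂ (ι → ℂ) := ⨅ x : ℝ, LinearMap.ker (Matrix.mulVecLin (ρ * resol G x)) with hS
  have hmem : ∀ u, u ∈ S ↔ ∀ x : ℝ, ρ *ᵥ (resol G x *ᵥ u) = 0 := fun u => by
    simp [hS, Submodule.mem_iInf, mulVec_mulVec]
  have hinv : ∀ u ∈ S, resol G 0 *ᵥ u ∈ S := by
    intro u hu
    rw [hmem] at hu ⊢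
    have h0 : ∀ x : ℝ, x ≠ 0 → ρ *ᵥ (resol G x *ᵥ (resol G 0 *ᵥ u)) = 0 := fun x hx => by
      have e := resol_mul_resol (h.regular x) (h.regular 0)
      have e' := congrArg (fun M => ρ *ᵥ (M *ᵥ u)) e
      simp only [sub_mulVec, mulVec_sub, hu, smul_mulVec, mulVec_smul, ← mulVec_mulVec, sub_self,
        ofReal_zero, sub_zero] at e'
      exact (smul_eq_zero.1 e'.symm).resolve_left (by exact_mod_cast hx)
    -- The resolvent identity says nothing at `x = 0`; continuity supplies this point.
    have hc : Continuous fun x : ℝ => ρ *ᵥ (resol G x *ᵥ (resol G 0 *ᵥ u)) :=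
      continuous_const.matrix_mulVec (hcont.matrix_mulVec continuous_const)
    have hclosed : IsClosed {x : ℝ | ρ *ᵥ (resol G x *ᵥ (resol G 0 *ᵥ u)) = 0} :=
      isClosed_eq hc continuous_const
    have hd : Dense {x : ℝ | x ≠ 0} := dense_compl_singleton (0 : ℝ)
    intro x
    exact hclosed.closure_subset_iff.2 (fun y hy => h0 y hy) (hd x)
  have hbot : S = ⊥ := by
    by_contra hne
    have : Nontrivial S := Submodule.nontrivial_iff_ne_bot.2 hne
    set L : Module.End ℂ S := (Matrix.mulVecLin (resol G 0)).restrict hinv with hL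
    obtain ⟨c, hc⟩ := Module.End.exists_eigenvalue L
    obtain ⟨u, hu⟩ := hc.exists_hasEigenvector
    have hu0 : (u : ι → ℂ) ≠ 0 := fun h0 => hu.2 (Subtype.ext h0)
    have hu1 : resol G 0 *ᵥ (u : ι → ℂ) = c • (u : ι → ℂ) := congrArg Subtype.val hu.apply_eq_smul
    have hu2 : (u : ι → ℂ) = c • (G *ᵥ (u : ι → ℂ)) := by
      have := congrArg (fun w => (G - ((0 : ℝ) : ℂ) • (1 : Matrix ι ι ℂ)) *ᵥ w) hu1
      simpa [mulVec_mulVec, mul_resol (h.regular 0), mulVec_smul, -ofReal_zero, 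
        show G - ((0 : ℝ) : ℂ) • (1 : Matrix ι ι ℂ) = G by simp, 
        show G * resol G 0 = 1 by simpa using mul_resol (h.regular 0)] using this
    have hc0 : c ≠ 0 := fun h0 => hu0 (by rw [hu2, h0, zero_smul])
    have hρ : ρ *ᵥ (u : ι → ℂ) = 0 := by
      have := (hmem u).1 u.2 0
      rw [hu1, mulVec_smul] at this
      exact (smul_eq_zero.1 this).resolve_left hc0
    have hG : G *ᵥ (u : ι → ℂ) = c⁻¹ • (u : ι → ℂ) := by
      conv_rhs => rw [hu2]
      rw [smul_smul, inv_mul_cancel₀ hc0, one_smul]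
    have hdis := congrArg (fun M => star (u : ι → ℂ) ⬝ᵥ (M *ᵥ (u : ι → ℂ))) h.dissip
    simp only [← mulVec_mulVec, hρ, mulVec_zero, dotProduct_zero, smul_mulVec, sub_mulVec, hG,
      dotProduct_smul, dotProduct_sub] at hdis
    have hGH : star (u : ι → ℂ) ⬝ᵥ (Gᴴ *ᵥ (u : ι → ℂ)) =
        star c⁻¹ * (star (u : ι → ℂ) ⬝ᵥ (u : ι → ℂ)) := by
      rw [dotProduct_mulVec, ← star_mulVec, hG, star_smul, smul_dotProduct, smul_eq_mul]
    rw [hGH] at hdis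
    have huu : star (u : ι → ℂ) ⬝ᵥ (u : ι → ℂ) ≠ 0 := fun h0 =>
      hu0 (dotProduct_star_self_eq_zero.1 h0)
    have hreal : c⁻¹ - star c⁻¹ = 0 := by
      have h1 : I * ((c⁻¹ - star c⁻¹) * (star (u : ι → ℂ) ⬝ᵥ (u : ι → ℂ))) = 0 := by
        rw [hdis]; simp only [smul_eq_mul]; ring
      exact (mul_eq_zero.1 ((mul_eq_zero.1 h1).resolve_left I_ne_zero)).resolve_right huu
    obtain ⟨r, hr⟩ : ∃ r : ℝ, (r : ℂ) = c⁻¹ := Complex.conj_eq_iff_real.1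
      (sub_eq_zero.1 hreal).symm |>.imp fun _ h => h.symm
    have hker : (G - (r : ℂ) • (1 : Matrix ι ι ℂ)) *ᵥ (u : ι → ℂ) = 0 := by
      rw [sub_mulVec, smul_mulVec, one_mulVec, hG, hr, sub_self]
    refine hu0 ?_
    have := congrArg (fun w => resol G r *ᵥ w) hker
    rwa [mulVec_mulVec, resol_mul (h.regular r), one_mulVec, mulVec_zero] at this
  rw [injective_iff_map_eq_zero]
  intro u hu
  have hmemS : u ∈ S := by
    rw [hmem]
    have h1 : (modelMap h.isStable ρ u : L2V d) = 0 := congrArg Subtype.val hu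
    rw [modelMap_coe] at h1
    have hL := h.isStable.hasFourierIn_Ioi (sandwichCLM ρ u)
    have h2 : (fun x => sandwichCLM ρ u (resol G x)) =ᵐ[volume] fun _ => 0 := by
      have h3 := hL.memLp.coeFn_toLp
      rw [h1] at h3
      exact h3.symm.trans (Lp.coeFn_zero _ _ _)
    have h4 := Continuous.ae_eq_iff_eq (μ := (volume : Measure ℝ))
      ((sandwichCLM ρ u).continuous.comp hcont) continuous_const |>.1 h2
    intro x
    have := congrArg WithLp.ofLp (congrFun h4 x)
    simpa [sandwichCLM_apply] using this
  rw [hbot] at hmemS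
  exact hmemS

/-- Clearing denominators gives a polynomial with infinitely many zeros, and its value at `z_n`
isolates the coefficient `g_n`. -/
theorem coeff_eq_zero_of_cauchy_sum {α : Type*} {s : Finset α} {z : α → ℂ} (hz : Set.InjOn z s)
    (him : ∀ n, (z n).im ≠ 0) {g : α → ℂ} {X' : Set ℝ} (hX : X'.Infinite)
    (h : ∀ x ∈ X', ∑ n ∈ s, g n * (z n - x)⁻¹ = 0) : ∀ n ∈ s, g n = 0 := by
  classical
  set P : ℂ[X] := ∑ n ∈ s, C (g n) * ∏ m ∈ s.erase n, (C (z m) - X) with hP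
  have hP0 : P = 0 := by
    refine eq_zero_of_infinite_isRoot P
      ((hX.image (Complex.ofReal_injective.injOn)).mono ?_)
    rintro _ ⟨x, hx, rfl⟩
    have hne : ∀ m, z m - x ≠ 0 := fun m h0 => him m (by simpa using congrArg Complex.im h0)
    have h1 : P.eval (x : ℂ) = (∏ m ∈ s, (z m - x)) * ∑ n ∈ s, g n * (z n - x)⁻¹ := by
      rw [hP, eval_finsetSum, Finset.mul_sum]
      refine Finset.sum_congr rfl fun n hn => ?_
      rw [← Finset.mul_prod_erase s _ hn, eval_mul, eval_prod]
      simp only [eval_C, eval_sub, eval_X]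
      field_simp [hne n]
    show P.eval (x : ℂ) = 0
    rw [h1, h x hx, mul_zero]
  intro n hn
  have h1 : P.eval (z n) = g n * ∏ m ∈ s.erase n, (z m - z n) := by
    rw [hP, eval_finsetSum, Finset.sum_eq_single n]
    · simp [eval_prod]
    · intro b hb hbn
      rw [eval_mul, eval_prod]
      refine mul_eq_zero_of_right _ (Finset.prod_eq_zero (Finset.mem_erase.2 ⟨hbn.symm, hn⟩) ?_)
      simp
    · exact fun h0 => absurd hn h0
  rw [hP0, eval_zero] at h1
  refine (mul_eq_zero.1 h1.symm).resolve_right (Finset.prod_ne_zero_iff.2 fun m hm => ?_)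
  exact sub_ne_zero.2 fun h0 => (Finset.mem_erase.1 hm).1
    (hz (Finset.mem_erase.1 hm).2 hn h0)

/-- If `W w = ε w`, then `U Ψ w = Ψ W w = ε Ψ w`, so every Hardy function that is a scalar multiple
of `Ψ w` is an eigenfunction. The factors `(z_n - x)⁻¹` with poles `z_n` in the lower half plane
give infinitely many independent ones. A vector `w ≠ 0` exists because `W + ε` is nonzero and its
range consists of eigenvectors. -/
theorem not_finiteDimensional_eigenspace_toeplitz (h : IsRealization W G T ρ) {ε : ℂ}
    (hε : ε ^ 2 = 1) (hW : W + ε • 1 ≠ 0) :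
    ¬ FiniteDimensional ℂ (Module.End.eigenspace
      (toeplitz (realized W G T ρ) : hardySpace d →ₗ[ℂ] hardySpace d) ε) := by
  intro hfin
  obtain ⟨w, hw0, hw⟩ : ∃ w : Fin d → ℂ, w ≠ 0 ∧ W *ᵥ w = ε • w := by
    obtain ⟨w₀, hw₀⟩ : ∃ w₀ : Fin d → ℂ, (W + ε • 1) *ᵥ w₀ ≠ 0 := by
      by_contra hall
      push Not at hall
      refine hW (Matrix.ext_of_mulVec_single fun i => ?_)
      rw [hall, zero_mulVec]
    refine ⟨_, hw₀, ?_⟩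
    rw [mulVec_mulVec, Matrix.mul_add, h.sq, Matrix.mul_smul, Matrix.mul_one, ← smul_mulVec,
      smul_add, smul_smul, ← pow_two, hε, one_smul, add_comm]
  set s : ℝ := ‖G‖ * ‖(1 : Matrix ι ι ℂ)‖ + 1 with hs
  have hs0 : 0 < s := by positivity
  let z : ℕ → ℂ := fun n => -((s + n : ℝ) : ℂ) * I
  have hzim : ∀ n, (z n).im = -(s + n) := fun n => by simp [z]
  have hzneg : ∀ n, (z n).im < 0 := fun n => by
    rw [hzim]; have : (0 : ℝ) ≤ n := n.cast_nonneg; linarith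
  have hzinj : Function.Injective z := fun a b hab => by
    have := congrArg Complex.im hab
    rw [hzim, hzim] at this
    have : (a : ℝ) = b := by linarith
    exact_mod_cast this
  have hGz : ∀ n, IsUnit (G - z n • (1 : Matrix ι ι ℂ)) := fun n => isUnit_sub_smul_of_norm_lt (by
    rw [hzim, abs_neg, abs_of_nonneg (by positivity)]
    have : (0 : ℝ) ≤ n := n.cast_nonneg
    linarith)
  set f : ℕ → ℝ → EuclideanSpace ℂ (Fin d) := fun n x =>
    (z n - x)⁻¹ • WithLp.toLp 2 (innerFun G ρ x *ᵥ w) with hf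
  have hfF : ∀ n, HasFourierIn (Set.Ioi 0) (f n) := fun n => by
    set N := (G - z n • (1 : Matrix ι ι ℂ))⁻¹
    have h1 := hasFourierIn_cauchy_Ioi (hzneg n) (WithLp.toLp 2 ((1 + I • (ρ * N * ρᴴ)) *ᵥ w))
    have h2 := h.isStable.hasFourierIn_Ioi (sandwichCLM ρ (-(I • ((N * ρᴴ) *ᵥ w))))
    convert h1.add h2 using 1
    ext1 x
    have c1 := cauchy_smul_resol (hzneg n).ne (hGz n) (h.regular x)
    have key : (z n - x)⁻¹ • innerFun G ρ x = (z n - x)⁻¹ • (1 + I • (ρ * N * ρᴴ)) +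
        ρ * resol G x * (-(I • (N * ρᴴ))) := by
      have e1 : (z n - x)⁻¹ • innerFun G ρ x =
          (z n - x)⁻¹ • 1 + I • (ρ * ((z n - x)⁻¹ • resol G x) * ρᴴ) := by
        rw [innerFun, Matrix.mul_smul, Matrix.smul_mul, smul_add, smul_comm]
      rw [e1, c1]
      simp only [Matrix.mul_sub, Matrix.sub_mul, Matrix.mul_smul, Matrix.smul_mul,
        Matrix.one_mul, Matrix.mul_neg, ← Matrix.mul_assoc]
      module
    change (z n - x)⁻¹ • WithLp.toLp 2 (innerFun G ρ x *ᵥ w) = _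
    rw [sandwichCLM_apply, ← WithLp.toLp_smul, ← WithLp.toLp_smul, ← WithLp.toLp_add]
    congr 1
    rw [← smul_mulVec, key]
    simp only [add_mulVec, ← mulVec_mulVec, smul_mulVec, neg_mulVec]
  set F : ℕ → hardySpace d := fun n => ⟨(hfF n).memLp.toLp, (hfF n).mem_hardySpace⟩ with hF
  have hFe : ∀ n, F n ∈ Module.End.eigenspace
      (toeplitz (realized W G T ρ) : hardySpace d →ₗ[ℂ] hardySpace d) ε := fun n => by
    rw [Module.End.mem_eigenspace_iff]
    have e : mulOp (realized W G T ρ) (F n : L2V d) = ε • (F n : L2V d) := by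
      change mulOp (realized W G T ρ) (hfF n).memLp.toLp = ε • (hfF n).memLp.toLp
      rw [← MemLp.toLp_const_smul]
      refine mulOp_toLp h.memLp_symbol _ _ fun x => ?_
      rw [hf, Pi.smul_apply, map_smul, symbol_toLp, smul_comm ε]
      congr 1
      rw [← WithLp.toLp_smul]
      congr 1
      rw [realized_eq h, mulVec_mulVec, Matrix.mul_assoc, innerFunH_mul_innerFun h.dissip
        (h.regular x), Matrix.mul_one, ← mulVec_mulVec, hw, mulVec_smul]
    change toeplitz (realized W G T ρ) (F n) = ε • F n
    rw [toeplitz_apply, e, map_smul, (hardySpace d).orthogonalProjectionOnto_mem_subspace_eq_self]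
  have hli : LinearIndependent ℂ fun n => (⟨F n, hFe n⟩ : Module.End.eigenspace
      (toeplitz (realized W G T ρ) : hardySpace d →ₗ[ℂ] hardySpace d) ε) := by
    rw [linearIndependent_iff']
    intro t g hg
    have h1 : ∑ n ∈ t, g n • (F n : L2V d) = 0 := by
      have := congrArg (fun y : Module.End.eigenspace (toeplitz (realized W G T ρ) :
        hardySpace d →ₗ[ℂ] hardySpace d) ε => ((y : hardySpace d) : L2V d)) hg
      simpa using this
    have h2 : ∀ᵐ x : ℝ, ∀ n, (F n : L2V d) x = f n x := ae_all_iff.2 fun n => (hfF n).memLp.coeFn_toLp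
    have h3 : ∀ᵐ x : ℝ, ∀ n, (g n • (F n : L2V d) : L2V d) x = g n • (F n : L2V d) x :=
      ae_all_iff.2 fun n => Lp.coeFn_smul _ _
    have h4 : ∀ᵐ x : ℝ, ∑ n ∈ t, g n * (z n - x)⁻¹ = 0 := by
      have h5 := Lp.coeFn_finsetSum t fun n => (g n • (F n : L2V d) : L2V d)
      rw [h1] at h5
      filter_upwards [h2, h3, h5, Lp.coeFn_zero (EuclideanSpace ℂ (Fin d)) 2 (volume : Measure ℝ)]
        with x a b c e
      rw [e, Finset.sum_apply] at c
      simp only [b, a, hf, smul_smul, ← Finset.sum_smul] at c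
      refine (smul_eq_zero.1 c.symm).resolve_right fun h0 => hw0 ?_
      have h6 : innerFun G ρ x *ᵥ w = 0 := by simpa using congrArg WithLp.ofLp h0
      have := congrArg (fun y => (innerFun G ρ x)ᴴ *ᵥ y) h6
      simpa [mulVec_mulVec, innerFunH_mul_innerFun h.dissip (h.regular x)] using this
    refine coeff_eq_zero_of_cauchy_sum hzinj.injOn (fun n => (hzneg n).ne)
      (X' := {x : ℝ | ∑ n ∈ t, g n * (z n - x)⁻¹ = 0}) (fun hfinite => ?_) fun x hx => hx
    have h7 : volume {x : ℝ | ∑ n ∈ t, g n * (z n - x)⁻¹ = 0} = 0 := hfinite.measure_zero _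
    have h8 : volume {x : ℝ | ∑ n ∈ t, g n * (z n - x)⁻¹ = 0}ᶜ = 0 := h4
    have h9 := measure_union_null h7 h8
    rw [Set.union_compl_self, Real.volume_univ] at h9
    exact ENNReal.top_ne_zero h9
  exact not_finite_iff_infinite.2 inferInstance hli.finite

/-- Here `W = -ε`, so `U` and the Toeplitz operator are the scalar `-ε`, which differs from `ε`. -/
theorem not_mem_spectrum_toeplitz (h : IsRealization W G T ρ) {ε : ℂ}
    (hε : ε ^ 2 = 1) (hW : W + ε • 1 = 0) : ε ∉ spectrum ℂ (toeplitz (realized W G T ρ)) := by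
  have hε0 : ε ≠ 0 := fun h0 => by simp [h0] at hε
  have hWε : W = -(ε • 1) := eq_neg_of_add_eq_zero_left hW
  have e : toeplitz (realized W G T ρ) = -(ε • 1) := by
    refine ContinuousLinearMap.ext fun f => ?_
    have e1 : mulOp (realized W G T ρ) (f : L2V d) = -(ε • (f : L2V d)) := by
      refine Lp.ext ?_
      filter_upwards [mulOp_coeFn h.memLp_symbol (f : L2V d), Lp.coeFn_neg (ε • (f : L2V d)),
        Lp.coeFn_smul ε (f : L2V d)] with x a b c
      rw [a, b, Pi.neg_apply, c, Pi.smul_apply]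
      have : realized W G T ρ x = -(ε • 1) := by
        rw [realized_eq h, hWε, Matrix.mul_neg, Matrix.neg_mul, Matrix.mul_smul, Matrix.mul_one,
          Matrix.smul_mul, innerFun_mul_innerFunH h.dissip (h.regular x)]
      rw [symbol, this, map_neg, map_smul, map_one]
      rfl
    rw [toeplitz_apply, e1, map_neg, map_smul,
      (hardySpace d).orthogonalProjectionOnto_mem_subspace_eq_self]
    rfl
  rw [spectrum.mem_iff, not_not, e, Algebra.algebraMap_eq_smul_one, sub_neg_eq_add, ← add_smul]
  have h2 : ε + ε ≠ 0 := by rw [← two_mul]; exact mul_ne_zero two_ne_zero hε0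
  rw [← Algebra.algebraMap_eq_smul_one]
  exact (isUnit_iff_ne_zero.2 h2).map (algebraMap ℂ (hardySpace d →L[ℂ] hardySpace d))

theorem discreteSpectrum_toeplitz {N : ℕ} {G : Matrix (Fin N) (Fin N) ℂ} {v : Fin N → ℝ}
    {ρ : Matrix (Fin d) (Fin N) ℂ} (h : IsRealization W G (realDiag v) ρ)
    (hv1 : ∀ j, v j ^ 2 ≠ 1) :
    discreteSpectrum (toeplitz (realized W G (realDiag v) ρ)) = Set.range fun j => (v j : ℂ) :=
  discreteSpectrum_of_model (modelMap_injective h) hv1 (toeplitz_modelMap h)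
    (toeplitz_toeplitz_sub h) fun _ hε hspec =>
      not_finiteDimensional_eigenspace_toeplitz h hε fun h0 => not_mem_spectrum_toeplitz h hε h0 hspec

theorem injective_of_hasSimpleDiscreteSpectrum {N : ℕ} {G : Matrix (Fin N) (Fin N) ℂ}
    {v : Fin N → ℝ} {ρ : Matrix (Fin d) (Fin N) ℂ} (h : IsRealization W G (realDiag v) ρ)
    (hv1 : ∀ j, v j ^ 2 ≠ 1)
    (hs : HasSimpleDiscreteSpectrum (toeplitz (realized W G (realDiag v) ρ))) :
    Function.Injective v :=
  injective_of_model (modelMap_injective h) (toeplitz_modelMap h) (discreteSpectrum_toeplitz h hv1)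
    hs

end ToeplitzSpectrum

end HWM

end

noncomputable section

namespace HWM

open Complex

/-! ### Regularity of solutions -/

section Evaluation

/-- A bounded square-integrable weight. -/
structure IsWeight (σ : ℝ → ℝ) : Prop where
  continuous : Continuous σ
  nonneg : ∀ ξ, 0 ≤ σ ξ
  le_one : ∀ ξ, σ ξ ≤ 1
  memLp : MemLp (fun ξ => (σ ξ : ℂ)) 2

/-- The weight `⟨ξ⟩⁻²`. -/
def weight (ξ : ℝ) : ℝ := (1 + (2 * Real.pi * ξ) ^ 2)⁻¹

/-- The weight `2π|ξ| ⟨ξ⟩⁻²`. -/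
def absWeight (ξ : ℝ) : ℝ := 2 * Real.pi * |ξ| * weight ξ

theorem weight_pos (ξ : ℝ) : 0 < weight ξ := by unfold weight; positivity

theorem continuous_weight : Continuous weight := by
  unfold weight
  exact Continuous.inv₀ (by fun_prop) fun ξ => by positivity

theorem integrable_weight : Integrable weight := by
  have := integrable_inv_one_add_sq.comp_mul_left' (R := 2 * Real.pi) (by positivity)
  exact this

/-- The function `⟨ξ⟩⁻²` is integrable and at most `1`, so its domination of `σ²` yields both
requirements. -/
theorem isWeight_of_sq_le {σ : ℝ → ℝ} (hc : Continuous σ) (h0 : ∀ ξ, 0 ≤ σ ξ)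
    (h : ∀ ξ, σ ξ ^ 2 ≤ weight ξ) : IsWeight σ := by
  have hw1 : ∀ ξ, weight ξ ≤ 1 := fun ξ => inv_le_one_of_one_le₀ (by nlinarith [sq_nonneg (2 * Real.pi * ξ)])
  refine ⟨hc, h0, fun ξ => ?_, ?_⟩
  · have := (h ξ).trans (hw1 ξ)
    nlinarith [h0 ξ]
  · have h2 : MemLp σ 2 := (memLp_two_iff_integrable_sq hc.aestronglyMeasurable).2
      (integrable_weight.mono' (hc.pow 2).aestronglyMeasurable (Eventually.of_forall fun ξ => by
        rw [Real.norm_of_nonneg (by positivity)]; exact h ξ))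
    exact h2.ofReal

theorem isWeight_weight : IsWeight weight :=
  isWeight_of_sq_le continuous_weight (fun ξ => (weight_pos ξ).le) fun ξ => by
    have h1 : weight ξ ≤ 1 := inv_le_one_of_one_le₀ (by nlinarith [sq_nonneg (2 * Real.pi * ξ)])
    nlinarith [weight_pos ξ]

theorem isWeight_absWeight : IsWeight absWeight := by
  refine isWeight_of_sq_le (by have := continuous_weight; unfold absWeight; fun_prop) (fun ξ => ?_)
    fun ξ => ?_
  · have := weight_pos ξ
    have := Real.pi_pos
    unfold absWeight; positivity
  · have h1 : (2 * Real.pi * |ξ|) ^ 2 * weight ξ ≤ 1 := by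
      rw [weight, mul_pow, sq_abs, ← mul_pow, mul_inv_le_iff₀ (by positivity)]
      nlinarith
    have h2 := weight_pos ξ
    have h3 : absWeight ξ ^ 2 = ((2 * Real.pi * |ξ|) ^ 2 * weight ξ) * weight ξ := by
      unfold absWeight; ring
    rw [h3]
    nlinarith

variable {σ : ℝ → ℝ} (g g' : Lp ℂ 2 (volume : Measure ℝ))

/-- The function whose Fourier transform is `σ g`. -/
def ev (σ : ℝ → ℝ) (g : Lp ℂ 2 (volume : Measure ℝ)) (x : ℝ) : ℂ := 𝓕⁻ (fun ξ => (σ ξ : ℂ) * g ξ) x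

/-- The `L²` norm of a weight. -/
def weightNorm (σ : ℝ → ℝ) : ℝ := (eLpNorm (fun ξ => (σ ξ : ℂ)) 2 volume).toReal

theorem IsWeight.integrable (h : IsWeight σ) : Integrable fun ξ => (σ ξ : ℂ) * g ξ :=
  h.memLp.integrable_mul (Lp.memLp g)

theorem IsWeight.memLp_mul (h : IsWeight σ) : MemLp (fun ξ => (σ ξ : ℂ) * g ξ) 2 :=
  (Lp.memLp g).of_le_mul (c := 1) (h.memLp.1.mul (Lp.memLp g).1) (Eventually.of_forall fun ξ => by
    rw [norm_mul, Complex.norm_real, Real.norm_of_nonneg (h.nonneg ξ)]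
    gcongr
    exact h.le_one ξ)

theorem IsWeight.integral_norm_le (h : IsWeight σ) :
    ∫ ξ, ‖(σ ξ : ℂ) * g ξ‖ ≤ weightNorm σ * ‖g‖ := by
  have h1 : ENNReal.ofReal (∫ ξ, ‖(σ ξ : ℂ) * g ξ‖) =
      eLpNorm (fun ξ => (σ ξ : ℂ) * g ξ) 1 volume := by
    rw [ofReal_integral_norm_eq_lintegral_enorm (h.integrable g), eLpNorm_one_eq_lintegral_enorm]
  have h2 : eLpNorm (fun ξ => (σ ξ : ℂ) * g ξ) 1 volume ≤
      eLpNorm (fun ξ => (σ ξ : ℂ)) 2 volume * eLpNorm (g : ℝ → ℂ) 2 volume := by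
    have e : (fun ξ => (σ ξ : ℂ) * g ξ) = (fun ξ => (σ ξ : ℂ)) • (g : ℝ → ℂ) := rfl
    rw [e]
    exact eLpNorm_smul_le_mul_eLpNorm (Lp.memLp g).1 h.memLp.1
  rw [← h1] at h2
  have h3 := ENNReal.toReal_mono (ENNReal.mul_ne_top h.memLp.2.ne (Lp.memLp g).2.ne) h2
  rw [ENNReal.toReal_ofReal (by positivity), ENNReal.toReal_mul] at h3
  exact h3

theorem IsWeight.norm_ev_le (h : IsWeight σ) (x : ℝ) : ‖ev σ g x‖ ≤ weightNorm σ * ‖g‖ :=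
  (norm_fourierInv_le _ x).trans (h.integral_norm_le g)

theorem IsWeight.ev_sub (h : IsWeight σ) (x : ℝ) : ev σ (g - g') x = ev σ g x - ev σ g' x := by
  rw [ev, ev, ev, ← fourierInv_sub (h.integrable g) (h.integrable g')]
  refine Real.fourierInv_congr_ae ?_ x
  filter_upwards [Lp.coeFn_sub g g'] with ξ hξ
  rw [hξ, Pi.sub_apply, mul_sub]

theorem IsWeight.continuous_ev (h : IsWeight σ) : Continuous (ev σ g) :=
  continuous_fourierInv (h.integrable g)

theorem tendsto_ev : Tendsto (ev σ g) (cocompact ℝ) (𝓝 0) :=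
  tendsto_fourierInv_cocompact _

theorem IsWeight.memLp_ev (h : IsWeight σ) : MemLp (ev σ g) 2 :=
  memLp_fourierInv (h.integrable g) (h.memLp_mul g)

theorem IsWeight.eLpNorm_ev (h : IsWeight σ) :
    eLpNorm (ev σ g) 2 volume = eLpNorm (fun ξ => (σ ξ : ℂ) * g ξ) 2 volume := by
  have h1 := fourier_toLp_fourierInv (h.integrable g) (h.memLp_mul g)
  have h2 : ‖(h.memLp_ev g).toLp‖ = ‖(h.memLp_mul g).toLp‖ := by
    rw [← h1]
    exact ((Lp.fourierTransformₗᵢ ℝ ℂ).norm_map _).symm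
  rw [Lp.norm_toLp, Lp.norm_toLp] at h2
  exact (ENNReal.toReal_eq_toReal_iff' (h.memLp_ev g).2.ne (h.memLp_mul g).2.ne).1 h2

/-- Joint continuity of the evaluation along a continuous curve. -/
theorem IsWeight.continuous_uncurry_ev (h : IsWeight σ) {γ : ℝ → Lp ℂ 2 (volume : Measure ℝ)}
    (hγ : Continuous γ) : Continuous fun p : ℝ × ℝ => ev σ (γ p.1) p.2 := by
  rw [continuous_iff_continuousAt]
  rintro ⟨t, x⟩
  have h1 : Tendsto (fun p : ℝ × ℝ => ev σ (γ p.1 - γ t) p.2) (𝓝 (t, x)) (𝓝 0) := by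
    refine squeeze_zero_norm (fun p => h.norm_ev_le _ _) ?_
    have : Continuous fun p : ℝ × ℝ => weightNorm σ * ‖γ p.1 - γ t‖ := by fun_prop
    simpa using this.tendsto (t, x)
  have h2 : Tendsto (fun p : ℝ × ℝ => ev σ (γ t) p.2) (𝓝 (t, x)) (𝓝 (ev σ (γ t) x)) :=
    ((h.continuous_ev (γ t)).comp continuous_snd).tendsto (t, x)
  have h3 := h1.add h2
  rw [zero_add] at h3
  refine h3.congr fun p => ?_
  rw [h.ev_sub]; abel

end Evaluation

/-! ### Uniqueness of the punctured Fourier transform -/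

section AbsD

/-- Both functions represent the same distribution against test functions supported away from the
origin, and the origin is a null set. -/
theorem HasPuncturedFourier.ae_eq {c : ℂ} {p g : ℝ → ℂ} (hp : Integrable p)
    (h : HasPuncturedFourier (fun x => c + 𝓕⁻ p x) g) : g =ᵐ[volume] p := by
  have h1 := hasPuncturedFourier_const_add hp c
  have hopen : IsOpen ({0}ᶜ : Set ℝ) := isOpen_compl_singleton
  have hloc : LocallyIntegrableOn (fun ξ => g ξ - p ξ) ({0}ᶜ : Set ℝ) := h.2.1.sub h1.2.1
  have h2 := hopen.ae_eq_zero_of_integral_contDiff_smul_eq_zero hloc fun φ hφ hcs hsub => ?_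
  · have h3 : ∀ᵐ ξ : ℝ, ξ ≠ 0 := by
      rw [ae_iff]; simp
    filter_upwards [h2, h3] with ξ a b
    exact sub_eq_zero.1 (a b)
  · have hφc : ContDiff ℝ (⊤ : ℕ∞) (fun ξ => (φ ξ : ℂ)) := Complex.ofRealCLM.contDiff.comp hφ
    have hcs' : HasCompactSupport (fun ξ => (φ ξ : ℂ)) := hcs.comp_left Complex.ofReal_zero
    set Φ : 𝓢(ℝ, ℂ) := hcs'.toSchwartzMap hφc with hΦ
    have hΦa : ∀ ξ, Φ ξ = (φ ξ : ℂ) := fun ξ => rfl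
    have hts : tsupport Φ ⊆ tsupport φ := closure_mono fun ξ hξ => by
      rw [Function.mem_support] at hξ ⊢
      intro h0
      exact hξ (by rw [hΦa, h0, Complex.ofReal_zero])
    have h0 : (0 : ℝ) ∉ tsupport Φ := fun hm => hsub (hts hm) rfl
    have e := (h.2.2 Φ hcs' h0).symm.trans (h1.2.2 Φ hcs' h0)
    have key : ∀ {q : ℝ → ℂ}, LocallyIntegrableOn q ({0}ᶜ : Set ℝ) →
        Integrable fun ξ => φ ξ • q ξ := fun {q} hq => by
      have hi : IntegrableOn (fun ξ => φ ξ • q ξ) (tsupport φ) :=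
        (hq.integrableOn_compact_subset hsub hcs).continuousOn_smul hφ.continuous.continuousOn hcs
      refine (integrableOn_iff_integrable_of_support_subset fun ξ hξ => ?_).1 hi
      refine subset_tsupport φ fun h0 => hξ ?_
      simp only [h0, zero_smul]
    simp_rw [smul_sub]
    rw [integral_sub (key h.2.1) (key h1.2.1), sub_eq_zero]
    refine Eq.trans ?_ (e.trans ?_)
    · refine integral_congr_ae (Eventually.of_forall fun ξ => ?_)
      simp [hΦa, mul_comm]
    · refine integral_congr_ae (Eventually.of_forall fun ξ => ?_)
      simp [hΦa, mul_comm]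

theorem IsAbsD.eq {c : ℂ} {p h : ℝ → ℂ} (hp : Integrable p)
    (hh : IsAbsD (fun x => c + 𝓕⁻ p x) h) (x : ℝ) :
    h x = 𝓕⁻ (fun ξ : ℝ => ((2 * Real.pi * |ξ| : ℝ) : ℂ) * p ξ) x := by
  obtain ⟨g, h1, -, h3⟩ := hh
  rw [h3]
  refine Real.fourierInv_congr_ae ?_ x
  filter_upwards [h1.ae_eq hp] with ξ hξ
  rw [hξ]

end AbsD

end HWM

end

noncomputable section

namespace HWM

open Complex

/-! ### Solutions as continuous curves of weighted Fourier data -/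

section Profile

variable {d k : ℕ} {U : ℝ → ℝ → Mat d}

/-- The matrix-valued function with entries `ev σ (g i j)`. -/
def evMat (σ : ℝ → ℝ) (g : Fin d → Fin d → Lp ℂ 2 (volume : Measure ℝ)) (x : ℝ) : Mat d :=
  Matrix.of fun i j => ev σ (g i j) x

theorem evMat_apply (σ : ℝ → ℝ) (g : Fin d → Fin d → Lp ℂ 2 (volume : Measure ℝ)) (x : ℝ)
    (i j : Fin d) : evMat σ g x i j = ev σ (g i j) x := rfl

/-- The curve is `γ = ⟨ξ⟩² 𝓕 V`, continuous in `L²` by continuity in `H²`. The index `2` suffices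
because both `⟨ξ⟩⁻²` and `2π|ξ|⟨ξ⟩⁻²` are square-integrable, which makes `V` and `|D| V` continuous
functions. -/
theorem exists_weighted_curve {V : ℝ → Lp ℂ 2 (volume : Measure ℝ)}
    (hV : ∀ t, sobolevENorm 2 (V t) < ⊤)
    (hc : ∀ t, Tendsto (fun τ => sobolevENorm 2 (V τ - V t)) (𝓝 t) (𝓝 0)) :
    ∃ γ : ℝ → Lp ℂ 2 (volume : Measure ℝ), Continuous γ ∧
      ∀ t, (V t : ℝ → ℂ) =ᵐ[volume] ev weight (γ t) := by
  set J : ℝ → ℂ := fun ξ => (((1 + (2 * Real.pi * ξ) ^ 2) ^ ((2 : ℝ) / 2) : ℝ) : ℂ) with hJ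
  have hJw : ∀ ξ, (weight ξ : ℂ) * J ξ = 1 := fun ξ => by
    rw [hJ, weight]
    norm_num
    rw [← ofReal_ofNat, ← ofReal_mul, ← ofReal_mul, ← ofReal_pow, ← ofReal_one, ← ofReal_add]
    exact_mod_cast inv_mul_cancel₀ (by positivity)
  have hJm : Continuous J := by
    rw [hJ]
    exact Complex.continuous_ofReal.comp ((by fun_prop : Continuous fun ξ : ℝ =>
      1 + (2 * Real.pi * ξ) ^ 2).rpow_const fun ξ => Or.inl (by positivity))
  have hm : ∀ w : Lp ℂ 2 (volume : Measure ℝ), sobolevENorm 2 w < ⊤ →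
      MemLp (fun ξ => J ξ * (𝓕 w : Lp ℂ 2 (volume : Measure ℝ)) ξ) 2 := fun w hw =>
    ⟨hJm.aestronglyMeasurable.mul (Lp.memLp _).1, hw⟩
  refine ⟨fun t => (hm _ (hV t)).toLp, ?_, fun t => ?_⟩
  · rw [continuous_iff_continuousAt]
    intro t
    rw [ContinuousAt, tendsto_iff_edist_tendsto_0]
    refine (hc t).congr fun τ => ?_
    rw [Lp.edist_toLp_toLp, sobolevENorm]
    refine eLpNorm_congr_ae ?_
    have e : (𝓕 (V τ - V t) : Lp ℂ 2 (volume : Measure ℝ)) = 𝓕 (V τ) - 𝓕 (V t) :=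
      map_sub (Lp.fourierTransformₗᵢ ℝ ℂ) _ _
    rw [e]
    filter_upwards [Lp.coeFn_sub (𝓕 (V τ) : Lp ℂ 2 (volume : Measure ℝ)) (𝓕 (V t))] with ξ hξ
    rw [hξ, Pi.sub_apply, Pi.sub_apply, mul_sub]
  · set γ := (hm _ (hV t)).toLp with hγ
    have h1 := isWeight_weight.integrable γ
    have h2 := isWeight_weight.memLp_mul γ
    have e1 : h2.toLp = (𝓕 (V t) : Lp ℂ 2 (volume : Measure ℝ)) := by
      refine Lp.ext ?_
      filter_upwards [h2.coeFn_toLp, (hm _ (hV t)).coeFn_toLp] with ξ a b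
      rw [a, hγ, b, ← mul_assoc, hJw, one_mul]
    have e2 := fourierInv_toLp_ae_eq h1 h2
    rw [e1, FourierTransform.fourierInv_fourier_eq] at e2
    exact e2

theorem IsSolution.exists_profile (h : IsSolution k d U) :
    ∃ (c : ℝ → Mat d) (g : ℝ → Fin d → Fin d → Lp ℂ 2 (volume : Measure ℝ)),
      (∀ i j, Continuous fun t => g t i j) ∧
      (∀ t x, U t x = c t + evMat weight (g t) x) ∧
      ∀ t x, HasDerivAt (fun τ => U τ x) (-(I / 2) • (U t x * evMat absWeight (g t) x -
        evMat absWeight (g t) x * U t x)) t := by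
  obtain ⟨hcont, c, V, -, hV, hs⟩ := h.curve
  have hex : ∀ i j, ∃ γ : ℝ → Lp ℂ 2 (volume : Measure ℝ), Continuous γ ∧
      ∀ t, (V t i j : ℝ → ℂ) =ᵐ[volume] ev weight (γ t) := fun i j =>
    exists_weighted_curve (fun t => (hs 2 two_pos t i j).1) fun t => (hs 2 two_pos t i j).2
  choose γ hγ hVγ using hex
  have hU : ∀ t i j, (fun x => U t x i j) = fun x => c t i j + ev weight (γ i j t) x := by
    intro t i j
    have hc1 : Continuous fun x => U t x i j := (continuous_apply_apply i j).comp (hcont t)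
    have hc2 : Continuous fun x => c t i j + ev weight (γ i j t) x :=
      continuous_const.add (isWeight_weight.continuous_ev _)
    refine (Continuous.ae_eq_iff_eq (μ := (volume : Measure ℝ)) hc1 hc2).1 ?_
    filter_upwards [hV t i j, hVγ i j t] with x a b
    rw [a, b]
  refine ⟨c, fun t i j => γ i j t, hγ, fun t x => ?_, fun t x => ?_⟩
  · ext i j
    exact congrFun (hU t i j) x
  · obtain ⟨A, hA, hd⟩ := h.equation t
    have hAe : A x = evMat absWeight (fun i j => γ i j t) x := by
      ext i j
      have h1 := hA i j
      rw [hU t i j] at h1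
      rw [evMat_apply, IsAbsD.eq (isWeight_weight.integrable _) h1, ev]
      refine Real.fourierInv_congr_ae (Eventually.of_forall fun ξ => ?_) x
      simp only [absWeight]
      push_cast
      ring
    rw [← hAe]
    exact hd x

theorem norm_entry_le_one_of_mem_gr {A : Mat d} (hA : A ∈ Gr k d) (i j : Fin d) : ‖A i j‖ ≤ 1 :=
  norm_entry_le_one hA.1 hA.2.1 i j

theorem hasDerivAt_entry {F : ℝ → Mat d} {F' : Mat d} {t : ℝ} (h : HasDerivAt F F' t)
    (i j : Fin d) : HasDerivAt (fun τ => F τ i j) (F' i j) t :=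
  hasDerivAt_pi.1 (hasDerivAt_pi.1 h i) j

/-- If the time derivative of `f` is locally bounded and vanishes at spatial infinity, then the
limit of `f` at spatial infinity does not depend on time. -/
theorem eq_of_tendsto_of_tendsto_deriv {f N : ℝ → ℝ → ℂ} {c : ℝ → ℂ} {b : ℝ → ℝ}
    (hf : ∀ x τ, HasDerivAt (fun s => f s x) (N τ x) τ) (hN : ∀ x, Continuous fun τ => N τ x)
    (hb : Continuous b) (hNb : ∀ x τ, ‖N τ x‖ ≤ b τ) (hN0 : ∀ τ, Tendsto (N τ) atTop (𝓝 0))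
    (hc : ∀ t, Tendsto (f t) atTop (𝓝 (c t))) (t : ℝ) : c t = c 0 := by
  have hFTC : ∀ x, f t x - f 0 x = ∫ τ in (0 : ℝ)..t, N τ x := fun x =>
    (intervalIntegral.integral_eq_sub_of_hasDerivAt (fun τ _ => hf x τ)
      ((hN x).intervalIntegrable _ _)).symm
  have hlim1 : Tendsto (fun x => ∫ τ in (0 : ℝ)..t, N τ x) atTop (𝓝 (∫ _ in (0 : ℝ)..t, (0 : ℂ))) :=
    intervalIntegral.tendsto_integral_filter_of_dominated_convergence b
      (Eventually.of_forall fun x => (hN x).aestronglyMeasurable)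
      (Eventually.of_forall fun x => Eventually.of_forall fun τ _ => hNb x τ)
      (hb.intervalIntegrable _ _) (Eventually.of_forall fun τ _ => hN0 τ)
  rw [intervalIntegral.integral_zero] at hlim1
  exact sub_eq_zero.1 (tendsto_nhds_unique ((hc t).sub (hc 0)) (hlim1.congr fun x => (hFTC x).symm))

theorem IsWeight.continuous_ev_left {σ : ℝ → ℝ} (h : IsWeight σ)
    {γ : ℝ → Lp ℂ 2 (volume : Measure ℝ)} (hγ : Continuous γ) (x : ℝ) :
    Continuous fun t => ev σ (γ t) x := by
  have h1 : Continuous fun t : ℝ => (t, x) := by fun_prop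
  have h2 := Continuous.comp (g := fun p : ℝ × ℝ => ev σ (γ p.1) p.2) (h.continuous_uncurry_ev hγ) h1
  simpa only [Function.comp_def] using h2

theorem tendsto_evMat {σ : ℝ → ℝ} (c : Mat d) (g : Fin d → Fin d → Lp ℂ 2 (volume : Measure ℝ))
    (i j : Fin d) : Tendsto (fun x => (c + evMat σ g x) i j) atTop (𝓝 (c i j)) := by
  have := ((tendsto_ev (g i j) (σ := σ)).mono_left atTop_le_cocompact).const_add (c i j)
  rwa [add_zero] at this

/-- The limit of a solution at spatial infinity does not depend on time. -/
theorem IsSolution.exists_profile_const (h : IsSolution k d U) :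
    ∃ (c : Mat d) (g : ℝ → Fin d → Fin d → Lp ℂ 2 (volume : Measure ℝ)),
      (∀ i j, Continuous fun t => g t i j) ∧
      (∀ t x, U t x = c + evMat weight (g t) x) ∧
      ∀ t x, HasDerivAt (fun τ => U τ x) (-(I / 2) • (U t x * evMat absWeight (g t) x -
        evMat absWeight (g t) x * U t x)) t := by
  obtain ⟨c, g, hg, hU, hd⟩ := h.exists_profile
  refine ⟨c 0, g, hg, fun t x => ?_, hd⟩
  suffices hc : c t = c 0 by rw [hU, hc]
  ext i j
  have hdU : ∀ x τ i j, HasDerivAt (fun s => U s x i j) (-(I / 2) *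
      (∑ l, U τ x i l * ev absWeight (g τ l j) x - ∑ l, ev absWeight (g τ i l) x * U τ x l j)) τ :=
    fun x τ i j => by
    have := hasDerivAt_entry (hd τ x) i j
    rwa [Matrix.smul_apply, Matrix.sub_apply, Matrix.mul_apply, Matrix.mul_apply] at this
  have hUc : ∀ x i j, Continuous fun τ => U τ x i j := fun x i j =>
    continuous_iff_continuousAt.2 fun τ => (hdU x τ i j).continuousAt
  have hAc : ∀ x i j, Continuous fun τ => ev absWeight (g τ i j) x := fun x i j =>
    isWeight_absWeight.continuous_ev_left (hg i j) x
  have hU1 : ∀ τ x i j, ‖U τ x i j‖ ≤ 1 := fun τ x => norm_entry_le_one_of_mem_gr (h.mem_gr τ x)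
  refine eq_of_tendsto_of_tendsto_deriv (f := fun t x => U t x i j)
    (c := fun t => c t i j) (b := fun τ => ∑ l, weightNorm absWeight * ‖g τ l j‖ +
    ∑ l, weightNorm absWeight * ‖g τ i l‖) (fun x τ => hdU x τ i j) (fun x => ?_) ?_ (fun x τ => ?_)
    (fun τ => ?_) (fun t => ?_) t
  · exact continuous_const.mul ((continuous_finsetSum _ fun l _ => (hUc x i l).mul (hAc x l j)).sub
      (continuous_finsetSum _ fun l _ => (hAc x i l).mul (hUc x l j)))
  · exact (continuous_finsetSum _ fun l _ => continuous_const.mul (hg l j).norm).add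
      (continuous_finsetSum _ fun l _ => continuous_const.mul (hg i l).norm)
  · have h1 : ‖-(I / 2)‖ ≤ 1 := by simp; norm_num
    rw [norm_mul]
    refine (mul_le_of_le_one_left (norm_nonneg _) h1).trans ?_
    refine (norm_sub_le _ _).trans (add_le_add ?_ ?_)
    · refine (norm_sum_le _ _).trans (Finset.sum_le_sum fun l _ => ?_)
      rw [norm_mul]
      exact (mul_le_of_le_one_left (norm_nonneg _) (hU1 _ _ _ _)).trans
        (isWeight_absWeight.norm_ev_le _ _)
    · refine (norm_sum_le _ _).trans (Finset.sum_le_sum fun l _ => ?_)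
      rw [norm_mul]
      exact (mul_le_of_le_one_right (norm_nonneg _) (hU1 _ _ _ _)).trans
        (isWeight_absWeight.norm_ev_le _ _)
  · have hA0 : ∀ l m, Tendsto (ev absWeight (g τ l m)) atTop (𝓝 0) := fun l m =>
      (tendsto_ev _).mono_left atTop_le_cocompact
    have h1 : ∀ l, Tendsto (fun x => U τ x i l * ev absWeight (g τ l j) x) atTop (𝓝 0) := fun l =>
      squeeze_zero_norm (fun x => by
        rw [norm_mul]; exact mul_le_of_le_one_left (norm_nonneg _) (hU1 _ _ _ _))
        (tendsto_zero_iff_norm_tendsto_zero.1 (hA0 l j))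
    have h2 : ∀ l, Tendsto (fun x => ev absWeight (g τ i l) x * U τ x l j) atTop (𝓝 0) := fun l =>
      squeeze_zero_norm (fun x => by
        rw [norm_mul]; exact mul_le_of_le_one_right (norm_nonneg _) (hU1 _ _ _ _))
        (tendsto_zero_iff_norm_tendsto_zero.1 (hA0 i l))
    have h3 := ((tendsto_finsetSum Finset.univ fun l _ => h1 l).sub
      (tendsto_finsetSum Finset.univ fun l _ => h2 l)).const_mul (-(I / 2))
    simpa only [Finset.sum_const_zero, sub_zero, mul_zero] using h3
  · refine (tendsto_evMat (σ := weight) (c t) (g t) i j).congr fun x => ?_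
    rw [hU t x]

end Profile

end HWM

end

noncomputable section

namespace HWM

open Complex

/-! ### Bilinear estimates -/

section Bilinear

theorem integral_norm_sq_eq {f : ℝ → ℂ} (hf : MemLp f 2) : ∫ x, ‖f x‖ ^ 2 = ‖hf.toLp‖ ^ 2 := by
  have h1 : ((‖hf.toLp‖ ^ 2 : ℝ) : ℂ) = inner ℂ hf.toLp hf.toLp := by
    rw [inner_self_eq_norm_sq_to_K]; push_cast; rfl
  have h2 : inner ℂ hf.toLp hf.toLp = ((∫ x, ‖f x‖ ^ 2 : ℝ) : ℂ) := by
    rw [L2.inner_def, ← integral_complex_ofReal]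
    refine integral_congr_ae ?_
    filter_upwards [hf.coeFn_toLp] with x hx
    rw [hx, inner_self_eq_norm_sq_to_K]
    push_cast
    rfl
  exact_mod_cast (h1.trans h2).symm

theorem conj_fourierInv (p : ℝ → ℂ) (x : ℝ) :
    (starRingEnd ℂ) (𝓕⁻ p x) = 𝓕⁻ (fun ξ => (starRingEnd ℂ) (p (-ξ))) x := by
  rw [fourierInv_eq_integral_chr, fourierInv_eq_integral_chr, ← integral_conj,
    ← integral_neg_eq_self]
  refine integral_congr_ae (Eventually.of_forall fun ξ => ?_)
  simp only [smul_eq_mul, map_mul]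
  rw [← chr_neg, neg_neg]

theorem memLp_comp_neg {p : ℝ → ℂ} (hp : MemLp p 2) : MemLp (fun ξ => p (-ξ)) 2 :=
  hp.comp_measurePreserving (Measure.measurePreserving_neg volume)

theorem memLp_comp_sub_right {p : ℝ → ℂ} (hp : MemLp p 2) (ζ : ℝ) : MemLp (fun ξ => p (ξ - ζ)) 2 :=
  hp.comp_measurePreserving (measurePreserving_sub_right volume ζ)

/-- Plancherel's identity in bilinear form; conjugating the first factor accounts for the reflection
`ξ ↦ -ξ`. -/
theorem integral_fourierInv_mul_fourierInv {p q : ℝ → ℂ} (hp : Integrable p) (hp2 : MemLp p 2)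
    (hq : Integrable q) (hq2 : MemLp q 2) :
    ∫ x, 𝓕⁻ p x * 𝓕⁻ q x = ∫ ξ, p (-ξ) * q ξ := by
  set r : ℝ → ℂ := fun ξ => (starRingEnd ℂ) (p (-ξ)) with hr
  have hr2 : MemLp r 2 := (memLp_comp_neg hp2).star
  have hr1 : Integrable r :=
    memLp_one_iff_integrable.1 (memLp_one_iff_integrable.2 hp.comp_neg).star
  have h1 : inner ℂ (memLp_fourierInv hr1 hr2).toLp (memLp_fourierInv hq hq2).toLp =
      inner ℂ hr2.toLp hq2.toLp := by
    rw [← fourier_toLp_fourierInv hr1 hr2, ← fourier_toLp_fourierInv hq hq2]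
    exact ((Lp.fourierTransformₗᵢ ℝ ℂ).inner_map_map _ _).symm
  rw [L2.inner_def, L2.inner_def] at h1
  refine Eq.trans ?_ (h1.trans ?_)
  · refine integral_congr_ae ?_
    filter_upwards [(memLp_fourierInv hr1 hr2).coeFn_toLp, (memLp_fourierInv hq hq2).coeFn_toLp]
      with x a b
    rw [a, b, RCLike.inner_apply, hr, ← conj_fourierInv, conj_conj, mul_comm]
  · refine integral_congr_ae ?_
    filter_upwards [hr2.coeFn_toLp, hq2.coeFn_toLp] with ξ a b
    rw [a, b, RCLike.inner_apply, hr, conj_conj, mul_comm]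

theorem chr_mul_fourierInv (q : ℝ → ℂ) (ζ x : ℝ) :
    chr ζ x * 𝓕⁻ q x = 𝓕⁻ (fun ξ => q (ξ - ζ)) x := by
  rw [fourierInv_eq_integral_chr, fourierInv_eq_integral_chr, ← integral_const_mul,
    ← integral_sub_right_eq_self _ ζ]
  refine integral_congr_ae (Eventually.of_forall fun ξ => ?_)
  simp only [smul_eq_mul, chr]
  rw [← mul_assoc, ← Complex.exp_add]
  congr 2
  push_cast
  ring

theorem fourierInv_mul {p q : ℝ → ℂ} (hp : Integrable p) (hp2 : MemLp p 2)
    (hq : Integrable q) (hq2 : MemLp q 2) (ζ : ℝ) :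
    𝓕⁻ (fun x => 𝓕⁻ p x * 𝓕⁻ q x) ζ = ∫ ξ, p (-ξ) * q (ξ - ζ) := by
  rw [fourierInv_eq_integral_chr, ← integral_fourierInv_mul_fourierInv hp hp2
    (hq.comp_sub_right ζ) (memLp_comp_sub_right hq2 ζ)]
  refine integral_congr_ae (Eventually.of_forall fun x => ?_)
  simp only [smul_eq_mul]
  rw [← chr_mul_fourierInv]
  ring

variable (g g' h₁ h₂ : Lp ℂ 2 (volume : Measure ℝ))

/-- The squared `L²` norm of `ev weight g`. -/
def evEnergy : ℝ := ∫ x, ‖ev weight g x‖ ^ 2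

theorem evEnergy_nonneg : 0 ≤ evEnergy g := integral_nonneg fun _ => by positivity

theorem evEnergy_eq_norm_sq : evEnergy g = ‖(isWeight_weight.memLp_mul g).toLp‖ ^ 2 := by
  rw [evEnergy, integral_norm_sq_eq (isWeight_weight.memLp_ev g), Lp.norm_toLp, Lp.norm_toLp,
    isWeight_weight.eLpNorm_ev]

theorem evEnergy_eq_integral : evEnergy g = ∫ ξ, ‖(weight ξ : ℂ) * g ξ‖ ^ 2 := by
  rw [evEnergy_eq_norm_sq, integral_norm_sq_eq]

theorem continuous_evEnergy : Continuous evEnergy := by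
  have h : LipschitzWith 1 fun g => (isWeight_weight.memLp_mul g).toLp := by
    refine LipschitzWith.of_dist_le_mul fun g g' => ?_
    rw [NNReal.coe_one, one_mul, dist_eq_norm, dist_eq_norm]
    refine Lp.norm_le_norm_of_ae_le ?_
    filter_upwards [Lp.coeFn_sub (isWeight_weight.memLp_mul g).toLp
      (isWeight_weight.memLp_mul g').toLp, (isWeight_weight.memLp_mul g).coeFn_toLp,
      (isWeight_weight.memLp_mul g').coeFn_toLp, Lp.coeFn_sub g g'] with ξ a b b' e
    rw [a, e, Pi.sub_apply, Pi.sub_apply, b, b', ← mul_sub, norm_mul, Complex.norm_real,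
      Real.norm_of_nonneg (isWeight_weight.nonneg ξ)]
    exact mul_le_of_le_one_left (norm_nonneg _) (isWeight_weight.le_one ξ)
  rw [funext evEnergy_eq_norm_sq]
  exact h.continuous.norm.pow 2

/-- The commutator expression `(|D|u₁) u₂ - u₁ (|D|u₂)`. -/
def commTerm (x : ℝ) : ℂ :=
  ev absWeight h₁ x * ev weight h₂ x - ev weight h₁ x * ev absWeight h₂ x

theorem integrable_ev_mul_ev {σ τ : ℝ → ℝ} (hσ : IsWeight σ) (hτ : IsWeight τ) :
    Integrable fun x => ev σ h₁ x * ev τ h₂ x :=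
  (hσ.memLp_ev h₁).integrable_mul (hτ.memLp_ev h₂)

theorem integrable_commTerm : Integrable (commTerm h₁ h₂) :=
  (integrable_ev_mul_ev h₁ h₂ isWeight_absWeight isWeight_weight).sub
    (integrable_ev_mul_ev h₁ h₂ isWeight_weight isWeight_absWeight)

/-- In Fourier variables the commutator multiplies the product of the two transforms by `2π(|ξ| - |ξ
- ζ|)`, and the triangle inequality bounds this by `2π|ζ|`. No derivative is left on either factor.
-/
theorem norm_fourierInv_commTerm_le (ζ : ℝ) :
    ‖𝓕⁻ (commTerm h₁ h₂) ζ‖ ≤ 2 * Real.pi * |ζ| * ((evEnergy h₁ + evEnergy h₂) / 2) := by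
  have ia := isWeight_absWeight.integrable
  have ma := isWeight_absWeight.memLp_mul
  have iw := isWeight_weight.integrable
  have mw := isWeight_weight.memLp_mul
  have e1 : 𝓕⁻ (commTerm h₁ h₂) ζ =
      (∫ ξ, ((absWeight (-ξ) : ℂ) * h₁ (-ξ)) * ((weight (ξ - ζ) : ℂ) * h₂ (ξ - ζ))) -
      ∫ ξ, ((weight (-ξ) : ℂ) * h₁ (-ξ)) * ((absWeight (ξ - ζ) : ℂ) * h₂ (ξ - ζ)) := by
    rw [← fourierInv_mul (ia h₁) (ma h₁) (iw h₂) (mw h₂), ← fourierInv_mul (iw h₁) (mw h₁)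
      (ia h₂) (ma h₂), ← fourierInv_sub]
    · rfl
    · exact integrable_ev_mul_ev h₁ h₂ isWeight_absWeight isWeight_weight
    · exact integrable_ev_mul_ev h₁ h₂ isWeight_weight isWeight_absWeight
  have j1 : Integrable fun ξ =>
      ((absWeight (-ξ) : ℂ) * h₁ (-ξ)) * ((weight (ξ - ζ) : ℂ) * h₂ (ξ - ζ)) :=
    (memLp_comp_neg (ma h₁)).integrable_mul (memLp_comp_sub_right (mw h₂) ζ)
  have j2 : Integrable fun ξ =>
      ((weight (-ξ) : ℂ) * h₁ (-ξ)) * ((absWeight (ξ - ζ) : ℂ) * h₂ (ξ - ζ)) :=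
    (memLp_comp_neg (mw h₁)).integrable_mul (memLp_comp_sub_right (ma h₂) ζ)
  rw [← integral_sub j1 j2] at e1
  have e2 : ∀ h, evEnergy h = ∫ ξ, ‖(weight (-ξ) : ℂ) * h (-ξ)‖ ^ 2 := fun h => by
    rw [evEnergy_eq_integral, ← integral_neg_eq_self]
  have e3 : ∀ h, evEnergy h = ∫ ξ, ‖(weight (ξ - ζ) : ℂ) * h (ξ - ζ)‖ ^ 2 := fun h => by
    rw [evEnergy_eq_integral, ← integral_sub_right_eq_self _ ζ]
  have i2 : Integrable fun ξ => ‖(weight (-ξ) : ℂ) * h₁ (-ξ)‖ ^ 2 :=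
    (memLp_two_iff_integrable_sq_norm (memLp_comp_neg (mw h₁)).1).1 (memLp_comp_neg (mw h₁))
  have i3 : Integrable fun ξ => ‖(weight (ξ - ζ) : ℂ) * h₂ (ξ - ζ)‖ ^ 2 :=
    (memLp_two_iff_integrable_sq_norm (memLp_comp_sub_right (mw h₂) ζ).1).1
      (memLp_comp_sub_right (mw h₂) ζ)
  rw [e1, e2 h₁, e3 h₂, ← integral_add i2 i3, ← integral_div, ← integral_const_mul]
  refine norm_integral_le_of_norm_le (((i2.add i3).div_const 2).const_mul _)
    (Eventually.of_forall fun ξ => ?_)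
  set a := (weight (-ξ) : ℂ) * h₁ (-ξ) with ha
  set b := (weight (ξ - ζ) : ℂ) * h₂ (ξ - ζ) with hb
  have e4 : (absWeight (-ξ) : ℂ) * h₁ (-ξ) * b - a * ((absWeight (ξ - ζ) : ℂ) * h₂ (ξ - ζ)) =
      ((2 * Real.pi * (|ξ| - |ξ - ζ|) : ℝ) : ℂ) * (a * b) := by
    rw [ha, hb, absWeight, absWeight, abs_neg]
    push_cast
    ring
  simp only [e4]
  rw [norm_mul, norm_mul, Complex.norm_real, Real.norm_eq_abs, abs_mul,
    abs_of_pos Real.two_pi_pos]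
  have h1 : |(|ξ| - |ξ - ζ|)| ≤ |ζ| := by
    have := abs_abs_sub_abs_le_abs_sub ξ (ξ - ζ)
    rwa [sub_sub_cancel] at this
  have h2 : ‖a‖ * ‖b‖ ≤ (‖a‖ ^ 2 + ‖b‖ ^ 2) / 2 := by nlinarith [sq_nonneg (‖a‖ - ‖b‖)]
  have := Real.pi_pos
  gcongr

/-- The commutator estimate: one derivative falls on the smooth factor. -/
theorem norm_integral_mul_commTerm_le (c : ℂ) :
    ‖∫ x, (c + ev weight g x) * commTerm h₁ h₂ x‖ ≤
      weightNorm absWeight * ‖g‖ * ((evEnergy h₁ + evEnergy h₂) / 2) := by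
  set F := commTerm h₁ h₂ with hF
  set n := (evEnergy h₁ + evEnergy h₂) / 2 with hn
  have hFi : Integrable F := integrable_commTerm h₁ h₂
  -- The bound at frequency zero: the commutator has mean zero, so the constant `c` contributes
  -- nothing.
  have h0 : ∫ x, F x = 0 := by
    have h1 := norm_fourierInv_commTerm_le h₁ h₂ 0
    rw [abs_zero, mul_zero, zero_mul, norm_le_zero_iff, fourierInv_eq_integral_chr] at h1
    rw [← h1]
    refine integral_congr_ae (Eventually.of_forall fun x => ?_)
    simp [chr, hF]
  have hi : Integrable fun x => F x * ev weight g x :=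
    hFi.mul_bdd (isWeight_weight.continuous_ev g).aestronglyMeasurable
      (Eventually.of_forall fun x => isWeight_weight.norm_ev_le g x)
  have e1 : ∫ x, (c + ev weight g x) * F x = ∫ x, F x • 𝓕⁻ (fun ξ => (weight ξ : ℂ) * g ξ) x := by
    have : ∀ x, (c + ev weight g x) * F x = c * F x + F x * ev weight g x := fun x => by ring
    simp_rw [this]
    rw [integral_add (hFi.const_mul c) hi, integral_const_mul, h0, mul_zero, zero_add]
    rfl
  rw [e1, integral_smul_fourierInv_eq hFi (isWeight_weight.integrable g)]
  have h2 := isWeight_absWeight.integral_norm_le g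
  have hn0 : 0 ≤ n := by
    have := evEnergy_nonneg h₁
    have := evEnergy_nonneg h₂
    positivity
  refine le_trans ?_ (mul_le_mul_of_nonneg_right h2 hn0)
  rw [← integral_mul_const]
  refine norm_integral_le_of_norm_le ((isWeight_absWeight.integrable g).norm.mul_const n)
    (Eventually.of_forall fun ξ => ?_)
  have h3 := norm_fourierInv_commTerm_le h₁ h₂ ξ
  have hw := weight_pos ξ
  rw [smul_eq_mul, norm_mul, norm_mul, norm_mul, Complex.norm_real, Complex.norm_real,
    Real.norm_of_nonneg hw.le, Real.norm_of_nonneg (isWeight_absWeight.nonneg ξ), absWeight]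
  calc _ ≤ (2 * Real.pi * |ξ| * n) * (weight ξ * ‖g ξ‖) := by gcongr
    _ = _ := by ring

end Bilinear

end HWM

end

noncomputable section

namespace HWM

open Complex

/-! ### Uniqueness -/

section Gronwall

/-- Grönwall is applied to the primitive `Φ` of `K E`, which is differentiable although `E` need not
be: `|Φ'| = K E ≤ M |Φ|` with `M` a bound of `K` on the compact interval. -/
theorem eq_zero_of_le_integral_of_nonneg {E K : ℝ → ℝ} (hE : Continuous E) (hK : Continuous K)
    (hE0 : ∀ t, 0 ≤ E t) (hK0 : ∀ t, 0 ≤ K t)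
    (h : ∀ t, E t ≤ |∫ τ in (0 : ℝ)..t, K τ * E τ|) {t : ℝ} (ht : 0 ≤ t) : E t = 0 := by
  set Φ : ℝ → ℝ := fun s => ∫ τ in (0 : ℝ)..s, K τ * E τ with hΦ
  have hKE : Continuous fun τ => K τ * E τ := hK.mul hE
  have hd : ∀ s, HasDerivAt Φ (K s * E s) s := fun s =>
    intervalIntegral.integral_hasDerivAt_right (hKE.intervalIntegrable _ _)
      hKE.aestronglyMeasurable.stronglyMeasurableAtFilter hKE.continuousAt
  obtain ⟨M, hM⟩ := (isCompact_Icc (a := (0 : ℝ)) (b := t)).bddAbove_image hK.continuousOn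
  have hb := norm_le_gronwallBound_of_norm_deriv_right_le (f := Φ) (f' := fun s => K s * E s)
    (δ := 0) (K := M) (ε := 0) (a := 0) (b := t)
    (fun s _ => (hd s).continuousAt.continuousWithinAt) (fun s _ => (hd s).hasDerivWithinAt)
    (by simp [hΦ]) (fun s hs => by
      have h1 : K s ≤ M := hM ⟨s, Set.Ico_subset_Icc_self hs, rfl⟩
      rw [add_zero, norm_mul, Real.norm_of_nonneg (hK0 s), Real.norm_of_nonneg (hE0 s)]
      exact mul_le_mul h1 (h s) (hE0 s) ((hK0 s).trans h1)) t ⟨ht, le_rfl⟩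
  rw [gronwallBound_ε0_δ0] at hb
  exact le_antisymm ((h t).trans hb) (hE0 t)

theorem eq_zero_of_le_integral {E K : ℝ → ℝ} (hE : Continuous E) (hK : Continuous K)
    (hE0 : ∀ t, 0 ≤ E t) (hK0 : ∀ t, 0 ≤ K t)
    (h : ∀ t, E t ≤ |∫ τ in (0 : ℝ)..t, K τ * E τ|) (t : ℝ) : E t = 0 := by
  rcases le_total 0 t with ht | ht
  · exact eq_zero_of_le_integral_of_nonneg hE hK hE0 hK0 h ht
  · have := eq_zero_of_le_integral_of_nonneg (E := fun s => E (-s)) (K := fun s => K (-s))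
      (hE.comp continuous_neg) (hK.comp continuous_neg) (fun s => hE0 _) (fun s => hK0 _)
      (fun s => ?_) (neg_nonneg.2 ht)
    · simpa using this
    · have e := intervalIntegral.integral_comp_neg (a := 0) (b := s) fun τ => K τ * E τ
      rw [e, neg_zero, intervalIntegral.integral_symm, abs_neg]
      exact h (-s)

/-- The fundamental theorem of calculus at each fixed `x`, followed by Fubini. The continuous bound
`b` makes the double integral converge absolutely. -/
theorem integral_sub_eq_intervalIntegral {Q Y : ℝ → ℝ → ℂ} {b : ℝ → ℝ}
    (hd : ∀ x t, HasDerivAt (fun τ => Q τ x) (Y t x) t) (hY : Continuous (Function.uncurry Y))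
    (hYi : ∀ t, Integrable (Y t)) (hb : Continuous b) (hYb : ∀ t, ∫ x, ‖Y t x‖ ≤ b t)
    (hQ : ∀ t, Integrable (Q t)) (t : ℝ) :
    (∫ x, Q t x) - ∫ x, Q 0 x = ∫ τ in (0 : ℝ)..t, ∫ x, Y τ x := by
  have hYx : ∀ x, Continuous fun τ => Y τ x := fun x =>
    hY.comp (Continuous.prodMk_left x)
  have h1 : ∀ x, Q t x - Q 0 x = ∫ τ in (0 : ℝ)..t, Y τ x := fun x =>
    (intervalIntegral.integral_eq_sub_of_hasDerivAt (fun τ _ => hd x τ)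
      ((hYx x).intervalIntegrable _ _)).symm
  rw [← integral_sub (hQ t) (hQ 0)]
  simp_rw [h1, intervalIntegral.intervalIntegral_eq_integral_uIoc]
  rw [integral_smul]
  congr 1
  symm
  refine integral_integral_swap ?_
  have hm : AEStronglyMeasurable (Function.uncurry Y)
      ((volume.restrict (Set.uIoc 0 t)).prod volume) := hY.aestronglyMeasurable
  refine (integrable_prod_iff hm).2 ⟨Eventually.of_forall hYi, ?_⟩
  have hbi : IntegrableOn b (Set.uIoc 0 t) :=
    (hb.continuousOn.integrableOn_compact isCompact_uIcc).mono_set Set.uIoc_subset_uIcc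
  refine hbi.mono' hm.norm.integral_prod_right' (Eventually.of_forall fun τ => ?_)
  rw [Real.norm_of_nonneg (integral_nonneg fun _ => norm_nonneg _)]
  exact hYb τ

end Gronwall

/-! ### The energy estimate for the difference of two solutions -/

section Uniqueness

variable {d k : ℕ}

/-- With `D = U₁ - U₂` and `B = A₁ - A₂`, the contribution `[D, A₁]` has zero trace against `D`.
Only `[U₂, B]` survives, and cyclicity moves `U₂` outside a commutator of `B` and `D`. -/
theorem trace_commutator_energy (U₁ U₂ A₁ A₂ : Mat d) :
    ((-(I / 2) • (U₁ * A₁ - A₁ * U₁) - -(I / 2) • (U₂ * A₂ - A₂ * U₂)) * (U₁ - U₂)).trace +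
      ((U₁ - U₂) * (-(I / 2) • (U₁ * A₁ - A₁ * U₁) - -(I / 2) • (U₂ * A₂ - A₂ * U₂))).trace =
      -I * (U₂ * ((A₁ - A₂) * (U₁ - U₂) - (U₁ - U₂) * (A₁ - A₂))).trace := by
  obtain ⟨D, rfl⟩ : ∃ D, U₁ = U₂ + D := ⟨U₁ - U₂, by abel⟩
  obtain ⟨B, rfl⟩ : ∃ B, A₁ = A₂ + B := ⟨A₁ - A₂, by abel⟩
  have e : -(I / 2) • ((U₂ + D) * (A₂ + B) - (A₂ + B) * (U₂ + D)) - -(I / 2) • (U₂ * A₂ - A₂ * U₂) =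
      -(I / 2) • (D * (A₂ + B) - (A₂ + B) * D + (U₂ * B - B * U₂)) := by
    rw [← smul_sub]
    congr 1
    noncomm_ring
  rw [e, Matrix.trace_mul_comm (U₂ + D - U₂), add_sub_cancel_left, add_sub_cancel_left,
    Matrix.smul_mul, Matrix.trace_smul, smul_eq_mul]
  generalize A₂ + B = A
  have h1 : ((D * A - A * D + (U₂ * B - B * U₂)) * D).trace = (U₂ * (B * D - D * B)).trace := by
    simp only [add_mul, sub_mul, mul_sub, Matrix.trace_add, Matrix.trace_sub]
    rw [Matrix.mul_assoc D A D, Matrix.trace_mul_comm D (A * D), sub_self, zero_add,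
      Matrix.mul_assoc U₂ B D, Matrix.mul_assoc B U₂ D, Matrix.trace_mul_comm B (U₂ * D),
      Matrix.mul_assoc U₂ D B]
  rw [h1]
  ring

theorem hasDerivAt_trace_sub_sq {F G : ℝ → Mat d} {F' G' : Mat d} {t : ℝ} (hF : HasDerivAt F F' t)
    (hG : HasDerivAt G G' t) :
    HasDerivAt (fun τ => ((F τ - G τ) * (F τ - G τ)).trace)
      (((F' - G') * (F t - G t)).trace + ((F t - G t) * (F' - G')).trace) t := by
  have h : ∀ i j, HasDerivAt (fun τ => (F τ - G τ) i j) ((F' - G') i j) t := fun i j =>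
    (hasDerivAt_entry hF i j).sub (hasDerivAt_entry hG i j)
  simp only [Matrix.trace, Matrix.diag_apply, Matrix.mul_apply]
  rw [← Finset.sum_add_distrib]
  refine HasDerivAt.fun_sum fun i _ => ?_
  rw [← Finset.sum_add_distrib]
  exact HasDerivAt.fun_sum fun j _ => (h i j).mul (h j i)

theorem IsWeight.evMat_sub {σ : ℝ → ℝ} (hσ : IsWeight σ)
    (g g' : Fin d → Fin d → Lp ℂ 2 (volume : Measure ℝ)) (x : ℝ) :
    evMat σ (g - g') x = evMat σ g x - evMat σ g' x := by
  ext i j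
  exact hσ.ev_sub _ _ x

theorem IsWeight.integral_norm_sq_ev_le {σ : ℝ → ℝ} (hσ : IsWeight σ)
    (h : Lp ℂ 2 (volume : Measure ℝ)) : ∫ x, ‖ev σ h x‖ ^ 2 ≤ ‖h‖ ^ 2 := by
  rw [integral_norm_sq_eq (hσ.memLp_ev h), Lp.norm_toLp, hσ.eLpNorm_ev, ← Lp.norm_toLp _ (hσ.memLp_mul h)]
  gcongr
  refine Lp.norm_le_norm_of_ae_le ?_
  filter_upwards [(hσ.memLp_mul h).coeFn_toLp] with ξ a
  rw [a, norm_mul, Complex.norm_real, Real.norm_of_nonneg (hσ.nonneg ξ)]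
  exact mul_le_of_le_one_left (norm_nonneg _) (hσ.le_one ξ)

theorem IsWeight.integrable_norm_sq_ev {σ : ℝ → ℝ} (hσ : IsWeight σ)
    (h : Lp ℂ 2 (volume : Measure ℝ)) : Integrable fun x => ‖ev σ h x‖ ^ 2 :=
  (memLp_two_iff_integrable_sq_norm (hσ.memLp_ev h).1).1 (hσ.memLp_ev h)

theorem integral_norm_commTerm_le (h₁ h₂ : Lp ℂ 2 (volume : Measure ℝ)) :
    ∫ x, ‖commTerm h₁ h₂ x‖ ≤ ‖h₁‖ ^ 2 + ‖h₂‖ ^ 2 := by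
  have ia := isWeight_absWeight.integrable_norm_sq_ev
  have iw := isWeight_weight.integrable_norm_sq_ev
  have h1 : ∫ x, ‖commTerm h₁ h₂ x‖ ≤ ∫ x, (((‖ev absWeight h₁ x‖ ^ 2 + ‖ev weight h₂ x‖ ^ 2) +
      (‖ev weight h₁ x‖ ^ 2 + ‖ev absWeight h₂ x‖ ^ 2)) / 2) := by
    refine integral_mono (integrable_commTerm h₁ h₂).norm
      ((((ia h₁).add (iw h₂)).add ((iw h₁).add (ia h₂))).div_const 2) fun x => ?_
    refine (norm_sub_le _ _).trans ?_
    rw [norm_mul, norm_mul]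
    nlinarith [sq_nonneg (‖ev absWeight h₁ x‖ - ‖ev weight h₂ x‖),
      sq_nonneg (‖ev weight h₁ x‖ - ‖ev absWeight h₂ x‖)]
  have j1 : Integrable fun x => ‖ev absWeight h₁ x‖ ^ 2 + ‖ev weight h₂ x‖ ^ 2 :=
    (ia h₁).add (iw h₂)
  have j2 : Integrable fun x => ‖ev weight h₁ x‖ ^ 2 + ‖ev absWeight h₂ x‖ ^ 2 :=
    (iw h₁).add (ia h₂)
  rw [integral_div, integral_add j1 j2, integral_add (ia h₁) (iw h₂),
    integral_add (iw h₁) (ia h₂)] at h1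
  linarith [isWeight_absWeight.integral_norm_sq_ev_le h₁, isWeight_weight.integral_norm_sq_ev_le h₁,
    isWeight_absWeight.integral_norm_sq_ev_le h₂, isWeight_weight.integral_norm_sq_ev_le h₂]

theorem continuous_uncurry_commTerm {γ₁ γ₂ : ℝ → Lp ℂ 2 (volume : Measure ℝ)}
    (h₁ : Continuous γ₁) (h₂ : Continuous γ₂) :
    Continuous fun p : ℝ × ℝ => commTerm (γ₁ p.1) (γ₂ p.1) p.2 :=
  ((isWeight_absWeight.continuous_uncurry_ev h₁).mul (isWeight_weight.continuous_uncurry_ev h₂)).sub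
    ((isWeight_weight.continuous_uncurry_ev h₁).mul (isWeight_absWeight.continuous_uncurry_ev h₂))

/-- The squared `L²` norm of a matrix-valued function. -/
def matEnergy (h : Fin d → Fin d → Lp ℂ 2 (volume : Measure ℝ)) : ℝ := ∑ i, ∑ j, evEnergy (h i j)

theorem matEnergy_nonneg (h : Fin d → Fin d → Lp ℂ 2 (volume : Measure ℝ)) : 0 ≤ matEnergy h :=
  Finset.sum_nonneg fun _ _ => Finset.sum_nonneg fun _ _ => evEnergy_nonneg _

theorem evEnergy_le_matEnergy (h : Fin d → Fin d → Lp ℂ 2 (volume : Measure ℝ)) (i j : Fin d) :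
    evEnergy (h i j) ≤ matEnergy h :=
  (Finset.single_le_sum (f := fun j => evEnergy (h i j)) (fun _ _ => evEnergy_nonneg _)
    (Finset.mem_univ j)).trans (Finset.single_le_sum (f := fun i => ∑ j, evEnergy (h i j))
    (fun _ _ => Finset.sum_nonneg fun _ _ => evEnergy_nonneg _) (Finset.mem_univ i))

theorem evMat_eq_zero_of_matEnergy {h : Fin d → Fin d → Lp ℂ 2 (volume : Measure ℝ)}
    (h0 : matEnergy h = 0) (x : ℝ) : evMat weight h x = 0 := by
  ext i j
  have h1 : evEnergy (h i j) = 0 :=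
    le_antisymm ((evEnergy_le_matEnergy h i j).trans h0.le) (evEnergy_nonneg _)
  have hc : Continuous fun x => ‖ev weight (h i j) x‖ ^ 2 :=
    (isWeight_weight.continuous_ev _).norm.pow 2
  have h2 := (integral_eq_zero_iff_of_nonneg (fun _ => by positivity)
    (isWeight_weight.integrable_norm_sq_ev (h i j))).1 h1
  have h3 : ‖ev weight (h i j) x‖ ^ 2 = 0 := congrFun ((Continuous.ae_eq_iff_eq
    (μ := (volume : Measure ℝ)) hc continuous_const).1 h2) x
  rw [evMat_apply]
  exact norm_eq_zero.1 (pow_eq_zero_iff two_ne_zero |>.1 h3)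

theorem integral_trace_mul_self {h : Fin d → Fin d → Lp ℂ 2 (volume : Measure ℝ)}
    (hh : ∀ x, (evMat weight h x).conjTranspose = evMat weight h x) :
    Integrable (fun x => (evMat weight h x * evMat weight h x).trace) ∧
      ∫ x, (evMat weight h x * evMat weight h x).trace = (matEnergy h : ℂ) := by
  have e : (fun x => (evMat weight h x * evMat weight h x).trace) =
      fun x => ((∑ i, ∑ j, ‖ev weight (h i j) x‖ ^ 2 : ℝ) : ℂ) := by
    funext x
    rw [Matrix.trace]
    push_cast
    refine Finset.sum_congr rfl fun i _ => ?_
    rw [Matrix.diag_apply, Matrix.mul_apply]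
    refine Finset.sum_congr rfl fun j _ => ?_
    have h1 : evMat weight h x j i = (starRingEnd ℂ) (evMat weight h x i j) := by
      conv_lhs => rw [← hh x]
      rfl
    rw [h1, Complex.mul_conj', evMat_apply]
  have hi : Integrable fun x => ∑ i, ∑ j, ‖ev weight (h i j) x‖ ^ 2 :=
    integrable_finsetSum _ fun i _ => integrable_finsetSum _ fun j _ =>
      isWeight_weight.integrable_norm_sq_ev _
  rw [e]
  refine ⟨hi.ofReal, ?_⟩
  rw [integral_complex_ofReal, integral_finsetSum _ fun i _ => integrable_finsetSum _ fun j _ =>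
      isWeight_weight.integrable_norm_sq_ev _]
  congr 1
  refine Finset.sum_congr rfl fun i _ => ?_
  rw [integral_finsetSum _ fun j _ => isWeight_weight.integrable_norm_sq_ev _]
  rfl

/-- The density of the time derivative of the energy of the difference of two solutions. -/
def energyFlux (U : Mat d) (h : Fin d → Fin d → Lp ℂ 2 (volume : Measure ℝ)) (x : ℝ) : ℂ :=
  -I * ∑ i, ∑ j, ∑ l, U i j * commTerm (h j l) (h l i) x

theorem trace_eq_energyFlux (U : Mat d) (h : Fin d → Fin d → Lp ℂ 2 (volume : Measure ℝ)) (x : ℝ) :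
    -I * (U * (evMat absWeight h x * evMat weight h x -
      evMat weight h x * evMat absWeight h x)).trace = energyFlux U h x := by
  rw [energyFlux, Matrix.trace]
  congr 1
  refine Finset.sum_congr rfl fun i _ => ?_
  rw [Matrix.diag_apply, Matrix.mul_apply]
  refine Finset.sum_congr rfl fun j _ => ?_
  rw [Matrix.sub_apply, Matrix.mul_apply, Matrix.mul_apply, ← Finset.sum_sub_distrib,
    Finset.mul_sum]
  rfl

theorem integrable_energyFlux {V : ℝ → Mat d} (hV : Continuous V) (hV1 : ∀ x i j, ‖V x i j‖ ≤ 1)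
    (h : Fin d → Fin d → Lp ℂ 2 (volume : Measure ℝ)) (i j l : Fin d) :
    Integrable fun x => V x i j * commTerm (h j l) (h l i) x :=
  (integrable_commTerm _ _).bdd_mul ((continuous_apply_apply i j).comp hV).aestronglyMeasurable
    (Eventually.of_forall fun x => hV1 x i j)

theorem continuous_uncurry_energyFlux (c : Mat d)
    {g h : ℝ → Fin d → Fin d → Lp ℂ 2 (volume : Measure ℝ)}
    (hg : ∀ i j, Continuous fun t => g t i j) (hh : ∀ i j, Continuous fun t => h t i j) :
    Continuous (Function.uncurry fun t x => energyFlux (c + evMat weight (g t) x) (h t) x) := by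
  have h1 : ∀ i j, Continuous fun p : ℝ × ℝ => (c + evMat weight (g p.1) p.2) i j := fun i j => by
    simp only [Matrix.add_apply, evMat_apply]
    exact (isWeight_weight.continuous_uncurry_ev (γ := fun t => g t i j) (hg i j)).const_add (c i j)
  have h2 : ∀ i j l, Continuous fun p : ℝ × ℝ => commTerm (h p.1 j l) (h p.1 l i) p.2 :=
    fun i j l => continuous_uncurry_commTerm (γ₁ := fun t => h t j l) (γ₂ := fun t => h t l i)
      (hh j l) (hh l i)
  simp only [Function.uncurry_def, energyFlux]
  exact continuous_const.mul (continuous_finsetSum _ fun i _ => continuous_finsetSum _ fun j _ =>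
    continuous_finsetSum _ fun l _ => (h1 i j).mul (h2 i j l))

theorem norm_energyFlux_le {V : Mat d} (hV : ∀ i j, ‖V i j‖ ≤ 1)
    (h : Fin d → Fin d → Lp ℂ 2 (volume : Measure ℝ)) (x : ℝ) :
    ‖energyFlux V h x‖ ≤ ∑ i, ∑ j, ∑ l, ‖commTerm (h j l) (h l i) x‖ := by
  rw [energyFlux, norm_mul, norm_neg, Complex.norm_I, one_mul]
  refine (norm_sum_le _ _).trans (Finset.sum_le_sum fun i _ => (norm_sum_le _ _).trans
    (Finset.sum_le_sum fun j _ => (norm_sum_le _ _).trans (Finset.sum_le_sum fun l _ => ?_)))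
  rw [norm_mul]
  exact mul_le_of_le_one_left (norm_nonneg _) (hV i j)

theorem integral_norm_energyFlux_le {V : ℝ → Mat d} (hV : Continuous V)
    (hV1 : ∀ x i j, ‖V x i j‖ ≤ 1) (h : Fin d → Fin d → Lp ℂ 2 (volume : Measure ℝ)) :
    ∫ x, ‖energyFlux (V x) h x‖ ≤ ∑ i, ∑ j, ∑ l, (‖h j l‖ ^ 2 + ‖h l i‖ ^ 2) := by
  have hc : ∀ i j l : Fin d, Integrable fun x => ‖commTerm (h j l) (h l i) x‖ := fun i j l =>
    (integrable_commTerm _ _).norm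
  have hi : Integrable fun x => energyFlux (V x) h x :=
    (integrable_finsetSum _ fun i _ => integrable_finsetSum _ fun j _ =>
      integrable_finsetSum _ fun l _ => integrable_energyFlux hV hV1 h i j l).const_mul _
  refine (integral_mono hi.norm (integrable_finsetSum _ fun i _ => integrable_finsetSum _ fun j _ =>
    integrable_finsetSum _ fun l _ => hc i j l) fun x => norm_energyFlux_le (hV1 x) h x).trans ?_
  rw [integral_finsetSum _ fun i _ => integrable_finsetSum _ fun j _ =>
    integrable_finsetSum _ fun l _ => hc i j l]
  refine Finset.sum_le_sum fun i _ => ?_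
  rw [integral_finsetSum _ fun j _ => integrable_finsetSum _ fun l _ => hc i j l]
  refine Finset.sum_le_sum fun j _ => ?_
  rw [integral_finsetSum _ fun l _ => hc i j l]
  exact Finset.sum_le_sum fun l _ => integral_norm_commTerm_le _ _

theorem norm_integral_energyFlux_le {c : Mat d} {g h : Fin d → Fin d → Lp ℂ 2 (volume : Measure ℝ)}
    (hi : ∀ i j l, Integrable fun x => (c + evMat weight g x) i j * commTerm (h j l) (h l i) x) :
    ‖∫ x, energyFlux (c + evMat weight g x) h x‖ ≤
      (∑ i, ∑ j, ∑ _l : Fin d, weightNorm absWeight * ‖g i j‖) * matEnergy h := by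
  simp only [energyFlux]
  rw [integral_const_mul, norm_mul, norm_neg, Complex.norm_I, one_mul, integral_finsetSum _ fun i _ =>
    integrable_finsetSum _ fun j _ => integrable_finsetSum _ fun l _ => hi i j l, Finset.sum_mul]
  refine (norm_sum_le _ _).trans (Finset.sum_le_sum fun i _ => ?_)
  rw [integral_finsetSum _ fun j _ => integrable_finsetSum _ fun l _ => hi i j l, Finset.sum_mul]
  refine (norm_sum_le _ _).trans (Finset.sum_le_sum fun j _ => ?_)
  rw [integral_finsetSum _ fun l _ => hi i j l, Finset.sum_mul]
  refine (norm_sum_le _ _).trans (Finset.sum_le_sum fun l _ => ?_)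
  refine (norm_integral_mul_commTerm_le (g i j) (h j l) (h l i) (c i j)).trans ?_
  have h1 := evEnergy_le_matEnergy h j l
  have h2 := evEnergy_le_matEnergy h l i
  have h3 : 0 ≤ weightNorm absWeight := ENNReal.toReal_nonneg
  gcongr
  linarith

/-- Two solutions with the same initial value agree. -/
theorem IsSolution.unique {U₁ U₂ : ℝ → ℝ → Mat d} (h₁ : IsSolution k d U₁)
    (h₂ : IsSolution k d U₂) (h0 : U₁ 0 = U₂ 0) : U₁ = U₂ := by
  obtain ⟨c, g₁, hg₁, hU₁, hd₁⟩ := h₁.exists_profile_const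
  obtain ⟨c₂, g₂, hg₂, hU₂, hd₂⟩ := h₂.exists_profile_const
  -- The limits at spatial infinity are constant in time and agree at time `0`; thus the difference
  -- belongs to `L²`.
  obtain rfl : c = c₂ := by
    ext i j
    refine tendsto_nhds_unique (tendsto_evMat (σ := weight) c (g₁ 0) i j) ?_
    refine (tendsto_evMat (σ := weight) c₂ (g₂ 0) i j).congr fun x => ?_
    rw [← hU₁, ← hU₂, h0]
  set h : ℝ → Fin d → Fin d → Lp ℂ 2 (volume : Measure ℝ) := fun t => g₁ t - g₂ t with hh
  have hhc : ∀ i j, Continuous fun t => h t i j := fun i j => (hg₁ i j).sub (hg₂ i j)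
  have hD : ∀ t x, evMat weight (h t) x = U₁ t x - U₂ t x := fun t x => by
    rw [hh, isWeight_weight.evMat_sub, hU₁, hU₂, add_sub_add_left_eq_sub]
  have hDh : ∀ t x, (evMat weight (h t) x).conjTranspose = evMat weight (h t) x := fun t x => by
    rw [hD, Matrix.conjTranspose_sub, (h₁.mem_gr t x).1, (h₂.mem_gr t x).1]
  have hder : ∀ x t, HasDerivAt (fun τ => (evMat weight (h τ) x * evMat weight (h τ) x).trace)
      (energyFlux (U₂ t x) (h t) x) t := fun x t => by
    have e1 := hasDerivAt_trace_sub_sq (hd₁ t x) (hd₂ t x)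
    rw [trace_commutator_energy, ← isWeight_absWeight.evMat_sub, ← hD,
      trace_eq_energyFlux] at e1
    simp only [hD]
    exact e1
  have hU2 : ∀ t x i j, ‖U₂ t x i j‖ ≤ 1 := fun t x => norm_entry_le_one_of_mem_gr (h₂.mem_gr t x)
  have hFi : ∀ t i j l, Integrable fun x => U₂ t x i j * commTerm (h t j l) (h t l i) x :=
    fun t => integrable_energyFlux (h₂.curve.1 t) (hU2 t) (h t)
  set K : ℝ → ℝ := fun t => ∑ i, ∑ j, ∑ _l : Fin d, weightNorm absWeight * ‖g₂ t i j‖ with hK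
  have hflux : ∀ t, ‖∫ x, energyFlux (U₂ t x) (h t) x‖ ≤ K t * matEnergy (h t) := fun t => by
    simp only [hU₂]
    refine norm_integral_energyFlux_le fun i j l => ?_
    simp only [← hU₂]
    exact hFi t i j l
  have hKc : Continuous K := continuous_finsetSum _ fun i _ => continuous_finsetSum _ fun j _ =>
    continuous_finsetSum _ fun l _ => continuous_const.mul (hg₂ i j).norm
  have hEc : Continuous fun t => matEnergy (h t) := continuous_finsetSum _ fun i _ =>
    continuous_finsetSum _ fun j _ => continuous_evEnergy.comp (hhc i j)
  -- The energy is an integral over an unbounded line. Its growth is obtained in integrated form,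
  -- which avoids differentiating under the integral sign.
  have hFubini := integral_sub_eq_intervalIntegral (b := fun t => ∑ i, ∑ j, ∑ l,
    (‖h t j l‖ ^ 2 + ‖h t l i‖ ^ 2)) hder ?_ (fun t => ?_) ?_ (fun t => ?_)
    (fun t => (integral_trace_mul_self (hDh t)).1)
  · have hE : ∀ t, matEnergy (h t) = 0 := by
      refine eq_zero_of_le_integral hEc hKc (fun t => matEnergy_nonneg _) (fun t => ?_) fun t => ?_
      · exact Finset.sum_nonneg fun _ _ => Finset.sum_nonneg fun _ _ => Finset.sum_nonneg fun _ _ =>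
          mul_nonneg ENNReal.toReal_nonneg (norm_nonneg _)
      · have e0 : ∫ x, (evMat weight (h 0) x * evMat weight (h 0) x).trace = 0 := by
          simp only [hD, h0, sub_self, mul_zero, Matrix.trace_zero, integral_zero]
        have e1 := hFubini t
        rw [e0, sub_zero, (integral_trace_mul_self (hDh t)).2] at e1
        have e2 : matEnergy (h t) = ‖(matEnergy (h t) : ℂ)‖ := by
          rw [Complex.norm_real, Real.norm_of_nonneg (matEnergy_nonneg _)]
        rw [e2, e1]
        exact intervalIntegral.norm_integral_le_abs_of_norm_le (Eventually.of_forall hflux)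
          ((hKc.mul hEc).intervalIntegrable _ _)
    funext t x
    have := evMat_eq_zero_of_matEnergy (hE t) x
    rwa [hD, sub_eq_zero] at this
  · simp only [hU₂]
    exact continuous_uncurry_energyFlux c hg₂ hhc
  · exact (integrable_finsetSum _ fun i _ => integrable_finsetSum _ fun j _ =>
      integrable_finsetSum _ fun l _ => hFi t i j l).const_mul _
  · exact continuous_finsetSum _ fun i _ => continuous_finsetSum _ fun j _ =>
      continuous_finsetSum _ fun l _ => ((hhc j l).norm.pow 2).add ((hhc l i).norm.pow 2)
  · exact integral_norm_energyFlux_le (h₂.curve.1 t) (hU2 t) (h t)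

end Uniqueness

end HWM

end

/-! ### The main theorem -/

open HWM in
theorem mainTheorem2 (d k : ℕ) (hd : 2 ≤ d) (hk : k ≤ d) (U₀ : ℝ → Mat d)
    (hU₀ : U₀ ∈ RatGr k d) (hsimple : HasSimpleDiscreteSpectrum (toeplitz U₀)) :
    ∃ U : ℝ → ℝ → Mat d,
      (IsSolution k d U ∧ U 0 = U₀ ∧
        ∀ U' : ℝ → ℝ → Mat d, IsSolution k d U' → U' 0 = U₀ → U' = U) ∧
      ∃ (N : ℕ) (v : Fin N → ℝ),
        Function.Injective v ∧
        discreteSpectrum (toeplitz U₀) = Set.range (fun j => (v j : ℂ)) ∧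
        ∃ (Uinf : Mat d) (A : Fin N → Mat d) (y δ : Fin N → ℝ),
          Tendsto U₀ (cocompact ℝ) (𝓝 Uinf) ∧ Uinf ∈ Gr k d ∧
          (∀ j, (A j).rank = 1 ∧ A j ^ 2 = 0 ∧ 0 < δ j ∧
            solitonProfile Uinf (A j) (y j) (δ j) ∈ RatGr k d ∧
            IsSolitaryWaveProfile k d (v j) (solitonProfile Uinf (A j) (y j) (δ j))) ∧
          (∀ s : ℝ, 0 < s →
            Tendsto (fun t => homSobolevENormMat s (fun x => U t x -
              ((∑ j, solitonProfile Uinf (A j) (y j) (δ j) (x - v j * t)) -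
                ((N : ℂ) - 1) • Uinf))) (atBot ⊔ atTop) (𝓝 0)) ∧
          ∀ s : ℝ, 0 < s → ∃ C : ℝ≥0, ∀ t, homSobolevENormMat s (U t) ≤ C := by
  obtain ⟨N, W, G, v, ρ, h, hv1, hW, rfl⟩ := exists_realization_of_mem_ratGr hU₀
  have hv : Function.Injective v := injective_of_hasSimpleDiscreteSpectrum h hv1 hsimple
  obtain ⟨C, c, hu⟩ := exists_uniformDecay h hv
  have hδ : ∀ j, 0 < -(G j j).im := fun j => neg_pos.2 (diag_im_neg h hv j)
  have hsol : IsSolution k d (flow W G (realDiag v) ρ) := isSolution_flow h hu hW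
  have hprof := isSolitaryWaveProfile_soliton h hv hW
  refine ⟨flow W G (realDiag v) ρ, ⟨hsol, flow_zero W G _ ρ, fun U' hU' h0 =>
    hU'.unique hsol (h0.trans (flow_zero W G _ ρ).symm)⟩, N, v, hv,
    discreteSpectrum_toeplitz h hv1, W, solitonResidue W v ρ, fun j => (G j j).re,
    fun j => -(G j j).im, tendsto_realized_cocompact h, hW, fun j =>
      ⟨solitonResidue_rank h hv hv1 j, solitonResidue_sq h j, hδ j,
        ⟨isRationalMap_solitonProfile _ _ _ (hδ j), (hprof j).mem_gr⟩, hprof j⟩,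
    fun s hs => ?_, fun s hs => exists_homSobolevENormMat_flow_le h hu hs⟩
  -- The sum of solitons, with the repeated value at infinity removed, is exactly the map built from
  -- the diagonal part of `G`.
  simp_rw [sum_solitonProfile_eq (fun j => (diag_im_neg h hv j).ne)]
  exact tendsto_flow_sub_diag h hv hs
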